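/- We work over $\mathbb{C}$; a point means a $\mathbb{C}$-valued point. Let $n\ge 4$, and let $\mathbf a=(a_1,\dots,a_r)$ and $\mathbf b=(b_1,\dots,b_s)$ be sequences of integers with $2\le a_1\le\dots\le a_r$, $1\le b_1\le\dots\le b_s$ and $1\le r<s<n$. Put $m:=n-r$, $l:=n-s$, $t_a:=\#\{i\mid a_i=a_r\}$ and $t_b:=\#\{j\mid b_j=a_r\}$. For $\mathbf c=\mathbf a,\mathbf b$ let $H_{\mathbf c}$ be the (smooth, irreducible, quasi-projective) scheme parametrizing the complete intersections of multi-degree $\mathbf c$ in $\mathbb{P}^n$. Let $\mathcal X=\{(p,X)\mid p\in X\}\subset\mathbb{P}^n\times H_{\mathbf a}$ and $\mathcal Z=\{(p,Z)\mid p\in Z\}\subset\mathbb{P}^n\times H_{\mathbf b}$ be the universal families, with projections $\phi:\mathcal X\to H_{\mathbf a}$ and $\phi':\mathcal Z\to H_{\mathbf b}$. Let $F_{\mathbf b,\mathbf a}\subset H_{\mathbf b}\times H_{\mathbf a}$ be the closed subscheme parametrizing the pairs $(Z,X)$ such that $Z$ is a subscheme of $X$, and let $\rho:F_{\mathbf b,\mathbf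 a}\to H_{\mathbf a}$ be the projection. Let $\widetilde{\mathcal Z}=\{(p,Z,X)\mid p\in Z\subset X\}$ be the pull-back of $\mathcal Z$ to $F_{\mathbf b,\mathbf a}$, with the morphisms $\pi:\widetilde{\mathcal Z}\to F_{\mathbf b,\mathbf a}$, $(p,Z,X)\mapsto(Z,X)$; $\alpha:\widetilde{\mathcal Z}\to\mathcal X$, $(p,Z,X)\mapsto(p,X)$; and $\beta:\widetilde{\mathcal Z}\to\mathcal Z$, $(p,Z,X)\mapsto(p,Z)$. Let $\Gamma\subset\mathcal X$ and $\Gamma'\subset\mathcal Z$ be the sets of critical points of $\phi$ and $\phi'$. Put $o:=[1:0:\dots:0]\in\mathbb{P}^n$, let $\Gamma_o$ be the set of points of $\Gamma$ lying over $o$, and let $\Xi_o$ be the set of points $Q=(o,Z,X)$ of $\widetilde{\mathcal Z}$ with $\alpha(Q)\in\Gamma$ and $\beta(Q)\notin\Gamma'$; equivalently, $X$ is singular at $o$ and $Z$ is smooth at $o$. Suppose that $$a_i\ge b_i\ (i=1,\dots,r),\qquad a_r\ge b_s,\qquad m-2l\ge t_b-t_a,\qquad m>2l.$$ Suppose also that,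 for a general point $u$ of the irreducible locus $S_{\mathbf a}\subset H_{\mathbf a}$ of singular complete intersections, there is a complete intersection of multi-degree $\mathbf b$ in $\mathbb{P}^n$ that is contained in the corresponding complete intersection $X_u$, passes through the unique singular point $p$ of $X_u$, and is smooth at $p$. Then there is a unique irreducible component $\Xi_o'$ of $\Xi_o$ that $\alpha$ maps dominantly to $\Gamma_o$, and for a general point $Q$ of $\Xi_o'$ (that is, for all $Q$ in a non-empty Zariski open subset of $\Xi_o'$) the following hold. (1) The morphism $\rho:F_{\mathbf b,\mathbf a}\to H_{\mathbf a}$ is dominant. (2) The kernel of $(d\alpha)_Q:T_Q\widetilde{\mathcal Z}\to T_{\alpha(Q)}\mathcal X$ has dimension $$\dim F_{\mathbf b,\mathbf a}-\dim H_{\mathbf a}-m+2l.$$ (3) The image of $(d\rho)_{\pi(Q)}:T_{\pi(Q)}F_{\mathbf b,\mathbf a}\to T_{\rho(\pi(Q))}H_{\mathbf a}$ has codimension $1$. -/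

import Mathlib

noncomputable section

/-! ## Complete intersections in projective space -/

/-- The homogeneous coordinate ring `ℂ[x₀, …, xₙ]` of `ℙⁿ`. -/
abbrev CoordRing (n : ℕ) : Type := MvPolynomial (Fin (n + 1)) ℂ

/-- The vector space of tuples of forms `f = (f₁, …, f_t)` with `deg f_i = c_i`. -/
abbrev Forms (n : ℕ) {t : ℕ} (c : Fin t → ℕ) : Type :=
  (i : Fin t) → MvPolynomial.homogeneousSubmodule (Fin (n + 1)) ℂ (c i)

/-- The homogeneous ideal `J_f` generated by the components of `f`. -/
def formIdeal {n t : ℕ} {c : Fin t → ℕ} (f : Forms n c) : Ideal (CoordRing n) :=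
  Ideal.span (Set.range fun i => (f i : CoordRing n))

/-- `f` defines a complete intersection in `ℙⁿ`: the subscheme `Proj (R / J_f)` has codimension
equal to the number `t` of equations. This is expressed through the affine cone, whose dimension
is the Krull dimension of `R / J_f` and has to be `n + 1 - t`. -/
def IsCI {n t : ℕ} {c : Fin t → ℕ} (f : Forms n c) : Prop :=
  ringKrullDim (CoordRing n ⧸ formIdeal f) + (t : WithBot ℕ∞) = (n : WithBot ℕ∞) + 1

/-- The points of the variety `H_c` that parametrizes the complete intersections of multi-degree
`c = (c₁, …, c_t)` in `ℙⁿ`. A complete intersection is given by its homogeneous ideal. (For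
`t < n`, the only case that is used, this ideal is saturated, so that it is determined by the
subscheme, and inclusion of subschemes is reverse inclusion of ideals.) -/
@[ext] structure CIParam (n : ℕ) {t : ℕ} (c : Fin t → ℕ) : Type where
  ideal : Ideal (CoordRing n)
  exists_forms : ∃ f : Forms n c, IsCI f ∧ formIdeal f = ideal

/-- The point of `H_c` given by a complete intersection `f`. -/
def CIParam.ofForms {n t : ℕ} {c : Fin t → ℕ} (f : Forms n c) (hf : IsCI f) : CIParam n c :=
  ⟨formIdeal f, f, hf, rfl⟩

/-- The points of `ℙⁿ`. -/
abbrev ProjPoint (n : ℕ) : Type := Projectivization ℂ (Fin (n + 1) → ℂ)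

/-- The homogeneous ideal `I_p` of a point `p` of `ℙⁿ`: the polynomials vanishing on the line
in `ℂⁿ⁺¹` that corresponds to `p`. -/
def pointIdeal {n : ℕ} (p : ProjPoint n) : Ideal (CoordRing n) :=
  MvPolynomial.vanishingIdeal ℂ (p.submodule : Set (Fin (n + 1) → ℂ))

/-- The point `o = [1 : 0 : … : 0]`. -/
def basePoint (n : ℕ) : ProjPoint n :=
  Projectivization.mk ℂ (Pi.single 0 1) (by simp)

/-- A complete intersection with ideal `J` and of codimension `t` is smooth at its point `p`
(Jacobian criterion): the gradients at `p` of the elements of `J` span a space of dimension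
`t`. -/
def IsSmoothAt {n : ℕ} (t : ℕ) (J : Ideal (CoordRing n)) (p : ProjPoint n) : Prop :=
  Module.finrank ℂ (Submodule.span ℂ
    ((fun (q : CoordRing n) (i : Fin (n + 1)) =>
      MvPolynomial.eval p.rep (MvPolynomial.pderiv i q)) '' (J : Set (CoordRing n)))) = t

/-- The singular points of a complete intersection. -/
def singularPoints {n t : ℕ} {c : Fin t → ℕ} (u : CIParam n c) : Set (ProjPoint n) :=
  {p | u.ideal ≤ pointIdeal p ∧ ¬ IsSmoothAt t u.ideal p}

/-- The subset `S_c` of `H_c` of all singular complete intersections. -/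
def singularLocus (n : ℕ) {t : ℕ} (c : Fin t → ℕ) : Set (CIParam n c) :=
  {u | (singularPoints u).Nonempty}

/-! ## The varieties, with their Zariski topologies

Only `ℂ`-valued points are considered. -/

/-- The point set of the universal family `{(p, Y) | p ∈ Y} ⊆ ℙⁿ × H_c`. For multi-degree `a` it
is the universal family `𝒳`, for multi-degree `b` the universal family `𝒵`. -/
@[ext] structure UnivFamily (n : ℕ) {t : ℕ} (c : Fin t → ℕ) : Type where
  pt : ProjPoint n
  ci : CIParam n c
  mem : ci.ideal ≤ pointIdeal pt

/-- The point set of `F_{b,a} ⊆ H_b × H_a`: the pairs `(Z, X)` with `Z` a subscheme of `X`. -/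
@[ext] structure FlagVariety (n : ℕ) {s r : ℕ} (b : Fin s → ℕ) (a : Fin r → ℕ) : Type where
  Z : CIParam n b
  X : CIParam n a
  sub : X.ideal ≤ Z.ideal

/-- The point set of the family `{(p, Z, X) | p ∈ Z ⊆ X} ⊆ ℙⁿ × H_b × H_a`, the pull-back of the
universal family over `H_b` to `F_{b,a}`. -/
@[ext] structure FlagFamily (n : ℕ) {s r : ℕ} (b : Fin s → ℕ) (a : Fin r → ℕ) : Type where
  pt : ProjPoint n
  Z : CIParam n b
  X : CIParam n a
  mem : Z.ideal ≤ pointIdeal pt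
  sub : X.ideal ≤ Z.ideal

/-- The polynomial functions on a complex vector space. -/
def polyFun (V : Type) [AddCommGroup V] [Module ℂ V] : Subalgebra ℂ (V → ℂ) :=
  Algebra.adjoin ℂ (Set.range fun (φ : Module.Dual ℂ V) (v : V) => φ v)

/-- The Zariski topology on a (finite-dimensional) complex vector space. -/
@[reducible] def zariskiTopology (V : Type) [AddCommGroup V] [Module ℂ V] : TopologicalSpace V :=
  TopologicalSpace.generateFrom {S | ∃ p ∈ polyFun V, S = {v | p v ≠ 0}}

/-- The quotient topology for a parametrization `κ` of `X` by a subset `D` of a vector space with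
its Zariski topology. It is used where `D` is Zariski open and `κ` is the map on points of a smooth
surjective morphism onto a variety; such a morphism is open, so that the quotient topology is the
Zariski topology of the variety. -/
@[reducible] def paramTopology {V X : Type} [AddCommGroup V] [Module ℂ V] (D : V → Prop)
    (κ : {v : V // D v} → X) : TopologicalSpace X :=
  ((zariskiTopology V).induced Subtype.val).coinduced κ

/-- The Zariski topology of `H_c`. -/
instance CIParam.instTop (n : ℕ) {t : ℕ} (c : Fin t → ℕ) : TopologicalSpace (CIParam n c) :=
  paramTopology (fun f : Forms n c => IsCI f) fun f => CIParam.ofForms f.1 f.2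

/-- The Zariski topology of the universal family, as a subset of `ℙⁿ × H_c`. (The Zariski topology
of a product is not the product topology.) -/
instance UnivFamily.instTop (n : ℕ) {t : ℕ} (c : Fin t → ℕ) : TopologicalSpace (UnivFamily n c) :=
  (paramTopology (X := ProjPoint n × CIParam n c)
    (fun x : (Fin (n + 1) → ℂ) × Forms n c => x.1 ≠ 0 ∧ IsCI x.2)
    fun x => (Projectivization.mk ℂ x.1.1 x.2.1, CIParam.ofForms x.1.2 x.2.2)).induced
      fun P => (P.pt, P.ci)

/-- The Zariski topology of `F_{b,a}`, as a subset of `H_b × H_a`. -/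
instance FlagVariety.instTop (n : ℕ) {s r : ℕ} (b : Fin s → ℕ) (a : Fin r → ℕ) :
    TopologicalSpace (FlagVariety n b a) :=
  (paramTopology (X := CIParam n b × CIParam n a)
    (fun x : Forms n b × Forms n a => IsCI x.1 ∧ IsCI x.2)
    fun x => (CIParam.ofForms x.1.1 x.2.1, CIParam.ofForms x.1.2 x.2.2)).induced
      fun P => (P.Z, P.X)

/-- The Zariski topology of the family over `F_{b,a}`, as a subset of `ℙⁿ × H_b × H_a`. -/
instance FlagFamily.instTop (n : ℕ) {s r : ℕ} (b : Fin s → ℕ) (a : Fin r → ℕ) :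
    TopologicalSpace (FlagFamily n b a) :=
  (paramTopology (X := ProjPoint n × CIParam n b × CIParam n a)
    (fun x : (Fin (n + 1) → ℂ) × Forms n b × Forms n a => x.1 ≠ 0 ∧ IsCI x.2.1 ∧ IsCI x.2.2)
    fun x => (Projectivization.mk ℂ x.1.1 x.2.1, CIParam.ofForms x.1.2.1 x.2.2.1,
      CIParam.ofForms x.1.2.2 x.2.2.2)).induced
      fun Q => (Q.pt, Q.Z, Q.X)

section Morphisms

variable {n s r : ℕ} {b : Fin s → ℕ} {a : Fin r → ℕ}

/-- `ρ : F_{b,a} → H_a`, `(Z, X) ↦ X`. -/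
def rho (P : FlagVariety n b a) : CIParam n a := P.X

/-- `π`, `(p, Z, X) ↦ (Z, X)`. -/
def piMap (Q : FlagFamily n b a) : FlagVariety n b a := ⟨Q.Z, Q.X, Q.sub⟩

/-- `α`, `(p, Z, X) ↦ (p, X)`. -/
def alpha (Q : FlagFamily n b a) : UnivFamily n a := ⟨Q.pt, Q.X, Q.sub.trans Q.mem⟩

/-- `β`, `(p, Z, X) ↦ (p, Z)`. -/
def beta (Q : FlagFamily n b a) : UnivFamily n b := ⟨Q.pt, Q.Z, Q.mem⟩

end Morphisms

/-! ## Zariski tangent spaces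

The varieties above represent functors of families of nested subschemes of `ℙⁿ`. Their Zariski
tangent spaces are the spaces of first-order deformations, that is, of points with values in the
dual numbers `ℂ[ε]`. A first-order deformation of the homogeneous ideal `J` is a homogeneous ideal
of `R[ε]`, flat over `ℂ[ε]` and reducing to `J` modulo `ε`; these are the ideals
`{p + ε q | p ∈ J, q mod J = φ p}` for the degree-preserving `R`-linear maps `φ : J → R / J`. -/

/-- The degree-preserving `R`-linear maps `J → R / J`. -/
def degreePreserving {n : ℕ} (J : Ideal (CoordRing n)) :
    Submodule ℂ (J →ₗ[CoordRing n] CoordRing n ⧸ J) where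
  carrier := {φ | ∀ (d : ℕ) (p : J), (p : CoordRing n).IsHomogeneous d →
    ∃ q : CoordRing n, q.IsHomogeneous d ∧ φ p = Ideal.Quotient.mk J q}
  zero_mem' := fun d p _ => ⟨0, MvPolynomial.isHomogeneous_zero _ _ _, by simp⟩
  add_mem' := by
    intro φ ψ hφ hψ d p hp
    obtain ⟨q, hq, e⟩ := hφ d p hp
    obtain ⟨q', hq', e'⟩ := hψ d p hp
    exact ⟨q + q', hq.add hq', by simp [e, e']⟩
  smul_mem' := by
    intro c φ hφ d p hp
    obtain ⟨q, hq, e⟩ := hφ d p hp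
    refine ⟨c • q, (MvPolynomial.homogeneousSubmodule (Fin (n + 1)) ℂ d).smul_mem c hq, ?_⟩
    rw [LinearMap.smul_apply, e]
    rfl

/-- The space of first-order deformations of `J`: the tangent space of `H_c` at the complete
intersection with ideal `J`, and the tangent space of `ℙⁿ` at the point with ideal `J`. -/
def Tangent {n : ℕ} (J : Ideal (CoordRing n)) : Type := degreePreserving J

instance Tangent.instAddCommGroup {n : ℕ} (J : Ideal (CoordRing n)) : AddCommGroup (Tangent J) :=
  inferInstanceAs (AddCommGroup (degreePreserving J))

instance Tangent.instModule {n : ℕ} (J : Ideal (CoordRing n)) : Module ℂ (Tangent J) :=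
  inferInstanceAs (Module ℂ (degreePreserving J))

/-- The map `J → R / J` that describes a first-order deformation. -/
def Tangent.toHom {n : ℕ} {J : Ideal (CoordRing n)} : Tangent J →ₗ[ℂ]
    (J →ₗ[CoordRing n] CoordRing n ⧸ J) :=
  (degreePreserving J).subtype

/-- The ideal `{p + ε q | p ∈ J, q mod J = φ p}` of `R[ε]`: the first-order deformation of `J`
given by `φ`. -/
def deformedIdeal {n : ℕ} {J : Ideal (CoordRing n)} (φ : Tangent J) :
    Ideal (DualNumber (CoordRing n)) where
  carrier := {z | ∃ h : z.fst ∈ J, φ.toHom ⟨z.fst, h⟩ = Ideal.Quotient.mk J z.snd}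
  zero_mem' := ⟨by simp, by
    have : (⟨(0 : DualNumber (CoordRing n)).fst, by simp⟩ : J) = 0 := Subtype.ext (by simp)
    rw [this]; simp⟩
  add_mem' := by
    rintro y z ⟨hy, ey⟩ ⟨hz, ez⟩
    refine ⟨by simpa using J.add_mem hy hz, ?_⟩
    have : (⟨(y + z).fst, by simpa using J.add_mem hy hz⟩ : J)
        = ⟨y.fst, hy⟩ + ⟨z.fst, hz⟩ := Subtype.ext (by simp)
    rw [this, map_add, ey, ez]; simp
  smul_mem' := by
    rintro w z ⟨hz, ez⟩
    have hm : (w • z).fst ∈ J := by simpa using J.mul_mem_left w.fst hz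
    refine ⟨hm, ?_⟩
    have : (⟨(w • z).fst, hm⟩ : J) = w.fst • ⟨z.fst, hz⟩ := Subtype.ext (by simp)
    rw [this, map_smul, ez]
    have h0 : Ideal.Quotient.mk J z.fst = 0 := Ideal.Quotient.eq_zero_iff_mem.2 hz
    simp only [smul_eq_mul, TrivSqZeroExt.snd_mul, map_add]
    simp [h0]
    rfl

theorem deformedIdeal_le_iff {n : ℕ} {J K : Ideal (CoordRing n)} (h : J ≤ K) (ψ : Tangent J)
    (φ : Tangent K) : deformedIdeal ψ ≤ deformedIdeal φ ↔
      ∀ p : J, Ideal.Quotient.factor h (ψ.toHom p) = φ.toHom ⟨p.1, h p.2⟩ := by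
  constructor
  · intro H p
    obtain ⟨q, hq⟩ := Ideal.Quotient.mk_surjective (ψ.toHom p)
    obtain ⟨_, e⟩ := H (show TrivSqZeroExt.inl p.1 + TrivSqZeroExt.inr q ∈ deformedIdeal ψ from
      ⟨by simp, by simpa using hq.symm⟩)
    rw [← hq]
    simpa using e.symm
  · rintro H z ⟨hz, ez⟩
    exact ⟨h hz, by rw [← H ⟨z.fst, hz⟩, ez]; simp⟩

/-- The tangent space of an incidence variety of nested subschemes at the pair with ideals
`K ⊇ J`: the pairs of first-order deformations that are again nested. -/
def NestedTangent {n : ℕ} {J K : Ideal (CoordRing n)} (h : J ≤ K) :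
    Submodule ℂ (Tangent K × Tangent J) where
  carrier := {x | deformedIdeal x.2 ≤ deformedIdeal x.1}
  zero_mem' := (deformedIdeal_le_iff h _ _).2 fun p => by simp
  add_mem' := by
    intro x y hx hy
    refine (deformedIdeal_le_iff h _ _).2 fun p => ?_
    have e := (deformedIdeal_le_iff h _ _).1 hx p
    have e' := (deformedIdeal_le_iff h _ _).1 hy p
    simp [e, e']
  smul_mem' := by
    intro c x hx
    refine (deformedIdeal_le_iff h _ _).2 fun p => ?_
    have e := (deformedIdeal_le_iff h _ _).1 hx p
    have e2 : ∀ y : CoordRing n ⧸ J,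
        Ideal.Quotient.factor h (c • y) = c • Ideal.Quotient.factor h y := by
      intro y
      obtain ⟨q, rfl⟩ := Ideal.Quotient.mk_surjective y
      rfl
    simp [e, e2]

section Differentials

variable {n t s r : ℕ} {c : Fin t → ℕ} {b : Fin s → ℕ} {a : Fin r → ℕ}

/-- The tangent space of `H_c` at `u`. -/
abbrev CIParam.T (u : CIParam n c) : Type := Tangent u.ideal

/-- The tangent space of the universal family over `H_c` at `P`. -/
abbrev UnivFamily.T (P : UnivFamily n c) :
    Submodule ℂ (Tangent (pointIdeal P.pt) × Tangent P.ci.ideal) :=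
  NestedTangent P.mem

/-- The tangent space of `F_{b,a}` at `P`. -/
abbrev FlagVariety.T (P : FlagVariety n b a) :
    Submodule ℂ (Tangent P.Z.ideal × Tangent P.X.ideal) :=
  NestedTangent P.sub

/-- The tangent space at `Q = (p, Z, X)` of the family over `F_{b,a}`: the triples of first-order
deformations of `p`, `Z` and `X` that satisfy `p ∈ Z ⊆ X`. -/
def FlagFamily.T (Q : FlagFamily n b a) :
    Submodule ℂ (Tangent (pointIdeal Q.pt) × Tangent Q.Z.ideal × Tangent Q.X.ideal) :=
  (NestedTangent Q.mem).comap
      ((LinearMap.fst ℂ _ _).prod ((LinearMap.fst ℂ _ _).comp (LinearMap.snd ℂ _ _))) ⊓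
    (NestedTangent Q.sub).comap (LinearMap.snd ℂ _ _)

/-- The differential at `P` of the projection from the universal family to `H_c`. -/
def dphi (P : UnivFamily n c) : P.T →ₗ[ℂ] P.ci.T :=
  (LinearMap.snd ℂ _ _).comp P.T.subtype

/-- The differential `(dρ)_P`. -/
def drho (P : FlagVariety n b a) : P.T →ₗ[ℂ] (rho P).T :=
  (LinearMap.snd ℂ _ _).comp P.T.subtype

/-- The differential `(dα)_Q`. -/
def dalpha (Q : FlagFamily n b a) : Q.T →ₗ[ℂ] (alpha Q).T :=
  (((LinearMap.fst ℂ _ _).prod ((LinearMap.snd ℂ _ _).comp (LinearMap.snd ℂ _ _))).comp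
    Q.T.subtype).codRestrict _ fun x => le_trans (b := deformedIdeal x.1.2.1) x.2.2 x.2.1

end Differentials

/-! ## Critical points and the locus `Ξ_o` -/

/-- The set of critical points of the projection from the universal family to `H_c`. -/
def criticalSet (n : ℕ) {t : ℕ} (c : Fin t → ℕ) : Set (UnivFamily n c) :=
  {P | ¬ Function.Surjective (dphi P)}

/-- The set `Γ_o` of critical points lying over `o`. -/
def criticalSetAt (n : ℕ) {t : ℕ} (c : Fin t → ℕ) : Set (UnivFamily n c) :=
  {P ∈ criticalSet n c | P.pt = basePoint n}

/-- The set `Ξ_o` of the points `(o, Z, X)` such that `(o, X)` is a critical point of `𝒳 → H_a`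
and `(o, Z)` is not a critical point of `𝒵 → H_b`. -/
def XiAt (n : ℕ) {s r : ℕ} (b : Fin s → ℕ) (a : Fin r → ℕ) : Set (FlagFamily n b a) :=
  {Q | Q.pt = basePoint n ∧ alpha Q ∈ criticalSet n a ∧ beta Q ∉ criticalSet n b}

/-- `C` is an irreducible component of `Ξ_o` that `α` maps dominantly to `Γ_o`. -/
def IsDominantComponent {n s r : ℕ} {b : Fin s → ℕ} {a : Fin r → ℕ}
    (C : Set (FlagFamily n b a)) : Prop :=
  (∃ D ∈ irreducibleComponents (XiAt n b a), C = Subtype.val '' D) ∧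
    criticalSetAt n a ⊆ closure (alpha '' C)

end

/-! If `X` has equations `f` and `Z` has equations `k`, then `Z ⊆ X` means `f = h k` for a matrix
`h` of forms of degrees `a_i - b_j`. To first order everything is governed by the differential `(g,
c) ↦ h g + c k` of the map `(k, h) ↦ h k`. Its image `diffRange` has the same codimension as the
image of `dρ` (`finrank_coker_drho`), and its image `diffRangeAt` on the `g` that vanish at `p`
determines the dimension of the kernel of `dα` (`finrank_ker_dalpha`). So (2) and (3) are two rank
computations.

Lower bounds for the codimensions. Write `∂` for the gradient at `o`. Over `Ξ_o` one has `k(o) = 0`,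
hence `∂f_i = Σ_j h_ij(o) ∂k_j`. The `∂k_j` are independent and the `∂f_i` are not, so `z h(o) = 0`
for some `z ≠ 0`. Every `F = h g + c k` then satisfies `z · F(o) = 0`; if `g(o) = 0`, then even
`F(o) = 0`, and `z · ∂F` lies in the span of the `∂k_j`. The codimensions are at least `1` and `r +
(n - s)`.

Equality at a general point. A row operation makes the last equation singular at `o`
(`exists_singForms`), so that the last row of `h` vanishes at `o`. These pairs `(k, h)` form a
vector space `singParams`, which the product maps to the vector space `singForms`. By the hypothesis
on general singular `X` this map is dominant, so that, in characteristic zero, its differential is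
onto somewhere (`HasQuadraticDifferential.dominant_iff`). The remaining directions are measured by
`γ = g(o)` and `δ = c_r(o)`; their leading terms are `leadingMap`, which sends `(γ, δ)` to the
numbers `Σ_j h_ij(o) γ_j` for `i < r` and the vector `Σ_j (γ_j ∂h_rj + δ_j ∂k_j)`. The numerical
conditions make it onto for a suitable, hence a general, pair (`exists_index_embedding`,
`exists_leadingMap_surjective`), and then both bounds are attained. They stay attained on an open
set, because ranks are lower semicontinuous.

Dominance of `ρ`. Since `m > 2l`, `leadingMap` has a kernel, which gives a vector in the kernel of
the full differential with `g(o) ≠ 0`. Adding `t x₀^(a_r - b_j)` to an entry of the last row of `h`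
moves the image of this vector out of the hyperplane `F_r(o) = 0`. Hence the differential is
surjective for some `t`, and the converse half of the dominance criterion applies.

The component. The points of `Ξ_o` for which all gradients but the last are independent, for some
equations of `X`, form an open subset `initPart`. It is irreducible, being parametrized by an open
subset of `singParams`, and it contains every point of `Ξ_o` over some open set that meets `Γ_o`.
Only its closure can dominate `Γ_o`.

Dimensions. Complete intersections are regular sequences (`IsCI.isRegSeq`), so the dimensions of the
graded pieces of their ideals depend on the degrees alone. Linear slices transversal to the orbits
therefore give charts of `H_a` and `F_{b,a}`, whose dimensions can be read off. -/

noncomputable section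

open Matrix

/-! ### Polynomial functions and polynomial maps on complex vector spaces -/

section PolynomialFunctions

variable {U V W X Y : Type} [AddCommGroup U] [Module ℂ U] [AddCommGroup V] [Module ℂ V]
  [AddCommGroup W] [Module ℂ W] [AddCommGroup X] [Module ℂ X] [AddCommGroup Y] [Module ℂ Y]

theorem dual_mem_polyFun (φ : Module.Dual ℂ V) : (fun v => φ v) ∈ polyFun V :=
  Algebra.subset_adjoin ⟨φ, rfl⟩

theorem const_mem_polyFun (c : ℂ) : (fun _ : V => c) ∈ polyFun V :=
  (polyFun V).algebraMap_mem c

/-- Polynomial maps between complex vector spaces. -/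
def IsPolyMap (g : V → W) : Prop := ∀ φ : Module.Dual ℂ W, (fun v => φ (g v)) ∈ polyFun V

theorem IsPolyMap.comp_mem {g : V → W} (hg : IsPolyMap g) {p : W → ℂ} (hp : p ∈ polyFun W) :
    (fun v => p (g v)) ∈ polyFun V := by
  induction hp using Algebra.adjoin_induction with
  | mem x hx => obtain ⟨φ, rfl⟩ := hx; exact hg φ
  | algebraMap r => exact const_mem_polyFun r
  | add x y _ _ hx hy => exact add_mem hx hy
  | mul x y _ _ hx hy => exact mul_mem hx hy

theorem IsPolyMap.comp {g : V → W} {f : U → V} (hg : IsPolyMap g) (hf : IsPolyMap f) :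
    IsPolyMap (fun u => g (f u)) := fun φ => hf.comp_mem (hg φ)

theorem LinearMap.isPolyMap (L : V →ₗ[ℂ] W) : IsPolyMap L := fun φ =>
  dual_mem_polyFun (φ.comp L)

theorem isPolyMap_id : IsPolyMap (fun v : V => v) := fun φ => dual_mem_polyFun φ

theorem isPolyMap_const (w : W) : IsPolyMap (fun _ : V => w) := fun φ => const_mem_polyFun (φ w)

theorem IsPolyMap.add {f g : V → W} (hf : IsPolyMap f) (hg : IsPolyMap g) :
    IsPolyMap (fun v => f v + g v) := fun φ => by
  simp only [map_add]
  exact add_mem (hf φ) (hg φ)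

theorem IsPolyMap.sub {f g : V → W} (hf : IsPolyMap f) (hg : IsPolyMap g) :
    IsPolyMap (fun v => f v - g v) := fun φ => by
  simp only [map_sub]
  exact sub_mem (hf φ) (hg φ)

theorem IsPolyMap.smul {p : V → ℂ} {g : V → W} (hp : p ∈ polyFun V) (hg : IsPolyMap g) :
    IsPolyMap (fun v => p v • g v) := fun φ => by
  simp only [map_smul, smul_eq_mul]
  exact mul_mem hp (hg φ)

theorem isPolyMap_sum {ι : Type*} (s : Finset ι) {g : ι → V → W} (hg : ∀ i ∈ s, IsPolyMap (g i)) :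
    IsPolyMap (fun v => ∑ i ∈ s, g i v) := fun φ => by
  have : (fun v => φ (∑ i ∈ s, g i v)) = ∑ i ∈ s, fun v => φ (g i v) := by
    ext v; simp
  rw [this]
  exact sum_mem fun i hi => hg i hi φ

theorem IsPolyMap.prodMk {f : U → V} {g : U → W} (hf : IsPolyMap f) (hg : IsPolyMap g) :
    IsPolyMap (fun u => (f u, g u)) := fun φ => by
  have : (fun u => φ (f u, g u)) = (fun u => φ.comp (LinearMap.inl ℂ V W) (f u)) +
      fun u => φ.comp (LinearMap.inr ℂ V W) (g u) := by
    ext u; simp [← map_add]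
  rw [this]
  exact add_mem (hf _) (hg _)

theorem IsPolyMap.fst {f : U → V × W} (hf : IsPolyMap f) : IsPolyMap (fun u => (f u).1) :=
  (LinearMap.fst ℂ V W).isPolyMap.comp hf

theorem IsPolyMap.snd {f : U → V × W} (hf : IsPolyMap f) : IsPolyMap (fun u => (f u).2) :=
  (LinearMap.snd ℂ V W).isPolyMap.comp hf

theorem IsPolyMap.linear {f : U → V} (hf : IsPolyMap f) (L : V →ₗ[ℂ] W) :
    IsPolyMap (fun u => L (f u)) := L.isPolyMap.comp hf

theorem IsPolyMap.bilin [FiniteDimensional ℂ V] (B : V →ₗ[ℂ] W →ₗ[ℂ] X) {f : U → V} {g : U → W}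
    (hf : IsPolyMap f) (hg : IsPolyMap g) : IsPolyMap (fun u => B (f u) (g u)) := by
  set e := Module.finBasis ℂ V
  have : (fun u => B (f u) (g u)) = fun u => ∑ i, e.coord i (f u) • B (e i) (g u) := by
    ext u
    conv_lhs => rw [← e.sum_repr (f u)]
    simp only [map_sum, map_smul, LinearMap.sum_apply, LinearMap.smul_apply, Module.Basis.coord_apply]
  rw [this]
  exact isPolyMap_sum _ fun i _ => (hg.linear (B (e i))).smul (hf _)

theorem IsPolyMap.apply [FiniteDimensional ℂ X] [FiniteDimensional ℂ Y] {L : U → X →ₗ[ℂ] Y}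
    {g : U → X} (hL : IsPolyMap L) (hg : IsPolyMap g) : IsPolyMap (fun u => L u (g u)) :=
  IsPolyMap.bilin LinearMap.id hL hg

theorem polyFun_det {d : ℕ} {A : V → Matrix (Fin d) (Fin d) ℂ}
    (hA : ∀ i j, (fun v => A v i j) ∈ polyFun V) : (fun v => (A v).det) ∈ polyFun V := by
  have : (fun v => (A v).det) = ∑ σ : Equiv.Perm (Fin d),
      (fun _ => ((Equiv.Perm.sign σ : ℤ) : ℂ)) * ∏ i, fun v => A v (σ i) i := by
    ext v
    simp [Matrix.det_apply, Finset.sum_apply, Finset.prod_apply, Units.smul_def]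
  rw [this]
  exact sum_mem fun σ _ => mul_mem (const_mem_polyFun _) (prod_mem fun i _ => hA _ _)

/-- Restriction to lines reduces the irreducibility of `V` to polynomials in one variable. -/
theorem exists_line_polynomial {p : V → ℂ} (hp : p ∈ polyFun V) (x v : V) :
    ∃ P : Polynomial ℂ, ∀ t : ℂ, p (x + t • v) = P.eval t := by
  induction hp using Algebra.adjoin_induction with
  | mem q hq =>
    obtain ⟨φ, rfl⟩ := hq
    exact ⟨Polynomial.C (φ x) + Polynomial.X * Polynomial.C (φ v), fun t => by simp [mul_comm t]⟩
  | algebraMap r => exact ⟨Polynomial.C r, fun t => by simp⟩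
  | add q q' _ _ h h' =>
    obtain ⟨P, h⟩ := h
    obtain ⟨P', h'⟩ := h'
    exact ⟨P + P', fun t => by simp [h, h']⟩
  | mul q q' _ _ h h' =>
    obtain ⟨P, h⟩ := h
    obtain ⟨P', h'⟩ := h'
    exact ⟨P * P', fun t => by simp [h, h']⟩

end PolynomialFunctions

/-! ### Zariski open sets: irreducibility, semicontinuity of ranks, solutions of linear systems -/

section ZariskiOpen

variable {U V W X Y : Type} [AddCommGroup U] [Module ℂ U] [AddCommGroup V] [Module ℂ V]
  [AddCommGroup W] [Module ℂ W] [AddCommGroup X] [Module ℂ X] [AddCommGroup Y] [Module ℂ Y]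

/-- Zariski open subsets of a complex vector space. -/
def ZOpen (S : Set V) : Prop := @IsOpen V (zariskiTopology V) S

theorem zopen_ne_zero {p : V → ℂ} (hp : p ∈ polyFun V) : ZOpen {v | p v ≠ 0} :=
  TopologicalSpace.isOpen_generateFrom_of_mem ⟨p, hp, rfl⟩

/-- The sets `p ≠ 0` are closed under finite intersection, because one can multiply the functions;
so they form a basis and not only a subbasis. -/
theorem zopen_iff {S : Set V} :
    ZOpen S ↔ ∀ x ∈ S, ∃ p ∈ polyFun V, p x ≠ 0 ∧ ∀ y, p y ≠ 0 → y ∈ S := by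
  constructor
  · intro h
    induction h with
    | basic s hs =>
      obtain ⟨p, hp, rfl⟩ := hs
      exact fun x hx => ⟨p, hp, hx, fun y hy => hy⟩
    | univ => exact fun x _ => ⟨1, one_mem _, by simp, by simp⟩
    | inter s t _ _ hs ht =>
      rintro x ⟨h1, h2⟩
      obtain ⟨p, hp, hpx, hps⟩ := hs x h1
      obtain ⟨q, hq, hqx, hqs⟩ := ht x h2
      refine ⟨p * q, mul_mem hp hq, mul_ne_zero hpx hqx, fun y hy => ?_⟩
      exact ⟨hps y (left_ne_zero_of_mul hy), hqs y (right_ne_zero_of_mul hy)⟩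
    | sUnion s _ hs =>
      rintro x ⟨t, ht, hx⟩
      obtain ⟨p, hp, hpx, hps⟩ := hs t ht x hx
      exact ⟨p, hp, hpx, fun y hy => ⟨t, ht, hps y hy⟩⟩
  · intro h
    choose! p hp hpx hps using h
    have : S = ⋃ x ∈ S, {v | p x v ≠ 0} := by
      ext y
      simp only [Set.mem_iUnion, Set.mem_ofPred_eq]
      exact ⟨fun hy => ⟨y, hy, hpx y hy⟩, fun ⟨x, hx, hy⟩ => hps x hx y hy⟩
    rw [this]
    exact @isOpen_biUnion _ _ (zariskiTopology V) _ _ fun x hx => zopen_ne_zero (hp x hx)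

theorem ZOpen.inter {S T : Set V} (hS : ZOpen S) (hT : ZOpen T) : ZOpen (S ∩ T) := by
  exact @IsOpen.inter _ (zariskiTopology V) _ _ hS hT

theorem ZOpen.and {S T : V → Prop} (hS : ZOpen {v | S v}) (hT : ZOpen {v | T v}) :
    ZOpen {v | S v ∧ T v} := hS.inter hT

theorem zopen_iUnion {ι : Sort*} {S : ι → Set V} (hS : ∀ i, ZOpen (S i)) : ZOpen (⋃ i, S i) := by
  exact @isOpen_iUnion _ _ (zariskiTopology V) _ hS

theorem zopen_exists {ι : Sort*} {S : ι → V → Prop} (hS : ∀ i, ZOpen {v | S i v}) :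
    ZOpen {v | ∃ i, S i v} := by
  have := zopen_iUnion hS
  rwa [← Set.ofPred_exists] at this

theorem zopen_univ : ZOpen (Set.univ : Set V) := by
  exact @isOpen_univ _ (zariskiTopology V)

theorem ZOpen.preimage {S : Set W} (hS : ZOpen S) {g : V → W} (hg : IsPolyMap g) :
    ZOpen (g ⁻¹' S) := by
  rw [zopen_iff] at hS ⊢
  intro x hx
  obtain ⟨p, hp, h1, h2⟩ := hS _ hx
  exact ⟨_, hg.comp_mem hp, h1, fun y hy => h2 _ hy⟩

/-- This is the irreducibility of a vector space. On the line from a point of `S` to a point of `T`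
the two defining functions are nonzero polynomials in `t`, by their values at `0` and at `1`, and so
they have a common non-root. -/
theorem ZOpen.nonempty_inter {S T : Set V} (hS : ZOpen S) (hT : ZOpen T) (hS' : S.Nonempty)
    (hT' : T.Nonempty) : (S ∩ T).Nonempty := by
  obtain ⟨x, hx⟩ := hS'
  obtain ⟨y, hy⟩ := hT'
  obtain ⟨p, hp, hpx, hpS⟩ := zopen_iff.1 hS x hx
  obtain ⟨q, hq, hqy, hqT⟩ := zopen_iff.1 hT y hy
  obtain ⟨P, hP⟩ := exists_line_polynomial hp x (y - x)
  obtain ⟨Q, hQ⟩ := exists_line_polynomial hq x (y - x)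
  have hP0 : P ≠ 0 := by
    rintro rfl
    apply hpx
    simpa using hP 0
  have hQ0 : Q ≠ 0 := by
    rintro rfl
    apply hqy
    simpa using hQ 1
  obtain ⟨t, ht⟩ : ∃ t, (P * Q).eval t ≠ 0 := by
    by_contra! h
    exact mul_ne_zero hP0 hQ0 (Polynomial.funext (by simpa using h))
  rw [Polynomial.eval_mul, ← hP, ← hQ] at ht
  exact ⟨_, hpS _ (left_ne_zero_of_mul ht), hqT _ (right_ne_zero_of_mul ht)⟩

/-- At a given point choose `ρ` vectors with independent images, and a left inverse `J` of the
resulting map from `ℂ^ρ`. The determinant of the composite `J ∘ L v ∘ I` is polynomial in `v`,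
equals `1` at the given point, and where it does not vanish the images stay independent. -/
theorem zopen_le_finrank_range [FiniteDimensional ℂ X] [FiniteDimensional ℂ Y]
    {L : V → X →ₗ[ℂ] Y} (hL : IsPolyMap L) (ρ : ℕ) :
    ZOpen {v | ρ ≤ Module.finrank ℂ (LinearMap.range (L v))} := by
  rw [zopen_iff]
  intro x hx
  obtain ⟨g, hg⟩ := exists_linearIndependent_of_le_finrank
    (show ρ ≤ Module.finrank ℂ (LinearMap.range (L x)) from hx)
  choose z hz using fun i => (g i).2
  have hg' : LinearIndependent ℂ fun i => L x (z i) := by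
    have := hg.map' (LinearMap.range (L x)).subtype (Submodule.ker_subtype _)
    simpa [Function.comp_def, hz] using this
  set I : (Fin ρ → ℂ) →ₗ[ℂ] X := Fintype.linearCombination ℂ z
  obtain ⟨J, hJ⟩ := LinearMap.exists_leftInverse_of_injective
    (Fintype.linearCombination ℂ fun i => L x (z i))
    (LinearMap.ker_eq_bot.2 hg'.fintypeLinearCombination_injective)
  set A : V → Matrix (Fin ρ) (Fin ρ) ℂ := fun v => LinearMap.toMatrix' (J ∘ₗ L v ∘ₗ I) with hA
  refine ⟨fun v => (A v).det, polyFun_det fun i j => ?_, ?_, fun y hy => ?_⟩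
  · have h1 : IsPolyMap fun v => J (L v (I (Pi.single j 1))) :=
      (hL.apply (isPolyMap_const _)).linear J
    have h2 := h1 (LinearMap.proj i)
    simpa [hA, LinearMap.toMatrix'_apply] using h2
  · have : J ∘ₗ L x ∘ₗ I = LinearMap.id := by
      rw [← hJ]
      ext i
      simp [I]
    simp [hA, this]
  · have h1 : Function.Injective (J ∘ₗ L y ∘ₗ I) := by
      have hu : IsUnit (A y) := (Matrix.isUnit_iff_isUnit_det _).2 (isUnit_iff_ne_zero.2 hy)
      have := Matrix.mulVec_injective_iff_isUnit.2 hu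
      intro v w hvw
      apply this
      simpa [hA, LinearMap.toMatrix'_mulVec] using hvw
    have h2 : LinearIndependent ℂ fun i => L y (z i) := by
      rw [Fintype.linearIndependent_iff]
      intro c hc i
      have : (J ∘ₗ L y ∘ₗ I) c = (J ∘ₗ L y ∘ₗ I) 0 := by
        simp [I, Fintype.linearCombination_apply, hc]
      exact congrFun (h1 this) i
    have h3 : LinearIndependent ℂ fun i =>
        (⟨L y (z i), LinearMap.mem_range_self _ _⟩ : LinearMap.range (L y)) :=
      LinearIndependent.of_comp (LinearMap.range (L y)).subtype h2
    have h4 := h3.fintype_card_le_finrank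
    rwa [Fintype.card_fin] at h4

theorem zopen_surjective [FiniteDimensional ℂ X] [FiniteDimensional ℂ Y]
    {L : V → X →ₗ[ℂ] Y} (hL : IsPolyMap L) : ZOpen {v | Function.Surjective (L v)} := by
  convert zopen_le_finrank_range hL (Module.finrank ℂ Y) using 3 with v
  rw [← LinearMap.range_eq_top]
  exact ⟨fun h => by rw [h, finrank_top], fun h => Submodule.eq_top_of_finrank_eq
    (le_antisymm (Submodule.finrank_le _) h)⟩

theorem zopen_injective [FiniteDimensional ℂ X] [FiniteDimensional ℂ Y]
    {L : V → X →ₗ[ℂ] Y} (hL : IsPolyMap L) : ZOpen {v | Function.Injective (L v)} := by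
  convert zopen_le_finrank_range hL (Module.finrank ℂ X) using 3 with v
  rw [← LinearMap.ker_eq_bot, ← (L v).finrank_range_add_finrank_ker, add_le_iff_nonpos_right,
    Nat.le_zero, Submodule.finrank_eq_zero]

theorem zopen_bijective [FiniteDimensional ℂ X] [FiniteDimensional ℂ Y]
    {L : V → X →ₗ[ℂ] Y} (hL : IsPolyMap L) : ZOpen {v | Function.Bijective (L v)} :=
  (zopen_injective hL).and (zopen_surjective hL)

theorem zopen_linearIndependent [FiniteDimensional ℂ W] {m : ℕ} {g : V → Fin m → W}
    (hg : ∀ i, IsPolyMap fun v => g v i) : ZOpen {v | LinearIndependent ℂ (g v)} := by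
  have hL : IsPolyMap fun v => (Fintype.linearCombination ℂ (g v) : (Fin m → ℂ) →ₗ[ℂ] W) := by
    have : (fun v => (Fintype.linearCombination ℂ (g v) : (Fin m → ℂ) →ₗ[ℂ] W)) =
        fun v => ∑ i, LinearMap.smulRightₗ (LinearMap.proj i : (Fin m → ℂ) →ₗ[ℂ] ℂ) (g v i) := by
      ext v i
      simp [Finset.sum_apply, Pi.single_apply]
    rw [this]
    exact isPolyMap_sum _ fun i _ => (hg i).linear
      (LinearMap.smulRightₗ (LinearMap.proj i : (Fin m → ℂ) →ₗ[ℂ] ℂ))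
  convert zopen_injective hL using 3 with v
  exact linearIndependent_iff_injective_fintypeLinearCombination

/-- Needed for solutions given by Cramer's rule, which are rational with a determinant `q` as
denominator. -/
theorem exists_clear_denominators [FiniteDimensional ℂ X] {q : V → ℂ} (hq : q ∈ polyFun V)
    {u : V → X} (hu : IsPolyMap u) {p : X → ℂ} (hp : p ∈ polyFun X) :
    ∃ m : ℕ, ∃ P ∈ polyFun V, ∀ v, q v ≠ 0 → P v = q v ^ m * p ((q v)⁻¹ • u v) := by
  induction hp using Algebra.adjoin_induction with
  | mem p hp =>
    obtain ⟨φ, rfl⟩ := hp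
    refine ⟨1, _, hu φ, fun v hv => ?_⟩
    simp [hv]
  | algebraMap r => exact ⟨0, _, const_mem_polyFun r, fun v _ => by simp⟩
  | add p p' _ _ h h' =>
    obtain ⟨m, P, hP, h⟩ := h
    obtain ⟨m', P', hP', h'⟩ := h'
    refine ⟨m + m', q ^ m' * P + q ^ m * P', add_mem (mul_mem (pow_mem hq _) hP)
      (mul_mem (pow_mem hq _) hP'), fun v hv => ?_⟩
    simp only [Pi.add_apply, Pi.mul_apply, Pi.pow_apply, h v hv, h' v hv]
    ring
  | mul p p' _ _ h h' =>
    obtain ⟨m, P, hP, h⟩ := h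
    obtain ⟨m', P', hP', h'⟩ := h'
    refine ⟨m + m', P * P', mul_mem hP hP', fun v hv => ?_⟩
    simp only [Pi.mul_apply, h v hv, h' v hv]
    ring

/-- The solution of a linear system depends continuously on the coefficients. -/
theorem zopen_solution [FiniteDimensional ℂ X] [FiniteDimensional ℂ Y] {L : V → X →ₗ[ℂ] Y}
    (hL : IsPolyMap L) {w : V → Y} (hw : IsPolyMap w) {O : Set X} (hO : ZOpen O) :
    ZOpen {v | Function.Bijective (L v) ∧ ∃ x ∈ O, L v x = w v} := by
  rw [zopen_iff]
  rintro v₀ ⟨hb, x₀, hx₀, e₀⟩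
  obtain ⟨p, hp, hpx, hpO⟩ := zopen_iff.1 hO x₀ hx₀
  -- The inverse at `v₀` turns the system into a square one with matrix `A v`, of determinant `1` at
  -- `v₀`. By Cramer's rule its solution is `u v` divided by `det (A v)`.
  set M : Y →ₗ[ℂ] X :=
    ((LinearEquiv.ofBijective (L v₀) hb).symm : Y →ₗ[ℂ] X) with hM
  have hML : ∀ x, M (L v₀ x) = x := fun x =>
    (LinearEquiv.ofBijective (L v₀) hb).symm_apply_apply x
  set e := Module.finBasis ℂ X
  set A : V → Matrix _ _ ℂ := fun v => LinearMap.toMatrix e e (M ∘ₗ L v) with hA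
  have hAp : ∀ i j, (fun v => A v i j) ∈ polyFun V := fun i j => by
    have := ((hL.apply (isPolyMap_const (e j))).linear M) (e.coord i)
    simpa [hA, LinearMap.toMatrix_apply] using this
  set u : V → X := fun v => ∑ i, Matrix.cramer (A v) (e.repr (M (w v))) i • e i with hu
  have hup : IsPolyMap u := isPolyMap_sum _ fun i _ => by
    refine IsPolyMap.smul ?_ (isPolyMap_const _)
    simp only [Matrix.cramer_apply]
    refine polyFun_det fun a b => ?_
    by_cases h : b = i
    · subst h
      simpa using (hw.linear M) (e.coord a)
    · simpa [Matrix.updateCol_ne h] using hAp a b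
  have hq := polyFun_det hAp
  obtain ⟨m, P, hP, hPq⟩ := exists_clear_denominators hq hup hp
  have key : ∀ v, (A v).det ≠ 0 → ∀ x, L v x = w v → ((A v).det)⁻¹ • u v = x := by
    intro v hv x hx
    rw [inv_smul_eq_iff₀ hv]
    apply e.repr.injective
    have h1 : A v *ᵥ (e.repr x) = e.repr (M (w v)) := by
      rw [hA, LinearMap.toMatrix_mulVec_repr]
      simp [hx]
    have h2 : Matrix.cramer (A v) (e.repr (M (w v))) = (A v).det • ⇑(e.repr x) := by
      rw [← h1, Matrix.cramer_eq_adjugate_mulVec, Matrix.mulVec_mulVec, Matrix.adjugate_mul,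
        Matrix.smul_mulVec, Matrix.one_mulVec]
    ext i
    rw [hu]
    simp only [e.repr_sum_self, h2]
    simp
  obtain ⟨D, hD, hD0, hDb⟩ := zopen_iff.1 (zopen_bijective hL) v₀ hb
  have hA0 : (A v₀).det = 1 := by
    have : M ∘ₗ L v₀ = LinearMap.id := LinearMap.ext hML
    simp [hA, this]
  refine ⟨D * ((fun v => (A v).det) * P), mul_mem hD (mul_mem hq hP), ?_, fun v hv => ?_⟩
  · have h1 := hPq v₀ (by simp [hA0])
    rw [key v₀ (by simp [hA0]) x₀ e₀] at h1
    simp only [Pi.mul_apply, hA0, h1]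
    simp [hD0, hpx]
  · have h1 : (A v).det ≠ 0 := left_ne_zero_of_mul (right_ne_zero_of_mul hv)
    have h2 : P v ≠ 0 := right_ne_zero_of_mul (right_ne_zero_of_mul hv)
    have h3 := hDb v (left_ne_zero_of_mul hv)
    obtain ⟨x, hx⟩ := h3.2 (w v)
    refine ⟨h3, x, hpO _ ?_, hx⟩
    rw [hPq v h1, key v h1 x hx] at h2
    exact right_ne_zero_of_mul h2

end ZariskiOpen

end

noncomputable section

/-! ### Krull dimension of Zariski topologies and of spaces with charts -/

section KrullDimension

/-- The dimension is the supremum of the coheights of irreducible closed sets, and such a coheight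
can be computed in any open set that meets the closed set. -/
theorem topologicalKrullDim_eq_of_open_cover {X : Type*} [TopologicalSpace X] [Nonempty X]
    (d : WithBot ℕ∞)
    (h : ∀ x : X, ∃ N : Set X, IsOpen N ∧ x ∈ N ∧ topologicalKrullDim N = d) :
    topologicalKrullDim X = d := by
  apply le_antisymm
  · rw [topologicalKrullDim, Order.krullDim_eq_iSup_coheight]
    apply iSup_le
    intro Z
    obtain ⟨x, hx⟩ := Z.isIrreducible.nonempty
    obtain ⟨N, hN, hxN, rfl⟩ := h x
    have hf : Topology.IsOpenEmbedding (Subtype.val : N → X) := hN.isOpenEmbedding_subtypeVal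
    have hne : (Subtype.val ⁻¹' (Z : Set X) : Set N).Nonempty := ⟨⟨x, hxN⟩, hx⟩
    obtain ⟨Z', hZ'⟩ : ∃ Z', TopologicalSpace.IrreducibleCloseds.map Subtype.val hf.continuous Z' = Z := by
      have := ((TopologicalSpace.IrreducibleCloseds.orderIsoOfIsOpenEmbedding Subtype.val
        hf).apply_symm_apply ⟨Z, hne⟩)
      exact ⟨_, congrArg Subtype.val this⟩
    rw [← hZ', hf.coheight_map]
    exact Order.coheight_le_krullDim _
  · obtain ⟨x⟩ := ‹Nonempty X›
    obtain ⟨N, hN, hxN, rfl⟩ := h x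
    exact topologicalKrullDim_subspace_le X N

theorem eval_mem_polyFun {V : Type} [AddCommGroup V] [Module ℂ V] {ι : Type*} [Fintype ι] {y : V → ι → ℂ}
    (hy : ∀ i, (fun v => y v i) ∈ polyFun V) (P : MvPolynomial ι ℂ) :
    (fun v => MvPolynomial.eval (y v) P) ∈ polyFun V := by
  induction P using MvPolynomial.induction_on with
  | C a => simpa using const_mem_polyFun a
  | add p q hp hq => simpa using! add_mem hp hq
  | mul_X p i hp => simpa using! mul_mem hp (hy i)

theorem exists_mvPolynomial_of_mem_polyFun {V : Type} [AddCommGroup V] [Module ℂ V]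
    {p : V → ℂ} (hp : p ∈ polyFun V) {ι : Type*} [Fintype ι]
    (e : Module.Basis ι ℂ V) :
    ∃ P : MvPolynomial ι ℂ, ∀ v, p v = MvPolynomial.eval (e.repr v) P := by
  induction hp using Algebra.adjoin_induction with
  | mem q hq =>
    obtain ⟨φ, rfl⟩ := hq
    refine ⟨∑ i, MvPolynomial.C (φ (e i)) * MvPolynomial.X i, fun v => ?_⟩
    conv_lhs => rw [← e.sum_repr v]
    simp only [map_sum, map_smul, smul_eq_mul, map_mul, MvPolynomial.eval_C, MvPolynomial.eval_X,
      mul_comm]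
  | algebraMap r => exact ⟨MvPolynomial.C r, fun v => by simp⟩
  | add q q' _ _ h h' =>
    obtain ⟨P, h⟩ := h
    obtain ⟨P', h'⟩ := h'
    exact ⟨P + P', fun v => by simp [h, h']⟩
  | mul q q' _ _ h h' =>
    obtain ⟨P, h⟩ := h
    obtain ⟨P', h'⟩ := h'
    exact ⟨P * P', fun v => by simp [h, h']⟩

variable {V : Type} [AddCommGroup V] [Module ℂ V] [FiniteDimensional ℂ V]

/-- Passing to vanishing ideals embeds the irreducible closed sets, with the order strictly
reversed, into the spectrum of the polynomial ring, whose dimension is known. -/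
theorem topologicalKrullDim_zariski_le :
    @topologicalKrullDim V (zariskiTopology V) ≤ Module.finrank ℂ V := by
  let _ := zariskiTopology V
  set e := Module.finBasis ℂ V
  set R := MvPolynomial (Fin (Module.finrank ℂ V)) ℂ
  have hR : ringKrullDim R = (Module.finrank ℂ V : ℕ) := by
    simp [R, MvPolynomial.ringKrullDim_of_isNoetherianRing]
  rw [← hR, ringKrullDim, ← Order.krullDim_orderDual]
  set I : Set V → Ideal R := fun Z =>
    { carrier := {P | ∀ v ∈ Z, MvPolynomial.eval (e.repr v) P = 0}
      zero_mem' := by simp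
      add_mem' := fun {P Q} hP hQ v hv => by simp [hP v hv, hQ v hv]
      smul_mem' := fun P Q hQ v hv => by simp [hQ v hv] }
  have hI : ∀ Z P, P ∈ I Z ↔ ∀ v ∈ Z, MvPolynomial.eval (e.repr v) P = 0 := fun Z P => Iff.rfl
  have hpoly : ∀ P : R, (fun v => MvPolynomial.eval (e.repr v) P) ∈ polyFun V := fun P =>
    eval_mem_polyFun (fun i => dual_mem_polyFun (e.coord i)) P
  have hprime : ∀ Z : TopologicalSpace.IrreducibleCloseds V, (I Z).IsPrime := by
    intro Z
    refine Ideal.isPrime_iff.2 ⟨fun h => ?_, fun {P Q} hPQ => ?_⟩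
    · obtain ⟨x, hx⟩ := Z.isIrreducible.nonempty
      have : (1 : R) ∈ I Z := by rw [h]; trivial
      simpa using (hI _ _).1 this x hx
    · by_contra! hcon
      obtain ⟨h1, h2⟩ := hcon
      simp only [hI, not_forall] at h1 h2
      obtain ⟨x, hx, hx'⟩ := h1
      obtain ⟨y, hy, hy'⟩ := h2
      obtain ⟨z, hz, hz1, hz2⟩ := Z.isIrreducible.2 _ _ (zopen_ne_zero (hpoly P))
        (zopen_ne_zero (hpoly Q)) ⟨x, hx, hx'⟩ ⟨y, hy, hy'⟩
      have := (hI _ _).1 hPQ z hz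
      rw [map_mul] at this
      exact mul_ne_zero hz1 hz2 this
  refine Order.krullDim_le_of_strictMono
    (fun Z => OrderDual.toDual (⟨I Z, hprime Z⟩ : PrimeSpectrum R)) ?_
  intro Z Z' h
  rw [OrderDual.toDual_lt_toDual]
  refine lt_of_le_of_ne (fun P hP v hv => hP v (h.le hv)) fun heq => ?_
  obtain ⟨v, hv, hvZ⟩ : ∃ v ∈ Z', v ∉ Z := Set.exists_of_ssubset h
  have ho : ZOpen (Z : Set V)ᶜ := Z.isClosed.isOpen_compl
  obtain ⟨p, hp, hpv, hpZ⟩ := zopen_iff.1 ho v hvZ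
  obtain ⟨P, hP⟩ := exists_mvPolynomial_of_mem_polyFun hp e
  have h1 : P ∈ I Z := fun w hw => by
    by_contra hne
    rw [← hP] at hne
    exact hpZ w hne hw
  have h2 : P ∈ I Z' := by
    have := congrArg PrimeSpectrum.asIdeal heq
    simp only at this
    rw [this]
    exact h1
  exact hpv (by rw [hP]; exact h2 v hv)

/-- A full flag of affine subspaces through a point of `D` gives a chain in `D`: each trace is
irreducible, as a nonempty open subset of an affine space. -/
theorem le_topologicalKrullDim_zopen {D : Set V} (hD : ZOpen D) (hne : D.Nonempty) :
    (Module.finrank ℂ V : WithBot ℕ∞) ≤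
      @topologicalKrullDim D ((zariskiTopology V).induced Subtype.val) := by
  let _ := zariskiTopology V
  obtain ⟨x₀, hx₀⟩ := hne
  set d := Module.finrank ℂ V
  set e := Module.finBasis ℂ V
  set F : ℕ → Submodule ℂ V := fun i => ⨅ j : {j : Fin d // i ≤ j}, LinearMap.ker (e.coord j.1)
  have hF : ∀ i v, v ∈ F i ↔ ∀ j : Fin d, i ≤ j → e.coord j v = 0 := fun i v => by
    simp [F]
  set Z : ℕ → Set D := fun i => {x | x.1 - x₀ ∈ F i}
  have hclosed : ∀ i, IsClosed (Z i) := by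
    intro i
    have : Z i = ⋂ j : {j : Fin d // i ≤ j}, {x : D | e.coord j.1 (x.1 - x₀) = 0} := by
      ext x
      simp only [Z, hF, Set.mem_iInter]
      simp
    rw [this]
    refine isClosed_iInter fun j => ?_
    rw [← isOpen_compl_iff]
    have h1 : (fun v : V => e.coord j.1 (v - x₀)) ∈ polyFun V :=
      ((isPolyMap_id.sub (isPolyMap_const x₀)) (e.coord j.1))
    exact isOpen_induced (zopen_ne_zero h1)
  have hirr : ∀ i, IsIrreducible (Z i) := by
    intro i
    refine ⟨⟨⟨x₀, hx₀⟩, by simp [Z]⟩, ?_⟩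
    rintro u v hu hv ⟨x, hxZ, hxu⟩ ⟨y, hyZ, hyv⟩
    obtain ⟨u, hu', rfl⟩ := isOpen_induced_iff.1 hu
    obtain ⟨v, hv', rfl⟩ := isOpen_induced_iff.1 hv
    have hg : IsPolyMap (fun w : F i => x₀ + (w : V)) :=
      (isPolyMap_const x₀).add (F i).subtype.isPolyMap
    obtain ⟨w, ⟨hw1, hw2⟩, hw3, hw4⟩ := ((ZOpen.inter hD hu').preimage hg).nonempty_inter
      ((ZOpen.inter hD hv').preimage hg) ⟨⟨_, hxZ⟩, by simpa using! hxu⟩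
      ⟨⟨_, hyZ⟩, by simpa using! hyv⟩
    exact ⟨⟨x₀ + w, hw1⟩, by simp [Z], hw2, hw4⟩
  have hlt : ∀ i < d, Z i ⊂ Z (i + 1) := by
    intro i hi
    refine ⟨fun x hx => (hF _ _).2 fun j hj => (hF _ _).1 hx j (by omega), fun hsub => ?_⟩
    -- A point `x₀ + t e_i` of `D` with `t ≠ 0` lies in `Z (i + 1)` but not in `Z i`.
    have hg : IsPolyMap (fun t : ℂ => x₀ + t • e ⟨i, hi⟩) := by
      refine (isPolyMap_const x₀).add (IsPolyMap.smul (p := fun t => t) ?_ (isPolyMap_const _))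
      exact dual_mem_polyFun (V := ℂ) LinearMap.id
    have h0 : ZOpen {t : ℂ | t ≠ 0} := zopen_ne_zero (dual_mem_polyFun (V := ℂ) LinearMap.id)
    obtain ⟨t, ht, ht0⟩ := (ZOpen.preimage hD hg).nonempty_inter h0
      ⟨0, by simpa using hx₀⟩ ⟨1, by simp⟩
    have h1 : (⟨x₀ + t • e ⟨i, hi⟩, ht⟩ : D) ∈ Z (i + 1) := by
      refine (hF _ _).2 fun j hj => ?_
      have : (⟨i, hi⟩ : Fin d) ≠ j := by rintro rfl; simp at hj
      simp [this]
    have h2 := (hF _ _).1 (hsub h1) ⟨i, hi⟩ le_rfl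
    simp at h2
    exact ht0 h2
  let l : LTSeries (TopologicalSpace.IrreducibleCloseds D) :=
    { length := d
      toFun := fun i => ⟨Z i, hirr i, hclosed i⟩
      step := fun i => by
        have := hlt i i.2
        exact this }
  exact Order.LTSeries.length_le_krullDim l

theorem topologicalKrullDim_eq_of_chart {X : Type*} [TopologicalSpace X] {N : Set X}
    (hN : N.Nonempty) {D : Set V} (hD : ZOpen D) {σ : X → V} {ι : V → X}
    (hσ : ∀ x ∈ N, σ x ∈ D ∧ ι (σ x) = x) (hι : ∀ y ∈ D, ι y ∈ N ∧ σ (ι y) = y)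
    (hιc : ∀ O, IsOpen O → ZOpen (D ∩ ι ⁻¹' O)) (hσc : ∀ O, ZOpen O → IsOpen (N ∩ σ ⁻¹' O)) :
    topologicalKrullDim N = Module.finrank ℂ V := by
  let _ := zariskiTopology V
  let f : N ≃ₜ D :=
    { toFun := fun x => ⟨σ x, (hσ x x.2).1⟩
      invFun := fun y => ⟨ι y, (hι y y.2).1⟩
      left_inv := fun x => Subtype.ext (hσ x x.2).2
      right_inv := fun y => Subtype.ext (hι y y.2).2
      continuous_toFun := by
        refine continuous_induced_rng.2 (continuous_def.2 fun O hO => ?_)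
        refine isOpen_induced_iff.2 ⟨_, hσc O hO, ?_⟩
        ext x
        simp
      continuous_invFun := by
        refine continuous_induced_rng.2 (continuous_def.2 fun O hO => ?_)
        refine isOpen_induced_iff.2 ⟨_, hιc O hO, ?_⟩
        ext x
        simp }
  rw [IsHomeomorph.topologicalKrullDim_eq f f.isHomeomorph]
  refine le_antisymm ((topologicalKrullDim_subspace_le V D).trans topologicalKrullDim_zariski_le)
    (le_topologicalKrullDim_zopen hD ?_)
  obtain ⟨x, hx⟩ := hN
  exact ⟨_, (hσ x hx).1⟩

end KrullDimension

end

noncomputable section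

/-! ### Depth, dimension and regular sequences over Noetherian local rings -/

section CohenMacaulay

open RingTheory.Sequence IsLocalRing CategoryTheory CategoryTheory.Abelian Pointwise

variable {A : Type} [CommRing A] [IsLocalRing A]

theorem maximalIdeal_smul_lt (M : Type) [AddCommGroup M] [Module A M] [Module.Finite A M]
    [Nontrivial M] : maximalIdeal A • (⊤ : Submodule A M) < ⊤ := by
  rw [lt_top_iff_ne_top]
  intro h
  have := Submodule.eq_bot_of_le_smul_of_le_jacobson_bot (maximalIdeal A) (⊤ : Submodule A M)
    Module.Finite.fg_top h.ge (maximalIdeal_le_jacobson _)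
  exact bot_ne_top this.symm

theorem nontrivial_quotSMulTop {y : A} (hy : y ∈ maximalIdeal A) (M : Type) [AddCommGroup M]
    [Module A M] [Module.Finite A M] [Nontrivial M] : Nontrivial (QuotSMulTop y M) := by
  refine Submodule.Quotient.nontrivial_iff.2 fun h => ?_
  have h1 : y • (⊤ : Submodule A M) ≤ maximalIdeal A • ⊤ := by
    rw [← Submodule.ideal_span_singleton_smul]
    exact Submodule.smul_mono_left (by simpa [Ideal.span_singleton_le_iff_mem] using hy)
  exact (maximalIdeal_smul_lt M).not_ge (h ▸ h1)

variable [IsNoetherianRing A]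

/-- Depth is bounded by `dim A/P` for every associated prime. Let `N ≠ 0` be the submodule killed by
`P`. If `N ⊆ xM` with `x` regular, then `N = xN`, against Nakayama. So some `z ∈ N` survives in
`M/xM`, and an associated prime `Q` of `M/xM` over the annihilator of its class contains `P` and
`x`. As `x ∉ P`, the dimension drops from `A/P` to `A/Q`, and induction applies to `Q`. -/
theorem length_le_ringKrullDim_of_isAssociatedPrime (rs : List A) {M : Type} [AddCommGroup M]
    [Module A M] [Module.Finite A M] (hrs : IsRegular M rs) {P : Ideal A}
    (hP : IsAssociatedPrime P M) : (rs.length : WithBot ℕ∞) ≤ ringKrullDim (A ⧸ P) := by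
  induction rs generalizing M P with
  | nil =>
    have := hP.1
    simpa using! ringKrullDim_nonneg_of_nontrivial
  | cons x rs ih =>
    have mem : x ∈ maximalIdeal A := by
      simpa using fun isu ↦ hrs.2 (by simp [Ideal.span_singleton_eq_top.mpr isu])
    obtain ⟨hx, hrs'⟩ := (isRegular_cons_iff M x rs).1 hrs
    have := hP.1
    obtain ⟨-, m, hm⟩ := isAssociatedPrime_iff.1 hP
    have hPm : ∀ a, a ∈ P ↔ a • m = 0 := fun a => by rw [hm]; simp [Submodule.mem_colon_singleton]
    have hm0 : m ≠ 0 := by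
      rintro rfl
      exact hP.1.ne_top (Ideal.eq_top_iff_one P |>.2 (by simp [hPm]))
    have hxP : x ∉ P := fun h => hm0 (hx (by simpa using (hPm x).1 h))
    let N : Submodule A M :=
      { carrier := {z | ∀ a ∈ P, a • z = 0}
        zero_mem' := by simp
        add_mem' := fun {y z} hy hz a ha => by simp [hy a ha, hz a ha]
        smul_mem' := fun c z hz a ha => by rw [smul_comm, hz a ha, smul_zero] }
    obtain ⟨z, hzN, hz⟩ : ∃ z ∈ N, z ∉ (x • ⊤ : Submodule A M) := by
      by_contra! hcon
      have h1 : N ≤ maximalIdeal A • N := by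
        intro z hz
        obtain ⟨w, -, rfl⟩ := (Submodule.mem_smul_pointwise_iff_exists _ _ _).1 (hcon z hz)
        refine Submodule.smul_mem_smul mem fun a ha => hx ?_
        simp only [smul_zero]
        rw [smul_comm]
        exact hz a ha
      have h2 := Submodule.eq_bot_of_le_smul_of_le_jacobson_bot _ N (IsNoetherian.noetherian N) h1
        (maximalIdeal_le_jacobson _)
      have h3 : m ∈ N := fun a ha => (hPm a).1 ha
      rw [h2] at h3
      exact hm0 ((Submodule.mem_bot A).1 h3)
    have hz0 : (Submodule.Quotient.mk z : QuotSMulTop x M) ≠ 0 := by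
      rwa [Ne, Submodule.Quotient.mk_eq_zero]
    obtain ⟨Q, hQ, hle⟩ := exists_le_isAssociatedPrime_of_isNoetherianRing A
      (Submodule.Quotient.mk z : QuotSMulTop x M) hz0
    have hPQ : P ≤ Q := fun a ha => hle <| by
      simp [Submodule.mem_colon_singleton, ← Submodule.Quotient.mk_smul, hzN a ha]
    have hxQ : x ∈ Q := hle <| by
      simp only [Submodule.mem_colon_singleton, ← Submodule.Quotient.mk_smul, Submodule.mem_bot,
        Submodule.Quotient.mk_eq_zero]
      exact Submodule.smul_mem_pointwise_smul _ _ _ trivial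
    have h1 := ih hrs' hQ
    have h2 := ringKrullDim_succ_le_of_surjective (Ideal.Quotient.factor hPQ)
      (Ideal.Quotient.factor_surjective hPQ) (r := Ideal.Quotient.mk P x)
      (mem_nonZeroDivisors_of_ne_zero (by rwa [Ne, Ideal.Quotient.eq_zero_iff_mem]))
      (by simpa [Ideal.Quotient.eq_zero_iff_mem] using hxQ)
    refine le_trans ?_ h2
    push_cast [List.length_cons]
    gcongr

/-- A module over a local ring has depth at least `p`. -/
def DepthGE (p : ℕ) (M : Type) [AddCommGroup M] [Module A M] : Prop :=
  ∃ rs : List A, rs.length = p ∧ (∀ r ∈ rs, r ∈ maximalIdeal A) ∧ IsRegular M rs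

/-- Here `y` need not belong to the given regular sequence. Depth is the vanishing of low `Ext`
groups, and the long exact sequence of `0 → M → M → M/yM → 0` places each `Ext` of `M/yM` between
two that vanish. -/
theorem DepthGE.quotSMulTop {p : ℕ} {M : Type} [AddCommGroup M] [Module A M] [Module.Finite A M]
    [Nontrivial M] (h : DepthGE (A := A) (p + 1) M) {y : A} (hy : y ∈ maximalIdeal A)
    (hreg : IsSMulRegular M y) : DepthGE (A := A) p (QuotSMulTop y M) := by
  have := nontrivial_quotSMulTop hy M
  have h1 := ((ModuleCat.exists_isRegular_tfae (maximalIdeal A) (p + 1) (ModuleCat.of A M)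
    (maximalIdeal_smul_lt M)).out 3 1).1 h
  refine ((ModuleCat.exists_isRegular_tfae (maximalIdeal A) p (ModuleCat.of A (QuotSMulTop y M))
    (maximalIdeal_smul_lt _)).out 3 1).2 fun i hi => ?_
  have zero1 := AddCommGrpCat.isZero_of_iff_subsingleton.mpr (h1 i (by omega))
  have zero2 := AddCommGrpCat.isZero_of_iff_subsingleton.mpr (h1 (i + 1) (by omega))
  exact AddCommGrpCat.subsingleton_of_isZero <| ShortComplex.Exact.isZero_of_both_zeros
    ((Ext.covariant_sequence_exact₃' _
      (IsSMulRegular.smulShortComplex_shortExact (M := ModuleCat.of A M) hreg)) i (i + 1) rfl)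
    (zero1.eq_zero_of_src _) (zero2.eq_zero_of_tgt _)

theorem supportDim_le_supportDim_quotient_ofList (fs : List A) (hfs : ∀ f ∈ fs, f ∈ maximalIdeal A)
    (M : Type) [AddCommGroup M] [Module A M] [Module.Finite A M] :
    Module.supportDim A M ≤
      Module.supportDim A (M ⧸ (Ideal.ofList fs • ⊤ : Submodule A M)) + fs.length := by
  induction fs generalizing M with
  | nil =>
    rw [Ideal.ofList_nil, Submodule.bot_smul]
    simpa using (Module.supportDim_eq_of_equiv (Submodule.quotEquivOfEqBot ⊥ rfl)).ge
  | cons f fs ih =>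
    refine (Module.supportDim_le_supportDim_quotSMulTop_succ (hfs f (by simp))).trans ?_
    have := ih (fun g hg => hfs g (by simp [hg])) (QuotSMulTop f M)
    rw [Module.supportDim_eq_of_equiv
      (Submodule.quotOfListConsSMulTopEquivQuotSMulTopInner M f fs)]
    push_cast [List.length_cons]
    rw [← add_assoc]
    gcongr

/-- The Cohen–Macaulay argument: a zero divisor `f` lies in an associated prime `P`, and `dim A/P ≥
p`. Cutting `A/P` by the remaining elements alone leaves dimension at least `p - (length - 1)`,
inside the support of `M/(f, fs)M`, whose dimension is at most `p - length`. -/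
theorem isWeaklyRegular_of_supportDim_le (fs : List A) (hfs : ∀ f ∈ fs, f ∈ maximalIdeal A)
    (M : Type) [AddCommGroup M] [Module A M] [Module.Finite A M] [Nontrivial M] {p : ℕ}
    (hM : DepthGE (A := A) p M)
    (hdim : Module.supportDim A (M ⧸ (Ideal.ofList fs • ⊤ : Submodule A M)) + fs.length ≤ p) :
    IsWeaklyRegular M fs := by
  induction fs generalizing M p with
  | nil => exact IsWeaklyRegular.nil A M
  | cons f fs ih =>
    have hf := hfs f (by simp)
    have hfs' := fun g hg => hfs g (List.mem_cons_of_mem f hg)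
    have hreg : IsSMulRegular M f := by
      by_contra hcon
      have h1 : f ∈ ⋃ P ∈ associatedPrimes A M, (P : Set A) := by
        rw [biUnion_associatedPrimes_eq_compl_regular]
        exact hcon
      simp only [Set.mem_iUnion, exists_prop] at h1
      obtain ⟨P, hP, hfP⟩ := h1
      obtain ⟨rs, hrs, -, hreg⟩ := hM
      have h2 := length_le_ringKrullDim_of_isAssociatedPrime rs hreg hP
      rw [hrs, ← Module.supportDim_quotient_eq_ringKrullDim] at h2
      have h3 := h2.trans (supportDim_le_supportDim_quotient_ofList fs hfs' (A ⧸ P))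
      have h4 : Module.supportDim A ((A ⧸ P) ⧸ (Ideal.ofList fs • ⊤ : Submodule A (A ⧸ P))) ≤
          Module.supportDim A (M ⧸ (Ideal.ofList (f :: fs) • ⊤ : Submodule A M)) := by
        have hsub : Module.support A ((A ⧸ P) ⧸ (Ideal.ofList fs • ⊤ : Submodule A (A ⧸ P))) ⊆
            Module.support A (M ⧸ (Ideal.ofList (f :: fs) • ⊤ : Submodule A M)) := by
          rw [Module.support_quotient, Module.support_quotient, Module.support_eq_zeroLocus,
            Module.support_eq_zeroLocus, Ideal.annihilator_quotient]
          rintro q ⟨hq1, hq2⟩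
          have h5 := hP.annihilator_le
          rw [Submodule.annihilator_top] at h5
          refine ⟨(PrimeSpectrum.mem_zeroLocus _ _).2 (h5.trans hq1), ?_⟩
          rw [Ideal.ofList_cons]
          refine (PrimeSpectrum.mem_zeroLocus _ _).2 (sup_le (c := q.asIdeal) ?_ hq2)
          rw [Ideal.span_singleton_le_iff_mem]
          exact hq1 hfP
        exact Order.krullDim_le_of_strictMono (Set.inclusion hsub) fun _ _ h => h
      generalize Module.supportDim A
        (M ⧸ (Ideal.ofList (f :: fs) • ⊤ : Submodule A M)) = d at h4 hdim
      have h5 : (p : WithBot ℕ∞) ≤ d + fs.length := h3.trans (by gcongr)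
      rw [List.length_cons] at hdim
      induction d with
      | bot => simp at h5
      | coe d =>
        induction d with
        | top => exact absurd hdim (by simpa using! WithBot.coe_lt_coe.2 (ENat.natCast_lt_top p))
        | coe d =>
          norm_cast at h5 hdim
          omega
    have := nontrivial_quotSMulTop hf M
    have hdim' := hdim
    rw [Module.supportDim_eq_of_equiv
      (Submodule.quotOfListConsSMulTopEquivQuotSMulTopInner M f fs)] at hdim'
    -- By Nakayama the quotient by `f :: fs` is nonzero, so its dimension is not `⊥`, and `hdim`
    -- forces `p ≥ 1`.
    obtain ⟨p, rfl⟩ : ∃ p', p = p' + 1 := by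
      refine Nat.exists_eq_succ_of_ne_zero ?_
      rintro rfl
      have h6 : Nontrivial (M ⧸ (Ideal.ofList (f :: fs) • ⊤ : Submodule A M)) := by
        refine Submodule.Quotient.nontrivial_iff.2 fun h => ?_
        refine (maximalIdeal_smul_lt M).not_ge (h.ge.trans (Submodule.smul_mono_left ?_))
        rw [Ideal.ofList, Ideal.span_le]
        exact fun g hg => hfs g hg
      have h7 := Module.supportDim_ne_bot_of_nontrivial A
        (M ⧸ (Ideal.ofList (f :: fs) • ⊤ : Submodule A M))
      generalize Module.supportDim A
        (M ⧸ (Ideal.ofList (f :: fs) • ⊤ : Submodule A M)) = d at h7 hdim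
      rw [List.length_cons] at hdim
      induction d with
      | bot => exact h7 rfl
      | coe d =>
        norm_cast at hdim
        simp at hdim
    refine (isWeaklyRegular_cons_iff M f fs).2 ⟨hreg, ih hfs' _ (hM.quotSMulTop hf hreg) ?_⟩
    rw [List.length_cons] at hdim'
    generalize Module.supportDim A
        (QuotSMulTop f M ⧸ (Ideal.ofList fs • ⊤ : Submodule A (QuotSMulTop f M))) = d at hdim'
    induction d with
    | bot => simp
    | coe d =>
      norm_cast at hdim' ⊢
      push_cast at hdim' ⊢
      rw [← add_assoc] at hdim'
      exact (ENat.add_le_add_iff_right (by simp)).1 hdim'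

end CohenMacaulay

end

noncomputable section

open MvPolynomial

attribute [local instance] MvPolynomial.gradedAlgebra

/-! ### Homogeneous ideals of the coordinate ring -/

section Graded

variable {n : ℕ}

instance homogeneousSubmodule_finiteDimensional (n d : ℕ) :
    FiniteDimensional ℂ (homogeneousSubmodule (Fin (n + 1)) ℂ d) :=
  Module.Finite.iff_fg.2 (homogeneousSubmodule_fg _ _ _)

instance forms_finiteDimensional {t : ℕ} (c : Fin t → ℕ) : FiniteDimensional ℂ (Forms n c) :=
  inferInstanceAs (FiniteDimensional ℂ ((i : Fin t) → homogeneousSubmodule (Fin (n + 1)) ℂ (c i)))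

/-- The forms of degree `d - k`, or zero if `d < k`. -/
def shiftForms (n d k : ℕ) : Submodule ℂ (CoordRing n) :=
  if k ≤ d then homogeneousSubmodule (Fin (n + 1)) ℂ (d - k) else ⊥

instance shiftForms_finiteDimensional (n d k : ℕ) : FiniteDimensional ℂ (shiftForms n d k) := by
  unfold shiftForms
  by_cases h : k ≤ d
  · rw [if_pos h]; infer_instance
  · rw [if_neg h]; infer_instance

theorem mem_shiftForms {d k : ℕ} (h : k ≤ d) {p : CoordRing n} :
    p ∈ shiftForms n d k ↔ p.IsHomogeneous (d - k) := by
  simp [shiftForms, h]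

theorem mem_shiftForms_of_lt {d k : ℕ} (h : d < k) {p : CoordRing n} :
    p ∈ shiftForms n d k ↔ p = 0 := by
  simp [shiftForms, h.not_ge]

theorem shiftForms_mul {d k : ℕ} {p q : CoordRing n} (hp : p ∈ shiftForms n d k)
    (hq : q.IsHomogeneous k) : (p * q).IsHomogeneous d := by
  rcases le_or_gt k d with h | h
  · have := ((mem_shiftForms h).1 hp).mul hq
    rwa [Nat.sub_add_cancel h] at this
  · rw [(mem_shiftForms_of_lt h).1 hp, zero_mul]
    exact isHomogeneous_zero _ _ _

/-- The component of `p` of degree `d - k`. -/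
def shiftComponent (n d k : ℕ) (p : CoordRing n) : CoordRing n :=
  if k ≤ d then homogeneousComponent (d - k) p else 0

theorem shiftComponent_mem (d k : ℕ) (p : CoordRing n) :
    shiftComponent n d k p ∈ shiftForms n d k := by
  unfold shiftComponent
  split_ifs with h
  · exact (mem_shiftForms h).2 (homogeneousComponent_isHomogeneous _ _)
  · exact zero_mem _

theorem homogeneousComponent_mul_of_isHomogeneous (d : ℕ) {k : ℕ} (p : CoordRing n)
    {q : CoordRing n} (hq : q.IsHomogeneous k) :
    homogeneousComponent d (p * q) = shiftComponent n d k p * q := by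
  unfold shiftComponent
  conv_lhs => rw [← sum_homogeneousComponent p, Finset.sum_mul, map_sum]
  have h1 : ∀ i, homogeneousComponent d (homogeneousComponent i p * q) =
      if d = i + k then homogeneousComponent i p * q else 0 := fun i =>
    homogeneousComponent_of_mem ((homogeneousComponent_isHomogeneous i p).mul hq)
  simp only [h1]
  split_ifs with h
  · by_cases h2 : d - k < p.totalDegree + 1
    · rw [Finset.sum_eq_single (d - k)]
      · rw [if_pos (by omega)]
      · intro i _ hi
        rw [if_neg (by omega)]
      · simp [h2]
    · rw [homogeneousComponent_eq_zero _ _ (by omega), zero_mul]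
      refine Finset.sum_eq_zero fun i hi => ?_
      rw [Finset.mem_range] at hi
      rw [if_neg (by omega)]
  · rw [zero_mul]
    refine Finset.sum_eq_zero fun i hi => ?_
    rw [if_neg (by omega)]

theorem exists_homogeneous_coeffs {t : ℕ} {c : Fin t → ℕ} {f : Fin t → CoordRing n}
    (hf : ∀ i, (f i).IsHomogeneous (c i)) {d : ℕ} {q : CoordRing n} (hq : q.IsHomogeneous d)
    (hqf : q ∈ Ideal.span (Set.range f)) :
    ∃ g : Fin t → CoordRing n, (∀ i, g i ∈ shiftForms n d (c i)) ∧ q = ∑ i, g i * f i := by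
  obtain ⟨g, rfl⟩ := Ideal.mem_span_range_iff_exists_fun.1 hqf
  refine ⟨fun i => shiftComponent n d (c i) (g i), fun i => shiftComponent_mem _ _ _, ?_⟩
  conv_lhs => rw [← homogeneousComponent_eq_self hq, map_sum]
  exact Finset.sum_congr rfl fun i _ => homogeneousComponent_mul_of_isHomogeneous d _ (hf i)

/-- A homogeneous ideal of the coordinate ring. -/
abbrev IsHomogIdeal (I : Ideal (CoordRing n)) : Prop :=
  I.IsHomogeneous (homogeneousSubmodule (Fin (n + 1)) ℂ)

theorem isHomogIdeal_span {S : Set (CoordRing n)} (h : ∀ f ∈ S, ∃ d, f.IsHomogeneous d) :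
    IsHomogIdeal (Ideal.span S) :=
  Ideal.homogeneous_span _ _ fun f hf => by
    obtain ⟨d, hd⟩ := h f hf
    exact ⟨d, hd⟩

theorem isHomogIdeal_formIdeal {t : ℕ} {c : Fin t → ℕ} (f : Forms n c) :
    IsHomogIdeal (formIdeal f) :=
  isHomogIdeal_span (by rintro _ ⟨i, rfl⟩; exact ⟨c i, (f i).2⟩)

instance isMaximal_idealOfVars (n : ℕ) : (idealOfVars (Fin (n + 1)) ℂ).IsMaximal := by
  have : idealOfVars (Fin (n + 1)) ℂ = RingHom.ker (constantCoeff (R := ℂ) (σ := Fin (n + 1))) := by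
    ext p
    have := mem_pow_idealOfVars_iff' (σ := Fin (n + 1)) (R := ℂ) 1 p
    rw [pow_one] at this
    rw [this, RingHom.mem_ker, constantCoeff_eq]
    constructor
    · exact fun h => h 0 (by simp)
    · intro h x hx
      have : x = 0 := by simpa [Finsupp.degree_eq_zero_iff] using hx
      rw [this, h]
  rw [this]
  exact RingHom.ker_isMaximal_of_surjective _ fun z => ⟨C z, by simp⟩

/-- A graded Nakayama argument: `g ≡ x^k g` modulo `I` for all `k`, and `x^(d+1) g` has no component
of degree `d`, so that every component of `g` lies in `I`. -/
theorem mem_of_sub_mul_mem {I : Ideal (CoordRing n)} (hI : IsHomogIdeal I) {x g : CoordRing n}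
    (hx : x ∈ idealOfVars (Fin (n + 1)) ℂ) (h : g - x * g ∈ I) : g ∈ I := by
  have h1 : ∀ k : ℕ, g - x ^ k * g ∈ I := by
    intro k
    induction k with
    | zero => simp
    | succ k ih =>
      have : g - x ^ (k + 1) * g = (g - x ^ k * g) + x ^ k * (g - x * g) := by ring
      rw [this]
      exact add_mem ih (I.mul_mem_left _ h)
  rw [mem_iff_homogeneousComponent_mem hI]
  intro d
  have h2 := homogeneousComponent_mem_of_mem hI (h1 (d + 1)) d
  have h3 : homogeneousComponent d (x ^ (d + 1) * g) = 0 := by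
    have h4 : x ^ (d + 1) * g ∈ idealOfVars (Fin (n + 1)) ℂ ^ (d + 1) :=
      Ideal.mul_mem_right _ _ (Ideal.pow_mem_pow hx _)
    rw [mem_pow_idealOfVars_iff'] at h4
    ext m
    rw [coeff_homogeneousComponent]
    split_ifs with hm
    · simpa using h4 m (by omega)
    · simp
  rwa [map_sub, h3, sub_zero] at h2

/-- Elements off the irrelevant ideal are nonzerodivisors modulo a homogeneous ideal: with an
inverse `v` of `u` modulo that ideal, take `x = 1 - u v` above. Because of this, nothing is lost by
localizing at the origin. -/
theorem mem_of_mul_mem_of_notMem_idealOfVars {I : Ideal (CoordRing n)} (hI : IsHomogIdeal I)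
    {u g : CoordRing n} (hu : u ∉ idealOfVars (Fin (n + 1)) ℂ) (h : u * g ∈ I) : g ∈ I := by
  obtain ⟨v, hv⟩ := Ideal.Quotient.exists_inv (I := idealOfVars (Fin (n + 1)) ℂ)
    (a := Ideal.Quotient.mk _ u) (by rwa [Ne, Ideal.Quotient.eq_zero_iff_mem])
  obtain ⟨v, rfl⟩ := Ideal.Quotient.mk_surjective v
  refine mem_of_sub_mul_mem hI (x := 1 - u * v) (g := g) ?_ ?_
  · rw [← Ideal.Quotient.eq_zero_iff_mem]
    simp [hv]
  · have : g - (1 - u * v) * g = v * (u * g) := by ring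
    rw [this]
    exact I.mul_mem_left _ h

end Graded

/-! ### Complete intersections are regular sequences -/

section RegularSequences

variable {n t : ℕ}

/-- The ideal generated by the first `i` members of a family. -/
def prefixIdeal {R : Type*} [CommRing R] {t : ℕ} (f : Fin t → R) (i : ℕ) : Ideal R :=
  Ideal.span (f '' {j | (j : ℕ) < i})

/-- Regular sequences, without the condition that the quotient be nontrivial. -/
def IsRegSeq {R : Type*} [CommRing R] {t : ℕ} (f : Fin t → R) : Prop :=
  ∀ i : Fin t, ∀ g, f i * g ∈ prefixIdeal f i → g ∈ prefixIdeal f i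

theorem isWeaklyRegular_ofFn_iff {R : Type*} [CommRing R] (f : Fin t → R) :
    RingTheory.Sequence.IsWeaklyRegular R (List.ofFn f) ↔ IsRegSeq f := by
  rw [RingTheory.Sequence.isWeaklyRegular_iff]
  have h : ∀ i, (Ideal.ofList (List.take i (List.ofFn f)) * ⊤ : Ideal R) = prefixIdeal f i := by
    intro i
    rw [Ideal.mul_top, Ideal.ofList, prefixIdeal]
    congr 1
    ext x
    simp only [List.mem_take_iff_getElem, List.length_ofFn, List.getElem_ofFn, Set.mem_ofPred_eq,
      Set.mem_image]
    constructor
    · rintro ⟨j, hj, rfl⟩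
      exact ⟨⟨j, by omega⟩, by simp; omega, rfl⟩
    · rintro ⟨j, hj, rfl⟩
      exact ⟨j, by have := j.2; omega, rfl⟩
  simp only [isSMulRegular_quotient_iff_mem_of_smul_mem, smul_eq_mul, List.getElem_ofFn]
  constructor
  · intro H i g hg
    have := H i (by simp) g
    rw [h] at this
    exact this hg
  · intro H i hi g hg
    rw [h] at hg ⊢
    exact H ⟨i, by simpa using hi⟩ g hg

theorem isRegSeq_X : IsRegSeq (X : Fin (n + 1) → CoordRing n) := by
  intro i g hg
  rw [prefixIdeal, mem_ideal_span_X_image] at hg ⊢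
  intro m hm
  obtain ⟨j, hj, hjm⟩ := hg (m + Finsupp.single i 1) (by
    rw [mem_support_iff, add_comm m, coeff_X_mul]
    exact mem_support_iff.1 hm)
  refine ⟨j, hj, ?_⟩
  have : j ≠ i := by rintro rfl; simp at hj
  simpa [Finsupp.single_apply, this.symm] using hjm

/-- In the local ring of the affine cone at the origin the variables show that the depth is at least
`n + 1`, while the dimension condition bounds the quotient by `n + 1 - t`; hence the forms are a
regular sequence there. The ideals involved are homogeneous, so regularity descends to the
polynomial ring. -/
theorem IsCI.isRegSeq {c : Fin t → ℕ} (hc : ∀ i, 1 ≤ c i) {f : Forms n c} (hf : IsCI f) :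
    IsRegSeq (fun i => (f i : CoordRing n)) := by
  set 𝔪 := idealOfVars (Fin (n + 1)) ℂ with h𝔪
  let A := Localization.AtPrime 𝔪
  have hA : IsNoetherianRing A := IsLocalization.isNoetherianRing 𝔪.primeCompl A inferInstance
  have hfm : ∀ i, (f i : CoordRing n) ∈ 𝔪 := by
    intro i
    have := (mem_pow_idealOfVars_iff' 1 (f i : CoordRing n)).2 fun x hx => by
      apply IsHomogeneous.coeff_eq_zero (f i).2
      have := hc i
      omega
    rwa [pow_one] at this
  have hdepth : DepthGE (A := A) (n + 1) A := by
    have h1 := (isWeaklyRegular_ofFn_iff _).2 (isRegSeq_X (n := n))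
    have h2 := h1.isRegular_of_isLocalization_of_mem A 𝔪 (by
      intro r hr
      obtain ⟨i, rfl⟩ := (List.mem_ofFn' _ _).1 hr
      exact Ideal.subset_span ⟨i, rfl⟩)
    refine ⟨_, by simp, ?_, h2⟩
    intro r hr
    simp only [List.mem_map, List.mem_ofFn', Set.mem_range] at hr
    obtain ⟨_, ⟨i, rfl⟩, rfl⟩ := hr
    exact (IsLocalization.AtPrime.to_map_mem_maximal_iff A 𝔪 _).2 (Ideal.subset_span ⟨i, rfl⟩)
  set fs : List A := List.ofFn fun i => algebraMap (CoordRing n) A (f i) with hfs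
  have hspan : Ideal.ofList fs = (formIdeal f).map (algebraMap (CoordRing n) A) := by
    rw [formIdeal, Ideal.map_span, ← Set.range_comp, Ideal.ofList]
    congr 1
    ext x
    simp [hfs, List.mem_ofFn']
  have hreg := isWeaklyRegular_of_supportDim_le fs (by
    intro r hr
    obtain ⟨i, rfl⟩ := (List.mem_ofFn' _ _).1 hr
    exact (IsLocalization.AtPrime.to_map_mem_maximal_iff A 𝔪 _).2 (hfm i)) A hdepth (by
    rw [IsCI] at hf
    rw [smul_eq_mul, Ideal.mul_top, Module.supportDim_quotient_eq_ringKrullDim, hspan]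
    simp only [hfs, List.length_ofFn]
    push_cast
    rw [← hf]
    gcongr
    rw [ringKrullDim_quotient, ringKrullDim_quotient]
    -- Localization does not raise the dimension of the quotient: primes of `A` over the extended
    -- ideal contract injectively.
    refine Order.krullDim_le_of_strictMono
      (fun P => ⟨P.1.comap (algebraMap (CoordRing n) A), fun x hx => P.2 (Ideal.mem_map_of_mem _ hx)⟩)
      ?_
    intro P Q h
    refine lt_of_le_of_ne (fun x hx => h.le hx) fun heq => h.ne (Subtype.ext ?_)
    exact PrimeSpectrum.localization_comap_injective A 𝔪.primeCompl (congrArg Subtype.val heq))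
  rw [hfs, isWeaklyRegular_ofFn_iff] at hreg
  have hmap : ∀ i, prefixIdeal (fun i => algebraMap (CoordRing n) A (f i)) i =
      (prefixIdeal (fun i => (f i : CoordRing n)) i).map (algebraMap (CoordRing n) A) := fun i => by
    rw [prefixIdeal, prefixIdeal, Ideal.map_span, ← Set.image_comp]
    rfl
  intro i g hg
  have h1 := hreg i (algebraMap _ A g) (by
    rw [hmap, ← map_mul]
    exact Ideal.mem_map_of_mem _ hg)
  rw [hmap, IsLocalization.mem_map_algebraMap_iff 𝔪.primeCompl A] at h1
  obtain ⟨⟨x, u⟩, hxu⟩ := h1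
  rw [← map_mul] at hxu
  obtain ⟨v, hv⟩ := (IsLocalization.eq_iff_exists 𝔪.primeCompl A).1 hxu
  have hhom : IsHomogIdeal (prefixIdeal (fun i => (f i : CoordRing n)) i) :=
    isHomogIdeal_span (by rintro _ ⟨j, -, rfl⟩; exact ⟨c j, (f j).2⟩)
  refine mem_of_mul_mem_of_notMem_idealOfVars hhom (v * u).2 ?_
  have : ((v * u : 𝔪.primeCompl) : CoordRing n) * g = v * (g * u) := by
    rw [Submonoid.coe_mul]; ring
  rw [this]
  erw [hv]
  exact Ideal.mul_mem_left _ _ x.2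

end RegularSequences

end

noncomputable section

open MvPolynomial

attribute [local instance] MvPolynomial.gradedAlgebra

/-! ### Syzygies of regular sequences -/

section Syzygies

variable {R : Type*} [CommRing R]

theorem prefixIdeal_length {t : ℕ} (f : Fin t → R) :
    prefixIdeal f t = Ideal.span (Set.range f) := by
  rw [prefixIdeal, ← Set.image_univ]
  congr 2
  ext j
  simp

theorem prefixIdeal_castSucc {t : ℕ} (f : Fin (t + 1) → R) {i : ℕ} (hi : i ≤ t) :
    prefixIdeal (fun j : Fin t => f j.castSucc) i = prefixIdeal f i := by
  rw [prefixIdeal, prefixIdeal]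
  congr 1
  ext x
  constructor
  · rintro ⟨j, hj, rfl⟩
    exact ⟨j.castSucc, by simpa using hj, rfl⟩
  · rintro ⟨j, hj, rfl⟩
    exact ⟨⟨j, by simp at hj; omega⟩, by simpa using hj, rfl⟩

theorem prefixIdeal_succ {t : ℕ} (f : Fin t → R) (i : Fin t) :
    prefixIdeal f (i + 1) = prefixIdeal f i ⊔ Ideal.span {f i} := by
  rw [prefixIdeal, prefixIdeal, ← Ideal.span_union]
  congr 1
  ext x
  constructor
  · rintro ⟨j, hj, rfl⟩
    rcases (Nat.lt_succ_iff_lt_or_eq.1 hj) with h | h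
    · exact Or.inl ⟨j, h, rfl⟩
    · exact Or.inr (by rw [Fin.ext h]; rfl)
  · rintro (⟨j, hj, rfl⟩ | hx)
    · exact ⟨j, Nat.lt_succ_of_lt hj, rfl⟩
    · exact ⟨i, Nat.lt_succ_self _, by rw [Set.mem_singleton_iff.1 hx]⟩

/-- By regularity the last coefficient is a combination `Σ c_j f_j` of the earlier members.
Substituting it turns the relation into one among the earlier members, with coefficients `g_j + c_j
f_t`, and induction applies. This makes normal vectors well defined on generators. -/
theorem IsRegSeq.mem_of_sum_mul_eq_zero {t : ℕ} {f : Fin t → R} (hf : IsRegSeq f) {g : Fin t → R}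
    (h : ∑ i, g i * f i = 0) (i : Fin t) : g i ∈ Ideal.span (Set.range f) := by
  induction t with
  | zero => exact i.elim0
  | succ t ih =>
    have hf' : IsRegSeq fun j : Fin t => f j.castSucc := by
      intro j x hx
      rw [prefixIdeal_castSucc f j.2.le] at hx ⊢
      exact hf j.castSucc x hx
    have hsub : Ideal.span (Set.range fun j : Fin t => f j.castSucc) ≤ Ideal.span (Set.range f) :=
      Ideal.span_mono (by rintro _ ⟨j, rfl⟩; exact ⟨_, rfl⟩)
    rw [Fin.sum_univ_castSucc] at h
    have hl : g (Fin.last t) ∈ Ideal.span (Set.range fun j : Fin t => f j.castSucc) := by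
      have := hf (Fin.last t) (g (Fin.last t)) (by
        rw [mul_comm, eq_neg_of_add_eq_zero_right h, Fin.val_last]
        rw [← prefixIdeal_castSucc f le_rfl, prefixIdeal_length]
        exact neg_mem (sum_mem fun j _ => Ideal.mul_mem_left _ _ (Ideal.subset_span ⟨j, rfl⟩)))
      rwa [Fin.val_last, ← prefixIdeal_castSucc f le_rfl, prefixIdeal_length] at this
    obtain ⟨c, hc⟩ := Ideal.mem_span_range_iff_exists_fun.1 hl
    have h2 : ∑ j : Fin t, (g j.castSucc + c j * f (Fin.last t)) * f j.castSucc = 0 := by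
      rw [← h, ← hc, Finset.sum_mul, ← Finset.sum_add_distrib]
      exact Finset.sum_congr rfl fun j _ => by ring
    refine Fin.lastCases (hsub hl) (fun j => ?_) i
    have := hsub (ih hf' h2 j)
    exact (add_mem_cancel_right (Ideal.mul_mem_left _ (c j) (Ideal.subset_span (Set.mem_range_self _)))).1 this

end Syzygies

/-! ### Hilbert functions of complete intersections -/

section Hilbert

variable {n t : ℕ}

/-- The elements of degree `d` of an ideal. -/
def degPart (I : Ideal (CoordRing n)) (d : ℕ) : Submodule ℂ (CoordRing n) :=
  I.restrictScalars ℂ ⊓ homogeneousSubmodule (Fin (n + 1)) ℂ d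

instance degPart_finiteDimensional (I : Ideal (CoordRing n)) (d : ℕ) :
    FiniteDimensional ℂ (degPart I d) :=
  Submodule.finiteDimensional_of_le (inf_le_right : degPart I d ≤ homogeneousSubmodule _ ℂ d)

theorem finrank_inf_shiftForms (I : Ideal (CoordRing n)) (d k : ℕ) :
    Module.finrank ℂ (I.restrictScalars ℂ ⊓ shiftForms n d k : Submodule ℂ (CoordRing n)) =
      if k ≤ d then Module.finrank ℂ (degPart I (d - k)) else 0 := by
  split_ifs with h
  · rw [shiftForms, if_pos h]
    rfl
  · rw [shiftForms, if_neg h, inf_bot_eq, finrank_bot]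

/-- Dimension count for `(g, p) ↦ g f + p` from `R_(d-k) ⊕ I_d` onto the degree `d` part of `I +
(f)`. By regularity of `f` the kernel is a copy of `I_(d-k)`. For `d < k` the shifted spaces are
zero. -/
theorem finrank_degPart_sup_span_singleton {I : Ideal (CoordRing n)} (hI : IsHomogIdeal I)
    {f : CoordRing n} {k : ℕ} (hf : f.IsHomogeneous k) (hreg : ∀ g, f * g ∈ I → g ∈ I) (d : ℕ) :
    Module.finrank ℂ (degPart (I ⊔ Ideal.span {f}) d) +
      Module.finrank ℂ (I.restrictScalars ℂ ⊓ shiftForms n d k : Submodule ℂ (CoordRing n)) =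
    Module.finrank ℂ (shiftForms n d k) + Module.finrank ℂ (degPart I d) := by
  have hm : ∀ x : shiftForms n d k × degPart I d,
      (x.1 : CoordRing n) * f + x.2 ∈ degPart (I ⊔ Ideal.span {f}) d := by
    intro x
    refine ⟨add_mem (Ideal.mem_sup_right (Ideal.mul_mem_left _ _ (Ideal.mem_span_singleton_self f)))
      (Ideal.mem_sup_left x.2.2.1), ?_⟩
    exact (shiftForms_mul x.1.2 hf).add x.2.2.2
  let Φ : (shiftForms n d k × degPart I d) →ₗ[ℂ] degPart (I ⊔ Ideal.span {f}) d :=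
    { toFun := fun x => ⟨_, hm x⟩
      map_add' := fun x y => Subtype.ext (by simp; ring)
      map_smul' := fun c x => Subtype.ext (by simp) }
  have hsurj : Function.Surjective Φ := by
    rintro ⟨p, hp, hpd⟩
    obtain ⟨a, ha, y, hy, rfl⟩ := Submodule.mem_sup.1 hp
    obtain ⟨g, rfl⟩ := Ideal.mem_span_singleton'.1 hy
    refine ⟨(⟨_, shiftComponent_mem d k g⟩, ⟨homogeneousComponent d a,
      homogeneousComponent_mem_of_mem hI ha d, homogeneousComponent_isHomogeneous _ _⟩),
      Subtype.ext ?_⟩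
    change shiftComponent n d k g * f + homogeneousComponent d a = a + g * f
    rw [← homogeneousComponent_mul_of_isHomogeneous d g hf, ← map_add, add_comm (g * f)]
    exact homogeneousComponent_eq_self hpd
  have hker : ∀ g : (I.restrictScalars ℂ ⊓ shiftForms n d k : Submodule ℂ (CoordRing n)),
      -((g : CoordRing n) * f) ∈ degPart I d := fun g =>
    ⟨neg_mem (I.mul_mem_right _ g.2.1), (shiftForms_mul g.2.2 hf).neg⟩
  let Ψ : (I.restrictScalars ℂ ⊓ shiftForms n d k : Submodule ℂ (CoordRing n)) →ₗ[ℂ]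
      LinearMap.ker Φ :=
    { toFun := fun g => ⟨(⟨g, g.2.2⟩, ⟨_, hker g⟩), Subtype.ext (by
        change (g : CoordRing n) * f + -((g : CoordRing n) * f) = 0
        ring)⟩
      map_add' := fun x y => Subtype.ext (Prod.ext rfl (Subtype.ext (by simp; ring)))
      map_smul' := fun c x => Subtype.ext (Prod.ext rfl (Subtype.ext (by simp))) }
  have hΨ : Function.Bijective Ψ := by
    constructor
    · intro x y h
      exact Subtype.ext (congrArg (fun z => ((z.1.1 : shiftForms n d k) : CoordRing n)) h)
    · rintro ⟨⟨g, p⟩, hgp⟩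
      have h0 : (g : CoordRing n) * f + p = 0 := congrArg Subtype.val hgp
      refine ⟨⟨g, hreg _ ?_, g.2⟩, Subtype.ext (Prod.ext rfl (Subtype.ext ?_))⟩
      · rw [mul_comm, eq_neg_of_add_eq_zero_left h0]
        exact neg_mem p.2.1
      · exact (eq_neg_of_add_eq_zero_right h0).symm
  have h1 := Module.finrank_prod (R := ℂ) (M := shiftForms n d k) (M' := degPart I d)
  rw [(LinearEquiv.ofBijective Ψ hΨ).finrank_eq, ← h1,
    ← Φ.finrank_range_add_finrank_ker, LinearMap.range_eq_top.2 hsurj, finrank_top]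

/-- The previous count computes the Hilbert function of each prefix ideal from that of the preceding
one and the degree of the new form, so only the degrees matter. -/
theorem finrank_degPart_eq_of_isRegSeq {c : Fin t → ℕ} {f f' : Forms n c}
    (hf : IsRegSeq fun i => (f i : CoordRing n)) (hf' : IsRegSeq fun i => (f' i : CoordRing n))
    (d : ℕ) :
    Module.finrank ℂ (degPart (formIdeal f) d) = Module.finrank ℂ (degPart (formIdeal f') d) := by
  have hhom : ∀ (f : Forms n c) i, IsHomogIdeal (prefixIdeal (fun i => (f i : CoordRing n)) i) :=
    fun f i => isHomogIdeal_span (by rintro _ ⟨j, -, rfl⟩; exact ⟨c j, (f j).2⟩)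
  have key : ∀ i ≤ t, ∀ d, Module.finrank ℂ (degPart (prefixIdeal (fun i => (f i : CoordRing n)) i) d)
      = Module.finrank ℂ (degPart (prefixIdeal (fun i => (f' i : CoordRing n)) i) d) := by
    intro i
    induction i with
    | zero =>
      intro _ d
      have : ∀ g : Fin t → CoordRing n, prefixIdeal g 0 = ⊥ := fun g => by simp [prefixIdeal]
      rw [this, this]
    | succ i ih =>
      intro hi d
      have ih := ih (by omega)
      have h1 := finrank_degPart_sup_span_singleton (hhom f i) (f ⟨i, hi⟩).2 (hf ⟨i, hi⟩) d
      have h2 := finrank_degPart_sup_span_singleton (hhom f' i) (f' ⟨i, hi⟩).2 (hf' ⟨i, hi⟩) d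
      rw [finrank_inf_shiftForms] at h1 h2
      have e1 := prefixIdeal_succ (fun i => (f i : CoordRing n)) ⟨i, hi⟩
      have e2 := prefixIdeal_succ (fun i => (f' i : CoordRing n)) ⟨i, hi⟩
      dsimp only at e1 e2
      rw [e1, e2]
      simp only [ih] at h1 h2
      omega
  have := key t le_rfl d
  rwa [prefixIdeal_length, prefixIdeal_length] at this

end Hilbert

/-! ### Matrices of forms and inclusion of ideals -/

section Matrices

variable {n s t : ℕ}

/-- Rows of forms by which a tuple of forms of degrees `c` is multiplied to give degree `d`. -/
abbrev FormRow (n d : ℕ) {t : ℕ} (c : Fin t → ℕ) : Type := (j : Fin t) → shiftForms n d (c j)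

/-- Matrices of forms that take tuples of forms of degrees `c` to tuples of degrees `a`. -/
abbrev FormMatrix (n : ℕ) {s t : ℕ} (a : Fin s → ℕ) (c : Fin t → ℕ) : Type :=
  (i : Fin s) → FormRow n (a i) c

instance formRow_finiteDimensional (d : ℕ) (c : Fin t → ℕ) : FiniteDimensional ℂ (FormRow n d c) :=
  inferInstanceAs (FiniteDimensional ℂ ((j : Fin t) → shiftForms n d (c j)))

instance formMatrix_finiteDimensional (a : Fin s → ℕ) (c : Fin t → ℕ) :
    FiniteDimensional ℂ (FormMatrix n a c) :=
  inferInstanceAs (FiniteDimensional ℂ ((i : Fin s) → FormRow n (a i) c))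

/-- The product of a row and a tuple of forms. -/
def mulRow (d : ℕ) (c : Fin t → ℕ) :
    FormRow n d c →ₗ[ℂ] Forms n c →ₗ[ℂ] homogeneousSubmodule (Fin (n + 1)) ℂ d :=
  LinearMap.mk₂ ℂ (fun A f => ⟨∑ j, (A j : CoordRing n) * f j,
      sum_mem fun j _ => shiftForms_mul (A j).2 (f j).2⟩)
    (fun A B f => Subtype.ext (by simp [add_mul, Finset.sum_add_distrib]))
    (fun z A f => Subtype.ext (by simp [Finset.smul_sum]))
    (fun A f g => Subtype.ext (by simp [mul_add, Finset.sum_add_distrib]))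
    (fun z A f => Subtype.ext (by simp [Finset.smul_sum]))

theorem coe_mulRow {d : ℕ} {c : Fin t → ℕ} (A : FormRow n d c) (f : Forms n c) :
    (mulRow d c A f : CoordRing n) = ∑ j, (A j : CoordRing n) * f j := rfl

/-- The product of a matrix and a tuple of forms. -/
def mulForms (a : Fin s → ℕ) (c : Fin t → ℕ) :
    FormMatrix n a c →ₗ[ℂ] Forms n c →ₗ[ℂ] Forms n a :=
  LinearMap.mk₂ ℂ (fun A f i => mulRow (a i) c (A i) f)
    (fun A B f => by ext1 i; simp) (fun z A f => by ext1 i; simp)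
    (fun A f g => by ext1 i; simp) (fun z A f => by ext1 i; simp)

theorem coe_mulForms {a : Fin s → ℕ} {c : Fin t → ℕ} (A : FormMatrix n a c) (f : Forms n c)
    (i : Fin s) : (mulForms a c A f i : CoordRing n) = ∑ j, (A i j : CoordRing n) * f j := rfl

theorem mem_formIdeal (f : Forms n (t := t) c) (i : Fin t) : (f i : CoordRing n) ∈ formIdeal f :=
  Ideal.subset_span ⟨i, rfl⟩

theorem exists_mulRow {d : ℕ} {c : Fin t → ℕ} {f : Forms n c}
    (q : homogeneousSubmodule (Fin (n + 1)) ℂ d) (hq : (q : CoordRing n) ∈ formIdeal f) :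
    ∃ A : FormRow n d c, mulRow d c A f = q := by
  obtain ⟨g, hg, e⟩ := exists_homogeneous_coeffs (fun i => (f i).2) q.2 hq
  exact ⟨fun j => ⟨g j, hg j⟩, Subtype.ext e.symm⟩

theorem mulRow_mem {d : ℕ} {c : Fin t → ℕ} (A : FormRow n d c) (f : Forms n c) :
    (mulRow d c A f : CoordRing n) ∈ formIdeal f := by
  rw [coe_mulRow]
  exact sum_mem fun j _ => Ideal.mul_mem_left _ _ (mem_formIdeal f j)

/-- The tuples of forms with entries in an ideal. -/
def tupleIdeal (J : Ideal (CoordRing n)) (a : Fin s → ℕ) : Submodule ℂ (Forms n a) :=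
  Submodule.pi Set.univ fun i =>
    (J.restrictScalars ℂ).comap (homogeneousSubmodule (Fin (n + 1)) ℂ (a i)).subtype

theorem mem_tupleIdeal {J : Ideal (CoordRing n)} {a : Fin s → ℕ} {F : Forms n a} :
    F ∈ tupleIdeal J a ↔ ∀ i, (F i : CoordRing n) ∈ J := by
  simp [tupleIdeal, Submodule.mem_pi]

theorem tupleIdeal_mono {I J : Ideal (CoordRing n)} (h : I ≤ J) (a : Fin s → ℕ) :
    tupleIdeal I a ≤ tupleIdeal J a := fun F hF => by
  rw [mem_tupleIdeal] at hF ⊢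
  exact fun i => h (hF i)

theorem range_mulForms (a : Fin s → ℕ) {c : Fin t → ℕ} (f : Forms n c) :
    LinearMap.range ((mulForms a c).flip f) = tupleIdeal (formIdeal f) a := by
  ext F
  rw [mem_tupleIdeal]
  constructor
  · rintro ⟨A, rfl⟩ i
    exact mulRow_mem (A i) f
  · intro h
    choose A hA using fun i => exists_mulRow (F i) (h i)
    exact ⟨A, funext hA⟩

theorem formIdeal_le_iff {a : Fin s → ℕ} {F : Forms n a} {J : Ideal (CoordRing n)} :
    formIdeal F ≤ J ↔ F ∈ tupleIdeal J a := by
  rw [mem_tupleIdeal, formIdeal, Ideal.span_le]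
  exact ⟨fun h i => h ⟨i, rfl⟩, by rintro h _ ⟨i, rfl⟩; exact h i⟩

theorem self_mem_tupleIdeal {c : Fin t → ℕ} (f : Forms n c) : f ∈ tupleIdeal (formIdeal f) c :=
  formIdeal_le_iff.1 le_rfl

theorem formIdeal_le_iff_exists {a : Fin s → ℕ} {c : Fin t → ℕ} {F : Forms n a} {f : Forms n c} :
    formIdeal F ≤ formIdeal f ↔ ∃ A, mulForms a c A f = F := by
  rw [formIdeal_le_iff, ← range_mulForms]
  exact Iff.rfl

theorem formIdeal_mulForms_le {a : Fin s → ℕ} {c : Fin t → ℕ} (A : FormMatrix n a c)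
    (f : Forms n c) : formIdeal (mulForms a c A f) ≤ formIdeal f :=
  formIdeal_le_iff_exists.2 ⟨A, rfl⟩

theorem finrank_tupleIdeal (J : Ideal (CoordRing n)) (a : Fin s → ℕ) :
    Module.finrank ℂ (tupleIdeal J a) = ∑ i, Module.finrank ℂ (degPart J (a i)) := by
  let e : tupleIdeal J a ≃ₗ[ℂ] ((i : Fin s) → degPart J (a i)) :=
    { toFun := fun F i => ⟨F.1 i, mem_tupleIdeal.1 F.2 i, (F.1 i).2⟩
      invFun := fun G => ⟨fun i => ⟨G i, (G i).2.2⟩, mem_tupleIdeal.2 fun i => (G i).2.1⟩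
      map_add' := fun _ _ => rfl
      map_smul' := fun _ _ => rfl
      left_inv := fun _ => rfl
      right_inv := fun _ => rfl }
  rw [e.finrank_eq, Module.finrank_pi_fintype]

theorem finrank_tupleIdeal_eq {c : Fin t → ℕ} (hc : ∀ i, 1 ≤ c i) {f f' : Forms n c} (hf : IsCI f)
    (hf' : IsCI f') (a : Fin s → ℕ) :
    Module.finrank ℂ (tupleIdeal (formIdeal f) a) =
      Module.finrank ℂ (tupleIdeal (formIdeal f') a) := by
  rw [finrank_tupleIdeal, finrank_tupleIdeal]
  exact Finset.sum_congr rfl fun i _ =>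
    finrank_degPart_eq_of_isRegSeq (hf.isRegSeq hc) (hf'.isRegSeq hc) _

/-- The two ideals have the same dimension in each of the degrees `c_i`, so the inclusion is an
equality there, and these degrees contain the generators. -/
theorem formIdeal_eq_of_le {c : Fin t → ℕ} (hc : ∀ i, 1 ≤ c i) {f f' : Forms n c} (hf : IsCI f)
    (hf' : IsCI f') (h : formIdeal f ≤ formIdeal f') : formIdeal f = formIdeal f' := by
  refine le_antisymm h ?_
  rw [formIdeal_le_iff, Submodule.eq_of_le_of_finrank_eq (tupleIdeal_mono h c)
    (finrank_tupleIdeal_eq hc hf hf' c)]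
  exact self_mem_tupleIdeal f'

end Matrices

end

noncomputable section

open MvPolynomial

attribute [local instance] MvPolynomial.gradedAlgebra

section LinearFamilies

variable {U V X Y : Type} [AddCommGroup U] [Module ℂ U] [AddCommGroup V] [Module ℂ V]
  [AddCommGroup X] [Module ℂ X] [AddCommGroup Y] [Module ℂ Y]

theorem IsPolyMap.linearHom {f : U → V} (hf : IsPolyMap f) (L : V →ₗ[ℂ] (X →ₗ[ℂ] Y)) :
    IsPolyMap (fun u => L (f u)) := fun φ => hf (φ.comp L)

theorem isPolyMap_hom (L : V →ₗ[ℂ] (X →ₗ[ℂ] Y)) : IsPolyMap (fun u => L u) :=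
  isPolyMap_id.linearHom L

end LinearFamilies

/-! ### Being a complete intersection is a Zariski open condition -/

section Dimension

variable {n t : ℕ}

theorem le_height_idealOfVars (n : ℕ) : ((n + 1 : ℕ) : ℕ∞) ≤ (idealOfVars (Fin (n + 1)) ℂ).height := by
  set 𝔪 := idealOfVars (Fin (n + 1)) ℂ with h𝔪
  let A := Localization.AtPrime 𝔪
  have hA : IsNoetherianRing A := IsLocalization.isNoetherianRing 𝔪.primeCompl A inferInstance
  have h1 := (isWeaklyRegular_ofFn_iff _).2 (isRegSeq_X (n := n))
  have h2 := h1.isRegular_of_isLocalization_of_mem A 𝔪 (by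
    intro r hr
    obtain ⟨i, rfl⟩ := (List.mem_ofFn' _ _).1 hr
    exact Ideal.subset_span ⟨i, rfl⟩)
  have h3 := ringKrullDim_add_length_eq_ringKrullDim_of_isRegular _ h2
  rw [IsLocalization.AtPrime.ringKrullDim_eq_height 𝔪 A] at h3
  have h4 : (0 : WithBot ℕ∞) ≤ ringKrullDim (A ⧸ Ideal.ofList
      (List.map (algebraMap (CoordRing n) A) (List.ofFn X))) := by
    have : Nontrivial (A ⧸ Ideal.ofList (List.map (algebraMap (CoordRing n) A) (List.ofFn X))) := by
      refine Ideal.Quotient.nontrivial_iff.2 ?_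
      have := h2.top_ne_smul
      rw [smul_eq_mul, Ideal.mul_top] at this
      exact this.symm
    exact ringKrullDim_nonneg_of_nontrivial
  have h5 : ((n + 1 : ℕ) : WithBot ℕ∞) ≤ (𝔪.height : WithBot ℕ∞) := by
    rw [← h3]
    simp only [List.length_map, List.length_ofFn]
    exact le_add_of_nonneg_left h4
  exact_mod_cast h5

/-- By Krull's height theorem, `t` equations lower the dimension by at most `t`. Only the opposite
inequality in `IsCI` is a condition on `f`. -/
theorem le_ringKrullDim_quotient_formIdeal {c : Fin t → ℕ} (hc : ∀ i, 1 ≤ c i) (f : Forms n c) :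
    (n : WithBot ℕ∞) + 1 ≤ ringKrullDim (CoordRing n ⧸ formIdeal f) + t := by
  have hfm : (Set.range fun i => (f i : CoordRing n)) ⊆ (idealOfVars (Fin (n + 1)) ℂ : Set _) := by
    rintro _ ⟨i, rfl⟩
    have := (mem_pow_idealOfVars_iff' 1 (f i : CoordRing n)).2 fun x hx => by
      apply IsHomogeneous.coeff_eq_zero (f i).2
      have := hc i
      omega
    rwa [pow_one] at this
  have h1 := Ideal.height_le_ringKrullDim_quotient_add_encard _ hfm
  have h2 : ((n + 1 : ℕ) : WithBot ℕ∞) ≤ ((idealOfVars (Fin (n + 1)) ℂ).height : WithBot ℕ∞) := by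
    exact_mod_cast le_height_idealOfVars n
  push_cast at h2
  refine h2.trans (h1.trans ?_)
  rw [formIdeal]
  gcongr
  have h3 : (Set.range fun i => (f i : CoordRing n)).encard ≤ (t : ℕ∞) := by
    rw [← Set.image_univ]
    exact (Set.encard_image_le _ _).trans (by simp [Set.encard_univ])
  exact_mod_cast h3

theorem mem_idealOfVars_pow {d k : ℕ} (h : d ≤ k) {q : CoordRing n} (hq : q.IsHomogeneous k) :
    q ∈ idealOfVars (Fin (n + 1)) ℂ ^ d := by
  rw [mem_pow_idealOfVars_iff']
  intro x hx
  exact hq.coeff_eq_zero (by omega)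

/-- `R/J` is a finite module over the polynomial ring in the `ℓ i`, spanned by forms of degree less
than `d`: a form of degree `k ≥ d` is an element of `J` plus a combination of the `ℓ i` with
coefficients of degree `k - 1`. Integrality bounds the dimension. -/
theorem ringKrullDim_quotient_le_of_linear_forms {J : Ideal (CoordRing n)} (hJ : IsHomogIdeal J) {e d : ℕ}
    {ℓ : Fin e → CoordRing n} (hℓ : ∀ i, (ℓ i).IsHomogeneous 1)
    (h : ∀ q : CoordRing n, q.IsHomogeneous d → q ∈ J ⊔ Ideal.span (Set.range ℓ)) :
    ringKrullDim (CoordRing n ⧸ J) ≤ e := by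
  have h' : ∀ k, d ≤ k → ∀ q : CoordRing n, q.IsHomogeneous k → q ∈ J ⊔ Ideal.span (Set.range ℓ) := by
    intro k hk q hq
    have h1 := mem_idealOfVars_pow hk hq
    rw [pow_idealOfVars_eq_span] at h1
    refine Ideal.span_le.2 ?_ h1
    rintro _ ⟨x, hx, rfl⟩
    exact h _ (isHomogeneous_monomial _ (by simpa using hx))
  let φ : MvPolynomial (Fin e) ℂ →ₐ[ℂ] CoordRing n ⧸ J :=
    aeval fun i => Ideal.Quotient.mk J (ℓ i)
  let _ : Algebra (MvPolynomial (Fin e) ℂ) (CoordRing n ⧸ J) := φ.toRingHom.toAlgebra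
  let _ : Module (MvPolynomial (Fin e) ℂ) (CoordRing n ⧸ J) := Algebra.toModule
  have hsm : ∀ (p : MvPolynomial (Fin e) ℂ) (y : CoordRing n ⧸ J), p • y = φ p * y := fun _ _ => rfl
  choose T hT using fun k => homogeneousSubmodule_fg (Fin (n + 1)) ℂ k
  let S : Set (CoordRing n ⧸ J) := Ideal.Quotient.mk J '' ⋃ k ∈ Set.Iio d, (T k : Set (CoordRing n))
  have hS : S.Finite := Set.Finite.image _ ((Set.finite_Iio d).biUnion fun k _ => (T k).finite_toSet)
  set N := Submodule.span (MvPolynomial (Fin e) ℂ) S with hN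
  have hNC : ∀ (z : ℂ) (q : CoordRing n), Ideal.Quotient.mk J q ∈ N → Ideal.Quotient.mk J (z • q) ∈ N := by
    intro z q hq
    have : Ideal.Quotient.mk J (z • q) = (C z : MvPolynomial (Fin e) ℂ) • Ideal.Quotient.mk J q := by
      rw [hsm, smul_eq_C_mul, map_mul]
      congr 1
      simp only [φ, aeval_C]
      rfl
    rw [this]
    exact N.smul_mem _ hq
  have hhom : ∀ k, ∀ q : CoordRing n, q.IsHomogeneous k → Ideal.Quotient.mk J q ∈ N := by
    intro k
    induction k using Nat.strong_induction_on with
    | _ k ih =>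
    intro q hq
    rcases lt_or_ge k d with hk | hk
    · have h1 : q ∈ Submodule.span ℂ (T k : Set (CoordRing n)) := by rw [hT]; exact hq
      induction h1 using Submodule.span_induction with
      | mem x hx => exact Submodule.subset_span ⟨x, Set.mem_biUnion hk hx, rfl⟩
      | zero => rw [map_zero]; exact N.zero_mem
      | add x y hx hy ihx ihy =>
        rw [map_add]
        rw [hT] at hx hy
        exact N.add_mem (ihx hx) (ihy hy)
      | smul z x hx ihx =>
        rw [hT] at hx
        exact hNC z x (ihx hx)
    · obtain ⟨p, hp, y, hy, hpy⟩ := Submodule.mem_sup.1 (h' k hk q hq)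
      obtain ⟨g, rfl⟩ := Ideal.mem_span_range_iff_exists_fun.1 hy
      have h1 : q = homogeneousComponent k p + ∑ i, shiftComponent n k 1 (g i) * ℓ i := by
        have h2 : homogeneousComponent k q = q := homogeneousComponent_eq_self hq
        rw [← h2, ← hpy, map_add, map_sum]
        congr 1
        exact Finset.sum_congr rfl fun i _ => homogeneousComponent_mul_of_isHomogeneous k _ (hℓ i)
      rw [h1, map_add, Ideal.Quotient.eq_zero_iff_mem.2 (homogeneousComponent_mem_of_mem hJ hp k),
        zero_add, map_sum]
      refine N.sum_mem fun i _ => ?_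
      have h3 : Ideal.Quotient.mk J (shiftComponent n k 1 (g i) * ℓ i) =
          (X i : MvPolynomial (Fin e) ℂ) • Ideal.Quotient.mk J (shiftComponent n k 1 (g i)) := by
        rw [hsm, map_mul, mul_comm]
        simp [φ]
      rw [h3]
      refine N.smul_mem _ ?_
      rcases Nat.eq_zero_or_pos k with rfl | hk0
      · have := (mem_shiftForms_of_lt (Nat.zero_lt_one)).1 (shiftComponent_mem 0 1 (g i))
        rw [this, map_zero]
        exact N.zero_mem
      · exact ih (k - 1) (by omega) _ ((mem_shiftForms hk0).1 (shiftComponent_mem k 1 (g i)))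
  have htop : N = ⊤ := by
    rw [eq_top_iff]
    intro y _
    obtain ⟨q, rfl⟩ := Ideal.Quotient.mk_surjective y
    rw [← sum_homogeneousComponent q, map_sum]
    exact N.sum_mem fun i _ => hhom i _ (homogeneousComponent_isHomogeneous _ _)
  have hfin : Module.Finite (MvPolynomial (Fin e) ℂ) (CoordRing n ⧸ J) :=
    ⟨⟨hS.toFinset, by rw [Set.Finite.coe_toFinset]; exact htop⟩⟩
  have hdim : ringKrullDim (MvPolynomial (Fin e) ℂ) = e := by simp
  rw [← hdim]
  refine Order.krullDim_le_of_strictMono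
    (PrimeSpectrum.comap (algebraMap (MvPolynomial (Fin e) ℂ) (CoordRing n ⧸ J))) ?_
  intro P Q h
  exact Ideal.IsIntegral.comap_lt_comap (R := MvPolynomial (Fin e) ℂ) (I := P.asIdeal)
    (J := Q.asIdeal) h

theorem IsHomogIdeal.le_idealOfVars {I : Ideal (CoordRing n)} (hI : IsHomogIdeal I) (h : I ≠ ⊤) :
    I ≤ idealOfVars (Fin (n + 1)) ℂ := by
  intro p hp
  have h1 := homogeneousComponent_mem_of_mem hI hp 0
  rw [homogeneousComponent_zero] at h1
  have h2 : coeff 0 p = 0 := by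
    by_contra h3
    exact h (Ideal.eq_top_of_isUnit_mem _ h1 ((isUnit_iff_ne_zero.2 h3).map C))
  have := (mem_pow_idealOfVars_iff' 1 p).2 fun x hx => by
    have : x = 0 := by
      rw [← Finsupp.degree_eq_zero_iff]
      omega
    rw [this, h2]
  rwa [pow_one] at this

/-- Converse of the previous criterion. A linear form can be chosen outside every minimal prime of
`J` other than the irrelevant ideal, because a complex vector space is not a finite union of proper
subspaces; adding it to `J` lowers the dimension by one. -/
theorem exists_linear_forms (e : ℕ) {J : Ideal (CoordRing n)} (hJ : IsHomogIdeal J)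
    (hdim : ringKrullDim (CoordRing n ⧸ J) ≤ e) :
    ∃ ℓ : Fin e → CoordRing n, (∀ i, (ℓ i).IsHomogeneous 1) ∧
      idealOfVars (Fin (n + 1)) ℂ ≤ (J ⊔ Ideal.span (Set.range ℓ)).radical := by
  induction e generalizing J with
  | zero =>
    refine ⟨Fin.elim0, fun i => i.elim0, ?_⟩
    rw [Ideal.radical_eq_sInf]
    refine le_sInf ?_
    rintro P ⟨hP, hPp⟩
    have hJP : J ≤ P := le_trans le_sup_left hP
    have hmax : ∀ Q : Ideal (CoordRing n), J ≤ Q → Q.IsPrime → ∀ Q' : Ideal (CoordRing n), Q'.IsPrime →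
        Q ≤ Q' → Q = Q' := by
      intro Q hQ hQp Q' hQ'p hQQ'
      by_contra hne
      have : (1 : WithBot ℕ∞) ≤ ringKrullDim (CoordRing n ⧸ J) := by
        rw [ringKrullDim_quotient]
        let x : PrimeSpectrum.zeroLocus (R := CoordRing n) J := ⟨⟨Q, hQp⟩, hQ⟩
        let y : PrimeSpectrum.zeroLocus (R := CoordRing n) J := ⟨⟨Q', hQ'p⟩, hQ.trans hQQ'⟩
        have hxy : x < y := lt_of_le_of_ne hQQ' fun h =>
          hne (congrArg (fun z => z.1.asIdeal) h)
        exact Order.LTSeries.length_le_krullDim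
          ((RelSeries.singleton _ x).snoc y hxy)
      have := this.trans hdim
      norm_cast at this
    have hcp := Ideal.IsPrime.homogeneousCore (𝒜 := homogeneousSubmodule (Fin (n + 1)) ℂ) hPp
    have hch : IsHomogIdeal (P.homogeneousCore (homogeneousSubmodule (Fin (n + 1)) ℂ)).toIdeal :=
      (P.homogeneousCore (homogeneousSubmodule (Fin (n + 1)) ℂ)).isHomogeneous
    have hJc : J ≤ (P.homogeneousCore (homogeneousSubmodule (Fin (n + 1)) ℂ)).toIdeal := by
      rw [← hJ.toIdeal_homogeneousCore_eq_self]
      exact Ideal.homogeneousCore_mono _ hJP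
    -- The homogeneous core of `P` is a prime over `J`, contained both in `P` and in the irrelevant
    -- ideal; in dimension zero the three coincide.
    have h1 := hmax _ hJc hcp _ (isMaximal_idealOfVars n).isPrime (hch.le_idealOfVars hcp.ne_top)
    have h2 := hmax _ hJc hcp _ hPp (Ideal.toIdeal_homogeneousCore_le _ _)
    rw [← h1, h2]
  | succ e ih =>
    set 𝔪 := idealOfVars (Fin (n + 1)) ℂ with h𝔪
    have hfin := J.finite_minimalPrimes_of_isNoetherianRing (CoordRing n)
    let E := homogeneousSubmodule (Fin (n + 1)) ℂ 1
    let toE : Ideal (CoordRing n) → Submodule ℂ E := fun P => (P.restrictScalars ℂ).comap E.subtype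
    have hS : {P ∈ J.minimalPrimes | ¬ 𝔪 ≤ P}.Finite := hfin.subset fun P hP => hP.1
    obtain ⟨ℓ₀, hℓ₀⟩ : ∃ ℓ₀ : E, ∀ P ∈ J.minimalPrimes, ¬ 𝔪 ≤ P → (ℓ₀ : CoordRing n) ∉ P := by
      classical
      have h1 : (⊤ : Submodule ℂ E) ∉ hS.toFinset.image toE := by
        simp only [Finset.mem_image, Set.Finite.mem_toFinset, not_exists, not_and]
        rintro P ⟨hP, hmP⟩ htop
        refine hmP ?_
        rw [h𝔪, idealOfVars, Ideal.span_le]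
        rintro _ ⟨i, rfl⟩
        have : (⟨X i, isHomogeneous_X ℂ i⟩ : E) ∈ toE P := by rw [htop]; trivial
        exact this
      have h2 := Subspace.biUnion_ne_univ_of_top_notMem h1
      obtain ⟨x, hx⟩ := (Set.ne_univ_iff_exists_notMem _).1 h2
      refine ⟨x, fun P hP hmP hxP => hx ?_⟩
      refine Set.mem_biUnion (x := toE P) ?_ hxP
      simp only [Finset.coe_image, Set.mem_image, SetLike.mem_coe]
      exact ⟨P, hS.mem_toFinset.2 ⟨hP, hmP⟩, rfl⟩
    have hJ' : IsHomogIdeal (J ⊔ Ideal.span {(ℓ₀ : CoordRing n)}) :=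
      hJ.sup (isHomogIdeal_span (by rintro _ rfl; exact ⟨1, ℓ₀.2⟩))
    obtain ⟨ℓ, hℓ, hrad⟩ := ih hJ' (by
      rw [ringKrullDim_quotient]
      refine iSup_le fun p => ?_
      have hp0 : J ⊔ Ideal.span {(ℓ₀ : CoordRing n)} ≤ p.head.1.asIdeal := p.head.2
      obtain ⟨P, hP, hPp⟩ := Ideal.exists_minimalPrimes_le
        (J := p.head.1.asIdeal) (le_sup_left.trans hp0)
      -- Over `P = 𝔪` a chain is a single prime. Otherwise `ℓ₀ ∉ P`, so `P` can be put strictly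
      -- below the chain, which must therefore be shorter than the chains over `J`.
      by_cases hmP : 𝔪 ≤ P
      · have hlast : p.head = p.last := by
          refine le_antisymm (LTSeries.head_le_last p) ?_
          have h1 : p.head.1.asIdeal = 𝔪 := ((isMaximal_idealOfVars n).eq_of_le
            p.head.1.2.ne_top (hmP.trans hPp)).symm
          have h2 : p.last.1.asIdeal = 𝔪 := ((isMaximal_idealOfVars n).eq_of_le
            p.last.1.2.ne_top (h1.symm.le.trans (LTSeries.head_le_last p))).symm
          exact (h2.trans h1.symm).le
        have hl : p.length = 0 := by
          by_contra h0
          have := LTSeries.strictMono p (show (0 : Fin (p.length + 1)) < Fin.last _ from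
            Fin.lt_def.2 (by simp; omega))
          exact absurd hlast this.ne
        rw [hl]
        exact_mod_cast Nat.zero_le e
      · have hPJ : J ≤ P := hP.1.2
        have hlt : P < p.head.1.asIdeal := by
          refine lt_of_le_of_ne hPp ?_
          rintro rfl
          exact hℓ₀ _ hP hmP (hp0 (Ideal.mem_sup_right (Ideal.mem_span_singleton_self _)))
        let x : PrimeSpectrum.zeroLocus (R := CoordRing n) J := ⟨⟨P, hP.1.1⟩, hPJ⟩
        let inc : PrimeSpectrum.zeroLocus (R := CoordRing n)
            (J ⊔ Ideal.span {(ℓ₀ : CoordRing n)} : Ideal _) →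
            PrimeSpectrum.zeroLocus (R := CoordRing n) J := fun Q => ⟨Q.1,
              (le_sup_left (a := J)).trans (show J ⊔ Ideal.span {(ℓ₀ : CoordRing n)} ≤ Q.1.asIdeal from Q.2)⟩
        let q := (p.map inc (fun _ _ h => h)).cons x hlt
        have h1 : ((q.length : ℕ∞) : WithBot ℕ∞) ≤ ((e + 1 : ℕ) : WithBot ℕ∞) := by
          refine le_trans ?_ hdim
          rw [ringKrullDim_quotient]
          exact Order.LTSeries.length_le_krullDim q
        have h2 : q.length = p.length + 1 := by
          simp [q, LTSeries.map]
        rw [h2] at h1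
        have h3 : p.length + 1 ≤ e + 1 := by exact_mod_cast h1
        exact_mod_cast Nat.le_of_succ_le_succ h3)
    refine ⟨Fin.cons ℓ₀ ℓ, fun i => Fin.cases ℓ₀.2 hℓ i, ?_⟩
    have : J ⊔ Ideal.span (Set.range (Fin.cons (ℓ₀ : CoordRing n) ℓ : Fin (e + 1) → CoordRing n)) =
        J ⊔ Ideal.span {(ℓ₀ : CoordRing n)} ⊔ Ideal.span (Set.range ℓ) := by
      rw [Fin.range_cons, Set.insert_eq, Ideal.span_union, sup_assoc]
    rw [this]
    exact hrad

/-- This form of the condition is visibly open: for fixed `ℓ` and `d` it says that a linear map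
depending polynomially on `f` is surjective. -/
theorem isCI_iff {c : Fin t → ℕ} (hc : ∀ i, 1 ≤ c i) (ht : t ≤ n + 1) (f : Forms n c) :
    IsCI f ↔ ∃ ℓ : Fin (n + 1 - t) → CoordRing n, (∀ i, (ℓ i).IsHomogeneous 1) ∧
      ∃ d, ∀ q : CoordRing n, q.IsHomogeneous d → q ∈ formIdeal f ⊔ Ideal.span (Set.range ℓ) := by
  have hnt : ((n + 1 - t : ℕ) : WithBot ℕ∞) + t = (n : WithBot ℕ∞) + 1 := by
    have : n + 1 - t + t = n + 1 := by omega
    exact_mod_cast this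
  constructor
  · intro hf
    rw [IsCI] at hf
    have hdim : ringKrullDim (CoordRing n ⧸ formIdeal f) ≤ ((n + 1 - t : ℕ) : WithBot ℕ∞) := by
      rw [← hnt] at hf
      clear hnt
      generalize ringKrullDim (CoordRing n ⧸ formIdeal f) = D at hf
      generalize n + 1 - t = k at hf
      induction D using WithBot.recBotCoe with
      | bot => exact bot_le
      | coe D =>
        induction D using ENat.recTopCoe with
        | top => exact absurd hf.symm (by rw [← ENat.WithBot.coe_eq_natCast] at *; norm_cast; simp)
        | coe D =>
          norm_cast at hf ⊢
          omega
    obtain ⟨ℓ, hℓ, hrad⟩ := exists_linear_forms _ (isHomogIdeal_formIdeal f) hdim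
    obtain ⟨d, hd⟩ := Ideal.exists_radical_pow_le_of_fg (formIdeal f ⊔ Ideal.span (Set.range ℓ))
      (IsNoetherian.noetherian _)
    exact ⟨ℓ, hℓ, d, fun q hq => hd (Ideal.pow_right_mono hrad d (mem_idealOfVars_pow le_rfl hq))⟩
  · rintro ⟨ℓ, hℓ, d, hd⟩
    refine le_antisymm ?_ (le_ringKrullDim_quotient_formIdeal hc f)
    rw [← hnt]
    gcongr
    exact ringKrullDim_quotient_le_of_linear_forms (isHomogIdeal_formIdeal f) hℓ hd

theorem zopen_isCI {c : Fin t → ℕ} (hc : ∀ i, 1 ≤ c i) (ht : t ≤ n + 1) :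
    ZOpen {f : Forms n c | IsCI f} := by
  simp only [isCI_iff hc ht]
  refine zopen_exists fun ℓ => ?_
  by_cases hℓ : ∀ i, (ℓ i).IsHomogeneous 1
  swap
  · convert zopen_iUnion (V := Forms n c) (ι := Empty) (S := fun i => i.elim)
    simp [hℓ]
  simp only [hℓ, implies_true, true_and]
  refine zopen_exists fun d => ?_
  have hℓh : IsHomogIdeal (Ideal.span (Set.range ℓ)) :=
    isHomogIdeal_span (by rintro _ ⟨i, rfl⟩; exact ⟨1, hℓ i⟩)
  let P := degPart (Ideal.span (Set.range ℓ)) d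
  let inc : P →ₗ[ℂ] homogeneousSubmodule (Fin (n + 1)) ℂ d := Submodule.inclusion inf_le_right
  let L : Forms n c → (P × FormRow n d c →ₗ[ℂ] homogeneousSubmodule (Fin (n + 1)) ℂ d) := fun f =>
    inc.coprod ((mulRow d c).flip f)
  have hL : IsPolyMap L := by
    let M : Forms n c →ₗ[ℂ] (P × FormRow n d c →ₗ[ℂ] homogeneousSubmodule (Fin (n + 1)) ℂ d) :=
      (LinearMap.lcomp ℂ _ (LinearMap.snd ℂ P (FormRow n d c))).comp (mulRow d c).flip
    have : L = fun f => inc.coprod 0 + M f := by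
      ext1 f
      refine LinearMap.ext fun x => ?_
      simp [L, M]
    rw [this]
    exact (isPolyMap_const _).add (isPolyMap_hom M)
  convert zopen_surjective hL using 3 with f
  constructor
  · rintro h ⟨q, hq⟩
    obtain ⟨p, hp, y, hy, hpy⟩ := Submodule.mem_sup.1 (h q hq)
    obtain ⟨A, hA⟩ := exists_mulRow (f := f) ⟨homogeneousComponent d p, homogeneousComponent_isHomogeneous _ _⟩
      (homogeneousComponent_mem_of_mem (isHomogIdeal_formIdeal f) hp d)
    refine ⟨(⟨homogeneousComponent d y, homogeneousComponent_mem_of_mem hℓh hy d,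
      homogeneousComponent_isHomogeneous _ _⟩, A), Subtype.ext ?_⟩
    have h2 : homogeneousComponent d q = q := homogeneousComponent_eq_self hq
    have h3 : (mulRow d c A f : CoordRing n) = homogeneousComponent d p := congrArg Subtype.val hA
    change homogeneousComponent d y + (mulRow d c A f : CoordRing n) = q
    rw [h3, ← map_add, add_comm y, hpy, h2]
  · intro h q hq
    obtain ⟨⟨p, A⟩, hpA⟩ := h ⟨q, hq⟩
    have : (p : CoordRing n) + (mulRow d c A f : CoordRing n) = q := congrArg Subtype.val hpA
    rw [← this]
    exact add_mem (Ideal.mem_sup_right p.2.1) (Ideal.mem_sup_left (mulRow_mem A f))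

end Dimension

end

noncomputable section

open MvPolynomial

attribute [local instance] MvPolynomial.gradedAlgebra

/-! ### Quotient topologies of parametrizations -/

section ParamTopology

variable {V X Y : Type} [AddCommGroup V] [Module ℂ V] {D : V → Prop} {κ : {v : V // D v} → X}

/-- Openness of the parametrization: the saturation of an open `O` is the union over `γ` of its
preimages under the transition maps, which are polynomial. -/
theorem isOpen_of_zopen_of_transitions {Γ : Type*} (T : Γ → V → V) (hT : ∀ γ, IsPolyMap (T γ))
    (hD : ZOpen {v | D v})
    (h1 : ∀ γ (x : {v : V // D v}) (h : D (T γ x)), κ ⟨T γ x, h⟩ = κ x)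
    (h2 : ∀ x y : {v : V // D v}, κ x = κ y → ∃ γ, T γ x = y) (ι : Y → X) {O : Set V}
    (hO : ZOpen O) :
    @IsOpen Y ((paramTopology D κ).induced ι) {y | ∃ x : {v : V // D v}, κ x = ι y ∧ x.1 ∈ O} := by
  let _ := paramTopology D κ
  refine isOpen_induced_iff.2 ⟨{z | ∃ x : {v : V // D v}, κ x = z ∧ x.1 ∈ O}, ?_, rfl⟩
  refine isOpen_coinduced.2 ?_
  let _ := zariskiTopology V
  refine isOpen_induced_iff.2 ⟨⋃ γ, {v | D (T γ v) ∧ T γ v ∈ O},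
    zopen_iUnion fun γ => (hD.inter hO).preimage (hT γ), ?_⟩
  ext x
  simp only [Set.mem_preimage, Set.mem_iUnion, Set.mem_ofPred_eq]
  constructor
  · rintro ⟨γ, hγ, hγO⟩
    exact ⟨⟨T γ x, hγ⟩, h1 γ x hγ, hγO⟩
  · rintro ⟨y, hy, hyO⟩
    obtain ⟨γ, hγ⟩ := h2 x y hy.symm
    exact ⟨γ, hγ ▸ y.2, hγ ▸ hyO⟩

theorem exists_zopen_of_isOpen (ι : Y → X) {U : Set Y}
    (hU : @IsOpen Y ((paramTopology D κ).induced ι) U) :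
    ∃ O : Set V, ZOpen O ∧ ∀ (x : {v : V // D v}) y, κ x = ι y → (x.1 ∈ O ↔ y ∈ U) := by
  let _ := paramTopology D κ
  obtain ⟨U', hU', rfl⟩ := isOpen_induced_iff.1 hU
  let _ := zariskiTopology V
  obtain ⟨O, hO, e⟩ := isOpen_induced_iff.1 (isOpen_coinduced.1 hU')
  refine ⟨O, hO, fun x y hxy => ?_⟩
  have := Set.ext_iff.1 e x
  rw [Set.mem_preimage, ← hxy]
  exact this

end ParamTopology

/-! ### Open subsets of the parameter spaces in terms of equations -/

section Spaces

variable {n t s r : ℕ} {c : Fin t → ℕ} {b : Fin s → ℕ} {a : Fin r → ℕ}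

theorem IsCI.of_formIdeal_eq {f f' : Forms n c} (hf : IsCI f) (h : formIdeal f = formIdeal f') :
    IsCI f' := by
  rw [IsCI, ← h]
  exact hf

theorem CIParam.isCI {u : CIParam n c} {f : Forms n c} (h : formIdeal f = u.ideal) : IsCI f := by
  obtain ⟨f', hf', e⟩ := u.exists_forms
  exact hf'.of_formIdeal_eq (e.trans h.symm)

theorem CIParam.ofForms_eq_iff {u : CIParam n c} {f : Forms n c} (hf : IsCI f) :
    CIParam.ofForms f hf = u ↔ formIdeal f = u.ideal :=
  CIParam.ext_iff

theorem isPolyMap_mulForms (a : Fin s → ℕ) (A : FormMatrix n a c) :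
    IsPolyMap (fun f => mulForms a c A f) := LinearMap.isPolyMap (mulForms a c A)

/-- The matrix `A` is not assumed invertible; that the product is again a complete intersection
suffices. So all square matrices of forms can serve as transition maps. -/
theorem formIdeal_mulForms_eq (hc : ∀ i, 1 ≤ c i) {A : FormMatrix n c c} {f : Forms n c}
    (hf : IsCI f) (hAf : IsCI (mulForms c c A f)) : formIdeal (mulForms c c A f) = formIdeal f :=
  formIdeal_eq_of_le hc hAf hf (formIdeal_mulForms_le A f)

theorem CIParam.isOpen_of_zopen (hc : ∀ i, 1 ≤ c i) (ht : t ≤ n + 1) {O : Set (Forms n c)}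
    (hO : ZOpen O) : IsOpen {u : CIParam n c | ∃ f, formIdeal f = u.ideal ∧ f ∈ O} := by
  have := isOpen_of_zopen_of_transitions (D := fun f : Forms n c => IsCI f)
    (κ := fun f => CIParam.ofForms f.1 f.2) (fun A f => mulForms c c A f)
    (isPolyMap_mulForms c) (zopen_isCI hc ht)
    (fun A f h => (CIParam.ofForms_eq_iff h).2 (formIdeal_mulForms_eq hc f.2 h))
    (fun f f' h => formIdeal_le_iff_exists.1 (CIParam.ext_iff.1 h).ge) id hO
  rw [induced_id] at this
  convert this using 1
  · rfl
  ext u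
  constructor
  · rintro ⟨f, hf, hfO⟩
    exact ⟨⟨f, CIParam.isCI hf⟩, CIParam.ext hf, hfO⟩
  · rintro ⟨f, hf, hfO⟩
    exact ⟨f, CIParam.ext_iff.1 hf, hfO⟩

theorem CIParam.exists_zopen {U : Set (CIParam n c)} (hU : IsOpen U) :
    ∃ O : Set (Forms n c), ZOpen O ∧ ∀ f (u : CIParam n c), formIdeal f = u.ideal →
      (f ∈ O ↔ u ∈ U) := by
  obtain ⟨O, hO, h⟩ := exists_zopen_of_isOpen (D := fun f : Forms n c => IsCI f)
    (κ := fun f => CIParam.ofForms f.1 f.2) (U := U) id (by rw [induced_id]; exact hU)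
  exact ⟨O, hO, fun f u hf => h ⟨f, CIParam.isCI hf⟩ u (CIParam.ext hf)⟩

/-- `v` represents the point `p`. -/
def Represents (v : Fin (n + 1) → ℂ) (p : ProjPoint n) : Prop :=
  ∃ h : v ≠ 0, Projectivization.mk ℂ v h = p

theorem represents_rep (p : ProjPoint n) : Represents p.rep p := ⟨p.rep_nonzero, p.mk_rep⟩

theorem zopen_vec_ne_zero : ZOpen {v : Fin (n + 1) → ℂ | v ≠ 0} := by
  convert zopen_exists (S := fun i (v : Fin (n + 1) → ℂ) => v i ≠ 0) fun i =>
    zopen_ne_zero (dual_mem_polyFun (LinearMap.proj i : (Fin (n + 1) → ℂ) →ₗ[ℂ] ℂ)) using 3 with v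
  exact Function.ne_iff

theorem isPolyMap_smul_const {V : Type} [AddCommGroup V] [Module ℂ V] (z : ℂ) :
    IsPolyMap (fun v : V => z • v) :=
  isPolyMap_id.smul (const_mem_polyFun z)

theorem UnivFamily.isOpen_of_zopen (hc : ∀ i, 1 ≤ c i) (ht : t ≤ n + 1)
    {O : Set ((Fin (n + 1) → ℂ) × Forms n c)} (hO : ZOpen O) :
    IsOpen {P : UnivFamily n c | ∃ v f, Represents v P.pt ∧ formIdeal f = P.ci.ideal ∧
      (v, f) ∈ O} := by
  have := isOpen_of_zopen_of_transitions
    (D := fun x : (Fin (n + 1) → ℂ) × Forms n c => x.1 ≠ 0 ∧ IsCI x.2)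
    (κ := fun x => (Projectivization.mk ℂ x.1.1 x.2.1, CIParam.ofForms x.1.2 x.2.2))
    (fun (γ : ℂ × FormMatrix n c c) x => (γ.1 • x.1, mulForms c c γ.2 x.2))
    (fun γ => ((isPolyMap_smul_const γ.1).comp isPolyMap_id.fst).prodMk
      ((isPolyMap_mulForms c γ.2).comp isPolyMap_id.snd))
    ((zopen_vec_ne_zero.preimage isPolyMap_id.fst).inter
      ((zopen_isCI hc ht).preimage isPolyMap_id.snd))
    (fun γ x h => Prod.ext ((Projectivization.mk_eq_mk_iff' _ _ _ _ _).2 ⟨γ.1, rfl⟩)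
      ((CIParam.ofForms_eq_iff h.2).2 (formIdeal_mulForms_eq hc x.2.2 h.2)))
    (fun x y h => by
      obtain ⟨z, hz⟩ := (Projectivization.mk_eq_mk_iff' _ _ _ _ _).1 (Prod.ext_iff.1 h).1.symm
      obtain ⟨A, hA⟩ := formIdeal_le_iff_exists.1 (CIParam.ext_iff.1 (Prod.ext_iff.1 h).2).ge
      exact ⟨(z, A), Prod.ext hz hA⟩) (fun P : UnivFamily n c => (P.pt, P.ci)) hO
  convert this using 1
  · rfl
  ext P
  constructor
  · rintro ⟨v, f, ⟨hv, hvp⟩, hf, hO⟩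
    exact ⟨⟨(v, f), hv, CIParam.isCI hf⟩, Prod.ext hvp (CIParam.ext hf), hO⟩
  · rintro ⟨x, hx, hO⟩
    exact ⟨x.1.1, x.1.2, ⟨x.2.1, (Prod.ext_iff.1 hx).1⟩, CIParam.ext_iff.1 (Prod.ext_iff.1 hx).2, hO⟩

theorem UnivFamily.exists_zopen {U : Set (UnivFamily n c)} (hU : IsOpen U) :
    ∃ O : Set ((Fin (n + 1) → ℂ) × Forms n c), ZOpen O ∧ ∀ v f (P : UnivFamily n c),
      Represents v P.pt → formIdeal f = P.ci.ideal → ((v, f) ∈ O ↔ P ∈ U) := by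
  obtain ⟨O, hO, h⟩ := exists_zopen_of_isOpen
    (D := fun x : (Fin (n + 1) → ℂ) × Forms n c => x.1 ≠ 0 ∧ IsCI x.2)
    (κ := fun x => (Projectivization.mk ℂ x.1.1 x.2.1, CIParam.ofForms x.1.2 x.2.2))
    (fun P : UnivFamily n c => (P.pt, P.ci)) hU
  exact ⟨O, hO, fun v f P hv hf =>
    h ⟨(v, f), hv.1, CIParam.isCI hf⟩ P (Prod.ext hv.2 (CIParam.ext hf))⟩

theorem FlagVariety.isOpen_of_zopen (hb : ∀ i, 1 ≤ b i) (hs : s ≤ n + 1) (ha : ∀ i, 1 ≤ a i)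
    (hr : r ≤ n + 1) {O : Set (Forms n b × Forms n a)} (hO : ZOpen O) :
    IsOpen {P : FlagVariety n b a | ∃ k f, formIdeal k = P.Z.ideal ∧ formIdeal f = P.X.ideal ∧
      (k, f) ∈ O} := by
  have := isOpen_of_zopen_of_transitions
    (D := fun x : Forms n b × Forms n a => IsCI x.1 ∧ IsCI x.2)
    (κ := fun x => (CIParam.ofForms x.1.1 x.2.1, CIParam.ofForms x.1.2 x.2.2))
    (fun (γ : FormMatrix n b b × FormMatrix n a a) x =>
      (mulForms b b γ.1 x.1, mulForms a a γ.2 x.2))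
    (fun γ => ((isPolyMap_mulForms b γ.1).comp isPolyMap_id.fst).prodMk
      ((isPolyMap_mulForms a γ.2).comp isPolyMap_id.snd))
    (((zopen_isCI hb hs).preimage isPolyMap_id.fst).inter
      ((zopen_isCI ha hr).preimage isPolyMap_id.snd))
    (fun γ x h => Prod.ext ((CIParam.ofForms_eq_iff h.1).2 (formIdeal_mulForms_eq hb x.2.1 h.1))
      ((CIParam.ofForms_eq_iff h.2).2 (formIdeal_mulForms_eq ha x.2.2 h.2)))
    (fun x y h => by
      obtain ⟨B, hB⟩ := formIdeal_le_iff_exists.1 (CIParam.ext_iff.1 (Prod.ext_iff.1 h).1).ge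
      obtain ⟨A, hA⟩ := formIdeal_le_iff_exists.1 (CIParam.ext_iff.1 (Prod.ext_iff.1 h).2).ge
      exact ⟨(B, A), Prod.ext hB hA⟩) (fun P : FlagVariety n b a => (P.Z, P.X)) hO
  convert this using 1
  · rfl
  ext P
  constructor
  · rintro ⟨k, f, hk, hf, hO⟩
    exact ⟨⟨(k, f), CIParam.isCI hk, CIParam.isCI hf⟩, Prod.ext (CIParam.ext hk) (CIParam.ext hf), hO⟩
  · rintro ⟨x, hx, hO⟩
    exact ⟨x.1.1, x.1.2, CIParam.ext_iff.1 (Prod.ext_iff.1 hx).1,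
      CIParam.ext_iff.1 (Prod.ext_iff.1 hx).2, hO⟩

theorem FlagVariety.exists_zopen {U : Set (FlagVariety n b a)} (hU : IsOpen U) :
    ∃ O : Set (Forms n b × Forms n a), ZOpen O ∧ ∀ k f (P : FlagVariety n b a),
      formIdeal k = P.Z.ideal → formIdeal f = P.X.ideal → ((k, f) ∈ O ↔ P ∈ U) := by
  obtain ⟨O, hO, h⟩ := exists_zopen_of_isOpen
    (D := fun x : Forms n b × Forms n a => IsCI x.1 ∧ IsCI x.2)
    (κ := fun x => (CIParam.ofForms x.1.1 x.2.1, CIParam.ofForms x.1.2 x.2.2))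
    (fun P : FlagVariety n b a => (P.Z, P.X)) hU
  exact ⟨O, hO, fun k f P hk hf =>
    h ⟨(k, f), CIParam.isCI hk, CIParam.isCI hf⟩ P (Prod.ext (CIParam.ext hk) (CIParam.ext hf))⟩

theorem FlagFamily.isOpen_of_zopen (hb : ∀ i, 1 ≤ b i) (hs : s ≤ n + 1) (ha : ∀ i, 1 ≤ a i)
    (hr : r ≤ n + 1) {O : Set ((Fin (n + 1) → ℂ) × Forms n b × Forms n a)} (hO : ZOpen O) :
    IsOpen {Q : FlagFamily n b a | ∃ v k f, Represents v Q.pt ∧ formIdeal k = Q.Z.ideal ∧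
      formIdeal f = Q.X.ideal ∧ (v, k, f) ∈ O} := by
  have := isOpen_of_zopen_of_transitions
    (D := fun x : (Fin (n + 1) → ℂ) × Forms n b × Forms n a =>
      x.1 ≠ 0 ∧ IsCI x.2.1 ∧ IsCI x.2.2)
    (κ := fun x => (Projectivization.mk ℂ x.1.1 x.2.1, CIParam.ofForms x.1.2.1 x.2.2.1,
      CIParam.ofForms x.1.2.2 x.2.2.2))
    (fun (γ : ℂ × FormMatrix n b b × FormMatrix n a a) x =>
      (γ.1 • x.1, mulForms b b γ.2.1 x.2.1, mulForms a a γ.2.2 x.2.2))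
    (fun γ => ((isPolyMap_smul_const γ.1).comp isPolyMap_id.fst).prodMk
      (((isPolyMap_mulForms b γ.2.1).comp isPolyMap_id.snd.fst).prodMk
      ((isPolyMap_mulForms a γ.2.2).comp isPolyMap_id.snd.snd)))
    ((zopen_vec_ne_zero.preimage isPolyMap_id.fst).inter
      (((zopen_isCI hb hs).preimage isPolyMap_id.snd.fst).inter
      ((zopen_isCI ha hr).preimage isPolyMap_id.snd.snd)))
    (fun γ x h => Prod.ext ((Projectivization.mk_eq_mk_iff' _ _ _ _ _).2 ⟨γ.1, rfl⟩) (Prod.ext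
      ((CIParam.ofForms_eq_iff h.2.1).2 (formIdeal_mulForms_eq hb x.2.2.1 h.2.1))
      ((CIParam.ofForms_eq_iff h.2.2).2 (formIdeal_mulForms_eq ha x.2.2.2 h.2.2))))
    (fun x y h => by
      obtain ⟨z, hz⟩ := (Projectivization.mk_eq_mk_iff' _ _ _ _ _).1 (Prod.ext_iff.1 h).1.symm
      have h' := Prod.ext_iff.1 (Prod.ext_iff.1 h).2
      obtain ⟨B, hB⟩ := formIdeal_le_iff_exists.1 (CIParam.ext_iff.1 h'.1).ge
      obtain ⟨A, hA⟩ := formIdeal_le_iff_exists.1 (CIParam.ext_iff.1 h'.2).ge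
      exact ⟨(z, B, A), Prod.ext hz (Prod.ext hB hA)⟩)
    (fun P : FlagFamily n b a => (P.pt, P.Z, P.X)) hO
  convert this using 1
  · rfl
  ext P
  constructor
  · rintro ⟨v, k, f, ⟨hv, hvp⟩, hk, hf, hO⟩
    exact ⟨⟨(v, k, f), hv, CIParam.isCI hk, CIParam.isCI hf⟩,
      Prod.ext hvp (Prod.ext (CIParam.ext hk) (CIParam.ext hf)), hO⟩
  · rintro ⟨x, hx, hO⟩
    have h' := Prod.ext_iff.1 (Prod.ext_iff.1 hx).2
    exact ⟨x.1.1, x.1.2.1, x.1.2.2, ⟨x.2.1, (Prod.ext_iff.1 hx).1⟩, CIParam.ext_iff.1 h'.1,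
      CIParam.ext_iff.1 h'.2, hO⟩

theorem FlagFamily.exists_zopen {U : Set (FlagFamily n b a)} (hU : IsOpen U) :
    ∃ O : Set ((Fin (n + 1) → ℂ) × Forms n b × Forms n a), ZOpen O ∧
      ∀ v k f (P : FlagFamily n b a), Represents v P.pt → formIdeal k = P.Z.ideal →
        formIdeal f = P.X.ideal → ((v, k, f) ∈ O ↔ P ∈ U) := by
  obtain ⟨O, hO, h⟩ := exists_zopen_of_isOpen
    (D := fun x : (Fin (n + 1) → ℂ) × Forms n b × Forms n a =>
      x.1 ≠ 0 ∧ IsCI x.2.1 ∧ IsCI x.2.2)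
    (κ := fun x => (Projectivization.mk ℂ x.1.1 x.2.1, CIParam.ofForms x.1.2.1 x.2.2.1,
      CIParam.ofForms x.1.2.2 x.2.2.2))
    (fun P : FlagFamily n b a => (P.pt, P.Z, P.X)) hU
  exact ⟨O, hO, fun v k f P hv hk hf =>
    h ⟨(v, k, f), hv.1, CIParam.isCI hk, CIParam.isCI hf⟩ P
      (Prod.ext hv.2 (Prod.ext (CIParam.ext hk) (CIParam.ext hf)))⟩

end Spaces

end

noncomputable section

open MvPolynomial

attribute [local instance] MvPolynomial.gradedAlgebra

/-! ### Charts given by solutions of linear systems -/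

section Charts

variable {V X Y : Type} [AddCommGroup V] [Module ℂ V] [AddCommGroup X] [Module ℂ X]
  [AddCommGroup Y] [Module ℂ Y]

/-- Adjoining an identity block makes the parameter `v` part of the solution, so that the open
condition may involve both. -/
theorem zopen_solution_prod [FiniteDimensional ℂ V] [FiniteDimensional ℂ X] [FiniteDimensional ℂ Y]
    {L : V → X →ₗ[ℂ] Y} (hL : IsPolyMap L) {w : V → Y} (hw : IsPolyMap w) {O : Set (V × X)}
    (hO : ZOpen O) :
    ZOpen {v | Function.Bijective (L v) ∧ ∃ x, (v, x) ∈ O ∧ L v x = w v} := by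
  let M : V → (V × X →ₗ[ℂ] V × Y) := fun v => LinearMap.prodMap LinearMap.id (L v)
  have hM : IsPolyMap M := by
    let P : (X →ₗ[ℂ] Y) →ₗ[ℂ] (V × X →ₗ[ℂ] V × Y) :=
      (LinearMap.lcomp ℂ _ (LinearMap.snd ℂ V X)).comp (LinearMap.compRight ℂ (LinearMap.inr ℂ V Y))
    have : M = fun v => LinearMap.prodMap LinearMap.id 0 + P (L v) := by
      ext1 v
      refine LinearMap.ext fun x => ?_
      simp [M, P]
    rw [this]
    exact (isPolyMap_const _).add (hL.linearHom P)
  convert zopen_solution hM (isPolyMap_id.prodMk hw) hO using 3 with v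
  refine and_congr ?_ ?_
  · change _ ↔ Function.Bijective (Prod.map id (L v))
    exact ⟨fun h => Function.bijective_id.prodMap h, fun h =>
      ⟨fun x y e => congrArg Prod.snd (h.1 (a₁ := (0, x)) (a₂ := (0, y)) (Prod.ext rfl e)), fun y => by
        obtain ⟨⟨_, x⟩, hx⟩ := h.2 (0, y)
        exact ⟨x, congrArg Prod.snd hx⟩⟩⟩
  · constructor
    · rintro ⟨x, hx, e⟩
      exact ⟨(v, x), hx, Prod.ext rfl e⟩
    · rintro ⟨⟨v', x⟩, hx, e⟩
      have h1 : v' = v := (Prod.ext_iff.1 e).1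
      exact ⟨x, h1 ▸ hx, (Prod.ext_iff.1 e).2⟩

theorem topologicalKrullDim_image_of_chart [FiniteDimensional ℂ V] {Z : Type*} [TopologicalSpace Z]
    {D : Set V} (hD : ZOpen D) (hne : D.Nonempty) {ι : V → Z} (hinj : Set.InjOn ι D)
    (hιc : ∀ O, IsOpen O → ZOpen (D ∩ ι ⁻¹' O)) (hop : ∀ O, ZOpen O → IsOpen (ι '' (D ∩ O))) :
    topologicalKrullDim (ι '' D) = Module.finrank ℂ V := by
  have hσ : ∀ y ∈ D, Function.invFunOn ι D (ι y) = y := fun y hy => hinj.leftInvOn_invFunOn hy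
  refine topologicalKrullDim_eq_of_chart (hne.image ι) hD (σ := Function.invFunOn ι D) (ι := ι)
    (by rintro _ ⟨y, hy, rfl⟩; rw [hσ y hy]; exact ⟨hy, rfl⟩)
    (fun y hy => ⟨Set.mem_image_of_mem _ hy, hσ y hy⟩) hιc fun O hO => ?_
  convert hop O hO using 1
  ext x
  constructor
  · rintro ⟨⟨y, hy, rfl⟩, hyO⟩
    rw [Set.mem_preimage, hσ y hy] at hyO
    exact ⟨y, ⟨hy, hyO⟩, rfl⟩
  · rintro ⟨y, ⟨hy, hyO⟩, rfl⟩
    refine ⟨⟨y, hy, rfl⟩, ?_⟩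
    rwa [Set.mem_preimage, hσ y hy]

end Charts

/-! ### Linear slices transversal to orbits -/

section Slices

variable {M V W : Type} [AddCommGroup M] [Module ℂ M] [AddCommGroup V] [Module ℂ V]
  [AddCommGroup W] [Module ℂ W] (B : M →ₗ[ℂ] V →ₗ[ℂ] W)

/-- The multiples of `f` with respect to a bilinear map. -/
def multiples (f : V) : Submodule ℂ W := LinearMap.range (B.flip f)

theorem apply_mem_multiples (A : M) (f : V) : B A f ∈ multiples B f := ⟨A, rfl⟩

/-- The map `(A, e) ↦ A f + e` on `G × C`. -/
def sliceMap (G : Submodule ℂ M) (C : Submodule ℂ W) (f : V) : G × C →ₗ[ℂ] W :=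
  ((B.flip f).comp G.subtype).coprod C.subtype

theorem sliceMap_apply (G : Submodule ℂ M) (C : Submodule ℂ W) (f : V) (x : G × C) :
    sliceMap B G C f x = B x.1 f + x.2 := rfl

theorem isPolyMap_sliceMap (G : Submodule ℂ M) (C : Submodule ℂ W) :
    IsPolyMap (sliceMap B G C) := by
  let L : V →ₗ[ℂ] (G × C →ₗ[ℂ] W) :=
    (LinearMap.lcomp ℂ _ (G.subtype.comp (LinearMap.fst ℂ G C))).comp B.flip
  have : sliceMap B G C = fun f => C.subtype.comp (LinearMap.snd ℂ G C) + L f := by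
    ext1 f
    refine LinearMap.ext fun x => ?_
    rw [sliceMap_apply, add_comm]
    rfl
  rw [this]
  exact (isPolyMap_const _).add (isPolyMap_hom L)

theorem exists_isCompl_ker (f : V) : ∃ G : Submodule ℂ M,
    (∀ A ∈ G, B A f = 0 → A = 0) ∧ (∀ x ∈ multiples B f, ∃ A ∈ G, B A f = x) ∧
    Module.finrank ℂ G = Module.finrank ℂ (multiples B f) := by
  obtain ⟨G, hG⟩ := (LinearMap.ker (B.flip f)).exists_isCompl
  have hrange : ∀ x ∈ multiples B f, ∃ A ∈ G, B A f = x := by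
    rintro _ ⟨A, rfl⟩
    obtain ⟨z, hz, y, hy, rfl⟩ := Submodule.mem_sup.1 (hG.sup_eq_top ▸ Submodule.mem_top : A ∈ _ ⊔ G)
    refine ⟨y, hy, ?_⟩
    rw [LinearMap.mem_ker] at hz
    rw [map_add, hz, zero_add]
    rfl
  have hinj : ∀ A ∈ G, B A f = 0 → A = 0 := fun A hA h =>
    (Submodule.mem_bot ℂ).1 (hG.inf_eq_bot ▸ ⟨h, hA⟩ : A ∈ (⊥ : Submodule ℂ _))
  refine ⟨G, hinj, hrange, ?_⟩
  let Φ : G →ₗ[ℂ] multiples B f :=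
    ((B.flip f).comp G.subtype).codRestrict _ fun A => apply_mem_multiples B A f
  refine (LinearEquiv.ofBijective Φ ⟨?_, ?_⟩).finrank_eq
  · rw [← LinearMap.ker_eq_bot, LinearMap.ker_eq_bot']
    exact fun A hA => Subtype.ext (hinj A A.2 (congrArg Subtype.val hA))
  · rintro ⟨x, hx⟩
    obtain ⟨A, hA, rfl⟩ := hrange x hx
    exact ⟨⟨A, hA⟩, rfl⟩

/-- `G` is a complement of the annihilator of `f`, and `C` a complement of the multiples of `f`.
Bijectivity of the slice map is an open condition, so the same `G` and `C` work for nearby `f`. -/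
theorem exists_slice (f : V) : ∃ (G : Submodule ℂ M) (C : Submodule ℂ W),
    Function.Bijective (sliceMap B G C f) ∧
      Module.finrank ℂ G = Module.finrank ℂ (multiples B f) ∧ IsCompl (multiples B f) C := by
  obtain ⟨G, hinj, hrange, hG⟩ := exists_isCompl_ker B f
  obtain ⟨C, hC⟩ := (multiples B f).exists_isCompl
  refine ⟨G, C, ⟨?_, ?_⟩, hG, hC⟩
  · rw [← LinearMap.ker_eq_bot, LinearMap.ker_eq_bot']
    rintro ⟨A, e⟩ h
    rw [sliceMap_apply] at h
    have h1 : (e : W) = 0 := by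
      refine (Submodule.mem_bot ℂ).1 (hC.inf_eq_bot ▸ ⟨?_, e.2⟩ : (e : W) ∈ (⊥ : Submodule ℂ _))
      rw [eq_neg_of_add_eq_zero_right h]
      exact neg_mem (apply_mem_multiples B _ f)
    have h2 : (A : M) = 0 := hinj A A.2 (by simpa [h1] using h)
    exact Prod.ext (Subtype.ext h2) (Subtype.ext h1)
  · intro x
    obtain ⟨y, hy, e, he, rfl⟩ := Submodule.mem_sup.1 (hC.sup_eq_top ▸ Submodule.mem_top : x ∈ _ ⊔ C)
    obtain ⟨A, hA, rfl⟩ := hrange y hy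
    exact ⟨(⟨A, hA⟩, ⟨e, he⟩), rfl⟩

/-- If the slice is transversal for `f`, then the products with members of `G` exhaust the
multiples. -/
theorem slice_spec [FiniteDimensional ℂ M] [FiniteDimensional ℂ W] {G : Submodule ℂ M}
    {C : Submodule ℂ W} {f : V} (hb : Function.Injective (sliceMap B G C f))
    (hG : Module.finrank ℂ G = Module.finrank ℂ (multiples B f)) :
    (∀ x ∈ multiples B f, ∃ A : G, B A f = x) ∧ ∀ x ∈ multiples B f, x ∈ C → x = 0 := by
  let Φ : G →ₗ[ℂ] multiples B f :=
    ((B.flip f).comp G.subtype).codRestrict _ fun A => apply_mem_multiples B A f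
  have hΦ : Function.Injective Φ := by
    intro A A' h
    have h1 := congrArg Subtype.val h
    have h2 : sliceMap B G C f (A, 0) = sliceMap B G C f (A', 0) := by
      rw [sliceMap_apply, sliceMap_apply]
      exact congrArg (· + (0 : W)) h1
    exact (Prod.ext_iff.1 (hb h2)).1
  have hs : ∀ x ∈ multiples B f, ∃ A : G, B A f = x := by
    intro x hx
    obtain ⟨A, hA⟩ := (LinearMap.injective_iff_surjective_of_finrank_eq_finrank hG).1 hΦ ⟨x, hx⟩
    exact ⟨A, congrArg Subtype.val hA⟩
  refine ⟨hs, fun x hx hxC => ?_⟩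
  obtain ⟨A, hA⟩ := hs x hx
  have h2 : sliceMap B G C f (A, 0) = sliceMap B G C f (0, ⟨x, hxC⟩) := by
    rw [sliceMap_apply, sliceMap_apply, hA]
    simp
  exact (congrArg Subtype.val (Prod.ext_iff.1 (hb h2)).2).symm

end Slices

/-! ### Dimension of a space of orbits -/

section DimensionOfOrbitSpaces

variable {M V I Z : Type} [AddCommGroup M] [Module ℂ M] [AddCommGroup V] [Module ℂ V]
  [FiniteDimensional ℂ M] [FiniteDimensional ℂ V] [TopologicalSpace Z]

/-- The dimension of a space of orbits whose classes are given by `J : V → I`. -/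
theorem topologicalKrullDim_orbitSpace {B : M →ₗ[ℂ] V →ₗ[ℂ] V} {P : V → Prop} {J : V → I}
    (hP : ZOpen {f | P f})
    (hJ : ∀ f f', P f → P f' → (J f = J f' ↔ f' ∈ multiples B f))
    (hrk : ∀ f f', P f → P f' →
      Module.finrank ℂ (multiples B f) = Module.finrank ℂ (multiples B f'))
    {JZ : Z → I} (hZ : Function.Injective JZ) (hPZ : ∀ z, ∃ f, P f ∧ J f = JZ z)
    (hZP : ∀ f, P f → ∃ z, J f = JZ z) (hPJ : ∀ f z, J f = JZ z → P f)
    (hopen : ∀ O, ZOpen O → IsOpen {z | ∃ f, J f = JZ z ∧ f ∈ O})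
    (hpre : ∀ U : Set Z, IsOpen U → ∃ O : Set V, ZOpen O ∧
      ∀ f z, J f = JZ z → (f ∈ O ↔ z ∈ U)) {f₁ : V} (hf₁ : P f₁) :
    topologicalKrullDim Z =
      ((Module.finrank ℂ V - Module.finrank ℂ (multiples B f₁) : ℕ) : WithBot ℕ∞) := by
  have : Nonempty Z := ⟨(hZP f₁ hf₁).choose⟩
  refine topologicalKrullDim_eq_of_open_cover _ fun u₀ => ?_
  obtain ⟨f₀, hf₀, hu₀⟩ := hPZ u₀
  obtain ⟨G, C, hbij₀, hG, hC⟩ := exists_slice B f₀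
  have hG' : ∀ f, P f → Module.finrank ℂ G = Module.finrank ℂ (multiples B f) := fun f hf =>
    hG.trans (hrk f₀ f hf₀ hf)
  have hself : ∀ f, P f → f ∈ multiples B f := fun f hf => (hJ f f hf hf).1 rfl
  have hsh : IsPolyMap fun e : C => f₀ + e := (isPolyMap_const f₀).add C.subtype.isPolyMap
  let D : Set C := {e | P (f₀ + e) ∧ Function.Bijective (sliceMap B G C (f₀ + e))}
  have hD : ZOpen D := (hP.preimage hsh).inter
    ((zopen_bijective (isPolyMap_sliceMap B G C)).preimage hsh)
  have hZP' : ∀ e : C, ∃ z, P (f₀ + e) → J (f₀ + e) = JZ z := fun e => by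
    by_cases h : P (f₀ + e)
    · obtain ⟨z, hz⟩ := hZP _ h
      exact ⟨z, fun _ => hz⟩
    · exact ⟨u₀, fun h' => absurd h' h⟩
  choose ι hι' using hZP'
  have hι : ∀ e ∈ D, J (f₀ + e) = JZ (ι e) := fun e he => hι' e he.1
  have h0 : (0 : C) ∈ D := by
    simp only [D, Set.mem_ofPred_eq, ZeroMemClass.coe_zero, add_zero]
    exact ⟨hf₀, hbij₀⟩
  have hinj : Set.InjOn ι D := by
    intro e he e' he' hee'
    have h1 : J (f₀ + e) = J (f₀ + e') := by rw [hι e he, hι e' he', hee']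
    -- Two points of the slice in one orbit differ by a multiple that lies in `C`, which is zero by
    -- transversality.
    have h2 := (slice_spec B he.2.1 (hG' _ he.1)).2 ((e : V) - e') (by
      have h3 := sub_mem (hself _ he.1) ((hJ _ _ he.1 he'.1).1 h1)
      rwa [add_sub_add_left_eq_sub] at h3) (sub_mem e.2 e'.2)
    exact Subtype.ext (sub_eq_zero.1 h2)
  have hop : ∀ O, ZOpen O → IsOpen (ι '' (D ∩ O)) := by
    intro O hO
    -- The chart is inverted by solving `A f + x = f₀` for `(A, x)`: then `f₀ - x` is the point of
    -- the slice in the orbit of `f`.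
    have h1 : ZOpen {f : V | Function.Bijective (sliceMap B G C f) ∧
        ∃ x ∈ {x : G × C | -x.2 ∈ D ∩ O}, sliceMap B G C f x = f₀} :=
      zopen_solution (isPolyMap_sliceMap B G C) (isPolyMap_const f₀)
        ((hD.inter hO).preimage (LinearMap.isPolyMap (-(LinearMap.snd ℂ G C))))
    convert hopen _ h1 using 1
    ext u
    constructor
    · rintro ⟨e, ⟨heD, heO⟩, rfl⟩
      refine ⟨f₀ + e, hι e heD, heD.2, ?_⟩
      obtain ⟨A, hA⟩ := (slice_spec B heD.2.1 (hG' _ heD.1)).1 _ (hself _ heD.1)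
      refine ⟨(A, -e), ?_, ?_⟩
      · simp only [Set.mem_ofPred_eq, neg_neg]
        exact ⟨heD, heO⟩
      · rw [sliceMap_apply, hA]
        simp
    · rintro ⟨f, hf, hb, ⟨A, e⟩, ⟨heD, heO⟩, hx⟩
      refine ⟨-e, ⟨heD, heO⟩, hZ ?_⟩
      rw [← hι _ heD, ← hf]
      refine ((hJ _ _ (hPJ _ _ hf) heD.1).2 ⟨A, ?_⟩).symm
      rw [← hx, sliceMap_apply]
      simp
  refine ⟨ι '' D, ?_, ⟨0, h0, ?_⟩, ?_⟩
  · simpa using hop _ zopen_univ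
  · refine hZ ?_
    rw [← hι 0 h0, ← hu₀]
    simp
  · rw [topologicalKrullDim_image_of_chart hD ⟨0, h0⟩ hinj ?_ hop]
    · congr 2
      have h1 := Submodule.finrank_add_eq_of_isCompl hC
      rw [hrk _ _ hf₀ hf₁] at h1
      omega
    · intro U hU
      obtain ⟨O, hO, h⟩ := hpre U hU
      convert hD.inter (hO.preimage hsh) using 1
      ext e
      refine and_congr_right fun he => ?_
      exact (h _ _ (hι e he)).symm

end DimensionOfOrbitSpaces

end

noncomputable section

/-! ### Dimension of a space of nested pairs of orbits -/

section DimensionOfIncidenceSpaces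

variable {M N K V W I I' Z : Type} [AddCommGroup M] [Module ℂ M] [AddCommGroup N] [Module ℂ N]
  [AddCommGroup K] [Module ℂ K] [AddCommGroup V] [Module ℂ V] [AddCommGroup W] [Module ℂ W]

/-- The bilinear map `((t, A), (k, f)) ↦ t k + A f`. -/
def sumBilin (T : N →ₗ[ℂ] V →ₗ[ℂ] W) (A : K →ₗ[ℂ] W →ₗ[ℂ] W) : N × K →ₗ[ℂ] V × W →ₗ[ℂ] W :=
  T.compl₁₂ (LinearMap.fst ℂ N K) (LinearMap.fst ℂ V W) +
    A.compl₁₂ (LinearMap.snd ℂ N K) (LinearMap.snd ℂ V W)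

theorem sumBilin_apply (T : N →ₗ[ℂ] V →ₗ[ℂ] W) (A : K →ₗ[ℂ] W →ₗ[ℂ] W) (x : N × K) (y : V × W) :
    sumBilin T A x y = T x.1 y.1 + A x.2 y.2 := rfl

theorem multiples_sumBilin {T : N →ₗ[ℂ] V →ₗ[ℂ] W} {A : K →ₗ[ℂ] W →ₗ[ℂ] W} {k : V} {f : W}
    (h : multiples A f ≤ multiples T k) : multiples (sumBilin T A) (k, f) = multiples T k := by
  refine le_antisymm ?_ ?_
  · rintro _ ⟨⟨t, B⟩, rfl⟩
    exact add_mem (apply_mem_multiples T t k) (h (apply_mem_multiples A B f))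
  · rintro _ ⟨t, rfl⟩
    exact ⟨(t, 0), by simp [sumBilin_apply]⟩

theorem finrank_submodule_prod [FiniteDimensional ℂ N] [FiniteDimensional ℂ K]
    (S : Submodule ℂ N) (G : Submodule ℂ K) :
    Module.finrank ℂ (S.prod G) = Module.finrank ℂ S + Module.finrank ℂ G := by
  rw [← Module.finrank_prod]
  exact LinearEquiv.finrank_eq
    { toFun := fun x => (⟨x.1.1, x.2.1⟩, ⟨x.1.2, x.2.2⟩)
      invFun := fun y => ⟨(y.1, y.2), y.1.2, y.2.2⟩
      map_add' := fun _ _ => rfl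
      map_smul' := fun _ _ => rfl
      left_inv := fun _ => rfl
      right_inv := fun _ => rfl }

/-- `S` is a complement of the `t` for which `t k` is already a multiple of `f`, so it parametrizes
the multiples of `k` modulo those of `f`. `G` accounts for the multiples of `f`, and `C` for
everything that is not a multiple of `k`. -/
theorem exists_incidence_slice [FiniteDimensional ℂ N] [FiniteDimensional ℂ K]
    [FiniteDimensional ℂ W] {T : N →ₗ[ℂ] V →ₗ[ℂ] W} {A : K →ₗ[ℂ] W →ₗ[ℂ] W} {k : V} {f : W}
    (h : multiples A f ≤ multiples T k) :
    ∃ (S : Submodule ℂ N) (G : Submodule ℂ K) (C : Submodule ℂ W),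
      Function.Bijective (sliceMap (sumBilin T A) (S.prod G) C (k, f)) ∧
      Module.finrank ℂ G = Module.finrank ℂ (multiples A f) ∧
      Module.finrank ℂ S + Module.finrank ℂ G = Module.finrank ℂ (multiples T k) := by
  obtain ⟨G, hGi, hGs, hG⟩ := exists_isCompl_ker A f
  obtain ⟨S, hS⟩ := ((multiples A f).comap (T.flip k)).exists_isCompl
  obtain ⟨C, hC⟩ := (multiples T k).exists_isCompl
  have hbij : Function.Bijective (sliceMap (sumBilin T A) (S.prod G) C (k, f)) := by
    constructor
    · rw [← LinearMap.ker_eq_bot, LinearMap.ker_eq_bot']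
      rintro ⟨⟨⟨t, B⟩, ht, hB⟩, c⟩ hx
      rw [sliceMap_apply, sumBilin_apply] at hx
      dsimp only at hx
      have h1 : (c : W) = 0 := by
        refine (Submodule.mem_bot ℂ).1 (hC.inf_eq_bot ▸ ⟨?_, c.2⟩ : (c : W) ∈ (⊥ : Submodule ℂ _))
        rw [eq_neg_of_add_eq_zero_right hx]
        exact neg_mem (add_mem (apply_mem_multiples T _ k) (h (apply_mem_multiples A _ f)))
      rw [h1, add_zero] at hx
      have h2 : t = 0 := by
        refine (Submodule.mem_bot ℂ).1 (hS.inf_eq_bot ▸ ⟨?_, ht⟩ : t ∈ (⊥ : Submodule ℂ _))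
        change T t k ∈ multiples A f
        rw [eq_neg_of_add_eq_zero_left hx]
        exact neg_mem (apply_mem_multiples A _ f)
      rw [h2, map_zero, LinearMap.zero_apply, zero_add] at hx
      have h3 := hGi B hB hx
      subst h2 h3
      exact Prod.ext rfl (Subtype.ext h1)
    · intro x
      obtain ⟨y, hy, c, hc, rfl⟩ :=
        Submodule.mem_sup.1 (hC.sup_eq_top ▸ Submodule.mem_top : x ∈ _ ⊔ C)
      obtain ⟨t, rfl⟩ := hy
      obtain ⟨z, hz, t', ht', rfl⟩ :=
        Submodule.mem_sup.1 (hS.sup_eq_top ▸ Submodule.mem_top : t ∈ _ ⊔ S)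
      obtain ⟨B, hB, hBz⟩ := hGs _ (show T z k ∈ multiples A f from hz)
      refine ⟨(⟨(t', B), ht', hB⟩, ⟨c, hc⟩), ?_⟩
      rw [sliceMap_apply, sumBilin_apply]
      simp [hBz, add_comm]
  refine ⟨S, G, C, hbij, hG, ?_⟩
  have h1 := (LinearEquiv.ofBijective _ hbij).finrank_eq
  have h2 := Submodule.finrank_add_eq_of_isCompl hC
  rw [Module.finrank_prod, finrank_submodule_prod] at h1
  omega

/-- The dimension of a space of pairs of orbits, the second contained in the first. -/
theorem topologicalKrullDim_incidenceSpace [FiniteDimensional ℂ M] [FiniteDimensional ℂ N]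
    [FiniteDimensional ℂ K] [FiniteDimensional ℂ V] [FiniteDimensional ℂ W] [TopologicalSpace Z]
    {B : M →ₗ[ℂ] V →ₗ[ℂ] V} {A : K →ₗ[ℂ] W →ₗ[ℂ] W} {T : N →ₗ[ℂ] V →ₗ[ℂ] W}
    {P : V → Prop} {P' : W → Prop} {J : V → I} {J' : W → I'}
    (hP : ZOpen {k | P k}) (hP' : ZOpen {f | P' f})
    (hJ : ∀ k k', P k → P k' → (J k = J k' ↔ k' ∈ multiples B k))
    (hJ' : ∀ f f', P' f → P' f' → (J' f = J' f' ↔ f' ∈ multiples A f))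
    (hrk : ∀ k k', P k → P k' →
      Module.finrank ℂ (multiples B k) = Module.finrank ℂ (multiples B k'))
    (hrkA : ∀ f f', P' f → P' f' →
      Module.finrank ℂ (multiples A f) = Module.finrank ℂ (multiples A f'))
    (hrkT : ∀ k k', P k → P k' →
      Module.finrank ℂ (multiples T k) = Module.finrank ℂ (multiples T k'))
    (hsub : ∀ k f, f ∈ multiples T k → multiples A f ≤ multiples T k)
    (hJT : ∀ k k', J k = J k' → multiples T k = multiples T k')
    {JZ : Z → I × I'} (hZ : Function.Injective JZ)
    (hPZ : ∀ z, ∃ k f, P k ∧ P' f ∧ (J k, J' f) = JZ z)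
    (hZP : ∀ k f, P k → P' f → f ∈ multiples T k → ∃ z, (J k, J' f) = JZ z)
    (hPJ : ∀ k f z, (J k, J' f) = JZ z → P k ∧ P' f ∧ f ∈ multiples T k)
    (hopen : ∀ O, ZOpen O → IsOpen {z | ∃ k f, (J k, J' f) = JZ z ∧ (k, f) ∈ O})
    (hpre : ∀ U : Set Z, IsOpen U → ∃ O : Set (V × W), ZOpen O ∧
      ∀ k f z, (J k, J' f) = JZ z → ((k, f) ∈ O ↔ z ∈ U))
    {k₁ : V} {f₁ : W} (hk₁ : P k₁) (hf₁ : P' f₁) (hkf₁ : f₁ ∈ multiples T k₁) :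
    topologicalKrullDim Z =
      ((Module.finrank ℂ V - Module.finrank ℂ (multiples B k₁) +
        (Module.finrank ℂ (multiples T k₁) - Module.finrank ℂ (multiples A f₁)) : ℕ) :
        WithBot ℕ∞) := by
  have : Nonempty Z := ⟨(hZP k₁ f₁ hk₁ hf₁ hkf₁).choose⟩
  refine topologicalKrullDim_eq_of_open_cover _ fun u₀ => ?_
  obtain ⟨k₀, f₀, hk₀, hf₀, hu₀⟩ := hPZ u₀
  obtain ⟨h₀, hkf₀⟩ := (hPJ _ _ _ hu₀).2.2
  obtain ⟨G, C, hbij₀, hG, hC⟩ := exists_slice B k₀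
  obtain ⟨S, G', C', hbij₀', hG', hSG⟩ := exists_incidence_slice (hsub k₀ f₀ ⟨h₀, hkf₀⟩)
  replace hkf₀ : T h₀ k₀ = f₀ := hkf₀
  have hdG : ∀ k, P k → Module.finrank ℂ G = Module.finrank ℂ (multiples B k) := fun k hk =>
    hG.trans (hrk k₀ k hk₀ hk)
  have hdG' : ∀ f, P' f → Module.finrank ℂ G' = Module.finrank ℂ (multiples A f) := fun f hf =>
    hG'.trans (hrkA f₀ f hf₀ hf)
  have hdS : ∀ k f, P k → f ∈ multiples T k →
      Module.finrank ℂ (S.prod G') = Module.finrank ℂ (multiples (sumBilin T A) (k, f)) :=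
    fun k f hk hf => by
      rw [multiples_sumBilin (hsub k f hf), finrank_submodule_prod, hSG, hrkT k₀ k hk₀ hk]
  have hself : ∀ k, P k → k ∈ multiples B k := fun k hk => (hJ k k hk hk).1 rfl
  have hself' : ∀ f, P' f → f ∈ multiples A f := fun f hf => (hJ' f f hf hf).1 rfl
  -- The chart sends `(e, t)` to the pair of `k₀ + e` and `(h₀ + t)(k₀ + e)`: `e` is transversal to
  -- the orbit of `k₀`, and `t` to the changes of `h₀` that alter `f₀` only by multiples of itself.
  let κ : C × S → V := fun x => k₀ + x.1
  let ψ : C × S → W := fun x => T (h₀ + x.2) (κ x)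
  have hκ : IsPolyMap κ := (isPolyMap_const k₀).add (isPolyMap_id.fst.linear C.subtype)
  have hψ : IsPolyMap ψ :=
    IsPolyMap.bilin T ((isPolyMap_const h₀).add (isPolyMap_id.snd.linear S.subtype)) hκ
  have hψT : ∀ x, ψ x ∈ multiples T (κ x) := fun x => apply_mem_multiples T _ _
  have hs1 : IsPolyMap (sliceMap B G C) := isPolyMap_sliceMap B G C
  have hs2 : IsPolyMap (sliceMap (sumBilin T A) (S.prod G') C') :=
    isPolyMap_sliceMap (sumBilin T A) (S.prod G') C'
  let D : Set (C × S) := {x | (P (κ x) ∧ P' (ψ x)) ∧ Function.Bijective (sliceMap B G C (κ x)) ∧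
    Function.Bijective (sliceMap (sumBilin T A) (S.prod G') C' (κ x, ψ x))}
  have hD : ZOpen D := ((hP.preimage hκ).inter (hP'.preimage hψ)).inter
    (((zopen_bijective hs1).preimage hκ).inter ((zopen_bijective hs2).preimage (hκ.prodMk hψ)))
  have hZP' : ∀ x : C × S, ∃ z, P (κ x) → P' (ψ x) → (J (κ x), J' (ψ x)) = JZ z := fun x => by
    by_cases h : P (κ x) ∧ P' (ψ x)
    · obtain ⟨z, hz⟩ := hZP _ _ h.1 h.2 (hψT x)
      exact ⟨z, fun _ _ => hz⟩
    · exact ⟨u₀, fun h1 h2 => absurd ⟨h1, h2⟩ h⟩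
  choose ι hι' using hZP'
  have hι : ∀ x ∈ D, (J (κ x), J' (ψ x)) = JZ (ι x) := fun x hx => hι' x hx.1.1 hx.1.2
  have hκ0 : κ 0 = k₀ := by simp [κ]
  have hψ0 : ψ 0 = f₀ := by
    simp only [ψ, hκ0, Prod.snd_zero, ZeroMemClass.coe_zero, add_zero]
    exact hkf₀
  have h0 : (0 : C × S) ∈ D := by
    simp only [D, Set.mem_ofPred_eq, hκ0, hψ0]
    exact ⟨⟨hk₀, hf₀⟩, hbij₀, hbij₀'⟩
  -- Restricted to `0 × G'`, the incidence slice is a slice for `f` with trivial complement, so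
  -- products with `G'` exhaust the multiples of `f`.
  have hGψ : ∀ k f, P' f →
      Function.Injective (sliceMap (sumBilin T A) (S.prod G') C' (k, f)) →
      ∀ x ∈ multiples A f, ∃ Y : G', A Y f = x := by
    intro k f hf hinj
    refine (slice_spec A (C := ⊥) ?_ (hdG' f hf)).1
    rw [← LinearMap.ker_eq_bot, LinearMap.ker_eq_bot']
    rintro ⟨Y, z⟩ hYz
    have hz : z = 0 := Subsingleton.elim _ _
    subst hz
    have h2 : sliceMap (sumBilin T A) (S.prod G') C' (k, f) (⟨(0, (Y : K)), S.zero_mem, Y.2⟩, 0) =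
        sliceMap (sumBilin T A) (S.prod G') C' (k, f) 0 := by
      rw [map_zero, ← hYz]
      simp [sliceMap_apply, sumBilin_apply]
    have h3 := congrArg (fun x => x.1.1.2) (hinj h2)
    exact Prod.ext (Subtype.ext h3) rfl
  have hinj : Set.InjOn ι D := by
    intro x hx y hy hxy
    have h1 : (J (κ x), J' (ψ x)) = (J (κ y), J' (ψ y)) := by rw [hι x hx, hι y hy, hxy]
    have h2 := (slice_spec B hx.2.1.1 (hdG _ hx.1.1)).2 ((x.1 : V) - y.1) (by
      have h3 := sub_mem (hself _ hx.1.1) ((hJ _ _ hx.1.1 hy.1.1).1 (Prod.ext_iff.1 h1).1)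
      rwa [add_sub_add_left_eq_sub] at h3) (sub_mem x.1.2 y.1.2)
    have h4 : x.1 = y.1 := Subtype.ext (sub_eq_zero.1 h2)
    have hκxy : κ x = κ y := by simp only [κ, h4]
    have h5 := sub_mem (hself' _ hx.1.2) ((hJ' _ _ hx.1.2 hy.1.2).1 (Prod.ext_iff.1 h1).2)
    obtain ⟨Y, hY⟩ := hGψ (κ x) (ψ x) hx.1.2 hx.2.2.1 _ h5
    have h6 : sliceMap (sumBilin T A) (S.prod G') C' (κ x, ψ x)
        (⟨((x.2 : N) - y.2, -(Y : K)), sub_mem x.2.2 y.2.2, neg_mem Y.2⟩, 0) =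
        sliceMap (sumBilin T A) (S.prod G') C' (κ x, ψ x) 0 := by
      rw [map_zero, sliceMap_apply, sumBilin_apply]
      simp only [map_neg, LinearMap.neg_apply, hY, ZeroMemClass.coe_zero, add_zero]
      simp only [ψ, ← hκxy, map_add, map_sub, LinearMap.add_apply, LinearMap.sub_apply]
      abel
    have h7 : (x.2 : N) - y.2 = 0 := congrArg (fun x => x.1.1.1) (hx.2.2.1 h6)
    exact Prod.ext h4 (Subtype.ext (sub_eq_zero.1 h7))
  have hop : ∀ O, ZOpen O → IsOpen (ι '' (D ∩ O)) := by
    intro O hO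
    -- Inverting the chart takes two linear systems in succession: `Y k + e = k₀` moves `k` to `k' =
    -- k₀ - e` on the slice, and then `t k' + Y' f + c = h₀ k'` yields the second coordinate `-t`.
    have hg : IsPolyMap fun y : (V × W) × (G × C) => (k₀ - y.2.2, y.1.2) :=
      ((isPolyMap_const k₀).sub (isPolyMap_id.snd.snd.linear C.subtype)).prodMk isPolyMap_id.fst.snd
    have h1 : ZOpen {y : (V × W) × (G × C) |
        Function.Bijective (sliceMap (sumBilin T A) (S.prod G') C' (k₀ - y.2.2, y.1.2)) ∧
        ∃ x : (S.prod G') × C', (y, x) ∈ {q : ((V × W) × (G × C)) × ((S.prod G') × C') |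
            (-q.1.2.2, -(⟨q.2.1.1.1, q.2.1.2.1⟩ : S)) ∈ D ∩ O} ∧
          sliceMap (sumBilin T A) (S.prod G') C' (k₀ - y.2.2, y.1.2) x = T h₀ (k₀ - y.2.2)} := by
      refine zopen_solution_prod (L := fun y : (V × W) × (G × C) =>
          sliceMap (sumBilin T A) (S.prod G') C' (k₀ - y.2.2, y.1.2)) (hs2.comp hg)
        (hg.fst.linear (T h₀)) ((hD.inter hO).preimage (IsPolyMap.prodMk ?_ ?_))
      · exact isPolyMap_id.fst.snd.snd.linear (-LinearMap.id)
      · let pr : (S.prod G') →ₗ[ℂ] S :=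
          ((LinearMap.fst ℂ N K).comp (S.prod G').subtype).codRestrict S fun x => x.2.1
        exact isPolyMap_id.snd.fst.linear (-pr)
    have h2 := zopen_solution_prod (L := fun y : V × W => sliceMap B G C y.1)
      (hs1.comp isPolyMap_id.fst) (isPolyMap_const k₀) h1
    convert hopen _ h2 using 1
    ext u
    constructor
    · rintro ⟨x, ⟨hxD, hxO⟩, rfl⟩
      refine ⟨κ x, ψ x, hι x hxD, hxD.2.1, ?_⟩
      obtain ⟨Y, hY⟩ := (slice_spec B hxD.2.1.1 (hdG _ hxD.1.1)).1 _ (hself _ hxD.1.1)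
      obtain ⟨Y', hY'⟩ := hGψ (κ x) (ψ x) hxD.1.2 hxD.2.2.1 _ (hself' _ hxD.1.2)
      have hk : k₀ - ((-x.1 : C) : V) = κ x := by simp [κ]
      refine ⟨(Y, -x.1), ⟨?_, (⟨((-x.2 : S), Y'), (-x.2).2, Y'.2⟩, 0), ?_, ?_⟩, ?_⟩
      · dsimp only
        rw [hk]
        exact hxD.2.2
      · have e1 : ((- -x.1 : C), -(⟨((-x.2 : S) : N), (-x.2).2⟩ : S)) = x :=
          Prod.ext (neg_neg _) (neg_neg _)
        change ((- -x.1 : C), -(⟨((-x.2 : S) : N), (-x.2).2⟩ : S)) ∈ D ∩ O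
        rw [e1]
        exact ⟨hxD, hxO⟩
      · dsimp only
        rw [hk, sliceMap_apply, sumBilin_apply]
        simp only [hY', ZeroMemClass.coe_zero, add_zero]
        simp only [ψ, map_add, map_neg, LinearMap.add_apply, LinearMap.neg_apply, NegMemClass.coe_neg]
        abel
      · dsimp only
        rw [sliceMap_apply, hY]
        simp [κ]
    · rintro ⟨k, f, hkf, hb, ⟨Y, e⟩, ⟨hb', ⟨⟨⟨t, Y'⟩, ht, hY'⟩, c⟩, ⟨hxD, hxO⟩, hx'⟩, hx⟩
      dsimp only at hb' hxD hxO hx' hx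
      have hk : κ (-e, -(⟨t, ht⟩ : S)) = k₀ - e := by simp [κ, sub_eq_add_neg]
      refine ⟨_, ⟨hxD, hxO⟩, hZ ?_⟩
      rw [← hι _ hxD, ← hkf]
      obtain ⟨hPk, hPf, hf⟩ := hPJ _ _ _ hkf
      have hJk : J k = J (κ (-e, -(⟨t, ht⟩ : S))) := by
        refine (hJ _ _ hPk hxD.1.1).2 ⟨Y, ?_⟩
        rw [hk, ← hx, sliceMap_apply]
        simp
      have hT := hJT _ _ hJk
      have hψf : ψ (-e, -(⟨t, ht⟩ : S)) = A Y' f + c := by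
        have h3 : ψ (-e, -(⟨t, ht⟩ : S)) = T h₀ (k₀ - e) - T t (k₀ - e) := by
          simp only [ψ, hk]
          simp [sub_eq_add_neg]
        rw [h3, ← hx', sliceMap_apply, sumBilin_apply]
        simp only
        abel
      -- For an incident pair the transversal term `c` is a multiple of `k'`, hence zero.
      have hc : (c : W) ∈ multiples T (κ (-e, -(⟨t, ht⟩ : S))) := by
        have h4 : (c : W) = ψ (-e, -(⟨t, ht⟩ : S)) - A Y' f := by rw [hψf]; abel
        rw [h4]
        refine sub_mem (hψT _) ?_
        rw [← hT]
        exact hsub k f hf (apply_mem_multiples A _ f)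
      have hf' : f ∈ multiples T (κ (-e, -(⟨t, ht⟩ : S))) := hT ▸ hf
      have hc0 := (slice_spec (sumBilin T A) (by rw [← hk] at hb'; exact hb'.1)
        (hdS _ f hxD.1.1 hf')).2 c (by
          rw [multiples_sumBilin (hsub _ f hf')]
          exact hc) c.2
      refine Prod.ext hJk.symm ((hJ' _ _ hPf hxD.1.2).2 ⟨Y', ?_⟩).symm
      rw [hψf, hc0, add_zero]
      rfl
  refine ⟨ι '' D, ?_, ⟨0, h0, ?_⟩, ?_⟩
  · simpa using hop _ zopen_univ
  · refine hZ ?_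
    rw [← hι 0 h0, ← hu₀, hκ0, hψ0]
  · rw [topologicalKrullDim_image_of_chart hD ⟨0, h0⟩ hinj ?_ hop]
    · congr 2
      have h1 := Submodule.finrank_add_eq_of_isCompl hC
      rw [hrk _ _ hk₀ hk₁] at h1
      rw [Module.finrank_prod, ← hrkT _ _ hk₀ hk₁, ← hrkA _ _ hf₀ hf₁]
      omega
    · intro U hU
      obtain ⟨O, hO, h⟩ := hpre U hU
      convert hD.inter (hO.preimage (hκ.prodMk hψ)) using 1
      ext x
      refine and_congr_right fun hx => ?_
      exact (h _ _ _ (hι x hx)).symm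

end DimensionOfIncidenceSpaces

end

noncomputable section

open MvPolynomial

attribute [local instance] MvPolynomial.gradedAlgebra

/-! ### The dimensions of `H_c` and `F_{b,a}` -/

section DimensionFormulas

variable {n t s r : ℕ} {c : Fin t → ℕ} {b : Fin s → ℕ} {a : Fin r → ℕ}

theorem multiples_mulForms (a : Fin r → ℕ) (f : Forms n c) :
    multiples (V := Forms n c) (W := Forms n a) (mulForms a c) f = tupleIdeal (formIdeal f) a :=
  range_mulForms a f

theorem formIdeal_eq_iff_mem_multiples (hc : ∀ i, 1 ≤ c i) {f f' : Forms n c} (hf : IsCI f)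
    (hf' : IsCI f') : formIdeal f = formIdeal f' ↔
      f' ∈ multiples (V := Forms n c) (W := Forms n c) (mulForms c c) f := by
  rw [multiples_mulForms, ← formIdeal_le_iff]
  exact ⟨fun h => h.ge, fun h => (formIdeal_eq_of_le hc hf' hf h).symm⟩

theorem CIParam.topologicalKrullDim_eq (hc : ∀ i, 1 ≤ c i) (ht : t ≤ n + 1) {f : Forms n c}
    (hf : IsCI f) : topologicalKrullDim (CIParam n c) =
      ((Module.finrank ℂ (Forms n c) - Module.finrank ℂ (tupleIdeal (formIdeal f) c) : ℕ) :
        WithBot ℕ∞) := by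
  have := topologicalKrullDim_orbitSpace (V := Forms n c) (M := FormMatrix n c c)
    (Z := CIParam n c) (B := mulForms c c) (P := fun f => IsCI f) (J := formIdeal)
    (JZ := CIParam.ideal) (zopen_isCI hc ht)
    (fun f f' hf hf' => formIdeal_eq_iff_mem_multiples hc hf hf')
    (fun f f' hf hf' => by
      rw [multiples_mulForms, multiples_mulForms]
      exact finrank_tupleIdeal_eq hc hf hf' c)
    (fun u v h => CIParam.ext h) (fun u => u.exists_forms)
    (fun f hf => ⟨CIParam.ofForms f hf, rfl⟩) (fun f u h => CIParam.isCI h)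
    (fun O hO => CIParam.isOpen_of_zopen hc ht hO) (fun U hU => CIParam.exists_zopen hU) hf
  rw [multiples_mulForms] at this
  exact this

theorem FlagVariety.topologicalKrullDim_eq (hb : ∀ i, 1 ≤ b i) (hs : s ≤ n + 1) (ha : ∀ i, 1 ≤ a i)
    (hr : r ≤ n + 1) {k : Forms n b} {f : Forms n a} (hk : IsCI k) (hf : IsCI f)
    (hkf : formIdeal f ≤ formIdeal k) : topologicalKrullDim (FlagVariety n b a) =
      ((Module.finrank ℂ (Forms n b) - Module.finrank ℂ (tupleIdeal (formIdeal k) b) +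
        (Module.finrank ℂ (tupleIdeal (formIdeal k) a) -
          Module.finrank ℂ (tupleIdeal (formIdeal f) a)) : ℕ) : WithBot ℕ∞) := by
  have hmem : ∀ {k : Forms n b} {f : Forms n a},
      f ∈ multiples (V := Forms n b) (W := Forms n a) (mulForms a b) k ↔
        formIdeal f ≤ formIdeal k := fun {k f} => by
    rw [multiples_mulForms, formIdeal_le_iff]
  have := topologicalKrullDim_incidenceSpace (V := Forms n b) (M := FormMatrix n b b)
    (W := Forms n a) (K := FormMatrix n a a) (N := FormMatrix n a b)
    (Z := FlagVariety n b a) (B := mulForms b b) (A := mulForms a a) (T := mulForms a b)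
    (P := fun f => IsCI f) (P' := fun f => IsCI f) (J := formIdeal) (J' := formIdeal)
    (JZ := fun P => (P.Z.ideal, P.X.ideal)) (zopen_isCI hb hs) (zopen_isCI ha hr)
    (fun f f' hf hf' => formIdeal_eq_iff_mem_multiples hb hf hf')
    (fun f f' hf hf' => formIdeal_eq_iff_mem_multiples ha hf hf')
    (fun f f' hf hf' => by
      rw [multiples_mulForms, multiples_mulForms]
      exact finrank_tupleIdeal_eq hb hf hf' b)
    (fun f f' hf hf' => by
      rw [multiples_mulForms, multiples_mulForms]
      exact finrank_tupleIdeal_eq ha hf hf' a)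
    (fun f f' hf hf' => by
      rw [multiples_mulForms, multiples_mulForms]
      exact finrank_tupleIdeal_eq hb hf hf' a)
    (fun k f h => by
      rw [multiples_mulForms, multiples_mulForms]
      exact tupleIdeal_mono (hmem.1 h) a)
    (fun k k' h => by
      rw [multiples_mulForms, multiples_mulForms, h])
    (fun P Q h => FlagVariety.ext (CIParam.ext (Prod.ext_iff.1 h).1)
      (CIParam.ext (Prod.ext_iff.1 h).2))
    (fun P => by
      obtain ⟨k, hk, e⟩ := P.Z.exists_forms
      obtain ⟨f, hf, e'⟩ := P.X.exists_forms
      exact ⟨k, f, hk, hf, Prod.ext e e'⟩)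
    (fun k f hk hf h => ⟨⟨CIParam.ofForms k hk, CIParam.ofForms f hf, hmem.1 h⟩, rfl⟩)
    (fun k f P h => ⟨CIParam.isCI (Prod.ext_iff.1 h).1, CIParam.isCI (Prod.ext_iff.1 h).2, hmem.2 (by
      have h1 : formIdeal k = P.Z.ideal := (Prod.ext_iff.1 h).1
      have h2 : formIdeal f = P.X.ideal := (Prod.ext_iff.1 h).2
      rw [h1, h2]
      exact P.sub)⟩)
    (fun O hO => by
      convert FlagVariety.isOpen_of_zopen hb hs ha hr hO using 1
      ext P
      simp only [Set.mem_ofPred_eq, Prod.mk.injEq, and_assoc])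
    (fun U hU => by
      obtain ⟨O, hO, h⟩ := FlagVariety.exists_zopen hU
      exact ⟨O, hO, fun k f P hP => h k f P (Prod.ext_iff.1 hP).1 (Prod.ext_iff.1 hP).2⟩)
    hk hf (hmem.2 hkf)
  rw [multiples_mulForms, multiples_mulForms, multiples_mulForms] at this
  exact this

end DimensionFormulas

end

noncomputable section

open MvPolynomial

attribute [local instance] MvPolynomial.gradedAlgebra

/-! ### Tangent spaces in terms of tuples of forms -/

section NormalSections

variable {n t s r : ℕ} {c : Fin t → ℕ}

/-- The map `Σ gᵢ fᵢ ↦ Σ gᵢ Fᵢ`. -/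
theorem exists_hom_of_isRegSeq {f : Forms n c} (hf : IsRegSeq fun i => (f i : CoordRing n))
    (F : Forms n c) : ∃ φ : formIdeal f →ₗ[CoordRing n] CoordRing n ⧸ formIdeal f,
      ∀ (g : Fin t → CoordRing n) (h : ∑ i, g i * (f i : CoordRing n) ∈ formIdeal f),
        φ ⟨_, h⟩ = Ideal.Quotient.mk _ (∑ i, g i * (F i : CoordRing n)) := by
  have hm : ∀ g : Fin t → CoordRing n, ∑ i, g i * (f i : CoordRing n) ∈ formIdeal f := fun g =>
    sum_mem fun i _ => Ideal.mul_mem_left _ _ (mem_formIdeal f i)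
  let Φ : (Fin t → CoordRing n) →ₗ[CoordRing n] formIdeal f :=
    { toFun := fun g => ⟨_, hm g⟩
      map_add' := fun x y => Subtype.ext (by simp [add_mul, Finset.sum_add_distrib])
      map_smul' := fun z x => Subtype.ext (by simp [Finset.mul_sum, mul_assoc]) }
  have hΦ : LinearMap.range Φ = ⊤ := by
    rw [LinearMap.range_eq_top]
    rintro ⟨x, hx⟩
    obtain ⟨g, rfl⟩ := Ideal.mem_span_range_iff_exists_fun.1 hx
    exact ⟨g, rfl⟩
  let Ψ : (Fin t → CoordRing n) →ₗ[CoordRing n] CoordRing n ⧸ formIdeal f :=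
    { toFun := fun g => Ideal.Quotient.mk _ (∑ i, g i * (F i : CoordRing n))
      map_add' := fun x y => by simp [add_mul, Finset.sum_add_distrib]
      map_smul' := fun z x => by
        simp only [Pi.smul_apply, smul_eq_mul, mul_assoc, ← Finset.mul_sum]
        rfl }
  -- The map is well defined because a syzygy of a regular sequence has its entries in `J_f`.
  have hker : LinearMap.ker Φ ≤ LinearMap.ker Ψ := by
    intro g hg
    have h0 : ∑ i, g i * (f i : CoordRing n) = 0 := congrArg Subtype.val hg
    refine Ideal.Quotient.eq_zero_iff_mem.2 (sum_mem fun i _ => ?_)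
    exact Ideal.mul_mem_right _ _ (hf.mem_of_sum_mul_eq_zero h0 i)
  refine ⟨((LinearMap.ker Φ).liftQ Ψ hker).comp
    (Φ.quotKerEquivOfSurjective (LinearMap.range_eq_top.1 hΦ)).symm.toLinearMap, fun g h => ?_⟩
  have h1 : (Φ.quotKerEquivOfSurjective (LinearMap.range_eq_top.1 hΦ)).symm ⟨_, h⟩ =
      Submodule.Quotient.mk g := by
    rw [LinearEquiv.symm_apply_eq]
    rfl
  rw [LinearMap.comp_apply]
  erw [h1]
  rfl

theorem formIdeal_hom_ext {f : Forms n c} {N : Type*} [AddCommGroup N] [Module (CoordRing n) N]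
    {φ ψ : formIdeal f →ₗ[CoordRing n] N}
    (h : ∀ i, φ ⟨f i, mem_formIdeal f i⟩ = ψ ⟨f i, mem_formIdeal f i⟩) : φ = ψ := by
  refine LinearMap.ext fun x => ?_
  obtain ⟨x, hx⟩ := x
  obtain ⟨g, rfl⟩ := Ideal.mem_span_range_iff_exists_fun.1 hx
  have : (⟨∑ i, g i * (f i : CoordRing n), hx⟩ : formIdeal f) =
      ∑ i, g i • (⟨f i, mem_formIdeal f i⟩ : formIdeal f) := Subtype.ext (by simp)
  rw [this, map_sum, map_sum]
  exact Finset.sum_congr rfl fun i _ => by rw [map_smul, map_smul, h i]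

theorem Tangent.ext_toHom {J : Ideal (CoordRing n)} {φ ψ : Tangent J} (h : φ.toHom = ψ.toHom) :
    φ = ψ := Subtype.ext h

theorem Tangent.ext_formIdeal {f : Forms n c} {φ ψ : Tangent (formIdeal f)}
    (h : ∀ i, φ.toHom ⟨f i, mem_formIdeal f i⟩ = ψ.toHom ⟨f i, mem_formIdeal f i⟩) : φ = ψ :=
  Tangent.ext_toHom (formIdeal_hom_ext h)

theorem exists_tangent {f : Forms n c} (hf : IsRegSeq fun i => (f i : CoordRing n))
    (F : Forms n c) : ∃ φ : Tangent (formIdeal f),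
      ∀ i, φ.toHom ⟨f i, mem_formIdeal f i⟩ = Ideal.Quotient.mk _ (F i : CoordRing n) := by
  obtain ⟨φ, hφ⟩ := exists_hom_of_isRegSeq hf F
  refine ⟨⟨φ, fun d p hp => ?_⟩, fun i => ?_⟩
  · obtain ⟨g, hg, e⟩ := exists_homogeneous_coeffs (fun i => (f i).2) hp p.2
    refine ⟨∑ i, g i * (F i : CoordRing n), IsHomogeneous.sum _ _ _ fun i _ =>
      shiftForms_mul (hg i) (F i).2, ?_⟩
    have h2 : p = ⟨∑ i, g i * (f i : CoordRing n), e ▸ p.2⟩ := Subtype.ext e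
    rw [h2]
    exact hφ g _
  · classical
    have h1 : (f i : CoordRing n) = ∑ j, (Pi.single i 1 : Fin t → CoordRing n) j * (f j : CoordRing n) := by
      simp [Pi.single_apply]
    have h2 : (⟨f i, mem_formIdeal f i⟩ : formIdeal f) = ⟨_, h1 ▸ mem_formIdeal f i⟩ := Subtype.ext h1
    change φ _ = _
    rw [h2, hφ]
    simp [Pi.single_apply]

/-- The first-order deformation of `J_f` in the direction of a tuple of forms. -/
def normalSection {f : Forms n c} (hf : IsRegSeq fun i => (f i : CoordRing n)) :
    Forms n c →ₗ[ℂ] Tangent (formIdeal f) where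
  toFun F := (exists_tangent hf F).choose
  map_add' F G := Tangent.ext_formIdeal fun i => by
    rw [map_add, LinearMap.add_apply, (exists_tangent hf _).choose_spec i,
      (exists_tangent hf _).choose_spec i, (exists_tangent hf _).choose_spec i, ← map_add]
    rfl
  map_smul' z F := Tangent.ext_formIdeal fun i => by
    rw [map_smul, LinearMap.smul_apply, (exists_tangent hf _).choose_spec i,
      (exists_tangent hf _).choose_spec i]
    rfl

theorem normalSection_apply {f : Forms n c} (hf : IsRegSeq fun i => (f i : CoordRing n))
    (F : Forms n c) (i : Fin t) :
    (normalSection hf F).toHom ⟨f i, mem_formIdeal f i⟩ =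
      Ideal.Quotient.mk _ (F i : CoordRing n) :=
  (exists_tangent hf F).choose_spec i

theorem normalSection_surjective {f : Forms n c} (hf : IsRegSeq fun i => (f i : CoordRing n)) :
    Function.Surjective (normalSection hf) := by
  intro φ
  choose q hq e using fun i => φ.2 (c i) ⟨f i, mem_formIdeal f i⟩ (f i).2
  refine ⟨fun i => ⟨q i, hq i⟩, Tangent.ext_formIdeal fun i => ?_⟩
  rw [normalSection_apply]
  exact (e i).symm

/-- With surjectivity, this identifies the tangent space of `H_c` with the tuples of forms modulo
those with entries in the ideal. -/
theorem ker_normalSection {f : Forms n c} (hf : IsRegSeq fun i => (f i : CoordRing n)) :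
    LinearMap.ker (normalSection hf) = tupleIdeal (formIdeal f) c := by
  ext F
  rw [LinearMap.mem_ker, mem_tupleIdeal]
  constructor
  · intro h i
    rw [← Ideal.Quotient.eq_zero_iff_mem, ← normalSection_apply hf, h, map_zero]
    rfl
  · intro h
    refine Tangent.ext_formIdeal fun i => ?_
    rw [normalSection_apply, map_zero]
    exact Ideal.Quotient.eq_zero_iff_mem.2 (h i)

/-- The value of a deformation on a product `h k`. -/
theorem normalSection_mulForms {b : Fin s → ℕ} {a : Fin r → ℕ} {k : Forms n b}
    (hk : IsRegSeq fun i => (k i : CoordRing n)) (h : FormMatrix n a b) (G : Forms n b) (i : Fin r)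
    (hi : (mulForms a b h k i : CoordRing n) ∈ formIdeal k) :
    (normalSection hk G).toHom ⟨_, hi⟩ =
      Ideal.Quotient.mk _ (mulForms a b h G i : CoordRing n) := by
  have : (⟨_, hi⟩ : formIdeal k) = ∑ j, (h i j : CoordRing n) • ⟨k j, mem_formIdeal k j⟩ :=
    Subtype.ext (by simp [coe_mulForms])
  rw [this, map_sum, coe_mulForms, map_sum]
  refine Finset.sum_congr rfl fun j _ => ?_
  rw [map_smul, normalSection_apply]
  rfl

/-- Nestedness of first-order deformations can be tested on generators. -/
theorem mem_nestedTangent_iff {f : Forms n c} {K : Ideal (CoordRing n)} (hJK : formIdeal f ≤ K)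
    (ψ : Tangent (formIdeal f)) (φ : Tangent K) :
    (φ, ψ) ∈ NestedTangent hJK ↔ ∀ i, Ideal.Quotient.factor hJK
      (ψ.toHom ⟨f i, mem_formIdeal f i⟩) = φ.toHom ⟨f i, hJK (mem_formIdeal f i)⟩ := by
  change deformedIdeal ψ ≤ deformedIdeal φ ↔ _
  rw [deformedIdeal_le_iff]
  constructor
  · exact fun h i => h ⟨f i, mem_formIdeal f i⟩
  · rintro h ⟨p, hp⟩
    obtain ⟨g, rfl⟩ := Ideal.mem_span_range_iff_exists_fun.1 hp
    have e1 : (⟨∑ i, g i * (f i : CoordRing n), hp⟩ : formIdeal f) =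
        ∑ i, g i • (⟨f i, mem_formIdeal f i⟩ : formIdeal f) := Subtype.ext (by simp)
    have e2 : (⟨∑ i, g i * (f i : CoordRing n), hJK hp⟩ : K) =
        ∑ i, g i • (⟨f i, hJK (mem_formIdeal f i)⟩ : K) := Subtype.ext (by simp)
    change Ideal.Quotient.factor hJK (ψ.toHom ⟨∑ i, g i * (f i : CoordRing n), hp⟩) =
      φ.toHom ⟨∑ i, g i * (f i : CoordRing n), hJK hp⟩
    rw [e1, e2, map_sum, map_sum, map_sum]
    refine Finset.sum_congr rfl fun i _ => ?_
    rw [map_smul ψ.toHom, map_smul φ.toHom, ← h i]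
    obtain ⟨q, hq⟩ := Ideal.Quotient.mk_surjective (ψ.toHom ⟨f i, mem_formIdeal f i⟩)
    rw [← hq]
    rfl

end NormalSections

end

noncomputable section

open MvPolynomial

attribute [local instance] MvPolynomial.gradedAlgebra

/-! ### Dimension counts for linear maps -/

section LinearAlgebra

variable {V W T : Type} [AddCommGroup V] [Module ℂ V] [AddCommGroup W] [Module ℂ W]
  [AddCommGroup T] [Module ℂ T]

theorem finrank_inf_comap_add_finrank_map_sup [FiniteDimensional ℂ V] [FiniteDimensional ℂ W]
    (L : V →ₗ[ℂ] W) (S : Submodule ℂ V) (U : Submodule ℂ W) :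
    Module.finrank ℂ (S ⊓ U.comap L : Submodule ℂ V) + Module.finrank ℂ (S.map L ⊔ U : Submodule ℂ W) =
      Module.finrank ℂ S + Module.finrank ℂ U := by
  have h1 : ∀ S' : Submodule ℂ V, Module.finrank ℂ (S'.map L) +
      Module.finrank ℂ (S' ⊓ LinearMap.ker L : Submodule ℂ V) = Module.finrank ℂ S' := by
    intro S'
    have e1 : LinearMap.range (L.comp S'.subtype) = S'.map L := by
      rw [LinearMap.range_comp, Submodule.range_subtype]
    have e2 : (LinearMap.ker (L.comp S'.subtype)).map S'.subtype = S' ⊓ LinearMap.ker L := by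
      rw [LinearMap.ker_comp, Submodule.map_comap_subtype]
    rw [← (L.comp S'.subtype).finrank_range_add_finrank_ker, e1, ← e2,
      (LinearEquiv.finrank_eq (Submodule.equivMapOfInjective _ S'.subtype_injective _))]
  have h2 := h1 S
  have h3 := h1 (S ⊓ U.comap L)
  have h4 : (S ⊓ U.comap L).map L = S.map L ⊓ U := by
    ext y
    constructor
    · rintro ⟨x, ⟨hxS, hxU⟩, rfl⟩
      exact ⟨⟨x, hxS, rfl⟩, hxU⟩
    · rintro ⟨⟨x, hxS, rfl⟩, hxU⟩
      exact ⟨x, ⟨hxS, hxU⟩, rfl⟩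
  have h5 : S ⊓ U.comap L ⊓ LinearMap.ker L = S ⊓ LinearMap.ker L := by
    ext x
    constructor
    · exact fun h => ⟨h.1.1, h.2⟩
    · intro h
      refine ⟨⟨h.1, ?_⟩, h.2⟩
      change L x ∈ U
      rw [LinearMap.mem_ker.1 h.2]
      exact U.zero_mem
  rw [h4, h5] at h3
  have h6 := Submodule.finrank_sup_add_finrank_inf_eq (S.map L) U
  omega

theorem finrank_quotient_add_finrank_comap [FiniteDimensional ℂ V] {τ : V →ₗ[ℂ] T}
    (hτ : Function.Surjective τ) (R : Submodule ℂ T) :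
    Module.finrank ℂ (T ⧸ R) + Module.finrank ℂ (R.comap τ) = Module.finrank ℂ V := by
  have h1 : LinearMap.ker (R.mkQ.comp τ) = R.comap τ := by
    rw [LinearMap.ker_comp, Submodule.ker_mkQ]
  have h2 : Function.Surjective (R.mkQ.comp τ) := R.mkQ_surjective.comp hτ
  have h3 := (LinearMap.quotKerEquivOfSurjective _ h2).finrank_eq
  rw [← h3, h1, Submodule.finrank_quotient_add_finrank]

theorem finite_and_finrank_of_surjective [FiniteDimensional ℂ V] {τ : V →ₗ[ℂ] T}
    (hτ : Function.Surjective τ) : Module.Finite ℂ T ∧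
      Module.finrank ℂ T + Module.finrank ℂ (LinearMap.ker τ) = Module.finrank ℂ V := by
  refine ⟨Module.Finite.of_surjective τ hτ, ?_⟩
  rw [← τ.finrank_range_add_finrank_ker, LinearMap.range_eq_top.2 hτ, finrank_top]

end LinearAlgebra

/-! ### The differentials of `ρ` and `α` in terms of `(g, c) ↦ h g + c k` -/

section Differentials

variable {n t s r : ℕ} {c : Fin t → ℕ} {b : Fin s → ℕ} {a : Fin r → ℕ}

/-- The image of `(g, c) ↦ h g + c k`. -/
def diffRange (h : FormMatrix n a b) (k : Forms n b) : Submodule ℂ (Forms n a) :=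
  LinearMap.range (mulForms a b h) ⊔ tupleIdeal (formIdeal k) a

/-- The image of `(g, c) ↦ h g + c k`, where `g` vanishes at `p`. -/
def diffRangeAt (p : ProjPoint n) (h : FormMatrix n a b) (k : Forms n b) :
    Submodule ℂ (Forms n a) :=
  (tupleIdeal (pointIdeal p) b).map (mulForms a b h) ⊔ tupleIdeal (formIdeal k) a

/-- The deformed equations must be a product `(h + εc)(k + εG) = h k + ε(h G + c k)`, where the term
`c k` is an arbitrary tuple with entries in the ideal of `k`. -/
theorem mem_nestedTangent_normalSection {k : Forms n b} {h : FormMatrix n a b}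
    (hk : IsRegSeq fun i => (k i : CoordRing n))
    (hf : IsRegSeq fun i => (mulForms a b h k i : CoordRing n))
    (hsub : formIdeal (mulForms a b h k) ≤ formIdeal k) (G : Forms n b) (F : Forms n a) :
    (normalSection hk G, normalSection hf F) ∈ NestedTangent hsub ↔
      F - mulForms a b h G ∈ tupleIdeal (formIdeal k) a := by
  rw [mem_nestedTangent_iff, mem_tupleIdeal]
  refine forall_congr' fun i => ?_
  rw [normalSection_apply, normalSection_mulForms, Ideal.Quotient.factor_mk, Ideal.Quotient.eq]
  rfl

/-- The preimage of the image of `dρ` in the space of tuples of forms is exactly `diffRange`, so the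
two have the same codimension. -/
theorem finrank_coker_drho (hb : ∀ i, 1 ≤ b i) (ha : ∀ i, 1 ≤ a i) (P : FlagVariety n b a)
    {k : Forms n b} {h : FormMatrix n a b} (hk : formIdeal k = P.Z.ideal)
    (hf : formIdeal (mulForms a b h k) = P.X.ideal) :
    Module.finrank ℂ ((rho P).T ⧸ LinearMap.range (drho P)) + Module.finrank ℂ (diffRange h k) =
      Module.finrank ℂ (Forms n a) := by
  have hkr := (CIParam.isCI hk).isRegSeq hb
  have hfr := (CIParam.isCI hf).isRegSeq ha
  obtain ⟨⟨Z, hZ⟩, ⟨X, hX⟩, hsub⟩ := P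
  dsimp only at hk hf hsub
  subst hk hf
  have h1 := finrank_quotient_add_finrank_comap (normalSection_surjective hfr)
    (LinearMap.range (drho (⟨⟨_, hZ⟩, ⟨_, hX⟩, hsub⟩ : FlagVariety n b a)))
  have h2 : diffRange h k = (LinearMap.range (drho (⟨⟨_, hZ⟩, ⟨_, hX⟩, hsub⟩ :
      FlagVariety n b a))).comap (normalSection hfr) := by
    ext F
    constructor
    · intro hF
      obtain ⟨y, ⟨G, rfl⟩, z, hz, rfl⟩ := Submodule.mem_sup.1 hF
      refine ⟨⟨(normalSection hkr G, normalSection hfr _),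
        (mem_nestedTangent_normalSection hkr hfr hsub G _).2 ?_⟩, rfl⟩
      rwa [add_sub_cancel_left]
    · rintro ⟨⟨⟨ψ, φ⟩, hx⟩, e⟩
      obtain ⟨G, rfl⟩ := normalSection_surjective hkr ψ
      change φ = _ at e
      subst e
      have h3 := (mem_nestedTangent_normalSection hkr hfr hsub G F).1 hx
      rw [← add_sub_cancel (mulForms a b h G) F]
      exact Submodule.add_mem_sup ⟨G, rfl⟩ h3
  rw [h2]
  exact h1

set_option maxHeartbeats 1600000 in
-- The kernel consists of the deformations of `Z` that fix `p` and `X`: the tuples `G` vanishing at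
-- `p` with all entries of `h G` in the ideal of `k`, modulo the tuples with entries in that ideal.
-- Rank and nullity of `G ↦ h G` modulo that ideal give the count.
theorem finrank_ker_dalpha (hb : ∀ i, 1 ≤ b i) (ha : ∀ i, 1 ≤ a i) (Q : FlagFamily n b a)
    {k : Forms n b} {h : FormMatrix n a b} (hk : formIdeal k = Q.Z.ideal)
    (hf : formIdeal (mulForms a b h k) = Q.X.ideal) :
    Module.Finite ℂ (LinearMap.ker (dalpha Q)) ∧
    Module.finrank ℂ (LinearMap.ker (dalpha Q)) + Module.finrank ℂ (tupleIdeal (formIdeal k) b) +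
      Module.finrank ℂ (diffRangeAt Q.pt h k) =
      Module.finrank ℂ (tupleIdeal (pointIdeal Q.pt) b) +
        Module.finrank ℂ (tupleIdeal (formIdeal k) a) := by
  have hkr := (CIParam.isCI hk).isRegSeq hb
  have hfr := (CIParam.isCI hf).isRegSeq ha
  obtain ⟨p, ⟨Z, hZ⟩, ⟨X, hX⟩, hmem, hsub⟩ := Q
  dsimp only at hk hf hmem hsub
  subst hk hf
  let S : Submodule ℂ (Forms n b) :=
    tupleIdeal (pointIdeal p) b ⊓ (tupleIdeal (formIdeal k) a).comap (mulForms a b h)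
  let Q : FlagFamily n b a := ⟨p, ⟨_, hZ⟩, ⟨_, hX⟩, hmem, hsub⟩
  have hpt : ∀ G : Forms n b, ((0 : Tangent (pointIdeal p)), normalSection hkr G) ∈
      NestedTangent hmem ↔ G ∈ tupleIdeal (pointIdeal p) b := by
    intro G
    rw [mem_nestedTangent_iff, mem_tupleIdeal]
    refine forall_congr' fun i => ?_
    rw [normalSection_apply, Ideal.Quotient.factor_mk, map_zero, ← Ideal.Quotient.eq_zero_iff_mem]
    rfl
  have hsb : ∀ G : Forms n b, (normalSection hkr G, (0 : Tangent (formIdeal (mulForms a b h k)))) ∈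
      NestedTangent hsub ↔ mulForms a b h G ∈ tupleIdeal (formIdeal k) a := by
    intro G
    have := mem_nestedTangent_normalSection hkr hfr hsub G 0
    rw [map_zero, zero_sub, neg_mem_iff] at this
    exact this
  let Λ : S →ₗ[ℂ] LinearMap.ker (dalpha Q) :=
    { toFun := fun G => ⟨⟨(0, normalSection hkr G, 0), (hpt G).2 G.2.1, (hsb G).2 G.2.2⟩,
        Subtype.ext rfl⟩
      map_add' := fun G G' => Subtype.ext (Subtype.ext (by
        refine Prod.ext (add_zero (0 : Tangent (pointIdeal p))).symm (Prod.ext ?_ ?_)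
        · exact map_add (normalSection hkr) _ _
        · exact (add_zero (0 : Tangent (formIdeal (mulForms a b h k)))).symm))
      map_smul' := fun z G => Subtype.ext (Subtype.ext (by
        refine Prod.ext (smul_zero z : z • (0 : Tangent (pointIdeal p)) = 0).symm (Prod.ext ?_ ?_)
        · exact map_smul (normalSection hkr) _ _
        · exact (smul_zero z : z • (0 : Tangent (formIdeal (mulForms a b h k))) = 0).symm)) }
  have hΛ : Function.Surjective Λ := by
    rintro ⟨⟨⟨θ, ψ, φ⟩, hx1, hx2⟩, hx⟩
    have h1 := congrArg Subtype.val hx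
    have h2 : θ = 0 := (Prod.ext_iff.1 h1).1
    have h3 : φ = 0 := (Prod.ext_iff.1 h1).2
    subst h2 h3
    obtain ⟨G, rfl⟩ := normalSection_surjective hkr ψ
    exact ⟨⟨G, (hpt G).1 hx1, (hsb G).1 hx2⟩, rfl⟩
  obtain ⟨hfin, h1⟩ := finite_and_finrank_of_surjective (V := S)
    (T := LinearMap.ker (dalpha Q)) (τ := Λ) hΛ
  refine ⟨hfin, ?_⟩
  have h2 : (LinearMap.ker Λ).map S.subtype = tupleIdeal (formIdeal k) b := by
    rw [← ker_normalSection hkr]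
    ext G
    constructor
    · rintro ⟨G, hG, rfl⟩
      exact congrArg (fun x => x.1.1.2.1) (LinearMap.mem_ker.1 hG)
    · intro hG
      have hG' := hG
      rw [ker_normalSection hkr] at hG'
      refine ⟨⟨G, tupleIdeal_mono hmem b hG', ?_⟩, ?_, rfl⟩
      · change mulForms a b h G ∈ tupleIdeal (formIdeal k) a
        rw [mem_tupleIdeal]
        intro i
        rw [coe_mulForms]
        exact sum_mem fun j _ => Ideal.mul_mem_left _ _ (mem_tupleIdeal.1 hG' j)
      · exact Subtype.ext (Subtype.ext (Prod.ext rfl (Prod.ext (LinearMap.mem_ker.1 hG) rfl)))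
  have h3 : Module.finrank ℂ (LinearMap.ker Λ) = Module.finrank ℂ (tupleIdeal (formIdeal k) b) := by
    rw [← h2]
    exact (LinearEquiv.finrank_eq (Submodule.equivMapOfInjective _ S.subtype_injective _))
  have h4 := finrank_inf_comap_add_finrank_map_sup (V := Forms n b) (W := Forms n a)
    (mulForms a b h) (tupleIdeal (pointIdeal p) b) (tupleIdeal (formIdeal k) a)
  rw [h3] at h1
  rw [h1]
  exact h4

end Differentials

end

noncomputable section

open MvPolynomial

attribute [local instance] MvPolynomial.gradedAlgebra

/-! ### Points, gradients and the Jacobian criterion -/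

section Points

variable {n t s r : ℕ} {c : Fin t → ℕ} {b : Fin s → ℕ}

theorem eval_smul_of_isHomogeneous {d : ℕ} {q : CoordRing n} (hq : q.IsHomogeneous d) (z : ℂ)
    (v : Fin (n + 1) → ℂ) : eval (z • v) q = z ^ d * eval v q := by
  rw [eval_eq', eval_eq', Finset.mul_sum]
  refine Finset.sum_congr rfl fun m hm => ?_
  have h1 : ∑ i, m i = d := by
    have h := hq (mem_support_iff.1 hm)
    rw [← h, Finsupp.weight_apply, Finsupp.sum_fintype _ _ (by simp)]
    simp
  simp only [Pi.smul_apply, smul_eq_mul, mul_pow, Finset.prod_mul_distrib, Finset.prod_pow_eq_pow_sum,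
    h1]
  ring

/-- The vector `(1, 0, …, 0)`. -/
def baseVec (n : ℕ) : Fin (n + 1) → ℂ := Pi.single 0 1

theorem represents_baseVec (n : ℕ) : Represents (baseVec n) (basePoint n) :=
  ⟨by simp [baseVec], rfl⟩

theorem Represents.mem_pointIdeal_iff {v : Fin (n + 1) → ℂ} {p : ProjPoint n} (hv : Represents v p)
    {d : ℕ} {q : CoordRing n} (hq : q.IsHomogeneous d) : q ∈ pointIdeal p ↔ eval v q = 0 := by
  obtain ⟨hv0, rfl⟩ := hv
  rw [pointIdeal, mem_vanishingIdeal_iff, Projectivization.submodule_mk]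
  simp only [SetLike.mem_coe]
  constructor
  · exact fun h => h v (Submodule.mem_span_singleton_self v)
  · intro h x hx
    obtain ⟨z, rfl⟩ := Submodule.mem_span_singleton.1 hx
    change eval (z • v) q = 0
    rw [eval_smul_of_isHomogeneous hq, h, mul_zero]

theorem Represents.eval_eq_zero {v : Fin (n + 1) → ℂ} {p : ProjPoint n} (hv : Represents v p)
    {q : CoordRing n} (hq : q ∈ pointIdeal p) : eval v q = 0 := by
  obtain ⟨hv0, rfl⟩ := hv
  rw [pointIdeal, mem_vanishingIdeal_iff, Projectivization.submodule_mk] at hq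
  exact hq v (Submodule.mem_span_singleton_self v)

theorem Represents.formIdeal_le_iff {v : Fin (n + 1) → ℂ} {p : ProjPoint n} (hv : Represents v p)
    {f : Forms n c} : formIdeal f ≤ pointIdeal p ↔ ∀ i, eval v (f i : CoordRing n) = 0 := by
  rw [_root_.formIdeal_le_iff, mem_tupleIdeal]
  exact forall_congr' fun i => hv.mem_pointIdeal_iff (f i).2

/-- The gradient at a point of affine space. -/
def gradAt (v : Fin (n + 1) → ℂ) : CoordRing n →ₗ[ℂ] Fin (n + 1) → ℂ where
  toFun q i := eval v (pderiv i q)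
  map_add' p q := by ext i; simp
  map_smul' z q := by ext i; simp [smul_eval]

theorem gradAt_mul (v : Fin (n + 1) → ℂ) (p q : CoordRing n) :
    gradAt v (p * q) = eval v p • gradAt v q + eval v q • gradAt v p := by
  ext i
  simp only [gradAt, LinearMap.coe_mk, AddHom.coe_mk, pderiv_mul, map_add, map_mul, Pi.add_apply,
    Pi.smul_apply, smul_eq_mul]
  ring

/-- The partial derivatives at `(1, 0, …, 0)` in the directions different from the first. -/
def gradO : CoordRing n →ₗ[ℂ] Fin n → ℂ :=
  (LinearMap.funLeft ℂ ℂ Fin.succ).comp (gradAt (baseVec n))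

theorem gradO_apply (q : CoordRing n) (j : Fin n) :
    gradO q j = eval (baseVec n) (pderiv j.succ q) := rfl

theorem gradO_mul (p q : CoordRing n) : gradO (p * q) =
    eval (baseVec n) p • gradO q + eval (baseVec n) q • gradO p := by
  simp [gradO, gradAt_mul]

/-- By Euler's formula the derivative in the direction `x₀` vanishes at a zero of the form, so only
`n` partial derivatives matter at `o`. -/
theorem gradAt_baseVec {d : ℕ} {q : CoordRing n} (hq : q.IsHomogeneous d)
    (h0 : eval (baseVec n) q = 0) : gradAt (baseVec n) q = Fin.cons 0 (gradO q) := by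
  ext i
  refine Fin.cases ?_ (fun j => ?_) i
  · have h1 := congrArg (eval (baseVec n)) hq.sum_X_mul_pderiv
    simp only [map_sum, map_mul, eval_X, map_nsmul, h0, smul_zero] at h1
    rw [Finset.sum_eq_single 0 (fun j _ hj => by simp [baseVec, hj]) (by simp)] at h1
    simpa [baseVec, gradAt] using h1
  · rfl

theorem linearIndependent_gradAt_baseVec_iff {f : Forms n c}
    (h0 : ∀ i, eval (baseVec n) (f i : CoordRing n) = 0) :
    LinearIndependent ℂ (fun i => gradAt (baseVec n) (f i : CoordRing n)) ↔
      LinearIndependent ℂ (fun i => gradO (f i : CoordRing n)) := by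
  constructor
  · intro h
    rw [Fintype.linearIndependent_iff] at h ⊢
    intro g hg
    refine h g ?_
    ext i
    rw [Finset.sum_apply]
    refine Fin.cases ?_ (fun j => ?_) i
    · refine Finset.sum_eq_zero fun i _ => ?_
      rw [gradAt_baseVec (f i).2 (h0 i)]
      simp
    · have := congrFun hg j
      rw [Finset.sum_apply] at this
      exact this
  · intro h
    exact LinearIndependent.of_comp (LinearMap.funLeft ℂ ℂ Fin.succ) h

/-- At a common zero the gradient of `Σ g_i f_i` is `Σ g_i(p)` times the gradient of `f_i`, so
generators suffice; changing the representative of `p` rescales each gradient by a nonzero factor.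
-/
theorem isSmoothAt_iff {f : Forms n c} {v : Fin (n + 1) → ℂ} {p : ProjPoint n}
    (hv : Represents v p) (hf : formIdeal f ≤ pointIdeal p) :
    IsSmoothAt t (formIdeal f) p ↔
      LinearIndependent ℂ (fun i => gradAt v (f i : CoordRing n)) := by
  have hrep := (represents_rep p).formIdeal_le_iff.1 hf
  have h1 : Submodule.span ℂ ((fun (q : CoordRing n) (i : Fin (n + 1)) =>
      eval p.rep (pderiv i q)) '' (formIdeal f : Set (CoordRing n))) =
      Submodule.span ℂ (Set.range fun i => gradAt p.rep (f i : CoordRing n)) := by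
    refine le_antisymm (Submodule.span_le.2 ?_) (Submodule.span_mono ?_)
    · rintro _ ⟨q, hq, rfl⟩
      obtain ⟨g, rfl⟩ := Ideal.mem_span_range_iff_exists_fun.1 hq
      change gradAt p.rep (∑ i, g i * (f i : CoordRing n)) ∈ _
      rw [map_sum]
      refine Submodule.sum_mem _ fun i _ => ?_
      rw [gradAt_mul, hrep i, zero_smul, add_zero]
      exact Submodule.smul_mem _ _ (Submodule.subset_span ⟨i, rfl⟩)
    · rintro _ ⟨i, rfl⟩
      exact ⟨f i, mem_formIdeal f i, rfl⟩
  have h2 : IsSmoothAt t (formIdeal f) p ↔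
      LinearIndependent ℂ (fun i => gradAt p.rep (f i : CoordRing n)) := by
    rw [IsSmoothAt, h1, linearIndependent_iff_card_eq_finrank_span, Fintype.card_fin, eq_comm]
    rfl
  rw [h2]
  obtain ⟨hv0, rfl⟩ := hv
  obtain ⟨z, hz⟩ := Projectivization.exists_smul_eq_mk_rep ℂ v hv0
  rw [← hz]
  have h3 : (fun i => gradAt (z • v) (f i : CoordRing n)) =
      (fun i => z ^ (c i - 1)) • fun i => gradAt v (f i : CoordRing n) := by
    ext i j
    change eval ((z : ℂ) • v) (pderiv j (f i : CoordRing n)) = _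
    rw [eval_smul_of_isHomogeneous ((f i).2.pderiv)]
    simp [gradAt, Units.smul_def]
  rw [h3]
  constructor
  · intro h
    have := h.units_smul (fun i => (z ^ (c i - 1))⁻¹)
    convert this using 1
    ext i
    simp
  · exact fun h => h.units_smul _

theorem surjective_iff_linearIndependent (g : Fin t → Fin n → ℂ) :
    (∀ y : Fin t → ℂ, ∃ v : Fin n → ℂ, ∀ i, ∑ j, v j * g i j = y i) ↔ LinearIndependent ℂ g := by
  have h1 : (∀ y : Fin t → ℂ, ∃ v : Fin n → ℂ, ∀ i, ∑ j, v j * g i j = y i) ↔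
      Function.Surjective (Matrix.mulVecLin (Matrix.of g)) := by
    refine forall_congr' fun y => exists_congr fun v => ?_
    rw [funext_iff]
    refine forall_congr' fun i => ?_
    simp [Matrix.mulVec, dotProduct, mul_comm]
  rw [h1, linearIndependent_iff_card_eq_finrank_span, ← LinearMap.range_eq_top]
  have h2 : Set.finrank ℂ (Set.range g) = (Matrix.of g).rank := by
    rw [Matrix.rank_eq_finrank_span_row]
    rfl
  rw [h2, Matrix.rank]
  constructor
  · intro h
    rw [h, finrank_top]
    simp
  · intro h
    refine Submodule.eq_top_of_finrank_eq ?_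
    rw [← h]
    simp

end Points

/-! ### Critical points of the universal family over `o` -/

section CriticalPoints

variable {n t : ℕ} {c : Fin t → ℕ}

theorem X_mem_pointIdeal_basePoint (j : Fin n) : (X j.succ : CoordRing n) ∈ pointIdeal (basePoint n) := by
  rw [(represents_baseVec n).mem_pointIdeal_iff (isHomogeneous_X ℂ _), eval_X]
  simp [baseVec]

/-- Restricting to the line through `o` reads off the coefficients of the powers of `x₀`. They
vanish, so each monomial that occurs involves another variable. -/
theorem pointIdeal_basePoint (n : ℕ) : pointIdeal (basePoint n) =
    Ideal.span (Set.range fun j : Fin n => (X j.succ : CoordRing n)) := by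
  refine le_antisymm ?_ (Ideal.span_le.2 (by rintro _ ⟨j, rfl⟩; exact X_mem_pointIdeal_basePoint j))
  intro q hq
  have h1 : (Set.range fun j : Fin n => (X j.succ : CoordRing n)) = X '' {i : Fin (n + 1) | i ≠ 0} := by
    ext x
    constructor
    · rintro ⟨j, rfl⟩
      exact ⟨j.succ, Fin.succ_ne_zero j, rfl⟩
    · rintro ⟨i, hi, rfl⟩
      obtain ⟨j, rfl⟩ := Fin.exists_succ_eq.2 hi
      exact ⟨j, rfl⟩
  rw [h1, mem_ideal_span_X_image]
  by_contra! hcon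
  obtain ⟨m, hm, hm0⟩ := hcon
  have hq' : ∀ z : ℂ, eval (z • baseVec n) q = 0 := by
    intro z
    rw [pointIdeal, mem_vanishingIdeal_iff] at hq
    have := hq (z • baseVec n) (by
      rw [basePoint, Projectivization.submodule_mk]
      exact Submodule.smul_mem _ _ (Submodule.mem_span_singleton_self _))
    exact this
  let P : Polynomial ℂ := aeval (Fin.cons Polynomial.X 0 : Fin (n + 1) → Polynomial ℂ) q
  have hP : P = 0 := by
    refine Polynomial.funext fun z => ?_
    rw [Polynomial.eval_zero, ← hq' z]
    have h3 : (Polynomial.evalRingHom z).comp (aeval (Fin.cons Polynomial.X 0 :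
        Fin (n + 1) → Polynomial ℂ) : CoordRing n →ₐ[ℂ] Polynomial ℂ).toRingHom =
        eval (z • baseVec n) := by
      ext i
      · simp
      · refine Fin.cases ?_ (fun j => ?_) i
        · simp [baseVec]
        · simp [baseVec]
    exact congrArg (fun φ => φ q) h3
  have h4 : P.coeff (m 0) = coeff m q := by
    have h5 : P = ∑ x ∈ q.support, Polynomial.C (coeff x q) *
        ∏ i, (Fin.cons Polynomial.X 0 : Fin (n + 1) → Polynomial ℂ) i ^ x i := by
      simp only [P, aeval_def, eval₂_eq']
      rfl
    rw [h5, Polynomial.finsetSum_coeff, Finset.sum_eq_single m]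
    · rw [Fin.prod_univ_succ]
      have : ∀ j : Fin n, m j.succ = 0 := fun j => hm0 _ (Fin.succ_ne_zero j)
      simp [this]
    · intro x hx hxm
      rw [Fin.prod_univ_succ]
      by_cases hx0 : ∀ j : Fin n, x j.succ = 0
      · have hne : x 0 ≠ m 0 := by
          intro h
          refine hxm (Finsupp.ext fun i => Fin.cases h (fun j => ?_) i)
          rw [hx0 j, hm0 _ (Fin.succ_ne_zero j)]
        simp [hx0, Polynomial.coeff_X_pow, hne.symm]
      · push Not at hx0
        obtain ⟨j, hj⟩ := hx0
        have : ∏ i : Fin n, (Fin.cons Polynomial.X 0 : Fin (n + 1) → Polynomial ℂ) i.succ ^ x i.succ = 0 :=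
          Finset.prod_eq_zero (Finset.mem_univ j) (by simp [hj])
        rw [this, mul_zero, mul_zero, Polynomial.coeff_zero]
    · intro h
      exact absurd hm h
  rw [hP, Polynomial.coeff_zero] at h4
  exact mem_support_iff.1 hm h4.symm

/-- Evaluation at `(1, 0, …, 0)`. -/
def evalO (n : ℕ) : CoordRing n ⧸ pointIdeal (basePoint n) →+* ℂ :=
  Ideal.Quotient.lift _ (eval (baseVec n)) fun _ hq => (represents_baseVec n).eval_eq_zero hq

theorem evalO_mk (q : CoordRing n) : evalO n (Ideal.Quotient.mk _ q) = eval (baseVec n) q := rfl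

theorem evalO_smul (g : CoordRing n) (y : CoordRing n ⧸ pointIdeal (basePoint n)) :
    evalO n (g • y) = eval (baseVec n) g * evalO n y := by
  rw [← evalO_mk g, ← map_mul]
  rfl

theorem evalO_tangent (φ : Tangent (pointIdeal (basePoint n))) :
    ∃ v : Fin n → ℂ, ∀ q : pointIdeal (basePoint n),
      evalO n (φ.toHom q) = ∑ j, v j * gradO (q : CoordRing n) j := by
  refine ⟨fun j => evalO n (φ.toHom ⟨X j.succ, X_mem_pointIdeal_basePoint j⟩), fun q => ?_⟩
  obtain ⟨q, hq⟩ := q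
  have hq' := hq
  rw [pointIdeal_basePoint] at hq'
  obtain ⟨g, rfl⟩ := Ideal.mem_span_range_iff_exists_fun.1 hq'
  have h1 : (⟨∑ j, g j * X j.succ, hq⟩ : pointIdeal (basePoint n)) =
      ∑ j, g j • ⟨X j.succ, X_mem_pointIdeal_basePoint j⟩ := Subtype.ext (by simp)
  rw [h1, map_sum, map_sum, ← h1]
  refine Finset.sum_congr rfl fun j _ => ?_
  rw [map_smul φ.toHom, evalO_smul, mul_comm]
  congr 1
  simp only [map_sum, Finset.sum_apply]
  rw [Finset.sum_eq_single j]
  · simp [gradO_apply, baseVec]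
  · intro i _ hij
    simp [gradO_apply, baseVec, pderiv_X, hij]
  · simp

/-- Modulo `I` the term `q D(g)` of the Leibniz rule disappears for `q ∈ I`, so a derivation is
`R`-linear there. -/
theorem exists_hom_of_leibniz {R : Type*} [CommRing R] {D : R → R}
    (hadd : ∀ p q, D (p + q) = D p + D q) (hmul : ∀ p q, D (p * q) = p * D q + q * D p)
    (I : Ideal R) : ∃ φ : I →ₗ[R] R ⧸ I, ∀ q : I, φ q = Ideal.Quotient.mk I (D q) :=
  ⟨{ toFun := fun q => Ideal.Quotient.mk I (D q)
     map_add' := fun p q => by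
      rw [← map_add, ← hadd]
      rfl
     map_smul' := fun g q => by
      have h1 : Ideal.Quotient.mk I (D (g * q)) = Ideal.Quotient.mk I (g * D q) := by
        rw [hmul, map_add, Ideal.Quotient.eq_zero_iff_mem.2 (I.mul_mem_right _ q.2), add_zero]
      exact h1 }, fun _ => rfl⟩

theorem exists_tangent_basePoint (v : Fin n → ℂ) :
    ∃ φ : Tangent (pointIdeal (basePoint n)), ∀ q : pointIdeal (basePoint n),
      evalO n (φ.toHom q) = ∑ j, v j * gradO (q : CoordRing n) j := by
  -- The factor `x₀`, which is `1` at `o`, makes the derivation preserve degrees.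
  let D : Derivation ℂ (CoordRing n) (CoordRing n) :=
    (X 0 : CoordRing n) • ∑ j : Fin n, (C (v j) : CoordRing n) • pderiv j.succ
  have hDq : ∀ q, D q = X 0 * ∑ j : Fin n, C (v j) * pderiv j.succ q := fun q => by
    have h1 : ∀ S : Finset (Fin n), (∑ j ∈ S, (C (v j) : CoordRing n) • pderiv (R := ℂ) j.succ) q =
        ∑ j ∈ S, C (v j) * pderiv j.succ q := fun S => by
      induction S using Finset.cons_induction with
      | empty => simp
      | cons i S hi ih => rw [Finset.sum_cons, Finset.sum_cons, Derivation.add_apply, ih]; rfl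
    rw [← h1]
    rfl
  obtain ⟨φ, hφ⟩ := exists_hom_of_leibniz (D := D) (map_add D)
    (fun p q => D.leibniz p q) (pointIdeal (basePoint n))
  have h0 : φ ∈ degreePreserving (pointIdeal (basePoint n)) := by
    intro d p hp
    -- In degree zero `1 + (d - 1) = d` fails, but a constant in the ideal of a point is zero.
    by_cases hd : d = 0
    · have hp0 : (p : CoordRing n) = 0 := by
        subst hd
        have h1 := totalDegree_eq_zero_iff_eq_C.1 ((totalDegree_zero_iff_isHomogeneous _).2 hp)
        have h2 := (represents_baseVec n).eval_eq_zero p.2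
        rw [h1, eval_C] at h2
        rw [h1, h2, C_0]
      refine ⟨0, isHomogeneous_zero _ _ _, ?_⟩
      have : p = 0 := Subtype.ext hp0
      rw [this, map_zero, map_zero]
    · refine ⟨D p, ?_, hφ p⟩
      rw [hDq]
      have h1 : (∑ j, C (v j) * pderiv j.succ (p : CoordRing n)).IsHomogeneous (d - 1) :=
        IsHomogeneous.sum _ _ _ fun j _ => by
          have := (isHomogeneous_C (Fin (n + 1)) (v j)).mul (hp.pderiv (i := j.succ))
          rwa [zero_add] at this
      have h2 := (isHomogeneous_X ℂ (0 : Fin (n + 1))).mul h1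
      rwa [show 1 + (d - 1) = d by omega] at h2
  refine ⟨⟨φ, h0⟩, fun q => ?_⟩
  · have h1 : Tangent.toHom (⟨φ, h0⟩ : Tangent (pointIdeal (basePoint n))) q = φ q := rfl
    rw [h1, hφ, evalO_mk, hDq]
    simp [gradO_apply, baseVec]

/-- A motion `v` of the point and a deformation `F` of the equations are compatible if and only if
`v · ∂f_i = F_i(o)` for all `i`. The values `F_i(o)` are arbitrary, so surjectivity says that the
Jacobian matrix has full rank. -/
theorem mem_criticalSet_iff (hc : ∀ i, 1 ≤ c i) {P : UnivFamily n c} (hP : P.pt = basePoint n)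
    {f : Forms n c} (hf : formIdeal f = P.ci.ideal) :
    P ∈ criticalSet n c ↔ ¬ LinearIndependent ℂ fun i => gradO (f i : CoordRing n) := by
  have hfr := (CIParam.isCI hf).isRegSeq hc
  obtain ⟨p, ⟨X, hX⟩, hmem⟩ := P
  dsimp only at hP hf hmem
  subst hP hf
  rw [← surjective_iff_linearIndependent]
  refine not_congr ?_
  have key : ∀ (φ : Tangent (pointIdeal (basePoint n))) (F : Forms n c),
      (φ, normalSection hfr F) ∈ NestedTangent hmem ↔
        ∀ i, evalO n (φ.toHom ⟨f i, hmem (mem_formIdeal f i)⟩) = eval (baseVec n) (F i : CoordRing n) := by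
    intro φ F
    rw [mem_nestedTangent_iff]
    refine forall_congr' fun i => ?_
    rw [normalSection_apply, Ideal.Quotient.factor_mk]
    obtain ⟨q, hq, e⟩ := φ.2 (c i) ⟨f i, hmem (mem_formIdeal f i)⟩ (f i).2
    have e' : φ.toHom ⟨f i, hmem (mem_formIdeal f i)⟩ = Ideal.Quotient.mk _ q := e
    rw [e', evalO_mk, Ideal.Quotient.eq,
      (represents_baseVec n).mem_pointIdeal_iff ((F i).2.sub hq), map_sub, sub_eq_zero, eq_comm]
  constructor
  · intro h y
    let F : Forms n c := fun i => ⟨C (y i) * X 0 ^ c i, by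
      have := (isHomogeneous_C (Fin (n + 1)) (y i)).mul ((isHomogeneous_X ℂ (0 : Fin (n + 1))).pow (c i))
      rwa [zero_add, one_mul] at this⟩
    obtain ⟨⟨⟨φ, ψ⟩, hx⟩, e⟩ := h (normalSection hfr F)
    have e' : ψ = normalSection hfr F := e
    subst e'
    obtain ⟨v, hv⟩ := evalO_tangent φ
    refine ⟨v, fun i => ?_⟩
    have h1 := (key φ F).1 hx i
    rw [hv] at h1
    rw [h1]
    simp [F, baseVec]
  · intro h ψ
    obtain ⟨F, rfl⟩ := normalSection_surjective hfr ψ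
    obtain ⟨v, hv⟩ := h fun i => eval (baseVec n) (F i : CoordRing n)
    obtain ⟨φ, hφ⟩ := exists_tangent_basePoint v
    refine ⟨⟨(φ, normalSection hfr F), (key φ F).2 fun i => ?_⟩, rfl⟩
    rw [hφ, hv]

end CriticalPoints

end

noncomputable section
open MvPolynomial

/-! ### Algebraic independence and the Jacobian matrix -/

section Jacobian

open scoped IntermediateField.algebraAdjoinAdjoin in
-- `K` is formally étale over the polynomial ring on the basis: pass to its fraction field by
-- localization, then to `K` by an algebraic extension, separable in characteristic zero. So the
-- basis `dX_i` of differentials is carried to a basis over `K`.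
theorem IsTranscendenceBasis.linearIndependent_kaehler {k K ι : Type} [Field k] [Field K] [Algebra k K]
    [CharZero k] {v : ι → K} (hv : IsTranscendenceBasis k v) :
    LinearIndependent K (fun i => KaehlerDifferential.D k K (v i)) := by
  let _ : Algebra (MvPolynomial ι k) K := (aeval v).toAlgebra
  let _ : Algebra (MvPolynomial ι k) (Algebra.adjoin k (Set.range v)) :=
    hv.1.aevalEquiv.toAlgHom.toAlgebra
  have : IsScalarTower k (MvPolynomial ι k) K := .of_algebraMap_eq fun x => by
    change _ = aeval v (C x)
    simp
  have : IsScalarTower (MvPolynomial ι k) (Algebra.adjoin k (Set.range v)) K :=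
    .of_algebraMap_eq fun x => (hv.1.algebraMap_aevalEquiv x).symm
  have h1 : Algebra.FormallyEtale (MvPolynomial ι k) (Algebra.adjoin k (Set.range v)) :=
    .of_equiv { hv.1.aevalEquiv with commutes' := fun _ => rfl }
  have h2 : Algebra.FormallyEtale (Algebra.adjoin k (Set.range v))
      (IntermediateField.adjoin k (Set.range v)) := .of_isLocalization (nonZeroDivisors _)
  have : Algebra.IsAlgebraic (IntermediateField.adjoin k (Set.range v)) K := hv.isAlgebraic_field
  have h3 : Algebra.FormallyEtale (IntermediateField.adjoin k (Set.range v)) K :=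
    Algebra.FormallyEtale.of_isSeparable _ K
  have h4 : Algebra.FormallyEtale (Algebra.adjoin k (Set.range v)) K :=
    .comp _ (IntermediateField.adjoin k (Set.range v)) _
  have h5 : Algebra.FormallyEtale (MvPolynomial ι k) K :=
    .comp _ (Algebra.adjoin k (Set.range v)) _
  let e := KaehlerDifferential.tensorKaehlerEquivOfFormallyEtale k (MvPolynomial ι k) K
  let b := ((KaehlerDifferential.mvPolynomialBasis k ι).baseChange K).map e
  convert b.linearIndependent using 1
  ext i
  simp only [b, Module.Basis.map_apply, Module.Basis.baseChange_apply,
    KaehlerDifferential.mvPolynomialBasis_apply, e]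
  rw [KaehlerDifferential.tensorKaehlerEquivOfFormallyEtale_apply, KaehlerDifferential.mapBaseChange_tmul]
  simp only [KaehlerDifferential.map_D, one_smul]
  congr 1
  exact (aeval_X v i).symm

theorem AlgebraicIndependent.linearIndependent_kaehler {k K ι : Type} [Field k] [Field K] [Algebra k K]
    [CharZero k] {v : ι → K} (hv : AlgebraicIndependent k v) :
    LinearIndependent K (fun i => KaehlerDifferential.D k K (v i)) := by
  obtain ⟨t, ht, h⟩ := exists_isTranscendenceBasis_superset
    (hv.to_subtype_range : AlgebraicIndepOn k id (Set.range v))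
  exact h.linearIndependent_kaehler.comp (fun i => ⟨v i, ht ⟨i, rfl⟩⟩)
    fun i j hij => hv.injective (congrArg Subtype.val hij)

theorem LinearIndependent.exists_matrix_mul_eq_one {K : Type*} [Field K] {M N : ℕ}
    {A : Matrix (Fin N) (Fin M) K} (hA : LinearIndependent K A.row) :
    ∃ B : Matrix (Fin M) (Fin N) K, A * B = 1 := by
  obtain ⟨g, hg⟩ := LinearMap.exists_leftInverse_of_injective (Matrix.toLin' A.transpose)
    (LinearMap.ker_eq_bot.2 fun x y h => by
      simp only [Matrix.toLin'_apply, Matrix.mulVec_transpose] at h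
      exact Matrix.vecMul_injective_iff.2 hA h)
  refine ⟨(LinearMap.toMatrix' g).transpose, ?_⟩
  have h1 := congrArg LinearMap.toMatrix' hg
  rw [LinearMap.toMatrix'_comp, LinearMap.toMatrix'_toLin', LinearMap.toMatrix'_id] at h1
  rw [← Matrix.transpose_inj, Matrix.transpose_mul, Matrix.transpose_transpose, h1, Matrix.transpose_one]

theorem kaehler_D_eq_sum {K : Type} {M : ℕ} [CommRing K] [Algebra ℂ K]
    (φ : MvPolynomial (Fin M) ℂ →ₐ[ℂ] K) (q : MvPolynomial (Fin M) ℂ) :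
    KaehlerDifferential.D ℂ K (φ q) =
      ∑ k, φ (pderiv k q) • KaehlerDifferential.D ℂ K (φ (X k)) := by
  induction q using MvPolynomial.induction_on with
  | C a =>
    rw [show φ (C a) = algebraMap ℂ K a from φ.commutes a, Derivation.map_algebraMap]
    exact (Finset.sum_eq_zero fun k _ => by rw [pderiv_C, map_zero, zero_smul]).symm
  | add p q hp hq =>
    simp only [map_add, hp, hq, add_smul, Finset.sum_add_distrib]
  | mul_X p i hp =>
    have h1 : ∀ k, φ (pderiv k (p * X i)) • KaehlerDifferential.D ℂ K (φ (X k)) =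
        φ (X i) • φ (pderiv k p) • KaehlerDifferential.D ℂ K (φ (X k)) +
          φ p • φ (pderiv k (X i)) • KaehlerDifferential.D ℂ K (φ (X k)) := fun k => by
      rw [pderiv_mul, map_add, map_mul, map_mul, add_smul, smul_smul, smul_smul, mul_comm (φ (X i))]
    rw [map_mul, Derivation.leibniz, hp, Finset.sum_congr rfl fun k _ => h1 k, Finset.sum_add_distrib,
      Finset.smul_sum, add_comm, ← Finset.smul_sum (r := φ p)]
    congr 2
    rw [Finset.sum_eq_single i (fun k _ hk => by rw [pderiv_X_of_ne hk.symm, map_zero, zero_smul])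
      (by simp), pderiv_X_self, map_one, one_smul]

/-- The Jacobian criterion for algebraic independence, in one direction: somewhere the Jacobian
matrix has independent rows. -/
theorem AlgebraicIndependent.exists_jacobian {M N : ℕ} {p : Fin N → MvPolynomial (Fin M) ℂ}
    (hp : AlgebraicIndependent ℂ p) : ∃ x : Fin M → ℂ,
      LinearIndependent ℂ fun (i : Fin N) (k : Fin M) => eval x (pderiv k (p i)) := by
  let K := FractionRing (MvPolynomial (Fin M) ℂ)
  let φ : MvPolynomial (Fin M) ℂ →ₐ[ℂ] K := IsScalarTower.toAlgHom ℂ _ K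
  have hinj : Function.Injective φ := IsFractionRing.injective (MvPolynomial (Fin M) ℂ) K
  have h2 := (hp.map' (f := φ) hinj).linearIndependent_kaehler
  let J : Matrix (Fin N) (Fin M) (MvPolynomial (Fin M) ℂ) := Matrix.of fun i k => pderiv k (p i)
  have h6 : LinearIndependent K (J.map φ).row := by
    rw [Fintype.linearIndependent_iff] at h2 ⊢
    intro g hg
    refine h2 g ?_
    refine (Finset.sum_congr rfl fun i _ => congrArg (g i • ·) (kaehler_D_eq_sum φ (p i))).trans ?_
    simp only [Finset.smul_sum, smul_smul]
    rw [Finset.sum_comm]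
    refine Finset.sum_eq_zero fun k _ => ?_
    rw [← Finset.sum_smul]
    have := congrFun hg k
    simp only [Finset.sum_apply, Pi.smul_apply, Pi.zero_apply, smul_eq_mul] at this
    rw [show ∑ i, g i * φ (pderiv k (p i)) = 0 from this, zero_smul]
  obtain ⟨B, hB⟩ := h6.exists_matrix_mul_eq_one
  -- The Jacobian matrix has a right inverse over the fraction field. With the common denominator
  -- `g` cleared, it shows independence of the rows wherever `g ≠ 0`.
  obtain ⟨g, hg⟩ := IsLocalization.exist_integer_multiples_of_finite
    (nonZeroDivisors (MvPolynomial (Fin M) ℂ)) fun x : Fin M × Fin N => B x.1 x.2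
  choose B' hB' using hg
  have hB'' : ∀ k j, φ (B' (k, j)) = φ g * B k j := fun k j => (hB' (k, j)).trans (Algebra.smul_def _ _)
  have h7 : ∀ i j, ∑ k, pderiv k (p i) * B' (k, j) = if i = j then (g : MvPolynomial (Fin M) ℂ) else 0 := by
    intro i j
    refine hinj ?_
    have h8 := congrFun (congrFun hB i) j
    rw [Matrix.mul_apply, Matrix.one_apply] at h8
    simp only [map_sum, map_mul, hB'', mul_left_comm _ (φ g), ← Finset.mul_sum]
    rw [show ∑ k, φ (pderiv k (p i)) * B k j = if i = j then 1 else 0 from h8]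
    split_ifs <;> simp
  obtain ⟨x, hx⟩ : ∃ x, eval x (g : MvPolynomial (Fin M) ℂ) ≠ 0 := by
    by_contra! h
    exact nonZeroDivisors.ne_zero g.2 (MvPolynomial.funext fun x => by simpa using h x)
  refine ⟨x, ?_⟩
  rw [Fintype.linearIndependent_iff]
  intro c hc j
  have h9 : ∀ k, ∑ i, c i * eval x (pderiv k (p i)) = 0 := fun k => by
    simpa using congrFun hc k
  have h10 : ∑ i, c i * ∑ k, eval x (pderiv k (p i)) * eval x (B' (k, j)) = 0 := by
    simp only [Finset.mul_sum]
    rw [Finset.sum_comm]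
    refine Finset.sum_eq_zero fun k _ => ?_
    simp only [← mul_assoc]
    rw [← Finset.sum_mul, h9, zero_mul]
  have h11 : ∀ i, ∑ k, eval x (pderiv k (p i)) * eval x (B' (k, j)) =
      if i = j then eval x (g : MvPolynomial (Fin M) ℂ) else 0 := fun i => by
    have := congrArg (eval x) (h7 i j)
    rw [map_sum] at this
    simp only [map_mul] at this
    rw [this]
    split_ifs <;> simp
  simp only [h11] at h10
  simpa [hx] using h10

end Jacobian

/-! ### Dominance of quadratic maps and surjectivity of the differential -/

section Dominant

variable {V E : Type} [AddCommGroup V] [Module ℂ V] [AddCommGroup E] [Module ℂ E]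

theorem exists_eval_taylor {M : ℕ} (P : MvPolynomial (Fin M) ℂ) (x y z : Fin M → ℂ) :
    ∃ R : Polynomial ℂ, ∀ t : ℂ, eval (x + t • y + t ^ 2 • z) P =
      eval x P + t * (∑ k, y k * eval x (pderiv k P)) + t ^ 2 * R.eval t := by
  induction P using MvPolynomial.induction_on with
  | C a => exact ⟨0, fun t => by simp⟩
  | add p q hp hq =>
    obtain ⟨R, hR⟩ := hp
    obtain ⟨S, hS⟩ := hq
    refine ⟨R + S, fun t => ?_⟩
    simp only [map_add, hR, hS, mul_add, Finset.sum_add_distrib, Polynomial.eval_add]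
    ring
  | mul_X p i hp =>
    obtain ⟨R, hR⟩ := hp
    refine ⟨Polynomial.C (eval x p * z i) + Polynomial.C ((∑ k, y k * eval x (pderiv k p)) * y i) +
      Polynomial.X * Polynomial.C ((∑ k, y k * eval x (pderiv k p)) * z i) +
      R * (Polynomial.C (x i) + Polynomial.X * Polynomial.C (y i) +
        Polynomial.X ^ 2 * Polynomial.C (z i)), fun t => ?_⟩
    have h1 : ∑ k, y k * eval x (pderiv k (p * X i)) =
        x i * (∑ k, y k * eval x (pderiv k p)) + eval x p * y i := by
      simp only [pderiv_mul, map_add, map_mul, eval_X, mul_add, Finset.sum_add_distrib, Finset.mul_sum]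
      congr 1
      · exact Finset.sum_congr rfl fun k _ => by ring
      · rw [Finset.sum_eq_single i (fun k _ hk => by simp [pderiv_X, hk.symm]) (by simp)]
        simp [mul_comm]
    rw [h1, map_mul (eval _), map_mul (eval _), hR, eval_X, eval_X]
    simp only [Pi.add_apply, Pi.smul_apply, smul_eq_mul, Polynomial.eval_add, Polynomial.eval_mul,
      Polynomial.eval_C, Polynomial.eval_X, Polynomial.eval_pow]
    ring

theorem eq_zero_of_forall_mul_eq {a : ℂ} {R : Polynomial ℂ} (h : ∀ t : ℂ, t * a = t ^ 2 * R.eval t) :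
    a = 0 := by
  have : Polynomial.X * Polynomial.C a = Polynomial.X ^ 2 * R := Polynomial.funext fun t => by
    simpa [-mul_eq_mul_left_iff, -mul_eq_mul_right_iff, mul_comm a] using h t
  have h1 := congrArg (fun p => Polynomial.coeff p 1) this
  rw [pow_two, mul_assoc] at h1
  simpa using h1

/-- `Ψ` is a quadratic map with differential `D`. -/
def HasQuadraticDifferential (Ψ : V → E) (D : V → V →ₗ[ℂ] E) : Prop :=
  ∀ x y, ∃ z, ∀ t : ℂ, Ψ (x + t • y) = Ψ x + t • D x y + t ^ 2 • z

/-- Induction on the degree: the partial derivatives also vanish on `Ω` and have lower degree, so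
they are zero. In characteristic zero `Q` is then constant, and it vanishes at a point. -/
theorem eq_zero_of_pderiv_eq_zero {N : ℕ} {Ω : Set (Fin N → ℂ)} (hΩ : Ω.Nonempty)
    (h : ∀ Q : MvPolynomial (Fin N) ℂ, (∀ x ∈ Ω, eval x Q = 0) → ∀ k, ∀ x ∈ Ω, eval x (pderiv k Q) = 0)
    (Q : MvPolynomial (Fin N) ℂ) (hQ : ∀ x ∈ Ω, eval x Q = 0) : Q = 0 := by
  obtain ⟨d, hd⟩ : ∃ d, ∀ m ∈ Q.support, m.degree ≤ d :=
    ⟨Q.support.sup Finsupp.degree, fun m hm => Finset.le_sup hm⟩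
  induction d generalizing Q with
  | zero =>
    have h1 : Q = C (coeff 0 Q) := by
      ext m
      rw [coeff_C]
      split_ifs with hm
      · rw [hm]
      · by_contra hne
        have := hd m (mem_support_iff.2 hne)
        exact hm ((Finsupp.degree_eq_zero_iff m).1 (by omega)).symm
    obtain ⟨x, hx⟩ := hΩ
    have h2 := hQ x hx
    rw [h1, eval_C] at h2
    rw [h1, h2, C_0]
  | succ d ih =>
    have h1 : ∀ k, pderiv k Q = 0 := by
      intro k
      refine ih _ (h Q hQ k) fun m hm => ?_
      have h2 : coeff (m + Finsupp.single k 1) Q ≠ 0 := by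
        intro h0
        rw [mem_support_iff, coeff_pderiv, h0, zero_mul] at hm
        exact hm rfl
      have := hd _ (mem_support_iff.2 h2)
      rw [map_add, Finsupp.degree_single] at this
      omega
    refine ih Q hQ fun m hm => ?_
    by_contra hlt
    obtain ⟨k, hk⟩ : ∃ k, m k ≠ 0 := by
      by_contra! h0
      rw [show m = 0 from Finsupp.ext h0, map_zero] at hlt
      omega
    have h2 := congrArg (coeff (m - Finsupp.single k 1)) (h1 k)
    rw [coeff_pderiv, tsub_add_cancel_of_le (Finsupp.single_le_iff.2 (Nat.one_le_iff_ne_zero.2 hk)),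
      coeff_zero] at h2
    exact mul_ne_zero (mem_support_iff.1 hm) (Nat.cast_add_one_ne_zero _) h2

variable [FiniteDimensional ℂ V] [FiniteDimensional ℂ E]

/-- A quadratic map is dominant if and only if its differential is surjective somewhere. -/
theorem HasQuadraticDifferential.dominant_iff {Ψ : V → E} {D : V → V →ₗ[ℂ] E}
    (h : HasQuadraticDifferential Ψ D) (hΨ : IsPolyMap Ψ) (hD : IsPolyMap D) :
    (∀ O : Set E, ZOpen O → O.Nonempty → ∃ x, Ψ x ∈ O) ↔ ∃ x, Function.Surjective (D x) := by
  set e := Module.finBasis ℂ V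
  set e' := Module.finBasis ℂ E
  constructor
  · intro H
    -- A polynomial relation between the coordinates of `Ψ` would confine its image to a
    -- hypersurface. So dominance makes them algebraically independent, and their Jacobian matrix
    -- has full rank somewhere.
    choose p hp using fun i => exists_mvPolynomial_of_mem_polyFun (hΨ (e'.coord i)) e
    have hai : AlgebraicIndependent ℂ p := by
      rw [algebraicIndependent_iff]
      intro Q hQ
      by_contra hne
      obtain ⟨y, hy⟩ : ∃ y, eval y Q ≠ 0 := by
        by_contra! h
        exact hne (MvPolynomial.funext fun x => by simpa using h x)
      obtain ⟨x, hx⟩ := H {w | eval (e'.equivFun w) Q ≠ 0}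
        (zopen_ne_zero (eval_mem_polyFun (fun i => dual_mem_polyFun (e'.coord i)) Q))
        ⟨e'.equivFun.symm y, by
          change eval (e'.equivFun (e'.equivFun.symm y)) Q ≠ 0
          rwa [LinearEquiv.apply_symm_apply]⟩
      refine hx ?_
      have h1 := congrArg (eval (e.repr x)) hQ
      have h2 : ((eval (e.repr x)).comp (aeval p).toRingHom : MvPolynomial _ ℂ →+* ℂ) =
          eval (e'.equivFun (Ψ x)) := by
        ext i
        · simp
        · simpa using (hp i x).symm
      have h3 := congrArg (fun φ => φ Q) h2
      exact h3.symm.trans (h1.trans (map_zero _))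
    obtain ⟨x, hx⟩ := hai.exists_jacobian
    rw [← surjective_iff_linearIndependent] at hx
    refine ⟨e.equivFun.symm x, fun w => ?_⟩
    obtain ⟨y, hy⟩ := hx (e'.equivFun w)
    refine ⟨e.equivFun.symm y, e'.equivFun.injective (funext fun i => ?_)⟩
    rw [← hy i]
    obtain ⟨z, hz⟩ := h (e.equivFun.symm x) (e.equivFun.symm y)
    obtain ⟨R, hR⟩ := exists_eval_taylor (p i) x y 0
    have h1 : ∀ u : Fin _ → ℂ, e'.coord i (Ψ (e.equivFun.symm u)) = eval u (p i) := fun u => by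
      rw [hp, show (e.repr (e.equivFun.symm u) : Fin _ → ℂ) = u from e.equivFun.apply_symm_apply u]
    rw [← sub_eq_zero]
    refine eq_zero_of_forall_mul_eq (R := R - Polynomial.C (e'.coord i z)) fun t => ?_
    have h2 := congrArg (e'.coord i) (hz t)
    rw [← map_smul, ← map_add, h1, map_add, map_add, map_smul, map_smul, h1] at h2
    have h3 := hR t
    rw [smul_zero, add_zero, h2] at h3
    simp only [smul_eq_mul] at h3
    rw [Polynomial.eval_sub, Polynomial.eval_C]
    change t * (e'.coord i _ - _) = _
    linear_combination h3
  · rintro ⟨x₀, hx₀⟩ O hO ⟨y₀, hy₀⟩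
    obtain ⟨q, hq, hq0, hqO⟩ := zopen_iff.1 hO y₀ hy₀
    by_contra! hcon
    obtain ⟨Q, hQ⟩ := exists_mvPolynomial_of_mem_polyFun hq e'
    -- If `P` vanishes on the image, differentiating `P ∘ Ψ` in a direction that `D` sends to a
    -- basis vector shows that a partial derivative of `P` vanishes wherever `D` is surjective,
    -- hence, by density, on the whole image.
    have hQ0 : Q = 0 := by
      refine eq_zero_of_pderiv_eq_zero (Ω := Set.range fun x => e'.equivFun (Ψ x)) ⟨_, x₀, rfl⟩ ?_ Q ?_
      · rintro P hP k _ ⟨x, rfl⟩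
        have h1 : ∀ x, Function.Surjective (D x) → eval (e'.equivFun (Ψ x)) (pderiv k P) = 0 := by
          intro x hx
          obtain ⟨y, hy⟩ := hx (e' k)
          obtain ⟨z, hz⟩ := h x y
          obtain ⟨R, hR⟩ := exists_eval_taylor P (e'.equivFun (Ψ x)) (Pi.single k 1) (e'.equivFun z)
          have h2 : ∑ j, (Pi.single k 1 : Fin _ → ℂ) j * eval (e'.equivFun (Ψ x)) (pderiv j P) =
              eval (e'.equivFun (Ψ x)) (pderiv k P) := by
            rw [Finset.sum_eq_single k (fun j _ hj => by simp [hj]) (by simp)]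
            simp
          rw [h2] at hR
          refine eq_zero_of_forall_mul_eq (R := -R) fun t => ?_
          have h3 := hR t
          have h4 : e'.equivFun (Ψ x) + t • (Pi.single k 1 : Fin _ → ℂ) + t ^ 2 • e'.equivFun z =
              e'.equivFun (Ψ (x + t • y)) := by
            rw [hz, hy, map_add, map_add, map_smul, map_smul]
            congr 3
            ext j
            simp [Pi.single_apply, eq_comm]
          rw [h4, hP _ ⟨_, rfl⟩, hP _ ⟨_, rfl⟩] at h3
          rw [Polynomial.eval_neg]
          linear_combination -h3
        by_contra hne
        obtain ⟨x', h5, h6⟩ := (zopen_surjective hD).nonempty_inter (zopen_ne_zero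
          (eval_mem_polyFun (fun i => hΨ (e'.coord i)) (pderiv k P))) ⟨x₀, hx₀⟩ ⟨x, hne⟩
        exact h6 (h1 x' h5)
      · rintro _ ⟨x, rfl⟩
        by_contra hne
        refine hcon x (hqO _ ?_)
        rw [hQ]
        exact hne
    rw [hQ, hQ0, map_zero] at hq0
    exact hq0 rfl

end Dominant
end

noncomputable section

open MvPolynomial

attribute [local instance] MvPolynomial.gradedAlgebra

section LinearAlgebra

variable {V U : Type} [AddCommGroup V] [Module ℂ V] [AddCommGroup U] [Module ℂ U]
  [FiniteDimensional ℂ V]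

theorem finrank_add_le_of_le_ker {φ : V →ₗ[ℂ] U} (hφ : Function.Surjective φ) {S : Submodule ℂ V}
    (hS : ∀ x ∈ S, φ x = 0) : Module.finrank ℂ S + Module.finrank ℂ U ≤ Module.finrank ℂ V := by
  have h1 := φ.finrank_range_add_finrank_ker
  rw [LinearMap.range_eq_top.2 hφ, finrank_top] at h1
  have h2 : Module.finrank ℂ S ≤ Module.finrank ℂ (LinearMap.ker φ) :=
    Submodule.finrank_mono fun x hx => hS x hx
  omega

theorem finrank_le_add_of_ker_le [FiniteDimensional ℂ U] {φ : V →ₗ[ℂ] U} {S : Submodule ℂ V} (hS : ∀ x, φ x = 0 → x ∈ S) :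
    Module.finrank ℂ V ≤ Module.finrank ℂ S + Module.finrank ℂ U := by
  have h1 := φ.finrank_range_add_finrank_ker
  have h2 : Module.finrank ℂ (LinearMap.ker φ) ≤ Module.finrank ℂ S :=
    Submodule.finrank_mono fun x hx => hS x hx
  have h3 := Submodule.finrank_le (LinearMap.range φ)
  omega

theorem finrank_quotient_span_range {n s : ℕ} {g : Fin s → Fin n → ℂ} (hg : LinearIndependent ℂ g) :
    Module.finrank ℂ ((Fin n → ℂ) ⧸ Submodule.span ℂ (Set.range g)) + s = n := by
  have h1 := (Submodule.span ℂ (Set.range g)).finrank_quotient_add_finrank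
  rw [finrank_span_eq_card hg] at h1
  simpa using h1

end LinearAlgebra

/-! ### Values and gradients at `o`, and the lower bounds for the codimensions -/

section BasePoint

variable {n t s r : ℕ} {c : Fin t → ℕ} {b : Fin s → ℕ} {a : Fin r → ℕ}

/-- The values of a tuple of forms at `(1, 0, …, 0)`. -/
def valO : Forms n c →ₗ[ℂ] Fin t → ℂ where
  toFun f i := eval (baseVec n) (f i : CoordRing n)
  map_add' f g := by ext i; simp
  map_smul' z f := by ext i; simp [smul_eval]

/-- The partial derivatives of a tuple of forms at `(1, 0, …, 0)`. -/
def jacO : Forms n c →ₗ[ℂ] Fin t → Fin n → ℂ where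
  toFun f i := gradO (f i : CoordRing n)
  map_add' f g := by ext i; simp
  map_smul' z f := by ext i; simp

/-- The values of a matrix of forms at `(1, 0, …, 0)`. -/
def matValO : FormMatrix n a b →ₗ[ℂ] Fin r → Fin s → ℂ where
  toFun h i j := eval (baseVec n) (h i j : CoordRing n)
  map_add' f g := by ext i; simp
  map_smul' z f := by ext i; simp [smul_eval]

/-- The partial derivatives of a matrix of forms at `(1, 0, …, 0)`. -/
def matJacO : FormMatrix n a b →ₗ[ℂ] Fin r → Fin s → Fin n → ℂ where
  toFun h i j := gradO (h i j : CoordRing n)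
  map_add' f g := by ext i; simp
  map_smul' z f := by ext i; simp

theorem valO_mulForms (h : FormMatrix n a b) (k : Forms n b) (i : Fin r) :
    valO (mulForms a b h k) i = ∑ j, matValO h i j * valO k j := by
  change eval (baseVec n) (mulForms a b h k i : CoordRing n) = _
  rw [coe_mulForms, map_sum]
  exact Finset.sum_congr rfl fun j _ => map_mul _ _ _

theorem jacO_mulForms (h : FormMatrix n a b) (k : Forms n b) (i : Fin r) :
    jacO (mulForms a b h k) i = ∑ j, (matValO h i j • jacO k j + valO k j • matJacO h i j) := by
  change gradO (mulForms a b h k i : CoordRing n) = _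
  rw [coe_mulForms, map_sum]
  exact Finset.sum_congr rfl fun j _ => gradO_mul _ _

theorem valO_eq_zero_iff {f : Forms n c} : valO f = 0 ↔ f ∈ tupleIdeal (pointIdeal (basePoint n)) c := by
  rw [mem_tupleIdeal, funext_iff]
  exact forall_congr' fun i => ((represents_baseVec n).mem_pointIdeal_iff (f i).2).symm

theorem baseVec_zero : baseVec n 0 = 1 := by simp [baseVec]

theorem eval_X_zero : eval (baseVec n) (X 0 : CoordRing n) = 1 := by simp [baseVec_zero]

theorem gradO_X_zero_pow (d : ℕ) : gradO ((X 0 : CoordRing n) ^ d) = 0 := by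
  ext j
  rw [gradO_apply, pderiv_pow, pderiv_X_of_ne (Fin.succ_ne_zero j).symm]
  simp

/-- The linear form with coefficients `w` that does not involve `x₀`. -/
def linPoly (w : Fin n → ℂ) : CoordRing n := ∑ j, C (w j) * X j.succ

theorem linPoly_isHomogeneous (w : Fin n → ℂ) : (linPoly w).IsHomogeneous 1 :=
  IsHomogeneous.sum _ _ _ fun j _ => by
    have := (isHomogeneous_C (Fin (n + 1)) (w j)).mul (isHomogeneous_X ℂ j.succ)
    rwa [zero_add] at this

theorem eval_linPoly (w : Fin n → ℂ) : eval (baseVec n) (linPoly w) = 0 := by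
  simp [linPoly, baseVec]

theorem gradO_linPoly (w : Fin n → ℂ) : gradO (linPoly w) = w := by
  ext j
  rw [gradO_apply, linPoly, map_sum, map_sum, Finset.sum_eq_single j]
  · simp
  · intro i _ hij
    rw [pderiv_C_mul, pderiv_X_of_ne (fun h => hij (Fin.succ_injective n h))]
    simp
  · simp

/-- The forms `γ_i x₀^(c_i)`. -/
def powForms (c : Fin t → ℕ) (γ : Fin t → ℂ) : Forms n c := fun i =>
  ⟨C (γ i) * X 0 ^ c i, by
    have := (isHomogeneous_C (Fin (n + 1)) (γ i)).mul ((isHomogeneous_X ℂ (0 : Fin (n + 1))).pow (c i))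
    rwa [zero_add, one_mul] at this⟩

theorem valO_powForms (γ : Fin t → ℂ) : valO (powForms (n := n) c γ) = γ := by
  ext i
  change eval (baseVec n) (C (γ i) * X 0 ^ c i : CoordRing n) = _
  simp [baseVec_zero]

theorem jacO_powForms (γ : Fin t → ℂ) : jacO (powForms (n := n) c γ) = 0 := by
  ext1 i
  change gradO (C (γ i) * X 0 ^ c i : CoordRing n) = _
  rw [C_mul', map_smul, gradO_X_zero_pow, smul_zero]
  rfl

/-- The forms `x₀^(c_i - 1) w_i`, where the `w_i` are linear forms that do not involve `x₀`. -/
def linForms (hc : ∀ i, 1 ≤ c i) (w : Fin t → Fin n → ℂ) : Forms n c := fun i =>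
  ⟨X 0 ^ (c i - 1) * linPoly (w i), by
    have := ((isHomogeneous_X ℂ (0 : Fin (n + 1))).pow (c i - 1)).mul (linPoly_isHomogeneous (w i))
    rwa [one_mul, Nat.sub_add_cancel (hc i)] at this⟩

theorem valO_linForms (hc : ∀ i, 1 ≤ c i) (w : Fin t → Fin n → ℂ) : valO (linForms hc w) = 0 := by
  ext i
  change eval (baseVec n) (X 0 ^ (c i - 1) * linPoly (w i) : CoordRing n) = _
  rw [map_mul, eval_linPoly, mul_zero]
  rfl

theorem jacO_linForms (hc : ∀ i, 1 ≤ c i) (w : Fin t → Fin n → ℂ) : jacO (linForms hc w) = w := by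
  ext1 i
  change gradO (X 0 ^ (c i - 1) * linPoly (w i) : CoordRing n) = _
  rw [gradO_mul, gradO_linPoly, eval_linPoly, zero_smul, add_zero, map_pow, eval_X_zero, one_pow, one_smul]

theorem C_mul_X_zero_pow_mem {d k : ℕ} (h : k ≤ d) (z : ℂ) :
    (C z * X 0 ^ (d - k) : CoordRing n) ∈ shiftForms n d k := by
  rw [mem_shiftForms h]
  have := (isHomogeneous_C (Fin (n + 1)) z).mul ((isHomogeneous_X ℂ (0 : Fin (n + 1))).pow (d - k))
  rwa [zero_add, one_mul] at this

theorem X_zero_pow_mul_linPoly_mem {d k : ℕ} (h : k < d) (w : Fin n → ℂ) :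
    (X 0 ^ (d - k - 1) * linPoly w : CoordRing n) ∈ shiftForms n d k := by
  rw [mem_shiftForms h.le]
  have := ((isHomogeneous_X ℂ (0 : Fin (n + 1))).pow (d - k - 1)).mul (linPoly_isHomogeneous w)
  rwa [one_mul, Nat.sub_add_cancel (Nat.sub_pos_of_lt h)] at this

/-- The forms `δ_ij x₀^(a_i - b_j)`. -/
def powMatrix (n : ℕ) (a : Fin r → ℕ) (b : Fin s → ℕ) (δ : Fin r → Fin s → ℂ) : FormMatrix n a b :=
  fun i j => if h : b j ≤ a i then ⟨C (δ i j) * X 0 ^ (a i - b j), C_mul_X_zero_pow_mem h _⟩ else 0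

theorem coe_powMatrix (δ : Fin r → Fin s → ℂ) {i : Fin r} {j : Fin s} (h : b j ≤ a i) :
    (powMatrix n a b δ i j : CoordRing n) = C (δ i j) * X 0 ^ (a i - b j) := by
  simp [powMatrix, h]

theorem matValO_powMatrix {δ : Fin r → Fin s → ℂ} (h : ∀ i j, δ i j ≠ 0 → b j ≤ a i) :
    matValO (powMatrix n a b δ) = δ := by
  ext i j
  change eval (baseVec n) (powMatrix n a b δ i j : CoordRing n) = _
  by_cases hij : b j ≤ a i
  · rw [coe_powMatrix δ hij]
    simp [baseVec_zero]
  · have : δ i j = 0 := by_contra fun h0 => hij (h i j h0)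
    simp [powMatrix, hij, this]

theorem matJacO_powMatrix (δ : Fin r → Fin s → ℂ) : matJacO (powMatrix n a b δ) = 0 := by
  ext1 i
  ext1 j
  change gradO (powMatrix n a b δ i j : CoordRing n) = _
  by_cases hij : b j ≤ a i
  · rw [coe_powMatrix δ hij, C_mul', map_smul, gradO_X_zero_pow, smul_zero]
    rfl
  · simp [powMatrix, hij]

/-- The forms `x₀^(a_i - b_j - 1) w_ij`, where the `w_ij` are linear forms that do not involve `x₀`. -/
def linMatrix (a : Fin r → ℕ) (b : Fin s → ℕ) (w : Fin r → Fin s → Fin n → ℂ) : FormMatrix n a b :=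
  fun i j => if h : b j < a i then
    ⟨X 0 ^ (a i - b j - 1) * linPoly (w i j), X_zero_pow_mul_linPoly_mem h _⟩ else 0

theorem matValO_linMatrix (w : Fin r → Fin s → Fin n → ℂ) : matValO (linMatrix a b w) = 0 := by
  ext i j
  change eval (baseVec n) (linMatrix a b w i j : CoordRing n) = _
  by_cases hij : b j < a i
  · simp [linMatrix, hij, eval_linPoly]
  · simp [linMatrix, hij]

theorem matJacO_linMatrix {w : Fin r → Fin s → Fin n → ℂ} (h : ∀ i j, w i j ≠ 0 → b j < a i) :
    matJacO (linMatrix a b w) = w := by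
  ext1 i
  ext1 j
  change gradO (linMatrix a b w i j : CoordRing n) = _
  by_cases hij : b j < a i
  · simp [linMatrix, hij, gradO_mul, eval_linPoly, gradO_linPoly, baseVec_zero]
  · have : w i j = 0 := by_contra fun h0 => hij (h i j h0)
    simp [linMatrix, hij, this]

theorem finrank_tupleIdeal_basePoint (c : Fin t → ℕ) :
    Module.finrank ℂ (tupleIdeal (pointIdeal (basePoint n)) c) + t = Module.finrank ℂ (Forms n c) := by
  have h1 := finrank_add_le_of_le_ker (V := Forms n c) (φ := valO)
    (fun γ => ⟨powForms c γ, valO_powForms γ⟩) (S := tupleIdeal (pointIdeal (basePoint n)) c)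
    fun x hx => valO_eq_zero_iff.2 hx
  have h2 := finrank_le_add_of_ker_le (V := Forms n c) (φ := valO)
    (S := tupleIdeal (pointIdeal (basePoint n)) c) fun x hx => valO_eq_zero_iff.1 hx
  simp only [Module.finrank_fintype_fun_eq_card, Fintype.card_fin] at h1 h2
  omega

/-- The equations satisfied by the image of the differential of `(k, h) ↦ h k`. -/
theorem exists_relation {k : Forms n b} {h : FormMatrix n a b} (hk0 : valO k = 0)
    (hk : LinearIndependent ℂ (jacO k)) (hf : ¬ LinearIndependent ℂ (jacO (mulForms a b h k))) :
    ∃ z : Fin r → ℂ, (∃ i, z i ≠ 0) ∧ ∀ j, ∑ i, z i * matValO h i j = 0 := by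
  rw [Fintype.linearIndependent_iff] at hf
  push Not at hf
  obtain ⟨z, hz, i, hi⟩ := hf
  refine ⟨z, ⟨i, hi⟩, Fintype.linearIndependent_iff.1 hk _ ?_⟩
  rw [← hz]
  simp only [jacO_mulForms, hk0, Pi.zero_apply, zero_smul, add_zero, Finset.smul_sum, Finset.sum_smul,
    smul_smul]
  exact Finset.sum_comm

/-- The value of `h g + c k` at `o` is `h(o) g(o)`, which is annihilated by `z`: one linear equation
for the image. -/
theorem finrank_diffRange_add_one_le {k : Forms n b} {h : FormMatrix n a b} (hk0 : valO k = 0)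
    {z : Fin r → ℂ} (hz0 : ∃ i, z i ≠ 0) (hz : ∀ j, ∑ i, z i * matValO h i j = 0) :
    Module.finrank ℂ (diffRange h k) + 1 ≤ Module.finrank ℂ (Forms n a) := by
  obtain ⟨i₀, hi₀⟩ := hz0
  let ζ : (Fin r → ℂ) →ₗ[ℂ] ℂ := Fintype.linearCombination ℂ z
  have hζ : ∀ y, ζ y = ∑ i, z i * y i := fun y => by
    simp [ζ, Fintype.linearCombination_apply, mul_comm]
  have h1 := finrank_add_le_of_le_ker (V := Forms n a) (φ := ζ.comp valO) (fun y => by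
    refine ⟨powForms a (Pi.single i₀ ((z i₀)⁻¹ * y)), ?_⟩
    rw [LinearMap.comp_apply, valO_powForms, hζ, Finset.sum_eq_single i₀ (fun i _ hi => by simp [hi])
      (by simp)]
    simp [hi₀]) (S := diffRange h k) fun F hF => by
      obtain ⟨_, ⟨g, rfl⟩, x, hx, rfl⟩ := Submodule.mem_sup.1 hF
      rw [← range_mulForms] at hx
      obtain ⟨A, rfl⟩ := hx
      rw [LinearMap.comp_apply, map_add, map_add, hζ, hζ]
      simp only [LinearMap.flip_apply, valO_mulForms, hk0, Pi.zero_apply, mul_zero,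
        Finset.sum_const_zero, add_zero, Finset.mul_sum]
      rw [Finset.sum_comm]
      refine Finset.sum_eq_zero fun j _ => ?_
      simp only [← mul_assoc]
      rw [← Finset.sum_mul, hz, zero_mul]
  simpa using h1

/-- If `g(o) = 0`, then `F = h g + c k` vanishes at `o`, which is `r` equations. Moreover `z` kills
the contribution `h(o) ∂g` to the gradient, and `c k` contributes combinations of the `∂k_j`; so `z
· ∂F` is zero in a quotient of dimension `n - s`. -/
theorem finrank_diffRangeAt_add_le (ha : ∀ i, 1 ≤ a i) {k : Forms n b} {h : FormMatrix n a b}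
    (hk0 : valO k = 0) (hk : LinearIndependent ℂ (jacO k))
    {z : Fin r → ℂ} (hz0 : ∃ i, z i ≠ 0) (hz : ∀ j, ∑ i, z i * matValO h i j = 0) :
    Module.finrank ℂ (diffRangeAt (basePoint n) h k) + (r + (n - s)) ≤
      Module.finrank ℂ (Forms n a) := by
  obtain ⟨i₀, hi₀⟩ := hz0
  let S := Submodule.span ℂ (Set.range (jacO k))
  let ζ : (Fin r → Fin n → ℂ) →ₗ[ℂ] Fin n → ℂ := ∑ i, z i • LinearMap.proj i
  have hζ : ∀ y, ζ y = ∑ i, z i • y i := fun y => by simp [ζ]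
  let φ : Forms n a →ₗ[ℂ] (Fin r → ℂ) × ((Fin n → ℂ) ⧸ S) :=
    valO.prod (S.mkQ.comp (ζ.comp jacO))
  have h1 := finrank_add_le_of_le_ker (V := Forms n a) (φ := φ) (fun y => by
    obtain ⟨y, w⟩ := y
    obtain ⟨w, rfl⟩ := S.mkQ_surjective w
    refine ⟨powForms a y + linForms ha (Pi.single i₀ ((z i₀)⁻¹ • w)), ?_⟩
    rw [map_add]
    refine Prod.ext ?_ ?_
    · change valO _ + valO _ = y
      rw [valO_powForms, valO_linForms, add_zero]
    change S.mkQ (ζ (jacO _)) + S.mkQ (ζ (jacO _)) = S.mkQ w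
    rw [jacO_powForms, jacO_linForms, map_zero, map_zero, zero_add]
    rw [hζ, Finset.sum_eq_single i₀ (fun i _ hi => by simp [hi]) (by simp)]
    simp [hi₀]) (S := diffRangeAt (basePoint n) h k) fun F hF => by
      obtain ⟨_, ⟨g, hg, rfl⟩, x, hx, rfl⟩ := Submodule.mem_sup.1 hF
      rw [← range_mulForms] at hx
      obtain ⟨A, rfl⟩ := hx
      have hg0 := valO_eq_zero_iff.2 hg
      refine Prod.ext ?_ ?_
      · change valO (_ + _) = 0
        rw [map_add]
        ext i
        simp only [Pi.add_apply, LinearMap.flip_apply, valO_mulForms, hk0, hg0]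
        simp
      · change S.mkQ (ζ (jacO (_ + _))) = 0
        rw [Submodule.mkQ_apply, Submodule.Quotient.mk_eq_zero, map_add, map_add]
        refine add_mem ?_ ?_
        · rw [hζ]
          simp only [jacO_mulForms, hg0, Pi.zero_apply, zero_smul, add_zero, Finset.smul_sum, smul_smul]
          rw [Finset.sum_comm]
          simp only [← Finset.sum_smul, hz, zero_smul, Finset.sum_const_zero]
          exact zero_mem _
        · rw [hζ]
          refine sum_mem fun i _ => Submodule.smul_mem _ _ ?_
          rw [LinearMap.flip_apply, jacO_mulForms]
          refine sum_mem fun j _ => ?_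
          rw [hk0, Pi.zero_apply, zero_smul, add_zero]
          exact Submodule.smul_mem _ _ (Submodule.subset_span ⟨j, rfl⟩)
  have h2 := finrank_quotient_span_range hk
  have h3 : Module.finrank ℂ ((Fin r → ℂ) × ((Fin n → ℂ) ⧸ S)) = r + (n - s) := by
    rw [Module.finrank_prod, Module.finrank_fintype_fun_eq_card, Fintype.card_fin]
    change r + Module.finrank ℂ ((Fin n → ℂ) ⧸ Submodule.span ℂ (Set.range (jacO k))) = _
    omega
  rwa [h3] at h1

end BasePoint

end

noncomputable section

open MvPolynomial

attribute [local instance] MvPolynomial.gradedAlgebra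

/-! ### Dominance of bilinear maps restricted to subspaces -/

section BilinearDominance

variable {V M W : Type} [AddCommGroup V] [Module ℂ V] [AddCommGroup M] [Module ℂ M]
  [AddCommGroup W] [Module ℂ W]

/-- The differential of `(v, A) ↦ B A v`. -/
def bilinDiff (B : M →ₗ[ℂ] V →ₗ[ℂ] W) : V × M →ₗ[ℂ] V × M →ₗ[ℂ] W :=
  LinearMap.mk₂ ℂ (fun x y => B x.2 y.1 + B y.2 x.1)
    (fun x x' y => by simp; abel) (fun z x y => by simp) (fun x y y' => by simp; abel)
    (fun z x y => by simp)

theorem bilinDiff_apply (B : M →ₗ[ℂ] V →ₗ[ℂ] W) (x y : V × M) :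
    bilinDiff B x y = B x.2 y.1 + B y.2 x.1 := rfl

/-- The differential of `(v, A) ↦ B A v`, restricted to subspaces. -/
def bilinDiffRestrict (B : M →ₗ[ℂ] V →ₗ[ℂ] W) {A : Submodule ℂ (V × M)} {E : Submodule ℂ W}
    (h : ∀ x ∈ A, ∀ y ∈ A, bilinDiff B x y ∈ E) : A →ₗ[ℂ] A →ₗ[ℂ] E :=
  LinearMap.mk₂ ℂ (fun x y => ⟨bilinDiff B x y, h x x.2 y y.2⟩)
    (fun x x' y => Subtype.ext (by simp)) (fun z x y => Subtype.ext (by simp))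
    (fun x y y' => Subtype.ext (by simp)) (fun z x y => Subtype.ext (by simp))

theorem surjective_bilinDiffRestrict_iff (B : M →ₗ[ℂ] V →ₗ[ℂ] W) {A : Submodule ℂ (V × M)}
    {E : Submodule ℂ W} (h : ∀ x ∈ A, ∀ y ∈ A, bilinDiff B x y ∈ E) (x : A) :
    Function.Surjective (bilinDiffRestrict B h x) ↔ ∀ F ∈ E, ∃ y ∈ A, bilinDiff B x y = F := by
  constructor
  · intro H F hF
    obtain ⟨y, hy⟩ := H ⟨F, hF⟩
    exact ⟨y, y.2, congrArg Subtype.val hy⟩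
  · rintro H ⟨F, hF⟩
    obtain ⟨y, hy, e⟩ := H F hF
    exact ⟨⟨y, hy⟩, Subtype.ext e⟩

variable [FiniteDimensional ℂ V] [FiniteDimensional ℂ M] [FiniteDimensional ℂ W]

theorem zopen_bilinDiff_surjective (B : M →ₗ[ℂ] V →ₗ[ℂ] W) {A : Submodule ℂ (V × M)}
    {E : Submodule ℂ W} (h : ∀ x ∈ A, ∀ y ∈ A, bilinDiff B x y ∈ E) :
    ZOpen {x : A | ∀ F ∈ E, ∃ y ∈ A, bilinDiff B x y = F} := by
  convert zopen_surjective (isPolyMap_hom (bilinDiffRestrict B h)) using 3 with x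
  exact (surjective_bilinDiffRestrict_iff B h x).symm

theorem bilin_dominant_iff (B : M →ₗ[ℂ] V →ₗ[ℂ] W) {A : Submodule ℂ (V × M)} {E : Submodule ℂ W}
    (hA : ∀ x ∈ A, B x.2 x.1 ∈ E) (h : ∀ x ∈ A, ∀ y ∈ A, bilinDiff B x y ∈ E) :
    (∀ O : Set W, ZOpen O → (∃ w ∈ E, w ∈ O) → ∃ x ∈ A, B x.2 x.1 ∈ O) ↔
      ∃ x : A, ∀ F ∈ E, ∃ y ∈ A, bilinDiff B x y = F := by
  let Ψ : A → E := fun x => ⟨B x.1.2 x.1.1, hA x x.2⟩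
  -- A linear retraction of `W` onto `E` carries open sets of `E` to open sets of `W`.
  obtain ⟨π, hπ⟩ := LinearMap.exists_leftInverse_of_injective E.subtype E.ker_subtype
  have hπ' : ∀ w : E, π w = w := fun w => congrArg (fun f => f w) hπ
  have h1 : HasQuadraticDifferential Ψ (fun x => bilinDiffRestrict B h x) := fun x y =>
    ⟨⟨B y.1.2 y.1.1, hA y y.2⟩, fun t => Subtype.ext (by
      change B (x.1.2 + t • y.1.2) (x.1.1 + t • y.1.1) = B x.1.2 x.1.1 +
        t • (B x.1.2 y.1.1 + B y.1.2 x.1.1) + t ^ 2 • B y.1.2 y.1.1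
      simp only [map_add, map_smul, LinearMap.add_apply, LinearMap.smul_apply]
      module)⟩
  have h2 : IsPolyMap (fun x : A => B x.1.2 x.1.1) :=
    IsPolyMap.bilin B (A.subtype.isPolyMap.snd) (A.subtype.isPolyMap.fst)
  have h3 : IsPolyMap Ψ := by
    have : Ψ = fun x => π (B x.1.2 x.1.1) := funext fun x => (hπ' (Ψ x)).symm
    rw [this]
    exact h2.linear π
  rw [← exists_congr fun x => surjective_bilinDiffRestrict_iff B h x,
    ← h1.dominant_iff h3 (isPolyMap_hom (bilinDiffRestrict B h))]
  constructor
  · intro H O hO ⟨w, hw⟩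
    obtain ⟨x, hx, hxO⟩ := H (π ⁻¹' O) (hO.preimage π.isPolyMap) ⟨w, w.2, by
      change π w ∈ O
      rwa [hπ']⟩
    refine ⟨⟨x, hx⟩, ?_⟩
    have h4 : π (Ψ ⟨x, hx⟩) ∈ O := hxO
    rwa [hπ'] at h4
  · rintro H O hO ⟨w, hw, hwO⟩
    obtain ⟨x, hx⟩ := H (E.subtype ⁻¹' O) (hO.preimage E.subtype.isPolyMap) ⟨⟨w, hw⟩, hwO⟩
    exact ⟨x, x.2, hx⟩

end BilinearDominance

/-! ### Pairs `(k, h)` whose last product is singular at `o`, and the attained bounds -/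

section SingularParameters

variable {n s r l : ℕ} {b : Fin s → ℕ} {a : Fin (r + 1) → ℕ}

/-- The pairs `(k, h)` such that `k` and the last row of `h` vanish at `(1, 0, …, 0)`. -/
def singParams (n : ℕ) (b : Fin s → ℕ) (a : Fin (r + 1) → ℕ) :
    Submodule ℂ (Forms n b × FormMatrix n a b) :=
  LinearMap.ker ((valO.comp (LinearMap.fst ℂ _ _)).prod
    ((LinearMap.proj (Fin.last r)).comp (matValO.comp (LinearMap.snd ℂ _ _))))

theorem mem_singParams {x : Forms n b × FormMatrix n a b} :
    x ∈ singParams n b a ↔ valO x.1 = 0 ∧ matValO x.2 (Fin.last r) = 0 :=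
  Prod.ext_iff

/-- The forms that vanish at `(1, 0, …, 0)` and the last of which is singular there. -/
def singForms (n : ℕ) (a : Fin (r + 1) → ℕ) : Submodule ℂ (Forms n a) :=
  LinearMap.ker ((valO).prod ((LinearMap.proj (Fin.last r)).comp jacO))

theorem mem_singForms {F : Forms n a} :
    F ∈ singForms n a ↔ valO F = 0 ∧ jacO F (Fin.last r) = 0 :=
  Prod.ext_iff

theorem mulForms_mem_singForms {x y : Forms n b × FormMatrix n a b} (hx : x ∈ singParams n b a)
    (hy : y ∈ singParams n b a) : mulForms a b x.2 y.1 ∈ singForms n a := by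
  rw [mem_singParams] at hx hy
  rw [mem_singForms]
  constructor
  · ext i
    simp [valO_mulForms, hy.1]
  · simp [jacO_mulForms, hy.1, hx.2]

theorem bilinDiff_mem_singForms (x : Forms n b × FormMatrix n a b) (hx : x ∈ singParams n b a)
    (y : Forms n b × FormMatrix n a b) (hy : y ∈ singParams n b a) :
    bilinDiff (V := Forms n b) (M := FormMatrix n a b) (W := Forms n a) (mulForms a b) x y ∈
      singForms n a :=
  add_mem (mulForms_mem_singForms hx hy) (mulForms_mem_singForms hy hx)

/-- The linear map that describes the leading terms of the differential of `(k, h) ↦ h k` on the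
directions `(γ_j x₀^(b_j))` and `(δ_j x₀^(a_r - b_j))`. -/
def leadingMap (n s r : ℕ) : (Fin s → Fin n → ℂ) × (Fin (r + 1) → Fin s → ℂ) ×
    (Fin (r + 1) → Fin s → Fin n → ℂ) →ₗ[ℂ]
      (Fin s → ℂ) × (Fin s → ℂ) →ₗ[ℂ] (Fin r → ℂ) × (Fin n → ℂ) :=
  LinearMap.mk₂ ℂ (fun x y => (fun i => ∑ j, x.2.1 i.castSucc j * y.1 j,
      ∑ j, (y.1 j • x.2.2 (Fin.last r) j + y.2 j • x.1 j)))
    (fun x x' y => Prod.ext (by ext i; simp [add_mul, Finset.sum_add_distrib])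
      (by simp [Finset.sum_add_distrib]; abel))
    (fun z x y => Prod.ext (by ext i; simp [Finset.mul_sum, mul_assoc])
      (by simp [Finset.sum_add_distrib, Finset.smul_sum, smul_comm z]))
    (fun x y y' => Prod.ext (by ext i; simp [mul_add, Finset.sum_add_distrib])
      (by simp [Finset.sum_add_distrib, add_smul]; abel))
    (fun z x y => Prod.ext (by ext i; simp [Finset.mul_sum, mul_left_comm])
      (by simp [Finset.sum_add_distrib, Finset.smul_sum, mul_smul]))

/-- The values and partial derivatives at `(1, 0, …, 0)` of a pair `(k, h)`. -/
def localData : Forms n b × FormMatrix n a b →ₗ[ℂ] (Fin s → Fin n → ℂ) ×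
    (Fin (r + 1) → Fin s → ℂ) × (Fin (r + 1) → Fin s → Fin n → ℂ) :=
  (jacO.comp (LinearMap.fst ℂ _ _)).prod
    ((matValO.comp (LinearMap.snd ℂ _ _)).prod (matJacO.comp (LinearMap.snd ℂ _ _)))

theorem leadingMap_localData (x : Forms n b × FormMatrix n a b) (γ δ : Fin s → ℂ) :
    leadingMap n s r (localData x) (γ, δ) = (fun i => ∑ j, matValO x.2 i.castSucc j * γ j,
      ∑ j, (γ j • matJacO x.2 (Fin.last r) j + δ j • jacO x.1 j)) := rfl

/-- Choose `∂k_j = e_j`, let row `i` of `h(o)` be the unit vector at `σ(i)`, and let the last row of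
`h` have gradient `e_(s+q)` at `σ(q)`. Then `δ` reaches the first `s` coordinates of the gradient,
the `γ` at the `σ(q)` the last `l`, and the `γ` at the `σ(i)` the values. An entry can be nonzero at
`o` only if `b_j ≤ a_i`; one that vanishes at `o` can have a nonzero gradient only if `b_j < a_i`.
-/
theorem exists_leadingMap_surjective {b : Fin s → ℕ} {a : Fin (r + 1) → ℕ} (hb : ∀ j, 1 ≤ b j)
    {σ : Fin r ⊕ Fin l → Fin s} (hσ : Function.Injective σ)
    (h1 : ∀ i, b (σ (Sum.inl i)) ≤ a i.castSucc) (h2 : ∀ q, b (σ (Sum.inr q)) < a (Fin.last r)) :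
    ∃ x ∈ singParams (s + l) b a, LinearIndependent ℂ (jacO x.1) ∧
      Function.Surjective (leadingMap (s + l) s r (localData x)) := by
  let e : Fin (s + l) → Fin (s + l) → ℂ := fun i => Pi.single i 1
  let δ : Fin (r + 1) → Fin s → ℂ :=
    Fin.snoc (α := fun _ => Fin s → ℂ) (fun i => Pi.single (σ (Sum.inl i)) 1) 0
  let ω : Fin s → Fin (s + l) → ℂ := Function.extend σ (Sum.elim 0 fun q => e (Fin.natAdd s q)) 0
  let w : Fin (r + 1) → Fin s → Fin (s + l) → ℂ := Fin.snoc (α := fun _ => Fin s → Fin (s + l) → ℂ) 0 ω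
  have hδ : ∀ i j, δ i j ≠ 0 → b j ≤ a i := by
    intro i j
    refine Fin.lastCases ?_ (fun i => ?_) i
    · simp [δ]
    · simp only [δ, Fin.snoc_castSucc]
      intro h
      have : j = σ (Sum.inl i) := by_contra fun h0 => h (by simp [h0])
      rw [this]
      exact h1 i
  have hw : ∀ i j, w i j ≠ 0 → b j < a i := by
    intro i j
    refine Fin.lastCases ?_ (fun i => ?_) i
    · simp only [w, Fin.snoc_last]
      intro h
      by_cases hj : ∃ x, σ x = j
      · obtain ⟨x, rfl⟩ := hj
        rw [show ω (σ x) = _ from hσ.extend_apply _ _ _] at h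
        rcases x with i | q
        · exact absurd rfl h
        · exact h2 q
      · exact absurd (Function.extend_apply' _ _ _ hj) h
    · simp [w]
  refine ⟨(linForms hb fun j => e (Fin.castAdd l j), powMatrix (s + l) a b δ + linMatrix a b w), ?_, ?_, ?_⟩
  · rw [mem_singParams]
    refine ⟨valO_linForms hb _, ?_⟩
    rw [map_add, matValO_powMatrix hδ, matValO_linMatrix]
    simp [δ]
  · rw [jacO_linForms]
    have := (Pi.basisFun ℂ (Fin (s + l))).linearIndependent.comp _ (Fin.castAdd_injective s l)
    convert this using 1
    ext1 j
    simp [e]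
  · rintro ⟨y, z⟩
    let γ : Fin s → ℂ := Function.extend σ (Sum.elim y fun q => z (Fin.natAdd s q)) 0
    refine ⟨(γ, fun j => z (Fin.castAdd l j)), ?_⟩
    rw [leadingMap_localData]
    simp only [map_add, matValO_powMatrix hδ, matValO_linMatrix, matJacO_powMatrix,
      matJacO_linMatrix hw, add_zero, zero_add, jacO_linForms]
    refine Prod.ext ?_ ?_
    · ext i
      simp only [δ, Fin.snoc_castSucc]
      rw [Finset.sum_eq_single (σ (Sum.inl i)) (fun j _ hj => by simp [hj]) (by simp)]
      rw [Pi.single_eq_same, one_mul]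
      exact hσ.extend_apply _ _ _
    · simp only [w, Fin.snoc_last, Finset.sum_add_distrib]
      rw [← Fintype.sum_of_injective σ hσ (fun x => γ (σ x) • ω (σ x)) _ (fun j hj => by
        rw [show ω j = _ from Function.extend_apply' _ _ _ (by simpa using hj)]
        simp) (fun x => rfl), Fintype.sum_sum_type]
      have h3 : ∀ x, γ (σ x) • ω (σ x) = (Sum.elim y fun q => z (Fin.natAdd s q)) x •
          (Sum.elim 0 fun q => e (Fin.natAdd s q) : Fin r ⊕ Fin l → _) x := fun x => by
        rw [show γ (σ x) = _ from hσ.extend_apply _ _ _, show ω (σ x) = _ from hσ.extend_apply _ _ _]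
      simp only [h3, Sum.elim_inl, Sum.elim_inr, Pi.zero_apply, smul_zero, Finset.sum_const_zero, zero_add]
      have h4 := Fin.sum_univ_add fun i => z i • e i
      rw [show ∑ i, z i • e i = z from (pi_eq_sum_univ' z).symm] at h4
      exact (add_comm _ _).trans h4.symm

theorem bilinDiff_mem_diffRange (x y : Forms n b × FormMatrix n a b) :
    bilinDiff (V := Forms n b) (M := FormMatrix n a b) (W := Forms n a) (mulForms a b) x y ∈
      diffRange x.2 x.1 :=
  Submodule.add_mem_sup ⟨y.1, rfl⟩ (by
    rw [← range_mulForms]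
    exact ⟨y.2, rfl⟩)

theorem bilinDiff_mem_diffRangeAt (x : Forms n b × FormMatrix n a b)
    {y : Forms n b × FormMatrix n a b} (hy : valO y.1 = 0) :
    bilinDiff (V := Forms n b) (M := FormMatrix n a b) (W := Forms n a) (mulForms a b) x y ∈
      diffRangeAt (basePoint n) x.2 x.1 :=
  Submodule.add_mem_sup ⟨y.1, valO_eq_zero_iff.1 hy, rfl⟩ (by
    rw [← range_mulForms]
    exact ⟨y.2, rfl⟩)

/-- The direction is `γ_j x₀^(b_j)` for `k` and `δ_j x₀^(a_r - b_j)` for the last row of `h`. Pure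
powers of `x₀` have zero gradient at `o`, so only the leading terms survive. -/
theorem exists_leading_direction (hba : ∀ j, b j ≤ a (Fin.last r))
    {x : Forms n b × FormMatrix n a b} (hx : x ∈ singParams n b a) (γ δ : Fin s → ℂ) :
    ∃ y : Forms n b × FormMatrix n a b, valO y.1 = γ ∧
      ∀ F, F = bilinDiff (V := Forms n b) (M := FormMatrix n a b) (W := Forms n a) (mulForms a b) x y →
        (∀ i, valO F (Fin.castSucc i) = (leadingMap n s r (localData x) (γ, δ)).1 i) ∧
        valO F (Fin.last r) = 0 ∧ jacO F (Fin.last r) = (leadingMap n s r (localData x) (γ, δ)).2 := by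
  rw [mem_singParams] at hx
  have hδ : ∀ i j, (Fin.snoc (α := fun _ => Fin s → ℂ) 0 δ : Fin (r + 1) → Fin s → ℂ) i j ≠ 0 →
      b j ≤ a i := by
    intro i j
    refine Fin.lastCases (fun _ => hba j) (fun i h => ?_) i
    simp at h
  refine ⟨(powForms b γ, powMatrix n a b (Fin.snoc (α := fun _ => Fin s → ℂ) 0 δ)),
    valO_powForms γ, ?_⟩
  rintro F rfl
  rw [bilinDiff_apply, map_add, map_add, leadingMap_localData]
  simp only [Pi.add_apply, valO_mulForms, jacO_mulForms, hx.1, hx.2, valO_powForms, jacO_powForms,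
    matValO_powMatrix hδ, matJacO_powMatrix, Pi.zero_apply, mul_zero, zero_mul, smul_zero,
    Finset.sum_const_zero, add_zero, zero_add, Fin.snoc_last, Finset.sum_add_distrib]
  simp

section Generic

variable {x : Forms n b × FormMatrix n a b}

/-- Any `F` with `F_r(o) = 0` is corrected by a leading direction to an element of `singForms`,
which `hD` puts in the image. -/
theorem finrank_le_diffRange_add_one (hba : ∀ j, b j ≤ a (Fin.last r)) (hx : x ∈ singParams n b a)
    (hD : ∀ F ∈ singForms n a, ∃ y ∈ singParams n b a,
      bilinDiff (V := Forms n b) (M := FormMatrix n a b) (W := Forms n a) (mulForms a b) x y = F)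
    (hL : Function.Surjective (leadingMap n s r (localData x))) :
    (∀ F : Forms n a, valO F (Fin.last r) = 0 → F ∈ diffRange x.2 x.1) ∧
      Module.finrank ℂ (Forms n a) ≤ Module.finrank ℂ (diffRange x.2 x.1) + 1 := by
  have h1 : ∀ F : Forms n a, valO F (Fin.last r) = 0 → F ∈ diffRange x.2 x.1 := by
    intro F hF
    obtain ⟨⟨γ, δ⟩, hγ⟩ := hL (fun i => valO F i.castSucc, jacO F (Fin.last r))
    obtain ⟨y, -, hy⟩ := exists_leading_direction hba hx γ δ
    obtain ⟨h1, h2, h3⟩ := hy _ rfl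
    rw [hγ] at h1 h3
    obtain ⟨y', -, hy'⟩ := hD (F - bilinDiff (V := Forms n b) (M := FormMatrix n a b)
      (W := Forms n a) (mulForms a b) x y) (by
        rw [mem_singForms, map_sub, map_sub, Pi.sub_apply, h3, sub_self]
        refine ⟨funext fun i => ?_, rfl⟩
        rw [Pi.sub_apply]
        refine Fin.lastCases ?_ (fun i => ?_) i
        · rw [h2, hF, sub_self]
          rfl
        · rw [h1, sub_self]
          rfl)
    rw [← sub_add_cancel F (bilinDiff (V := Forms n b) (M := FormMatrix n a b)
      (W := Forms n a) (mulForms a b) x y), ← hy']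
    exact add_mem (bilinDiff_mem_diffRange x y') (bilinDiff_mem_diffRange x y)
  refine ⟨h1, ?_⟩
  have h2 := finrank_le_add_of_ker_le (V := Forms n a)
    (φ := (LinearMap.proj (Fin.last r) : (Fin (r + 1) → ℂ) →ₗ[ℂ] ℂ).comp valO)
    (S := diffRange x.2 x.1) h1
  simpa using h2

/-- The same correction with `γ = 0`: if `F(o) = 0` and `∂F_r` is a combination of the `∂k_j`, the
coefficients `δ` bring `F` into `singForms`. -/
theorem finrank_le_diffRangeAt_add (hba : ∀ j, b j ≤ a (Fin.last r)) (hx : x ∈ singParams n b a)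
    (hk : LinearIndependent ℂ (jacO x.1))
    (hD : ∀ F ∈ singForms n a, ∃ y ∈ singParams n b a,
      bilinDiff (V := Forms n b) (M := FormMatrix n a b) (W := Forms n a) (mulForms a b) x y = F) :
    Module.finrank ℂ (Forms n a) ≤
      Module.finrank ℂ (diffRangeAt (basePoint n) x.2 x.1) + (r + 1 + (n - s)) := by
  let S := Submodule.span ℂ (Set.range (jacO x.1))
  let φ : Forms n a →ₗ[ℂ] (Fin (r + 1) → ℂ) × ((Fin n → ℂ) ⧸ S) :=
    valO.prod (S.mkQ.comp ((LinearMap.proj (Fin.last r)).comp jacO))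
  have h1 := finrank_le_add_of_ker_le (V := Forms n a) (φ := φ)
    (S := diffRangeAt (basePoint n) x.2 x.1) fun F hF => by
      have hF0 : valO F = 0 := congrArg Prod.fst hF
      have hF1 : S.mkQ (jacO F (Fin.last r)) = 0 := congrArg Prod.snd hF
      rw [Submodule.mkQ_apply, Submodule.Quotient.mk_eq_zero, Submodule.mem_span_range_iff_exists_fun] at hF1
      obtain ⟨δ, hδ⟩ := hF1
      obtain ⟨y, hy0, hy⟩ := exists_leading_direction hba hx 0 δ
      obtain ⟨h1, h2, h3⟩ := hy _ rfl
      rw [leadingMap_localData] at h1 h3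
      obtain ⟨y', hy1', hy'⟩ := hD (F - bilinDiff (V := Forms n b) (M := FormMatrix n a b)
        (W := Forms n a) (mulForms a b) x y) (by
          rw [mem_singForms, map_sub, map_sub, Pi.sub_apply, h3, ← hδ]
          refine ⟨funext fun i => ?_, by simp⟩
          rw [Pi.sub_apply, hF0]
          refine Fin.lastCases ?_ (fun i => ?_) i
          · rw [h2]
            simp
          · rw [h1]
            simp)
      rw [← sub_add_cancel F (bilinDiff (V := Forms n b) (M := FormMatrix n a b)
        (W := Forms n a) (mulForms a b) x y), ← hy']
      exact add_mem (bilinDiff_mem_diffRangeAt x (mem_singParams.1 hy1').1)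
        (bilinDiff_mem_diffRangeAt x hy0)
  have h2 := finrank_quotient_span_range hk
  have h3 : Module.finrank ℂ ((Fin (r + 1) → ℂ) × ((Fin n → ℂ) ⧸ S)) = r + 1 + (n - s) := by
    rw [Module.finrank_prod, Module.finrank_fintype_fun_eq_card, Fintype.card_fin]
    change r + 1 + Module.finrank ℂ ((Fin n → ℂ) ⧸ Submodule.span ℂ (Set.range (jacO x.1))) = _
    omega
  rwa [h3] at h1

/-- `leadingMap` goes from dimension `2s` to dimension `r + n`, so it has a kernel vector `(γ, δ)`;
independence of the `∂k_j` forces `γ ≠ 0`. The corresponding direction maps into `singForms`, and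
the correction from `hD` vanishes at `o`, so `γ` is unchanged. -/
theorem exists_ker_bilinDiff (hba : ∀ j, b j ≤ a (Fin.last r)) (hrns : r + n < s + s)
    (hx : x ∈ singParams n b a) (hk : LinearIndependent ℂ (jacO x.1))
    (hD : ∀ F ∈ singForms n a, ∃ y ∈ singParams n b a,
      bilinDiff (V := Forms n b) (M := FormMatrix n a b) (W := Forms n a) (mulForms a b) x y = F) :
    ∃ y, bilinDiff (V := Forms n b) (M := FormMatrix n a b) (W := Forms n a) (mulForms a b) x y = 0 ∧
      valO y.1 ≠ 0 := by
  obtain ⟨⟨γ, δ⟩, h0, hne⟩ : ∃ y, leadingMap n s r (localData x) y = 0 ∧ y ≠ 0 := by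
    have h1 := LinearMap.ker_ne_bot_of_finrank_lt (f := leadingMap n s r (localData x))
      (by simpa using hrns)
    obtain ⟨y, hy, hne⟩ := Submodule.exists_mem_ne_zero_of_ne_bot h1
    exact ⟨y, hy, hne⟩
  have hγ : γ ≠ 0 := by
    rintro rfl
    have h1 := congrArg Prod.snd h0
    rw [leadingMap_localData] at h1
    have h2 : δ = 0 := funext (Fintype.linearIndependent_iff.1 hk δ (by simpa using h1))
    exact hne (by rw [h2]; rfl)
  obtain ⟨y, hy0, hy⟩ := exists_leading_direction hba hx γ δ
  obtain ⟨h1, h2, h3⟩ := hy _ rfl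
  rw [h0] at h1 h3
  obtain ⟨y', hy1', hy'⟩ := hD (bilinDiff (V := Forms n b) (M := FormMatrix n a b)
    (W := Forms n a) (mulForms a b) x y) (by
      rw [mem_singForms]
      refine ⟨funext fun i => ?_, h3⟩
      refine Fin.lastCases ?_ (fun i => ?_) i
      · rw [h2, Pi.zero_apply]
      · rw [h1, Pi.zero_apply, Prod.fst_zero, Pi.zero_apply])
  refine ⟨y - y', ?_, ?_⟩
  · rw [map_sub, hy', sub_self]
  · rw [Prod.fst_sub, map_sub, (mem_singParams.1 hy1').1, sub_zero, hy0]
    exact hγ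

end Generic

end SingularParameters

end

noncomputable section

open MvPolynomial

attribute [local instance] MvPolynomial.gradedAlgebra

/-! ### Perturbing a linear map of corank one -/

section Perturbation

variable {V W : Type} [AddCommGroup V] [Module ℂ V] [AddCommGroup W] [Module ℂ W]
  [FiniteDimensional ℂ V] [FiniteDimensional ℂ W]

/-- With `D₁ y` as an additional column `D₀` becomes onto, hence so does `D₀ + t D₁` for general
`t`. For `t ≠ 0` the column is redundant, because `(D₀ + t D₁) y = t D₁ y`. -/
theorem exists_surjective_perturbation {D₀ D₁ : V →ₗ[ℂ] W} {ℓ : W →ₗ[ℂ] ℂ}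
    (hℓ : ∀ F, ℓ F = 0 → ∃ x, D₀ x = F) {y : V} (hy : D₀ y = 0) (hy1 : ℓ (D₁ y) ≠ 0) :
    ∃ t : ℂ, Function.Surjective (D₀ + t • D₁) := by
  let L : ℂ → (V × ℂ →ₗ[ℂ] W) := fun t => D₀.coprod (LinearMap.toSpanSingleton ℂ W (D₁ y)) +
    t • D₁.comp (LinearMap.fst ℂ V ℂ)
  have hL : IsPolyMap L := (isPolyMap_const _).add
    (IsPolyMap.smul (dual_mem_polyFun LinearMap.id) (isPolyMap_const _))
  have h0 : Function.Surjective (L 0) := by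
    intro F
    obtain ⟨x, hx⟩ := hℓ (F - (ℓ F / ℓ (D₁ y)) • D₁ y) (by
      rw [map_sub, map_smul, smul_eq_mul, div_mul_cancel₀ _ hy1, sub_self])
    refine ⟨(x, ℓ F / ℓ (D₁ y)), ?_⟩
    simp [L, hx]
  obtain ⟨t, ht, ht0⟩ := (zopen_surjective hL).nonempty_inter
    (zopen_ne_zero (dual_mem_polyFun (LinearMap.id : Module.Dual ℂ ℂ))) ⟨0, h0⟩ ⟨1, one_ne_zero⟩
  refine ⟨t, fun F => ?_⟩
  obtain ⟨⟨x, c⟩, hx⟩ := ht F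
  refine ⟨x + (c * t⁻¹) • y, ?_⟩
  rw [← hx]
  have ht0' : t ≠ 0 := ht0
  have h1 : (c * t⁻¹) • t • D₁ y = c • D₁ y := by
    rw [smul_smul]
    congr 1
    field_simp
  simp only [L, LinearMap.add_apply, LinearMap.smul_apply, map_add, map_smul, hy,
    LinearMap.coprod_apply, LinearMap.toSpanSingleton_apply, LinearMap.comp_apply, LinearMap.fst_apply,
    smul_add, smul_zero, h1]
  abel

end Perturbation

/-! ### Dominance of `ρ` -/

section Dominance

variable {n s r : ℕ} {b : Fin s → ℕ} {a : Fin (r + 1) → ℕ}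

/-- The matrix whose only non-zero entry is a power of `x₀` in the last row. -/
def lastRowPow (n : ℕ) (b : Fin s → ℕ) (a : Fin (r + 1) → ℕ) (j : Fin s) : FormMatrix n a b :=
  powMatrix n a b (Fin.snoc (α := fun _ => Fin s → ℂ) 0 (Pi.single j 1))

theorem valO_lastRowPow (hba : ∀ j, b j ≤ a (Fin.last r)) (j : Fin s) (g : Forms n b) :
    valO (mulForms a b (lastRowPow n b a j) g) (Fin.last r) = valO g j := by
  have hδ : ∀ i j', (Fin.snoc (α := fun _ => Fin s → ℂ) 0 (Pi.single j 1) :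
      Fin (r + 1) → Fin s → ℂ) i j' ≠ 0 → b j' ≤ a i := by
    intro i j'
    refine Fin.lastCases (fun _ => hba j') (fun i h => ?_) i
    simp at h
  rw [valO_mulForms, lastRowPow, matValO_powMatrix hδ, Fin.snoc_last,
    Finset.sum_eq_single j (fun i _ hi => by simp [hi]) (by simp)]
  simp

theorem bilinDiff_smul_right {V M W : Type} [AddCommGroup V] [Module ℂ V] [AddCommGroup M] [Module ℂ M]
    [AddCommGroup W] [Module ℂ W] (B : M →ₗ[ℂ] V →ₗ[ℂ] W) (x : V × M) (t : ℂ) (A : M) :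
    bilinDiff B (x + t • (0, A)) = bilinDiff B x + t • (B A).comp (LinearMap.fst ℂ V M) := by
  refine LinearMap.ext fun y => ?_
  simp [bilinDiff_apply]

/-- At `x` the differential reaches the hyperplane `F_r(o) = 0`. A power of `x₀` in column `j` of
the last row supplies the missing direction, applied to a kernel vector whose component `j` does not
vanish at `o`. -/
theorem exists_bilinDiff_surjective (hba : ∀ j, b j ≤ a (Fin.last r)) (hrns : r + n < s + s)
    {x : Forms n b × FormMatrix n a b} (hx : x ∈ singParams n b a)
    (hk : LinearIndependent ℂ (jacO x.1))
    (hD : ∀ F ∈ singForms n a, ∃ y ∈ singParams n b a,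
      bilinDiff (V := Forms n b) (M := FormMatrix n a b) (W := Forms n a) (mulForms a b) x y = F)
    (hL : Function.Surjective (leadingMap n s r (localData x))) :
    ∃ x', Function.Surjective
      (bilinDiff (V := Forms n b) (M := FormMatrix n a b) (W := Forms n a) (mulForms a b) x') := by
  obtain ⟨y, hy, hy0⟩ := exists_ker_bilinDiff hba hrns hx hk hD
  obtain ⟨j, hj⟩ := Function.ne_iff.1 hy0
  obtain ⟨t, ht⟩ := exists_surjective_perturbation
    (V := Forms n b × FormMatrix n a b) (W := Forms n a)
    (D₀ := bilinDiff (V := Forms n b) (M := FormMatrix n a b) (W := Forms n a) (mulForms a b) x)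
    (D₁ := (mulForms a b (lastRowPow n b a j)).comp (LinearMap.fst ℂ _ _))
    (ℓ := (LinearMap.proj (Fin.last r) : (Fin (r + 1) → ℂ) →ₗ[ℂ] ℂ).comp valO)
    (fun F hF => by
      obtain ⟨_, ⟨g, rfl⟩, z, hz, rfl⟩ := Submodule.mem_sup.1
        ((finrank_le_diffRange_add_one hba hx hD hL).1 F hF)
      rw [← range_mulForms] at hz
      obtain ⟨A, rfl⟩ := hz
      exact ⟨(g, A), rfl⟩) hy (by
      change valO (mulForms a b (lastRowPow n b a j) y.1) (Fin.last r) ≠ 0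
      rw [valO_lastRowPow hba]
      exact hj)
  refine ⟨x + t • (0, lastRowPow n b a j), ?_⟩
  rw [bilinDiff_smul_right (V := Forms n b) (M := FormMatrix n a b) (W := Forms n a)]
  exact ht

theorem denseRange_rho {r : ℕ} {a : Fin r → ℕ} (hb : ∀ j, 1 ≤ b j) (hs : s ≤ n + 1) (ha : ∀ i, 1 ≤ a i)
    (hr : r ≤ n + 1) {x : Forms n b × FormMatrix n a b} (hx : Function.Surjective
      (bilinDiff (V := Forms n b) (M := FormMatrix n a b) (W := Forms n a) (mulForms a b) x))
    {k : Forms n b} (hk : IsCI k) : DenseRange (rho : FlagVariety n b a → CIParam n a) := by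
  have hdom := (bilin_dominant_iff (V := Forms n b) (M := FormMatrix n a b) (W := Forms n a)
    (mulForms a b) (A := ⊤) (E := ⊤) (fun _ _ => trivial) (fun _ _ _ _ => trivial)).2
    ⟨⟨x, trivial⟩, fun F _ => by
      obtain ⟨y, hy⟩ := hx F
      exact ⟨y, trivial, hy⟩⟩
  refine dense_iff_inter_open.2 fun U hU hne => ?_
  obtain ⟨u, hu⟩ := hne
  obtain ⟨O, hO, hOU⟩ := CIParam.exists_zopen hU
  obtain ⟨f, hf, hfu⟩ := u.exists_forms
  obtain ⟨y, -, hyO, hyCI⟩ := hdom (O ∩ {f | IsCI f}) (hO.inter (zopen_isCI ha hr))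
    ⟨f, trivial, (hOU f u hfu).2 hu, hf⟩
  have h1 : IsPolyMap (fun y : Forms n b × FormMatrix n a b => mulForms a b y.2 y.1) :=
    IsPolyMap.bilin (V := FormMatrix n a b) (W := Forms n b) (X := Forms n a) (mulForms a b)
      isPolyMap_id.snd isPolyMap_id.fst
  -- The first component of `y` need not be a complete intersection; irreducibility gives a pair for
  -- which both tuples are.
  obtain ⟨z, ⟨hzO, hzCI⟩, hzk⟩ := ((hO.inter (zopen_isCI ha hr)).preimage h1).nonempty_inter
    ((zopen_isCI hb hs).preimage (isPolyMap_id (V := Forms n b × FormMatrix n a b)).fst)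
    ⟨y, hyO, hyCI⟩ ⟨(k, 0), hk⟩
  exact ⟨CIParam.ofForms _ hzCI, (hOU _ _ rfl).1 hzO,
    ⟨CIParam.ofForms _ hzk, CIParam.ofForms _ hzCI, formIdeal_mulForms_le _ _⟩, rfl⟩

end Dominance

/-! ### The numerical conditions and the choice of indices -/

section Indices

/-- In a monotone sequence the indices where the bound is attained are the final ones, so their
number locates them. -/
theorem Monotone.eq_iff_card_le {m N : ℕ} {f : Fin m → ℕ} (hf : Monotone f) (hN : ∀ i, f i ≤ N) (i : Fin m) :
    f i = N ↔ m ≤ i + Fintype.card {i : Fin m // f i = N} := by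
  rw [Fintype.card_subtype]
  constructor
  · intro h
    have h1 : Finset.Ici i ⊆ Finset.univ.filter fun j => f j = N := fun j hj => by
      rw [Finset.mem_Ici] at hj
      rw [Finset.mem_filter]
      exact ⟨Finset.mem_univ _, le_antisymm (hN j) (h ▸ hf hj)⟩
    have h2 := Finset.card_le_card h1
    rw [Fin.card_Ici] at h2
    omega
  · intro h
    by_contra hne
    have h1 : (Finset.univ.filter fun j => f j = N) ⊆ Finset.Ioi i := fun j hj => by
      rw [Finset.mem_filter] at hj
      rw [Finset.mem_Ioi]
      by_contra hle
      have := hf (not_lt.1 hle)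
      have := hN i
      omega
    have h2 := Finset.card_le_card h1
    rw [Fin.card_Ioi] at h2
    have := i.2
    omega

theorem exists_index_embedding {r s l ta tb : ℕ} {a : Fin (r + 1) → ℕ} {b : Fin s → ℕ}
    (ha : Monotone a) (hb : Monotone b) (hrs : r + 1 ≤ s)
    (hta : ta = Fintype.card {i : Fin (r + 1) // a i = a (Fin.last r)})
    (htb : tb = Fintype.card {j : Fin s // b j = a (Fin.last r)})
    (hab : ∀ i : Fin (r + 1), b (Fin.castLE hrs i) ≤ a i) (hba : ∀ j, b j ≤ a (Fin.last r))
    (h1 : tb + l + (r + 1) ≤ s + ta) (h2 : l + (r + 1) < s) :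
    ∃ σ : Fin r ⊕ Fin l → Fin s, Function.Injective σ ∧
      (∀ i, b (σ (Sum.inl i)) ≤ a i.castSucc) ∧ ∀ q, b (σ (Sum.inr q)) < a (Fin.last r) := by
  have hta' : ta ≤ r + 1 := by
    rw [hta]
    exact (Fintype.card_subtype_le _).trans (by simp)
  have hai : ∀ i, a i = a (Fin.last r) ↔ r + 1 ≤ i + ta := fun i => by
    rw [hta]
    exact ha.eq_iff_card_le (fun i => ha (Fin.le_last i)) i
  have hbj : ∀ j, b j = a (Fin.last r) ↔ s ≤ j + tb := fun j => by
    rw [htb]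
    exact hb.eq_iff_card_le hba j
  -- Indices with `a_i < a_r` stay in place. Those with `a_i = a_r` may take any `b_j` and are
  -- shifted by `l`. The gap of length `l` from `r + 1 - ta` on is given to the `q`; it ends before
  -- the last `tb` indices by `h1`, so there `b_j < a_r`.
  refine ⟨Sum.elim (fun i => if r + 1 ≤ i + ta then ⟨i + l, by omega⟩ else ⟨i, by omega⟩)
    fun q => ⟨r + 1 - ta + q, by omega⟩, ?_, fun i => ?_, fun q => ?_⟩
  · rintro (i | q) (i' | q') h
    · simp only [Sum.elim_inl] at h
      congr 1
      split_ifs at h <;> · rw [Fin.ext_iff] at h ⊢; simp only at h; omega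
    · simp only [Sum.elim_inl, Sum.elim_inr] at h
      exfalso
      split_ifs at h <;> · rw [Fin.ext_iff] at h; simp only at h; omega
    · simp only [Sum.elim_inl, Sum.elim_inr] at h
      exfalso
      split_ifs at h <;> · rw [Fin.ext_iff] at h; simp only at h; omega
    · simp only [Sum.elim_inr, Fin.mk.injEq] at h
      congr 1
      rw [Fin.ext_iff]
      omega
  · simp only [Sum.elim_inl]
    split_ifs with h
    · rw [(hai i.castSucc).2 h]
      exact hba _
    · exact hab i.castSucc
  · refine lt_of_le_of_ne (hba _) fun h => ?_
    have := (hbj _).1 h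
    simp only [Sum.elim_inr] at this
    omega

end Indices

end

noncomputable section

open MvPolynomial

attribute [local instance] MvPolynomial.gradedAlgebra

/-! ### Linear changes of coordinates and the transport of singular points to `o` -/

section Substitution

variable {n t s r : ℕ} {c : Fin t → ℕ} {b : Fin s → ℕ} {a : Fin r → ℕ}

/-- Substitution of a linear map into a polynomial. -/
def subst (G : (Fin (n + 1) → ℂ) →ₗ[ℂ] Fin (n + 1) → ℂ) : CoordRing n →ₐ[ℂ] CoordRing n :=
  aeval fun i => ∑ j, C (G (Pi.single j 1) i) * X j

theorem eval_subst (G : (Fin (n + 1) → ℂ) →ₗ[ℂ] Fin (n + 1) → ℂ) (v : Fin (n + 1) → ℂ)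
    (q : CoordRing n) : eval v (subst G q) = eval (G v) q := by
  have h1 : ((eval v).comp (subst G).toRingHom : CoordRing n →+* ℂ) = eval (G v) := by
    ext i
    · simp
    · have h2 : G v = ∑ j, v j • G (Pi.single j 1) := by
        conv_lhs => rw [pi_eq_sum_univ' v]
        rw [map_sum]
        simp only [map_smul]
      rw [h2]
      simp [subst, mul_comm]
  exact congrArg (fun φ => φ q) h1

theorem subst_comp (G H : (Fin (n + 1) → ℂ) →ₗ[ℂ] Fin (n + 1) → ℂ) (q : CoordRing n) :
    subst G (subst H q) = subst (H.comp G) q :=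
  MvPolynomial.funext fun v => by rw [eval_subst, eval_subst, eval_subst]; rfl

theorem subst_id (q : CoordRing n) : subst LinearMap.id q = q :=
  MvPolynomial.funext fun v => by rw [eval_subst]; rfl

theorem subst_isHomogeneous (G : (Fin (n + 1) → ℂ) →ₗ[ℂ] Fin (n + 1) → ℂ) {d : ℕ} {q : CoordRing n}
    (hq : q.IsHomogeneous d) : (subst G q).IsHomogeneous d := by
  have := hq.aeval (fun i => ∑ j, C (G (Pi.single j 1) i) * X j) (n := 1) fun i =>
    IsHomogeneous.sum _ _ _ fun j _ => by
      have := (isHomogeneous_C (Fin (n + 1)) (G (Pi.single j 1) i)).mul (isHomogeneous_X ℂ j)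
      rwa [zero_add] at this
  rwa [one_mul] at this

theorem gradAt_subst (G : (Fin (n + 1) → ℂ) →ₗ[ℂ] Fin (n + 1) → ℂ) (v : Fin (n + 1) → ℂ)
    (q : CoordRing n) (i : Fin (n + 1)) :
    gradAt v (subst G q) i = ∑ j, G (Pi.single i 1) j * gradAt (G v) q j := by
  induction q using MvPolynomial.induction_on with
  | C z =>
    have h1 : ∀ w, gradAt w (C z : CoordRing n) = 0 := fun w => by ext; simp [gradAt]
    rw [show subst G (C z) = C z from (subst G).commutes z, h1, h1]
    simp
  | add p q hp hq => simp [hp, hq, mul_add, Finset.sum_add_distrib]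
  | mul_X p k hp =>
    have h1 : gradAt v (subst G (X k)) i = G (Pi.single i 1) k := by
      rw [subst, aeval_X]
      simp only [map_sum, Finset.sum_apply]
      rw [Finset.sum_eq_single i]
      · simp [gradAt]
      · intro j _ hj
        simp [gradAt, pderiv_X_of_ne hj]
      · simp
    have h2 : ∑ j, G (Pi.single i 1) j * gradAt (G v) (X k) j = G (Pi.single i 1) k := by
      rw [Finset.sum_eq_single k]
      · simp [gradAt]
      · intro j _ hj
        simp [gradAt, pderiv_X_of_ne hj.symm]
      · simp
    rw [map_mul, gradAt_mul, gradAt_mul, Pi.add_apply, Pi.smul_apply, Pi.smul_apply, hp, h1, eval_subst,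
      eval_subst]
    simp only [Pi.add_apply, Pi.smul_apply, smul_eq_mul, mul_add, Finset.sum_add_distrib]
    rw [← h2, Finset.mul_sum, Finset.mul_sum]
    congr 1 <;> exact Finset.sum_congr rfl fun j _ => by ring

/-- Substitution of a linear map into a tuple of forms. -/
def substForms (c : Fin t → ℕ) (G : (Fin (n + 1) → ℂ) →ₗ[ℂ] Fin (n + 1) → ℂ) :
    Forms n c →ₗ[ℂ] Forms n c where
  toFun f i := ⟨subst G (f i : CoordRing n), subst_isHomogeneous G (f i).2⟩
  map_add' f g := by ext1 i; exact Subtype.ext (map_add (subst G) _ _)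
  map_smul' z f := by ext1 i; exact Subtype.ext (map_smul (subst G) _ _)

theorem coe_substForms (G : (Fin (n + 1) → ℂ) →ₗ[ℂ] Fin (n + 1) → ℂ) (f : Forms n c) (i : Fin t) :
    (substForms c G f i : CoordRing n) = subst G (f i : CoordRing n) := rfl

theorem formIdeal_substForms (G : (Fin (n + 1) → ℂ) →ₗ[ℂ] Fin (n + 1) → ℂ) (f : Forms n c) :
    formIdeal (substForms c G f) = (formIdeal f).map (subst G) := by
  rw [formIdeal, formIdeal, Ideal.map_span, ← Set.range_comp]
  rfl

theorem substForms_comp_symm (G : (Fin (n + 1) → ℂ) ≃ₗ[ℂ] Fin (n + 1) → ℂ) (f : Forms n c) :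
    substForms c (G : (Fin (n + 1) → ℂ) →ₗ[ℂ] Fin (n + 1) → ℂ)
      (substForms c (G.symm : (Fin (n + 1) → ℂ) →ₗ[ℂ] Fin (n + 1) → ℂ) f) = f := by
  ext1 i
  refine Subtype.ext ?_
  rw [coe_substForms, coe_substForms, subst_comp, LinearEquiv.comp_coe, LinearEquiv.self_trans_symm]
  exact subst_id _

theorem substForms_symm_comp (G : (Fin (n + 1) → ℂ) ≃ₗ[ℂ] Fin (n + 1) → ℂ) (f : Forms n c) :
    substForms c (G.symm : (Fin (n + 1) → ℂ) →ₗ[ℂ] Fin (n + 1) → ℂ)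
      (substForms c (G : (Fin (n + 1) → ℂ) →ₗ[ℂ] Fin (n + 1) → ℂ) f) = f := by
  ext1 i
  refine Subtype.ext ?_
  rw [coe_substForms, coe_substForms, subst_comp, LinearEquiv.comp_coe, LinearEquiv.symm_trans_self]
  exact subst_id _

/-- Substitution of a linear automorphism. -/
def substEquiv (G : (Fin (n + 1) → ℂ) ≃ₗ[ℂ] Fin (n + 1) → ℂ) : CoordRing n ≃ₐ[ℂ] CoordRing n :=
  AlgEquiv.ofAlgHom (subst G.toLinearMap) (subst G.symm.toLinearMap)
    (AlgHom.ext fun q => by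
      rw [AlgHom.comp_apply, subst_comp, LinearEquiv.comp_coe, LinearEquiv.self_trans_symm]
      exact subst_id q)
    (AlgHom.ext fun q => by
      rw [AlgHom.comp_apply, subst_comp, LinearEquiv.comp_coe, LinearEquiv.symm_trans_self]
      exact subst_id q)

theorem isCI_substForms (G : (Fin (n + 1) → ℂ) ≃ₗ[ℂ] Fin (n + 1) → ℂ) {f : Forms n c} (hf : IsCI f) :
    IsCI (substForms c (G : (Fin (n + 1) → ℂ) →ₗ[ℂ] Fin (n + 1) → ℂ) f) := by
  have h1 := ringKrullDim_eq_of_ringEquiv (Ideal.quotientEquiv (formIdeal f) _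
    (substEquiv G).toRingEquiv (formIdeal_substForms G.toLinearMap f))
  unfold IsCI at hf ⊢
  rw [← h1]
  exact hf

theorem linearIndependent_gradAt_subst (G : (Fin (n + 1) → ℂ) ≃ₗ[ℂ] Fin (n + 1) → ℂ)
    (v : Fin (n + 1) → ℂ) (f : Forms n c) :
    LinearIndependent ℂ (fun i => gradAt v
      (substForms c (G : (Fin (n + 1) → ℂ) →ₗ[ℂ] Fin (n + 1) → ℂ) f i : CoordRing n)) ↔
      LinearIndependent ℂ (fun i => gradAt (G v) (f i : CoordRing n)) := by
  let T : (Fin (n + 1) → ℂ) →ₗ[ℂ] Fin (n + 1) → ℂ :=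
    Matrix.mulVecLin (Matrix.of fun i j => G (Pi.single i 1) j)
  have hT : ∀ y i, T y i = ∑ j, G (Pi.single i 1) j * y j := fun y i => rfl
  have hker : LinearMap.ker T = ⊥ := by
    rw [LinearMap.ker_eq_bot']
    intro y hy
    have h1 : ∀ x, ∑ j, G x j * y j = 0 := by
      intro x
      rw [pi_eq_sum_univ' x, map_sum]
      simp only [map_smul, Finset.sum_apply, Pi.smul_apply, smul_eq_mul, Finset.sum_mul, mul_assoc]
      rw [Finset.sum_comm]
      simp only [← Finset.mul_sum, ← hT, hy, Pi.zero_apply, mul_zero, Finset.sum_const_zero]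
    ext k
    have h2 := h1 (G.symm (Pi.single k 1))
    rw [LinearEquiv.apply_symm_apply, Finset.sum_eq_single k (fun j _ hj => by simp [hj]) (by simp)] at h2
    simpa using h2
  have h3 : (fun i => gradAt v
      (substForms c (G : (Fin (n + 1) → ℂ) →ₗ[ℂ] Fin (n + 1) → ℂ) f i : CoordRing n)) =
      T ∘ fun i => gradAt (G v) (f i : CoordRing n) := by
    ext i j
    exact gradAt_subst _ v _ j
  rw [h3]
  exact LinearMap.linearIndependent_iff T hker

theorem exists_linearEquiv_baseVec (p : ProjPoint n) :
    ∃ G : (Fin (n + 1) → ℂ) ≃ₗ[ℂ] Fin (n + 1) → ℂ, Represents (G (baseVec n)) p := by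
  obtain ⟨G, hG⟩ := SeparatingDual.exists_continuousLinearEquiv_apply_eq (R := ℂ)
    (represents_baseVec n).1 p.rep_nonzero
  refine ⟨G.toLinearEquiv, ?_⟩
  change Represents (G (baseVec n)) p
  rw [hG]
  exact represents_rep p

/-- Singularity at a point in terms of the transported equations. -/
theorem mem_singularPoints_iff {G : (Fin (n + 1) → ℂ) ≃ₗ[ℂ] Fin (n + 1) → ℂ} {p : ProjPoint n}
    (hG : Represents (G (baseVec n)) p) {f : Forms n c} :
    (formIdeal f ≤ pointIdeal p ↔
      valO (substForms c (G : (Fin (n + 1) → ℂ) →ₗ[ℂ] Fin (n + 1) → ℂ) f) = 0) ∧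
    (formIdeal f ≤ pointIdeal p → (IsSmoothAt t (formIdeal f) p ↔ LinearIndependent ℂ
      (jacO (substForms c (G : (Fin (n + 1) → ℂ) →ₗ[ℂ] Fin (n + 1) → ℂ) f)))) := by
  have h1 : formIdeal f ≤ pointIdeal p ↔
      valO (substForms c (G : (Fin (n + 1) → ℂ) →ₗ[ℂ] Fin (n + 1) → ℂ) f) = 0 := by
    rw [hG.formIdeal_le_iff, funext_iff]
    refine forall_congr' fun i => ?_
    change _ ↔ eval (baseVec n) (subst _ (f i : CoordRing n)) = 0
    rw [eval_subst]
    rfl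
  refine ⟨h1, fun h => ?_⟩
  rw [isSmoothAt_iff hG h, ← linearIndependent_gradAt_subst,
    linearIndependent_gradAt_baseVec_iff (congrFun (h1.1 h))]
  rfl

/-- If a general singular complete intersection contains a complete intersection of multi-degree `b`
that is smooth at the singular point, then this is so for the complete intersections that are singular
at the base point. -/
theorem exists_zopen_of_generic_containment (ha : ∀ i, 1 ≤ a i) (hr : r ≤ n + 1)
    (hgen : ∃ W : Set (CIParam n a), IsOpen W ∧ (W ∩ singularLocus n a).Nonempty ∧
      ∀ u ∈ W ∩ singularLocus n a, ∀ p ∈ singularPoints u,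
        ∃ Z : CIParam n b, u.ideal ≤ Z.ideal ∧ Z.ideal ≤ pointIdeal p ∧
          IsSmoothAt s Z.ideal p) :
    ∃ O : Set (Forms n a), ZOpen O ∧ (∃ f ∈ O, valO f = 0 ∧ ¬ LinearIndependent ℂ (jacO f)) ∧
      (∀ f f', formIdeal f = formIdeal f' → f ∈ O → f' ∈ O) ∧ ∀ f ∈ O, IsCI f ∧ (valO f = 0 → ¬ LinearIndependent ℂ (jacO f) →
        ∃ k : Forms n b, IsCI k ∧ formIdeal f ≤ formIdeal k ∧ valO k = 0 ∧
          LinearIndependent ℂ (jacO k)) := by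
  obtain ⟨W, hW, ⟨u, huW, p, hup, hus⟩, hgen⟩ := hgen
  -- One automorphism `G` with `G(o) = p`, for a single singular point `p` in the given open set,
  -- suffices: pulled back by `G`, the open set becomes one that contains a complete intersection
  -- singular at `o`.
  obtain ⟨G, hG⟩ := exists_linearEquiv_baseVec p
  obtain ⟨O, hO, hOW⟩ := CIParam.exists_zopen hW
  obtain ⟨f₀, hf₀, hu⟩ := u.exists_forms
  rw [← hu] at hup hus
  refine ⟨{f | IsCI f} ∩ (substForms a (G.symm : (Fin (n + 1) → ℂ) →ₗ[ℂ] Fin (n + 1) → ℂ)) ⁻¹' O,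
    (zopen_isCI ha hr).inter (hO.preimage (LinearMap.isPolyMap (V := Forms n a) (W := Forms n a) _)),
    ⟨substForms a (G : (Fin (n + 1) → ℂ) →ₗ[ℂ] Fin (n + 1) → ℂ) f₀, ⟨isCI_substForms G hf₀, ?_⟩,
      (mem_singularPoints_iff hG).1.1 hup, fun h => hus (((mem_singularPoints_iff hG).2 hup).2 h)⟩, ?_, ?_⟩
  · rw [Set.mem_preimage, substForms_symm_comp]
    exact (hOW _ _ hu).2 huW
  · rintro f f' h ⟨hf, hfO⟩
    have h1 : formIdeal (substForms a (G.symm : (Fin (n + 1) → ℂ) →ₗ[ℂ] Fin (n + 1) → ℂ) f') =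
        (CIParam.ofForms _ (isCI_substForms G.symm hf)).ideal := by
      rw [formIdeal_substForms, ← h]
      exact (formIdeal_substForms _ f).symm
    exact ⟨hf.of_formIdeal_eq h, (hOW _ _ h1).2 ((hOW _ _ rfl).1 hfO)⟩
  · rintro f ⟨hf, hfO⟩
    refine ⟨hf, fun h0 hs => ?_⟩
    obtain ⟨f', hf', hCI, hfO', hff'⟩ : ∃ f', f' =
        substForms a (G.symm : (Fin (n + 1) → ℂ) →ₗ[ℂ] Fin (n + 1) → ℂ) f ∧ IsCI f' ∧ f' ∈ O ∧
        substForms a (G : (Fin (n + 1) → ℂ) →ₗ[ℂ] Fin (n + 1) → ℂ) f' = f :=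
      ⟨_, rfl, isCI_substForms G.symm hf, hfO, substForms_comp_symm G f⟩
    have h1 : formIdeal f' ≤ pointIdeal p := (mem_singularPoints_iff hG).1.2 (by rw [hff', h0])
    have h2 : ¬ IsSmoothAt r (formIdeal f') p := fun h => hs (by
      have h3 := ((mem_singularPoints_iff hG).2 h1).1 h
      rwa [hff'] at h3)
    obtain ⟨Z, hZu, hZp, hZs⟩ := hgen (CIParam.ofForms f' hCI)
      ⟨(hOW f' (CIParam.ofForms f' hCI) rfl).1 hfO', p, h1, h2⟩ p ⟨h1, h2⟩
    obtain ⟨k, hk, hkZ⟩ := Z.exists_forms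
    rw [← hkZ] at hZu hZp hZs
    refine ⟨substForms b (G : (Fin (n + 1) → ℂ) →ₗ[ℂ] Fin (n + 1) → ℂ) k, isCI_substForms G hk, ?_,
      (mem_singularPoints_iff hG).1.1 hZp, ((mem_singularPoints_iff hG).2 hZp).1 hZs⟩
    have h4 := Ideal.map_mono (f := subst (G : (Fin (n + 1) → ℂ) →ₗ[ℂ] Fin (n + 1) → ℂ)) hZu
    rw [← formIdeal_substForms] at h4
    refine le_trans (le_of_eq ?_) h4
    conv_lhs => rw [← hff']
    exact formIdeal_substForms _ f'

end Substitution

end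

noncomputable section

open MvPolynomial

attribute [local instance] MvPolynomial.gradedAlgebra

/-! ### Tuples of forms singular at `o` -/

section SingularForms

variable {n s r : ℕ} {b : Fin s → ℕ} {a : Fin (r + 1) → ℕ}

theorem exists_factor_of_not_linearIndependent {U : Type} [AddCommGroup U] [Module ℂ U]
    {g : Fin (r + 1) → U} (hg : ¬ LinearIndependent ℂ g) :
    ∃ (N : Fin (r + 1) → Fin r → ℂ) (L : Fin r → U), ∀ i, ∑ q, N i q • L q = g i := by
  rw [Fintype.linearIndependent_iff] at hg
  push Not at hg
  obtain ⟨z, hz, i₀, hi₀⟩ := hg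
  refine ⟨i₀.insertNth (α := fun _ => Fin r → ℂ) (fun q => -(z i₀)⁻¹ * z (i₀.succAbove q))
    (fun q => Pi.single q 1), fun q => g (i₀.succAbove q), fun i => ?_⟩
  refine Fin.succAboveCases i₀ ?_ (fun p => ?_) i
  · simp only [Fin.insertNth_apply_same]
    rw [Fin.sum_univ_succAbove _ i₀] at hz
    have h1 : g i₀ = -(z i₀)⁻¹ • ∑ q, z (i₀.succAbove q) • g (i₀.succAbove q) := by
      rw [eq_neg_of_add_eq_zero_right hz, smul_neg, neg_smul, neg_neg, smul_smul, inv_mul_cancel₀ hi₀,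
        one_smul]
    rw [h1, Finset.smul_sum]
    simp only [smul_smul]
  · simp only [Fin.insertNth_apply_succAbove]
    rw [Finset.sum_eq_single p (fun q _ hq => by simp [hq]) (by simp)]
    simp

theorem not_linearIndependent_factor {U : Type} [AddCommGroup U] [Module ℂ U]
    (N : Fin (r + 1) → Fin r → ℂ) (L : Fin r → U) :
    ¬ LinearIndependent ℂ fun i => ∑ q, N i q • L q := by
  intro h
  have h1 : LinearIndependent ℂ N := by
    rw [Fintype.linearIndependent_iff] at h ⊢
    intro z hz
    refine h z ?_
    simp only [Finset.smul_sum, smul_smul]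
    rw [Finset.sum_comm]
    refine Finset.sum_eq_zero fun q _ => ?_
    rw [← Finset.sum_smul]
    have := congrFun hz q
    simp only [Finset.sum_apply, Pi.smul_apply, smul_eq_mul, Pi.zero_apply] at this
    rw [this, zero_smul]
  have := h1.fintype_card_le_finrank
  simp at this

/-- The forms that vanish at `(1, 0, …, 0)` to the second order. -/
def doubleForms (n : ℕ) {t : ℕ} (c : Fin t → ℕ) : Submodule ℂ (Forms n c) :=
  LinearMap.ker (valO.prod jacO)

/-- `linForms` as a linear map. -/
def linFormsHom {t : ℕ} {c : Fin t → ℕ} (hc : ∀ i, 1 ≤ c i) : (Fin t → Fin n → ℂ) →ₗ[ℂ] Forms n c where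
  toFun := linForms hc
  map_add' v w := by
    ext1 i
    refine Subtype.ext ?_
    simp [linForms, linPoly, add_mul, mul_add, Finset.sum_add_distrib]
  map_smul' z w := by
    ext1 i
    refine Subtype.ext ?_
    simp [linForms, linPoly, smul_eq_C_mul, Finset.mul_sum, mul_assoc, mul_left_comm]

/-- The multiplication of matrices of numbers. -/
def factorMap (n r : ℕ) : (Fin (r + 1) → Fin r → ℂ) →ₗ[ℂ] (Fin r → Fin n → ℂ) →ₗ[ℂ]
    Fin (r + 1) → Fin n → ℂ :=
  LinearMap.mk₂ ℂ (fun N L i => ∑ q, N i q • L q)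
    (fun N N' L => by ext i; simp [add_mul, Finset.sum_add_distrib])
    (fun z N L => by ext i; simp [Finset.mul_sum, mul_assoc])
    (fun N L L' => by ext i; simp [Finset.sum_add_distrib])
    (fun z N L => by ext i; simp [Finset.mul_sum, mul_left_comm])

theorem isPolyMap_bilin_add_subtype {V M U W : Type} [AddCommGroup V] [Module ℂ V] [AddCommGroup M]
    [Module ℂ M] [AddCommGroup U] [Module ℂ U] [AddCommGroup W] [Module ℂ W] [FiniteDimensional ℂ M]
    (B : M →ₗ[ℂ] V →ₗ[ℂ] U) (L : U →ₗ[ℂ] W) (S : Submodule ℂ W) :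
    IsPolyMap fun x : M × V × S => L (B x.1 x.2.1) + S.subtype x.2.2 :=
  have h : IsPolyMap (fun x : M × V × S => x) := isPolyMap_id
  ((IsPolyMap.bilin B h.fst h.snd.fst).linear L).add (h.snd.snd.linear S.subtype)

/-- The tuples of forms that are singular at `(1, 0, …, 0)` form an irreducible set. -/
theorem exists_singular_mem_inter (ha : ∀ i, 1 ≤ a i) {O₁ O₂ : Set (Forms n a)} (h₁ : ZOpen O₁)
    (h₂ : ZOpen O₂) (hO₁ : ∃ f ∈ O₁, valO f = 0 ∧ ¬ LinearIndependent ℂ (jacO f))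
    (hO₂ : ∃ f ∈ O₂, valO f = 0 ∧ ¬ LinearIndependent ℂ (jacO f)) :
    ∃ f ∈ O₁ ∩ O₂, valO f = 0 ∧ ¬ LinearIndependent ℂ (jacO f) := by
  -- Singularity means that the Jacobian matrix has rank at most `r`, that is, factors through
  -- `ℂ^r`. This parametrizes the singular tuples polynomially by a vector space, the remaining
  -- freedom being linear.
  let Θ : (Fin (r + 1) → Fin r → ℂ) × (Fin r → Fin n → ℂ) × doubleForms n a → Forms n a :=
    fun x => linFormsHom ha (factorMap n r x.1 x.2.1) + (doubleForms n a).subtype x.2.2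
  have hΘ : IsPolyMap Θ :=
    isPolyMap_bilin_add_subtype (W := Forms n a) (factorMap n r) (linFormsHom ha) (doubleForms n a)
  have hsing : ∀ x, valO (Θ x) = 0 ∧ ¬ LinearIndependent ℂ (jacO (Θ x)) := by
    rintro ⟨N, L, g, hg⟩
    have hg0 : valO g = 0 := congrArg Prod.fst hg
    have hg1 : jacO g = 0 := congrArg Prod.snd hg
    change valO (linForms ha _ + g) = 0 ∧ ¬ LinearIndependent ℂ (jacO (linForms ha _ + g))
    rw [map_add, map_add, valO_linForms, jacO_linForms, hg0, hg1, add_zero, add_zero]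
    exact ⟨rfl, not_linearIndependent_factor N L⟩
  have hsurj : ∀ f : Forms n a, valO f = 0 → ¬ LinearIndependent ℂ (jacO f) → ∃ x, Θ x = f := by
    intro f hf0 hf1
    obtain ⟨N, L, hNL⟩ := exists_factor_of_not_linearIndependent hf1
    refine ⟨(N, L, ⟨f - linForms ha (jacO f), Prod.ext ?_ ?_⟩), ?_⟩
    · change valO (f - linForms ha (jacO f)) = 0
      rw [map_sub, valO_linForms, hf0, sub_zero]
    · change jacO (f - linForms ha (jacO f)) = 0
      rw [map_sub, jacO_linForms, sub_self]
    · have h1 : factorMap n r N L = jacO f := funext hNL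
      change linFormsHom ha (factorMap n r N L) + (f - linForms ha (jacO f)) = f
      rw [h1]
      exact add_sub_cancel _ _
  have hne : ∀ O : Set (Forms n a), (∃ f ∈ O, valO f = 0 ∧ ¬ LinearIndependent ℂ (jacO f)) →
      (Θ ⁻¹' O).Nonempty := by
    rintro O ⟨f, hfO, hf0, hf1⟩
    obtain ⟨x, rfl⟩ := hsurj f hf0 hf1
    exact ⟨x, hfO⟩
  obtain ⟨x, hx₁, hx₂⟩ := (h₁.preimage hΘ).nonempty_inter (h₂.preimage hΘ) (hne _ hO₁) (hne _ hO₂)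
  exact ⟨Θ x, ⟨hx₁, hx₂⟩, hsing x⟩

/-- The forms all but the last of which have independent gradients at `(1, 0, …, 0)`. -/
def initIndep (n : ℕ) (a : Fin (r + 1) → ℕ) : Set (Forms n a) :=
  {f | LinearIndependent ℂ fun i : Fin r => jacO f i.castSucc}

theorem zopen_initIndep : ZOpen (initIndep n a) :=
  zopen_linearIndependent fun i => LinearMap.isPolyMap (V := Forms n a)
    ((LinearMap.proj i.castSucc : (Fin (r + 1) → Fin n → ℂ) →ₗ[ℂ] _).comp jacO)

theorem exists_mem_initIndep (ha : ∀ i, 1 ≤ a i) (hr : r ≤ n) :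
    ∃ f ∈ initIndep n a, valO f = 0 ∧ ¬ LinearIndependent ℂ (jacO f) := by
  refine ⟨linForms ha (Fin.snoc (α := fun _ => Fin n → ℂ) (fun i => Pi.single (Fin.castLE hr i) 1) 0),
    ?_, valO_linForms _ _, ?_⟩
  · change LinearIndependent ℂ fun i : Fin r => jacO _ i.castSucc
    simp only [jacO_linForms, Fin.snoc_castSucc]
    have := (Pi.basisFun ℂ (Fin n)).linearIndependent.comp _ (Fin.castLE_injective hr)
    convert this using 1
    ext1 j
    simp
  · rw [jacO_linForms]
    intro h
    exact h.ne_zero (Fin.last r) (by simp)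

/-- A row operation that makes the last form singular. -/
theorem exists_singForms (ha : Monotone a) {f : Forms n a} (hf0 : valO f = 0)
    (hf1 : ¬ LinearIndependent ℂ (jacO f)) (hf : f ∈ initIndep n a) :
    ∃ f' ∈ singForms n a, formIdeal f' = formIdeal f ∧ f' ∈ initIndep n a := by
  obtain ⟨z, hz⟩ : ∃ z : Fin r → ℂ, ∑ i, z i • jacO f i.castSucc = jacO f (Fin.last r) := by
    by_contra hcon
    refine hf1 ?_
    have h1 := LinearIndependent.finSnoc (x := jacO f (Fin.last r)) hf (fun h => hcon
      ((Submodule.mem_span_range_iff_exists_fun ℂ).1 h))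
    have h2 : jacO f = Fin.snoc (α := fun _ => Fin n → ℂ) (fun i : Fin r => jacO f i.castSucc)
        (jacO f (Fin.last r)) := by
      ext1 i
      refine Fin.lastCases ?_ (fun i => ?_) i <;> simp
    rw [h2]
    exact h1
  -- The relation among gradients is lifted to forms by powers of `x₀`; the exponents are
  -- nonnegative because `a_r` is the largest degree. The last coefficient is `0`, so the operation
  -- can be undone.
  let A : FormRow n (a (Fin.last r)) a := fun j =>
    ⟨C (Fin.snoc (α := fun _ => ℂ) z 0 j) * X 0 ^ (a (Fin.last r) - a j),
      C_mul_X_zero_pow_mem (ha (Fin.le_last j)) _⟩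
  have hA : ∀ j, eval (baseVec n) (A j : CoordRing n) = Fin.snoc (α := fun _ => ℂ) z 0 j := fun j => by
    simp [A, baseVec_zero]
  let q := mulRow (a (Fin.last r)) a A f
  have hq0 : eval (baseVec n) (q : CoordRing n) = 0 := by
    rw [coe_mulRow, map_sum]
    refine Finset.sum_eq_zero fun j _ => ?_
    rw [map_mul, show eval (baseVec n) (f j : CoordRing n) = 0 from congrFun hf0 j, mul_zero]
  have hq1 : gradO (q : CoordRing n) = jacO f (Fin.last r) := by
    rw [coe_mulRow, map_sum, ← hz, Fin.sum_univ_castSucc]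
    have h1 : ∀ j, gradO ((A j : CoordRing n) * (f j : CoordRing n)) =
        (Fin.snoc (α := fun _ => ℂ) z 0 j : ℂ) • jacO f j := fun j => by
      rw [gradO_mul, hA, show eval (baseVec n) (f j : CoordRing n) = 0 from congrFun hf0 j, zero_smul,
        add_zero]
      rfl
    simp only [h1, Fin.snoc_castSucc, Fin.snoc_last, zero_smul, add_zero]
  let f' : Forms n a := Function.update f (Fin.last r) (f (Fin.last r) - q)
  have hi : ∀ i : Fin r, f' i.castSucc = f i.castSucc := fun i =>
    Function.update_of_ne (Fin.castSucc_lt_last i).ne _ _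
  have hlast : f' (Fin.last r) = f (Fin.last r) - q := Function.update_self _ _ _
  have hji : ∀ i : Fin r, jacO f' i.castSucc = jacO f i.castSucc := fun i => by
    change gradO (f' i.castSucc : CoordRing n) = gradO (f i.castSucc : CoordRing n)
    rw [hi]
  refine ⟨f', ?_, ?_, ?_⟩
  · rw [mem_singForms]
    constructor
    · ext i
      change eval (baseVec n) (f' i : CoordRing n) = 0
      refine Fin.lastCases ?_ (fun i => ?_) i
      · rw [hlast, Submodule.coe_sub, map_sub, hq0, sub_zero]
        exact congrFun hf0 _
      · rw [hi]
        exact congrFun hf0 _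
    · change gradO (f' (Fin.last r) : CoordRing n) = 0
      rw [hlast, Submodule.coe_sub, map_sub, hq1]
      exact sub_self _
  · refine le_antisymm ?_ ?_
    · rw [formIdeal_le_iff, mem_tupleIdeal]
      intro i
      refine Fin.lastCases ?_ (fun i => ?_) i
      · rw [hlast, Submodule.coe_sub]
        exact Ideal.sub_mem _ (mem_formIdeal f _) (mulRow_mem A f)
      · rw [hi]
        exact mem_formIdeal f _
    · rw [formIdeal_le_iff, mem_tupleIdeal]
      have h1 : ∀ i : Fin r, (f i.castSucc : CoordRing n) ∈ formIdeal f' := fun i => by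
        rw [← hi]
        exact mem_formIdeal f' _
      intro i
      refine Fin.lastCases ?_ (fun i => h1 i) i
      have h2 : (f (Fin.last r) : CoordRing n) = f' (Fin.last r) + q := by
        rw [hlast, Submodule.coe_sub, sub_add_cancel]
      rw [h2]
      refine Ideal.add_mem _ (mem_formIdeal f' _) ?_
      rw [coe_mulRow, Fin.sum_univ_castSucc]
      refine Ideal.add_mem _ (sum_mem fun i _ => Ideal.mul_mem_left _ _ (h1 i)) ?_
      simp [A]
  · change LinearIndependent ℂ fun i : Fin r => jacO f' i.castSucc
    simp only [hji]
    exact hf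

/-- `0 = ∂f_r = Σ_j h_rj(o) ∂k_j` with independent `∂k_j`. -/
theorem mem_singParams_of_mulForms {k : Forms n b} {h : FormMatrix n a b} (hk0 : valO k = 0)
    (hk : LinearIndependent ℂ (jacO k)) (hf : mulForms a b h k ∈ singForms n a) :
    (k, h) ∈ singParams n b a := by
  rw [mem_singParams]
  refine ⟨hk0, ?_⟩
  have h1 := (mem_singForms.1 hf).2
  rw [jacO_mulForms] at h1
  simp only [hk0, Pi.zero_apply, zero_smul, add_zero] at h1
  exact funext (Fintype.linearIndependent_iff.1 hk _ h1)

theorem not_linearIndependent_of_mem_singForms {f : Forms n a} (hf : f ∈ singForms n a) :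
    ¬ LinearIndependent ℂ (jacO f) := fun h => h.ne_zero (Fin.last r) (mem_singForms.1 hf).2

end SingularForms

end

noncomputable section

open MvPolynomial

attribute [local instance] MvPolynomial.gradedAlgebra

/-! ### A criterion for a unique dominating component -/

section Components

/-- `V` is irreducible and open in `Ξ`, so its closure is the only component that meets it. A
component dominating `Γ` has a point over `U`, because `U` meets `Γ`, and that point lies in `V`. -/
theorem existsUnique_dominant_component {X Y : Type*} [TopologicalSpace X] [TopologicalSpace Y]
    {Ξ V W : Set X} {α : X → Y} {Γ U : Set Y} (hV : IsPreirreducible V) (hne : V.Nonempty)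
    (hW : IsOpen W) (hVW : V = W ∩ Ξ) (hdom : Γ ⊆ closure (α '' V)) (hU : IsOpen U)
    (hUΓ : (U ∩ Γ).Nonempty) (hUV : ∀ x ∈ Ξ, α x ∈ U → x ∈ V) :
    (∃! C : Set X, (∃ D ∈ irreducibleComponents Ξ, C = Subtype.val '' D) ∧ Γ ⊆ closure (α '' C)) ∧
      ∀ C : Set X, (∃ D ∈ irreducibleComponents Ξ, C = Subtype.val '' D) ∧ Γ ⊆ closure (α '' C) →
        V ⊆ C := by
  let V' : Set Ξ := Subtype.val ⁻¹' V
  have hVΞ : V ⊆ Ξ := fun x hx => (hVW ▸ hx : x ∈ W ∩ Ξ).2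
  have hV'o : IsOpen V' := by
    have : V' = Subtype.val ⁻¹' W := by
      ext x
      change (x : X) ∈ V ↔ (x : X) ∈ W
      rw [hVW]
      exact ⟨fun h => h.1, fun h => ⟨h, x.2⟩⟩
    rw [this]
    exact hW.preimage continuous_subtype_val
  have hV'ne : V'.Nonempty := by
    obtain ⟨x, hx⟩ := hne
    exact ⟨⟨x, hVΞ hx⟩, hx⟩
  have hV' : IsPreirreducible V' := by
    rintro A B hA hB ⟨x, hxV, hxA⟩ ⟨y, hyV, hyB⟩
    obtain ⟨A', hA', rfl⟩ := isOpen_induced_iff.1 hA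
    obtain ⟨B', hB', rfl⟩ := isOpen_induced_iff.1 hB
    obtain ⟨z, hzV, hzA, hzB⟩ := hV A' B' hA' hB' ⟨x, hxV, hxA⟩ ⟨y, hyV, hyB⟩
    exact ⟨⟨z, hVΞ hzV⟩, hzV, hzA, hzB⟩
  have hirr : IsIrreducible (closure V') := ⟨hV'ne.closure, hV'.closure⟩
  have hsub : ∀ D : Set Ξ, IsPreirreducible D → (D ∩ V').Nonempty → D ⊆ closure V' := fun D hD h =>
    (subset_closure_inter_of_isPreirreducible_of_isOpen hD hV'o h).trans
      (closure_mono Set.inter_subset_right)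
  have hmax : closure V' ∈ irreducibleComponents Ξ := by
    refine ⟨hirr, fun D hD hle => hsub D hD.2 ?_⟩
    obtain ⟨x, hx⟩ := hV'ne
    exact ⟨x, hle (subset_closure hx), hx⟩
  have himg : V ⊆ Subtype.val '' closure V' := fun x hx => ⟨⟨x, hVΞ hx⟩, subset_closure hx, rfl⟩
  have huniq : ∀ C : Set X, (∃ D ∈ irreducibleComponents Ξ, C = Subtype.val '' D) ∧
      Γ ⊆ closure (α '' C) → C = Subtype.val '' closure V' := by
    rintro C ⟨⟨D, hD, rfl⟩, hC⟩
    have hDV : (D ∩ V').Nonempty := by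
      obtain ⟨y, hyU, hyΓ⟩ := hUΓ
      obtain ⟨_, hzU, _, ⟨x, hx, rfl⟩, rfl⟩ := mem_closure_iff.1 (hC hyΓ) U hU hyU
      exact ⟨x, hx, hUV x x.2 hzU⟩
    rw [Set.Subset.antisymm (hsub D hD.1.2 hDV) (hD.2 hirr (hsub D hD.1.2 hDV))]
  refine ⟨⟨_, ⟨⟨_, hmax, rfl⟩, hdom.trans (closure_mono (Set.image_mono himg))⟩, huniq⟩, fun C hC => ?_⟩
  rw [huniq C hC]
  exact himg

end Components

/-! ### The dominant component of `Ξ_o` -/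

section Parameters

variable {n s r : ℕ} {b : Fin s → ℕ}

theorem mem_XiAt_iff {a : Fin r → ℕ} (hb : ∀ j, 1 ≤ b j) (ha : ∀ i, 1 ≤ a i) {Q : FlagFamily n b a}
    {k : Forms n b} {f : Forms n a} (hk : formIdeal k = Q.Z.ideal) (hf : formIdeal f = Q.X.ideal) :
    Q ∈ XiAt n b a ↔ Q.pt = basePoint n ∧ ¬ LinearIndependent ℂ (jacO f) ∧
      LinearIndependent ℂ (jacO k) := by
  refine and_congr_right fun hp => and_congr ?_ ?_
  · exact mem_criticalSet_iff ha (P := alpha Q) hp hf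
  · rw [mem_criticalSet_iff hb (P := beta Q) hp hk, not_not]
    rfl

variable {a : Fin (r + 1) → ℕ}

/-- The points of `Ξ_o` such that, for some equations of `X`, the gradients of all but the last are
linearly independent at `o`. -/
def initPart (n : ℕ) (b : Fin s → ℕ) (a : Fin (r + 1) → ℕ) : Set (FlagFamily n b a) :=
  {Q ∈ XiAt n b a | ∃ f : Forms n a, formIdeal f = Q.X.ideal ∧ f ∈ initIndep n a}

/-- The parameters of the points of `initPart`. -/
def goodParams (n : ℕ) (b : Fin s → ℕ) (a : Fin (r + 1) → ℕ) : Set (singParams n b a) :=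
  {x | (IsCI x.1.1 ∧ LinearIndependent ℂ (jacO x.1.1)) ∧
    (IsCI (mulForms a b x.1.2 x.1.1) ∧ mulForms a b x.1.2 x.1.1 ∈ initIndep n a)}

theorem isPolyMap_subtype_fst {V M : Type} [AddCommGroup V] [Module ℂ V] [AddCommGroup M] [Module ℂ M]
    (A : Submodule ℂ (V × M)) : IsPolyMap fun x : A => x.1.1 :=
  (LinearMap.isPolyMap A.subtype).fst

theorem isPolyMap_subtype_bilin {V M W : Type} [AddCommGroup V] [Module ℂ V] [AddCommGroup M]
    [Module ℂ M] [AddCommGroup W] [Module ℂ W] [FiniteDimensional ℂ M]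
    (B : M →ₗ[ℂ] V →ₗ[ℂ] W) (A : Submodule ℂ (V × M)) : IsPolyMap fun x : A => B x.1.2 x.1.1 :=
  IsPolyMap.bilin B (LinearMap.isPolyMap A.subtype).snd (LinearMap.isPolyMap A.subtype).fst

theorem zopen_linearIndependent_jacO {t : ℕ} {c : Fin t → ℕ} :
    ZOpen {f : Forms n c | LinearIndependent ℂ (jacO f)} :=
  zopen_linearIndependent fun i => LinearMap.isPolyMap (V := Forms n c)
    ((LinearMap.proj i : (Fin t → Fin n → ℂ) →ₗ[ℂ] _).comp jacO)

theorem zopen_goodParams (hb : ∀ j, 1 ≤ b j) (hs : s ≤ n + 1) (ha : ∀ i, 1 ≤ a i) (hr : r + 1 ≤ n + 1) :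
    ZOpen (goodParams n b a) :=
  (((zopen_isCI hb hs).inter zopen_linearIndependent_jacO).preimage
    (isPolyMap_subtype_fst (V := Forms n b) (M := FormMatrix n a b) (singParams n b a))).inter
    (((zopen_isCI ha hr).inter zopen_initIndep).preimage
      (isPolyMap_subtype_bilin (V := Forms n b) (M := FormMatrix n a b) (W := Forms n a)
        (mulForms a b) (singParams n b a)))

theorem exists_flagFamily {r : ℕ} {a : Fin r → ℕ} {k : Forms n b} {f : Forms n a} (hk : IsCI k)
    (hf : IsCI f) (h0 : valO k = 0) (hle : formIdeal f ≤ formIdeal k) : ∃ Q : FlagFamily n b a,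
      Q.pt = basePoint n ∧ formIdeal k = Q.Z.ideal ∧ formIdeal f = Q.X.ideal :=
  ⟨⟨basePoint n, CIParam.ofForms k hk, CIParam.ofForms f hf,
    (represents_baseVec n).formIdeal_le_iff.2 (congrFun h0), hle⟩, rfl, rfl, rfl⟩

theorem exists_mem_initPart_of_mem {k : Forms n b} {f : Forms n a} (hb : ∀ j, 1 ≤ b j)
    (ha : ∀ i, 1 ≤ a i) (hk : IsCI k) (hf : IsCI f) (h0 : valO k = 0)
    (hk1 : LinearIndependent ℂ (jacO k)) (hle : formIdeal f ≤ formIdeal k)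
    (hf0 : ¬ LinearIndependent ℂ (jacO f)) (hf1 : f ∈ initIndep n a) : ∃ Q ∈ initPart n b a,
      Represents (baseVec n) Q.pt ∧ formIdeal k = Q.Z.ideal ∧ formIdeal f = Q.X.ideal := by
  obtain ⟨Q, hpt, hZ, hX⟩ := exists_flagFamily hk hf h0 hle
  exact ⟨Q, ⟨(mem_XiAt_iff hb ha hZ hX).2 ⟨hpt, hf0, hk1⟩, f, hX, hf1⟩,
    hpt ▸ represents_baseVec n, hZ, hX⟩

theorem exists_mem_initPart (hb : ∀ j, 1 ≤ b j) (ha : ∀ i, 1 ≤ a i) {x : singParams n b a}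
    (hx : x ∈ goodParams n b a) : ∃ Q ∈ initPart n b a, Represents (baseVec n) Q.pt ∧
      formIdeal x.1.1 = Q.Z.ideal ∧ formIdeal (mulForms a b x.1.2 x.1.1) = Q.X.ideal :=
  exists_mem_initPart_of_mem hb ha hx.1.1 hx.2.1 (mem_singParams.1 x.2).1 hx.1.2
    (formIdeal_mulForms_le _ _)
    (not_linearIndependent_of_mem_singForms (mulForms_mem_singForms x.2 x.2)) hx.2.2

/-- The row operation of `exists_singForms` changes the equations of `X` but not its ideal, and it
makes the last row of `h` vanish at `o`. -/
theorem exists_mem_goodParams (hb : ∀ j, 1 ≤ b j) (ha : ∀ i, 1 ≤ a i) (ham : Monotone a)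
    {Q : FlagFamily n b a} (hQ : Q ∈ initPart n b a) : ∃ x ∈ goodParams n b a,
      formIdeal x.1.1 = Q.Z.ideal ∧ formIdeal (mulForms a b x.1.2 x.1.1) = Q.X.ideal := by
  obtain ⟨hQ, f, hf, hf1⟩ := hQ
  obtain ⟨k, hk, hkZ⟩ := Q.Z.exists_forms
  obtain ⟨hpt, hsing, hk1⟩ := (mem_XiAt_iff hb ha hkZ hf).1 hQ
  have hv : Represents (baseVec n) Q.pt := hpt ▸ represents_baseVec n
  have hk0 : valO k = 0 := funext (hv.formIdeal_le_iff.1 (hkZ ▸ Q.mem))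
  have hf0 : valO f = 0 := funext (hv.formIdeal_le_iff.1 (hf ▸ Q.sub.trans Q.mem))
  obtain ⟨f', hf', hff', hf'1⟩ := exists_singForms ham hf0 hsing hf1
  have hle : formIdeal f' ≤ formIdeal k := by
    rw [hff', hf, hkZ]
    exact Q.sub
  obtain ⟨h, rfl⟩ := formIdeal_le_iff_exists.1 hle
  refine ⟨⟨(k, h), mem_singParams_of_mulForms hk0 hk1 hf'⟩, ⟨⟨hk, hk1⟩, ?_, hf'1⟩, hkZ, hff'.trans hf⟩
  exact CIParam.isCI (u := Q.X) (hff'.trans hf)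

/-- The set is the continuous image of `goodParams`, an open subset of the vector space
`singParams`. -/
theorem isPreirreducible_initPart (hb : ∀ j, 1 ≤ b j) (hs : s ≤ n + 1) (ha : ∀ i, 1 ≤ a i)
    (hr : r + 1 ≤ n + 1) (ham : Monotone a) : IsPreirreducible (initPart n b a) := by
  have key : ∀ A : Set (FlagFamily n b a), IsOpen A → (initPart n b a ∩ A).Nonempty →
      ∃ P : Set (singParams n b a), ZOpen P ∧ P.Nonempty ∧ ∀ x ∈ P, ∀ Q : FlagFamily n b a,
        Represents (baseVec n) Q.pt → formIdeal x.1.1 = Q.Z.ideal →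
        formIdeal (mulForms a b x.1.2 x.1.1) = Q.X.ideal → Q ∈ A := by
    rintro A hA ⟨Q, hQ, hQA⟩
    obtain ⟨O, hO, h⟩ := FlagFamily.exists_zopen hA
    obtain ⟨x, -, hZ, hX⟩ := exists_mem_goodParams hb ha ham hQ
    have hpt : Represents (baseVec n) Q.pt := by
      rw [hQ.1.1]
      exact represents_baseVec n
    refine ⟨_, hO.preimage ((isPolyMap_const (baseVec n)).prodMk
      ((isPolyMap_subtype_fst (V := Forms n b) (M := FormMatrix n a b) (singParams n b a)).prodMk
        (isPolyMap_subtype_bilin (V := Forms n b) (M := FormMatrix n a b) (W := Forms n a)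
          (mulForms a b) (singParams n b a)))), ⟨x, (h _ _ _ Q hpt hZ hX).2 hQA⟩,
      fun y hy Q' h1 h2 h3 => (h _ _ _ Q' h1 h2 h3).1 hy⟩
  rintro A B hA hB hxA hyB
  obtain ⟨P₁, hP₁, hne₁, h₁⟩ := key A hA hxA
  obtain ⟨P₂, hP₂, hne₂, h₂⟩ := key B hB hyB
  obtain ⟨Q₀, hQ₀, -⟩ := hxA
  obtain ⟨x₀, hx₀, -⟩ := exists_mem_goodParams hb ha ham hQ₀
  obtain ⟨x, ⟨hx1, hx2⟩, hx⟩ := (hP₁.inter hP₂).nonempty_inter (zopen_goodParams hb hs ha hr)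
    (hP₁.nonempty_inter hP₂ hne₁ hne₂) ⟨x₀, hx₀⟩
  obtain ⟨Q, hQ, hpt, hZ, hX⟩ := exists_mem_initPart hb ha hx
  exact ⟨Q, hQ, h₁ x hx1 Q hpt hZ hX, h₂ x hx2 Q hpt hZ hX⟩

theorem exists_isOpen_initPart (hb : ∀ j, 1 ≤ b j) (hs : s ≤ n + 1) (ha : ∀ i, 1 ≤ a i)
    (hr : r + 1 ≤ n + 1) : ∃ W, IsOpen W ∧ initPart n b a = W ∩ XiAt n b a := by
  refine ⟨_, FlagFamily.isOpen_of_zopen (n := n) hb hs ha hr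
    (O := {x | x.2.2 ∈ initIndep n a}) (zopen_initIndep.preimage isPolyMap_id.snd.snd), ?_⟩
  ext Q
  constructor
  · rintro ⟨hQ, f, hf, hf1⟩
    obtain ⟨k, -, hk⟩ := Q.Z.exists_forms
    refine ⟨⟨baseVec n, k, f, ?_, hk, hf, hf1⟩, hQ⟩
    rw [hQ.1]
    exact represents_baseVec n
  · rintro ⟨⟨v, k, f, -, -, hf, hf1⟩, hQ⟩
    exact ⟨hQ, f, hf, hf1⟩

/-- By irreducibility of the tuples singular at `o`, any neighbourhood of a point of `Γ_o` contains
one that lies in `O` and has independent initial gradients; such an `X` contains a suitable `Z`. -/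
theorem criticalSetAt_subset_closure (hb : ∀ j, 1 ≤ b j) (ha : ∀ i, 1 ≤ a i) (hr : r ≤ n)
    {O : Set (Forms n a)} (hO : ZOpen O) (hne : ∃ f ∈ O, valO f = 0 ∧ ¬ LinearIndependent ℂ (jacO f))
    (hOk : ∀ f ∈ O, IsCI f ∧ (valO f = 0 → ¬ LinearIndependent ℂ (jacO f) →
      ∃ k : Forms n b, IsCI k ∧ formIdeal f ≤ formIdeal k ∧ valO k = 0 ∧
        LinearIndependent ℂ (jacO k))) :
    criticalSetAt n a ⊆ closure (alpha '' initPart n b a) := by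
  rintro P ⟨hP, hpt⟩
  obtain ⟨f₁, -, hf₁⟩ := P.ci.exists_forms
  have hv : Represents (baseVec n) P.pt := hpt ▸ represents_baseVec n
  rw [mem_closure_iff]
  intro U hU hPU
  obtain ⟨O', hO', h'⟩ := UnivFamily.exists_zopen hU
  obtain ⟨f, ⟨⟨hfO', hfI⟩, hfO⟩, hf0, hf1⟩ := exists_singular_mem_inter ha
    ((hO'.preimage ((isPolyMap_const (baseVec n)).prodMk isPolyMap_id)).inter zopen_initIndep) hO
    (exists_singular_mem_inter ha (hO'.preimage ((isPolyMap_const (baseVec n)).prodMk isPolyMap_id))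
      zopen_initIndep ⟨f₁, (h' _ _ P hv hf₁).2 hPU, funext (hv.formIdeal_le_iff.1 (hf₁ ▸ P.mem)),
        (mem_criticalSet_iff ha hpt hf₁).1 hP⟩ (exists_mem_initIndep ha hr)) hne
  obtain ⟨hf, hfk⟩ := hOk f hfO
  obtain ⟨k, hk, hle, hk0, hk1⟩ := hfk hf0 hf1
  obtain ⟨Q, hQ, hpt, hZ, hX⟩ := exists_mem_initPart_of_mem hb ha hk hf hk0 hk1 hle hf1 hfI
  exact ⟨alpha Q, (h' _ _ (alpha Q) hpt hX).1 hfO', Q, hQ, rfl⟩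

theorem existsUnique_isDominantComponent (hb : ∀ j, 1 ≤ b j) (hs : s ≤ n + 1) (ha : ∀ i, 1 ≤ a i)
    (hr : r ≤ n) (ham : Monotone a) {O : Set (Forms n a)} (hO : ZOpen O)
    (hne : ∃ f ∈ O, valO f = 0 ∧ ¬ LinearIndependent ℂ (jacO f))
    (hOk : ∀ f ∈ O, IsCI f ∧ (valO f = 0 → ¬ LinearIndependent ℂ (jacO f) →
      ∃ k : Forms n b, IsCI k ∧ formIdeal f ≤ formIdeal k ∧ valO k = 0 ∧
        LinearIndependent ℂ (jacO k))) :
    (∃! C : Set (FlagFamily n b a), IsDominantComponent C) ∧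
      ∀ C : Set (FlagFamily n b a), IsDominantComponent C → initPart n b a ⊆ C := by
  have hr1 : r + 1 ≤ n + 1 := Nat.succ_le_succ hr
  obtain ⟨W, hW, hW'⟩ := exists_isOpen_initPart (n := n) hb hs ha hr1
  obtain ⟨f, ⟨hfO, hfI⟩, hf0, hf1⟩ := exists_singular_mem_inter ha hO zopen_initIndep hne
    (exists_mem_initIndep ha hr)
  obtain ⟨hf, hfk⟩ := hOk f hfO
  obtain ⟨k, hk, hle, hk0, hk1⟩ := hfk hf0 hf1
  obtain ⟨Q, hQ, hpt, hZ, hX⟩ := exists_mem_initPart_of_mem hb ha hk hf hk0 hk1 hle hf1 hfI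
  refine existsUnique_dominant_component (isPreirreducible_initPart hb hs ha hr1 ham) ⟨Q, hQ⟩ hW hW'
    (criticalSetAt_subset_closure hb ha hr hO hne hOk)
    (UnivFamily.isOpen_of_zopen (n := n) ha hr1 (O := {x | x.2 ∈ initIndep n a})
      (zopen_initIndep.preimage isPolyMap_id.snd))
    ⟨alpha Q, ⟨baseVec n, f, hpt, hX, hfI⟩, hQ.1.2.1, hQ.1.1⟩ ?_
  rintro x hx ⟨v, f, -, hf, hfI⟩
  exact ⟨hx, f, hf, hfI⟩

end Parameters

end

noncomputable section

open MvPolynomial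

attribute [local instance] MvPolynomial.gradedAlgebra

section LinearFamilies

theorem zopen_surjective_of_linear {U N X Y : Type} [AddCommGroup U] [Module ℂ U] [AddCommGroup N]
    [Module ℂ N] [AddCommGroup X] [Module ℂ X] [AddCommGroup Y] [Module ℂ Y] [FiniteDimensional ℂ X]
    [FiniteDimensional ℂ Y] (A : Submodule ℂ U) (L : U →ₗ[ℂ] N) (K : N →ₗ[ℂ] X →ₗ[ℂ] Y) :
    ZOpen {x : A | Function.Surjective (K (L x))} :=
  zopen_surjective (isPolyMap_hom (K.comp (L.comp A.subtype)))

end LinearFamilies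

/-! ### Ranks of differentials of bilinear maps -/

section BilinearRanks

variable {V M W : Type} [AddCommGroup V] [Module ℂ V] [AddCommGroup M] [Module ℂ M]
  [AddCommGroup W] [Module ℂ W] (B : M →ₗ[ℂ] V →ₗ[ℂ] W)

/-- The differential of `(v, A) ↦ B A v` on the tangent directions `(y, A)` with `y ∈ E`. -/
def bilinDiffOn (E : Submodule ℂ V) : V × M →ₗ[ℂ] E × M →ₗ[ℂ] W :=
  (LinearMap.lcomp ℂ W (E.subtype.prodMap LinearMap.id)).comp (bilinDiff B)

theorem range_bilinDiffOn (E : Submodule ℂ V) (x : V × M) :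
    LinearMap.range (bilinDiffOn B E x) = E.map (B x.2) ⊔ LinearMap.range (B.flip x.1) := by
  apply le_antisymm
  · rintro _ ⟨⟨y, A⟩, rfl⟩
    exact Submodule.add_mem_sup ⟨y, y.2, rfl⟩ ⟨A, rfl⟩
  · refine sup_le ?_ ?_
    · rintro _ ⟨y, hy, rfl⟩
      refine ⟨(⟨y, hy⟩, 0), ?_⟩
      change B x.2 y + B 0 x.1 = _
      simp
    · rintro _ ⟨A, rfl⟩
      refine ⟨(0, A), ?_⟩
      change B x.2 0 + B A x.1 = _
      simp

theorem zopen_slice_ranks [FiniteDimensional ℂ V] [FiniteDimensional ℂ M] [FiniteDimensional ℂ W]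
    (E E' : Submodule ℂ V) (G : Submodule ℂ M) (C : Submodule ℂ W) (ρ ρ' : ℕ) :
    ZOpen {x : V × W | Function.Bijective (sliceMap B G C x.1) ∧ ∃ y : G × C,
      (x, y) ∈ {z : (V × W) × G × C |
        ρ ≤ Module.finrank ℂ (LinearMap.range (bilinDiffOn B E (z.1.1, z.2.1))) ∧
        ρ' ≤ Module.finrank ℂ (LinearMap.range (bilinDiffOn B E' (z.1.1, z.2.1)))} ∧
      sliceMap B G C x.1 y = x.2} := by
  have h : IsPolyMap fun z : (V × W) × G × C => (z.1.1, (z.2.1 : M)) :=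
    isPolyMap_id.fst.fst.prodMk (G.subtype.isPolyMap.comp isPolyMap_id.snd.fst)
  exact zopen_solution_prod ((isPolyMap_sliceMap B G C).comp isPolyMap_id.fst) isPolyMap_id.snd
    ((zopen_le_finrank_range (h.linearHom (bilinDiffOn B E)) ρ).inter
      (zopen_le_finrank_range (h.linearHom (bilinDiffOn B E')) ρ'))

variable [FiniteDimensional ℂ V] [FiniteDimensional ℂ M] [FiniteDimensional ℂ W]

theorem exists_bilinDiff_surjective_of_subset_image {A : Submodule ℂ (V × M)} {E : Submodule ℂ W}
    (hA : ∀ x ∈ A, B x.2 x.1 ∈ E) (h : ∀ x ∈ A, ∀ y ∈ A, bilinDiff B x y ∈ E) {O : Set W}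
    (hO : ZOpen O) (hne : ∃ w ∈ E, w ∈ O) (himg : ∀ w ∈ E, w ∈ O → ∃ x ∈ A, B x.2 x.1 = w) :
    ∃ x : A, ∀ F ∈ E, ∃ y ∈ A, bilinDiff B x y = F := by
  refine (bilin_dominant_iff B hA h).1 ?_
  rintro O' hO' ⟨w', hw'E, hw'⟩
  obtain ⟨w, hwE, hw⟩ := hne
  obtain ⟨⟨g, hgE⟩, hg', hg⟩ := (hO'.preimage E.subtype.isPolyMap).nonempty_inter
    (hO.preimage E.subtype.isPolyMap) ⟨⟨w', hw'E⟩, hw'⟩ ⟨⟨w, hwE⟩, hw⟩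
  obtain ⟨x, hx, rfl⟩ := himg g hgE hg
  exact ⟨x, hx, hg'⟩

theorem exists_bilinDiff_surjective_mem {A : Submodule ℂ (V × M)} {E : Submodule ℂ W}
    (h : ∀ x ∈ A, ∀ y ∈ A, bilinDiff B x y ∈ E) {P P' : Set A} (hP : ZOpen P) (hP' : ZOpen P')
    (hne : P.Nonempty) (hne' : P'.Nonempty) (hD : ∃ x : A, ∀ F ∈ E, ∃ y ∈ A, bilinDiff B x y = F) :
    ∃ x ∈ P, x ∈ P' ∧ ∀ F ∈ E, ∃ y ∈ A, bilinDiff B x y = F := by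
  obtain ⟨x, ⟨h1, h2⟩, h3⟩ := (hP.inter hP').nonempty_inter (zopen_bilinDiff_surjective B h)
    (hP.nonempty_inter hP' hne hne') hD
  exact ⟨x, h1, h2, h3⟩

end BilinearRanks

/-! ### General parameters and the exact ranks -/

section GenericPoint

variable {n s r : ℕ} {b : Fin s → ℕ} {a : Fin (r + 1) → ℕ}

theorem diffRangeAt_eq_range {r : ℕ} {a : Fin r → ℕ} (p : ProjPoint n) (h : FormMatrix n a b) (k : Forms n b) :
    diffRangeAt p h k = LinearMap.range (bilinDiffOn (V := Forms n b) (M := FormMatrix n a b)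
      (W := Forms n a) (mulForms a b) (tupleIdeal (pointIdeal p) b) (k, h)) := by
  rw [range_bilinDiffOn, diffRangeAt, ← range_mulForms]

theorem diffRange_eq_range {r : ℕ} {a : Fin r → ℕ} (h : FormMatrix n a b) (k : Forms n b) :
    diffRange h k = LinearMap.range (bilinDiffOn (V := Forms n b) (M := FormMatrix n a b)
      (W := Forms n a) (mulForms a b) ⊤ (k, h)) := by
  rw [range_bilinDiffOn, diffRange, ← range_mulForms, Submodule.map_top]

theorem zopen_surjective_leadingMap :
    ZOpen {x : singParams n b a | Function.Surjective (leadingMap n s r (localData x.1))} :=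
  zopen_surjective_of_linear (U := Forms n b × FormMatrix n a b) (singParams n b a) localData
    (leadingMap n s r)

/-- By the containment hypothesis the product map from `singParams` covers a nonempty open part of
`singForms`, so its differential is onto somewhere. Each of the three requirements is open in the
vector space `singParams`, and each holds at some point; hence they hold together. -/
theorem exists_generic_params (hb : ∀ j, 1 ≤ b j) (hs : s ≤ n + 1) (ha : ∀ i, 1 ≤ a i)
    (hr : r ≤ n) (ham : Monotone a) {O : Set (Forms n a)} (hO : ZOpen O)
    (hne : ∃ f ∈ O, valO f = 0 ∧ ¬ LinearIndependent ℂ (jacO f))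
    (hinv : ∀ f f' : Forms n a, formIdeal f = formIdeal f' → f ∈ O → f' ∈ O)
    (hOk : ∀ f ∈ O, IsCI f ∧ (valO f = 0 → ¬ LinearIndependent ℂ (jacO f) →
      ∃ k : Forms n b, IsCI k ∧ formIdeal f ≤ formIdeal k ∧ valO k = 0 ∧
        LinearIndependent ℂ (jacO k)))
    (hL : ∃ x ∈ singParams n b a, Function.Surjective (leadingMap n s r (localData x))) :
    ∃ x ∈ goodParams n b a, (∀ F ∈ singForms n a, ∃ y ∈ singParams n b a,
      bilinDiff (V := Forms n b) (M := FormMatrix n a b) (W := Forms n a) (mulForms a b) x y = F) ∧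
      Function.Surjective (leadingMap n s r (localData x.1)) := by
  have hr1 : r + 1 ≤ n + 1 := Nat.succ_le_succ hr
  have key : ∀ f ∈ singForms n a, f ∈ O → f ∈ initIndep n a →
      ∃ x ∈ goodParams n b a, mulForms a b x.1.2 x.1.1 = f := by
    intro f hf hfO hfI
    obtain ⟨hf', hfk⟩ := hOk f hfO
    obtain ⟨k, hk, hle, hk0, hk1⟩ := hfk (mem_singForms.1 hf).1
      (not_linearIndependent_of_mem_singForms hf)
    obtain ⟨h, rfl⟩ := formIdeal_le_iff_exists.1 hle
    exact ⟨⟨(k, h), mem_singParams_of_mulForms hk0 hk1 hf⟩, ⟨⟨hk, hk1⟩, hf', hfI⟩, rfl⟩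
  -- The row operation preserves the ideal, so by `hinv` the new tuple stays in `O`.
  obtain ⟨f, hfS, hfO, hfI⟩ : ∃ f ∈ singForms n a, f ∈ O ∧ f ∈ initIndep n a := by
    obtain ⟨f, ⟨hfO, hfI⟩, hf0, hf1⟩ := exists_singular_mem_inter ha hO zopen_initIndep hne
      (exists_mem_initIndep ha hr)
    obtain ⟨f', hf', hff', hfI'⟩ := exists_singForms ham hf0 hf1 hfI
    exact ⟨f', hf', hinv _ _ hff'.symm hfO, hfI'⟩
  obtain ⟨x₁, hx₁, -⟩ := key f hfS hfO hfI
  obtain ⟨y, hy, hyL⟩ := hL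
  have hdom := exists_bilinDiff_surjective_of_subset_image (V := Forms n b) (M := FormMatrix n a b)
    (W := Forms n a) (mulForms a b) (A := singParams n b a) (E := singForms n a)
    (fun x hx => mulForms_mem_singForms hx hx) bilinDiff_mem_singForms (hO.inter zopen_initIndep)
    ⟨f, hfS, hfO, hfI⟩ fun w hw hwO => by
      obtain ⟨x, -, hx⟩ := key w hw hwO.1 hwO.2
      exact ⟨x, x.2, hx⟩
  obtain ⟨x, hx1, hx2, hx3⟩ := exists_bilinDiff_surjective_mem (V := Forms n b)
    (M := FormMatrix n a b) (W := Forms n a) (mulForms a b) (A := singParams n b a)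
    (E := singForms n a) bilinDiff_mem_singForms (zopen_goodParams hb hs ha hr1)
    zopen_surjective_leadingMap ⟨x₁, hx₁⟩ ⟨⟨y, hy⟩, hyL⟩ hdom
  exact ⟨x, hx1, hx3, hx2⟩

/-- The assumed bounds `h1` and `h2` meet the opposite bounds, which hold at every point of `Ξ_o`,
so both codimensions are known exactly. -/
theorem finrank_ker_and_coker (hb : ∀ j, 1 ≤ b j) (hs : s ≤ n) (ha : ∀ i, 1 ≤ a i)
    {Q : FlagFamily n b a} (hQ : Q ∈ XiAt n b a)
    {k : Forms n b} {h : FormMatrix n a b} (hk : formIdeal k = Q.Z.ideal)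
    (hf : formIdeal (mulForms a b h k) = Q.X.ideal)
    (h1 : Module.finrank ℂ (Forms n a) ≤ Module.finrank ℂ (diffRange h k) + 1)
    (h2 : Module.finrank ℂ (Forms n a) ≤
      Module.finrank ℂ (diffRangeAt (basePoint n) h k) + (r + 1 + (n - s))) :
    (Module.Finite ℂ (LinearMap.ker (dalpha Q)) ∧
      (Module.finrank ℂ (LinearMap.ker (dalpha Q)) : ℤ) = Module.finrank ℂ (Forms n b) -
        Module.finrank ℂ (tupleIdeal (formIdeal k) b) + Module.finrank ℂ (tupleIdeal (formIdeal k) a) -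
        Module.finrank ℂ (Forms n a) - (n - (r + 1)) + 2 * (n - s)) ∧
    Module.finrank ℂ ((rho (piMap Q)).T ⧸ LinearMap.range (drho (piMap Q))) = 1 := by
  obtain ⟨hpt, hsing, hk1⟩ := (mem_XiAt_iff hb ha hk hf).1 hQ
  have hk0 : valO k = 0 := funext ((hpt ▸ represents_baseVec n :
    Represents (baseVec n) Q.pt).formIdeal_le_iff.1 (hk ▸ Q.mem))
  obtain ⟨z, hz0, hz⟩ := exists_relation hk0 hk1 hsing
  have h3 := finrank_diffRange_add_one_le hk0 hz0 hz
  have h4 := finrank_diffRangeAt_add_le ha hk0 hk1 hz0 hz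
  have h5 := finrank_coker_drho hb ha (piMap Q) hk hf
  obtain ⟨h6, h7⟩ := finrank_ker_dalpha hb ha Q hk hf
  have h8 := finrank_tupleIdeal_basePoint (n := n) b
  rw [← hpt] at h2 h4 h8
  refine ⟨⟨h6, ?_⟩, ?_⟩ <;> omega

end GenericPoint

end

noncomputable section

open MvPolynomial

attribute [local instance] MvPolynomial.gradedAlgebra

/-! ### Spreading the rank bounds over an open set -/

section OpenCondition

variable {n s r : ℕ} {b : Fin s → ℕ} {a : Fin r → ℕ}

/-- The matrix `h` is determined by `k` and `f` only up to syzygies. The ranks do not depend on the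
choice, because they are expressed by `dρ` and `dα`. -/
theorem finrank_diffRange_eq (hb : ∀ j, 1 ≤ b j) (ha : ∀ i, 1 ≤ a i) {Q : FlagFamily n b a}
    {k : Forms n b} {h h' : FormMatrix n a b} (hk : formIdeal k = Q.Z.ideal)
    (hf : formIdeal (mulForms a b h k) = Q.X.ideal) (hh : mulForms a b h' k = mulForms a b h k) :
    Module.finrank ℂ (diffRange h' k) = Module.finrank ℂ (diffRange h k) ∧
      Module.finrank ℂ (diffRangeAt Q.pt h' k) = Module.finrank ℂ (diffRangeAt Q.pt h k) := by
  have h1 := finrank_coker_drho hb ha (piMap Q) hk hf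
  have h2 := finrank_coker_drho hb ha (piMap Q) hk (hh ▸ hf)
  have h3 := (finrank_ker_dalpha hb ha Q hk hf).2
  have h4 := (finrank_ker_dalpha hb ha Q hk (hh ▸ hf)).2
  constructor <;> omega

theorem zopen_diffRange_slice (G : Submodule ℂ (FormMatrix n a b)) (C : Submodule ℂ (Forms n a))
    (p : ProjPoint n) (ρ ρ' : ℕ) :
    ZOpen {x : Forms n b × Forms n a |
      Function.Bijective (sliceMap (V := Forms n b) (M := FormMatrix n a b) (W := Forms n a)
        (mulForms a b) G C x.1) ∧
      ∃ y : G × C, (ρ ≤ Module.finrank ℂ (diffRange (y.1 : FormMatrix n a b) x.1) ∧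
        ρ' ≤ Module.finrank ℂ (diffRangeAt p (y.1 : FormMatrix n a b) x.1)) ∧
      sliceMap (V := Forms n b) (M := FormMatrix n a b) (W := Forms n a) (mulForms a b) G C x.1 y =
        x.2} := by
  have h := zopen_slice_ranks (V := Forms n b) (M := FormMatrix n a b) (W := Forms n a)
    (mulForms a b) ⊤ (tupleIdeal (pointIdeal p) b) G C ρ ρ'
  refine (congrArg ZOpen (Set.ext fun x => and_congr_right fun _ => exists_congr fun y =>
    and_congr_left fun _ => ?_)).mpr h
  rw [diffRange_eq_range, diffRangeAt_eq_range]
  exact Iff.rfl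

/-- Near `Q₀` the slice `G` singles out one matrix `h` with `f = h k`. It solves a linear system in
the coefficients of `k` and `f`, so the lower semicontinuity of ranks applies to it. -/
theorem exists_isOpen_finrank_diffRange (hb : ∀ j, 1 ≤ b j) (hs : s ≤ n + 1) (ha : ∀ i, 1 ≤ a i)
    (hr : r ≤ n + 1) {Q₀ : FlagFamily n b a} {k₀ : Forms n b} {h₀ : FormMatrix n a b}
    (hv : Represents (baseVec n) Q₀.pt) (hpt : Q₀.pt = basePoint n)
    (hk₀ : formIdeal k₀ = Q₀.Z.ideal) (hf₀ : formIdeal (mulForms a b h₀ k₀) = Q₀.X.ideal) :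
    ∃ W, IsOpen W ∧ Q₀ ∈ W ∧ ∀ Q ∈ W, ∃ (k : Forms n b) (h : FormMatrix n a b),
      formIdeal k = Q.Z.ideal ∧ formIdeal (mulForms a b h k) = Q.X.ideal ∧
      Module.finrank ℂ (diffRange h₀ k₀) ≤ Module.finrank ℂ (diffRange h k) ∧
      Module.finrank ℂ (diffRangeAt (basePoint n) h₀ k₀) ≤
        Module.finrank ℂ (diffRangeAt (basePoint n) h k) := by
  obtain ⟨G, C, hbij, hG, -⟩ := exists_slice (V := Forms n b) (M := FormMatrix n a b)
    (W := Forms n a) (mulForms a b) k₀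
  have hG' : ∀ k : Forms n b, IsCI k → Module.finrank ℂ G = Module.finrank ℂ
      (multiples (V := Forms n b) (M := FormMatrix n a b) (W := Forms n a) (mulForms a b) k) := by
    intro k hk
    rw [hG, multiples_mulForms, multiples_mulForms]
    exact finrank_tupleIdeal_eq hb (CIParam.isCI hk₀) hk a
  refine ⟨_, FlagFamily.isOpen_of_zopen hb hs ha hr ((zopen_diffRange_slice G C (basePoint n)
    (Module.finrank ℂ (diffRange h₀ k₀))
    (Module.finrank ℂ (diffRangeAt (basePoint n) h₀ k₀))).preimage isPolyMap_id.snd),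
    ⟨baseVec n, k₀, mulForms a b h₀ k₀, hv, hk₀, hf₀, ?_⟩, ?_⟩
  · obtain ⟨t, ht⟩ := (slice_spec _ hbij.1 hG).1 _ (apply_mem_multiples _ h₀ k₀)
    obtain ⟨h1, h2⟩ := finrank_diffRange_eq hb ha hk₀ hf₀ ht
    rw [hpt] at h2
    refine ⟨hbij, (t, 0), ⟨h1.ge, h2.ge⟩, ?_⟩
    rw [sliceMap_apply, ht]
    exact add_zero _
  · rintro Q ⟨v, k, f, -, hk, hf, hbij', ⟨t, e⟩, ⟨h1, h2⟩, he⟩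
    refine ⟨k, t, hk, ?_, h1, h2⟩
    have hmem : f ∈ multiples (V := Forms n b) (M := FormMatrix n a b) (W := Forms n a)
        (mulForms a b) k := by
      rw [multiples_mulForms, ← formIdeal_le_iff, hf, hk]
      exact Q.sub
    -- Since `f` is a multiple of `k`, the transversal term of the slice vanishes.
    have he0 : (e : Forms n a) = 0 := by
      refine (slice_spec _ hbij'.1 (hG' k (CIParam.isCI hk))).2 _ ?_ e.2
      have h3 := sub_mem hmem (apply_mem_multiples (V := Forms n b) (M := FormMatrix n a b)
        (W := Forms n a) (mulForms a b) t k)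
      rw [sliceMap_apply] at he
      rwa [← eq_sub_of_add_eq' he] at h3
    have he' : mulForms a b t k + (e : Forms n a) = f := he
    rw [← hf, ← he', he0, add_zero]

end OpenCondition

end

noncomputable section

open MvPolynomial

attribute [local instance] MvPolynomial.gradedAlgebra

/-! ### Open sets of good points, dimensions, and the main theorem -/

section GenericFibre

variable {n s r : ℕ} {b : Fin s → ℕ} {a : Fin (r + 1) → ℕ}

theorem exists_isOpen_finrank_ker_and_coker (hb : ∀ j, 1 ≤ b j) (hs : s ≤ n) (ha : ∀ i, 1 ≤ a i)
    (hr : r ≤ n) (hba : ∀ j, b j ≤ a (Fin.last r)) {x : singParams n b a} (hx : x ∈ goodParams n b a)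
    (hD : ∀ F ∈ singForms n a, ∃ y ∈ singParams n b a,
      bilinDiff (V := Forms n b) (M := FormMatrix n a b) (W := Forms n a) (mulForms a b) x y = F)
    (hL : Function.Surjective (leadingMap n s r (localData x.1))) :
    ∃ W : Set (FlagFamily n b a), IsOpen W ∧ (W ∩ initPart n b a).Nonempty ∧
      ∀ Q ∈ W, Q ∈ XiAt n b a → (Module.Finite ℂ (LinearMap.ker (dalpha Q)) ∧
        (Module.finrank ℂ (LinearMap.ker (dalpha Q)) : ℤ) = Module.finrank ℂ (Forms n b) -
          Module.finrank ℂ (tupleIdeal (formIdeal x.1.1) b) +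
          Module.finrank ℂ (tupleIdeal (formIdeal x.1.1) a) -
          Module.finrank ℂ (Forms n a) - (n - (r + 1)) + 2 * (n - s)) ∧
      Module.finrank ℂ ((rho (piMap Q)).T ⧸ LinearMap.range (drho (piMap Q))) = 1 := by
  obtain ⟨Q₀, hQ₀, hv, hk₀, hf₀⟩ := exists_mem_initPart hb ha hx
  obtain ⟨W, hW, hQW, h⟩ := exists_isOpen_finrank_diffRange hb (hs.trans (Nat.le_succ n)) ha
    (Nat.succ_le_succ hr) hv hQ₀.1.1 hk₀ hf₀
  have h1 := (finrank_le_diffRange_add_one hba x.2 hD hL).2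
  have h2 := finrank_le_diffRangeAt_add hba x.2 hx.1.2 hD
  refine ⟨W, hW, ⟨Q₀, hQW, hQ₀⟩, fun Q hQ hQΞ => ?_⟩
  obtain ⟨k, h', hk, hf, h3, h4⟩ := h Q hQ
  rw [finrank_tupleIdeal_eq hb hx.1.1 (CIParam.isCI hk) a,
    finrank_tupleIdeal_eq hb hx.1.1 (CIParam.isCI hk) b]
  exact finrank_ker_and_coker hb hs ha hQΞ hk hf (h1.trans (Nat.add_le_add_right h3 1))
    (h2.trans (Nat.add_le_add_right h4 _))

theorem exists_topologicalKrullDim (hb : ∀ j, 1 ≤ b j) (hs : s ≤ n) (ha : ∀ i, 1 ≤ a i)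
    (hr : r ≤ n) {x : singParams n b a} (hx : x ∈ goodParams n b a) :
    ∃ dF dH : ℕ, topologicalKrullDim (FlagVariety n b a) = (dF : WithBot ℕ∞) ∧
      topologicalKrullDim (CIParam n a) = (dH : WithBot ℕ∞) ∧
      (dF : ℤ) - dH = Module.finrank ℂ (Forms n b) -
        Module.finrank ℂ (tupleIdeal (formIdeal x.1.1) b) +
        Module.finrank ℂ (tupleIdeal (formIdeal x.1.1) a) - Module.finrank ℂ (Forms n a) := by
  have hle : formIdeal (mulForms a b x.1.2 x.1.1) ≤ formIdeal x.1.1 := formIdeal_mulForms_le _ _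
  refine ⟨_, _, FlagVariety.topologicalKrullDim_eq hb (hs.trans (Nat.le_succ n)) ha
    (Nat.succ_le_succ hr) hx.1.1 hx.2.1 hle,
    CIParam.topologicalKrullDim_eq ha (Nat.succ_le_succ hr) hx.2.1, ?_⟩
  have h1 := Submodule.finrank_le (tupleIdeal (formIdeal x.1.1) b)
  have h2 := Submodule.finrank_le (tupleIdeal (formIdeal (mulForms a b x.1.2 x.1.1)) a)
  have h3 : Module.finrank ℂ (tupleIdeal (formIdeal (mulForms a b x.1.2 x.1.1)) a) ≤
      Module.finrank ℂ (tupleIdeal (formIdeal x.1.1) a) :=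
    Submodule.finrank_mono fun F hF => formIdeal_le_iff.1 ((formIdeal_le_iff.2 hF).trans hle)
  omega

end GenericFibre

end

theorem mainTheorem6 (n r s : ℕ) (hn : 4 ≤ n) (hr : 0 < r) (hrs : r < s) (hsn : s < n)
    (a : Fin r → ℕ) (b : Fin s → ℕ)
    (ha : Monotone a) (ha2 : ∀ i, 2 ≤ a i) (hb : Monotone b) (hb1 : ∀ j, 1 ≤ b j)
    (m l : ℤ) (hm : m = (n : ℤ) - r) (hl : l = (n : ℤ) - s)
    (ar bs ta tb : ℕ)
    (har : ar = a ⟨r - 1, Nat.sub_lt hr Nat.one_pos⟩)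
    (hbs : bs = b ⟨s - 1, Nat.sub_lt (hr.trans hrs) Nat.one_pos⟩)
    (hta : ta = Fintype.card {i : Fin r // a i = ar})
    (htb : tb = Fintype.card {j : Fin s // b j = ar})
    -- the numerical conditions
    (hab : ∀ i : Fin r, b (Fin.castLE hrs.le i) ≤ a i)
    (hasbs : bs ≤ ar)
    (hml : (tb : ℤ) - ta ≤ m - 2 * l)
    (hml' : 2 * l < m)
    -- a general singular complete intersection `X_u` of multi-degree `a` contains, through its
    -- singular point `p`, a complete intersection of multi-degree `b` that is smooth at `p`
    (hgen : ∃ W : Set (CIParam n a), IsOpen W ∧ (W ∩ singularLocus n a).Nonempty ∧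
      ∀ u ∈ W ∩ singularLocus n a, ∀ p ∈ singularPoints u,
        ∃ Z : CIParam n b, u.ideal ≤ Z.ideal ∧ Z.ideal ≤ pointIdeal p ∧
          IsSmoothAt s Z.ideal p) :
    -- the dominant component of `Ξ_o` exists and is unique
    (∃! C : Set (FlagFamily n b a), IsDominantComponent C) ∧
    -- (1)
    DenseRange (rho : FlagVariety n b a → CIParam n a) ∧
    ∃ dF dH : ℕ,
      topologicalKrullDim (FlagVariety n b a) = (dF : WithBot ℕ∞) ∧
      topologicalKrullDim (CIParam n a) = (dH : WithBot ℕ∞) ∧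
      ∀ C : Set (FlagFamily n b a), IsDominantComponent C →
        ∃ W : Set (FlagFamily n b a), IsOpen W ∧ (W ∩ C).Nonempty ∧ ∀ Q ∈ W ∩ C,
          -- (2)
          (Module.Finite ℂ (LinearMap.ker (dalpha Q)) ∧
            (Module.finrank ℂ (LinearMap.ker (dalpha Q)) : ℤ) = (dF : ℤ) - dH - m + 2 * l) ∧
          -- (3)
          Module.finrank ℂ ((rho (piMap Q)).T ⧸ LinearMap.range (drho (piMap Q))) = 1 := by
  -- From here on `r + 1` and `s + l'` replace `r` and `n`, so that the last equation has index
  -- `Fin.last r` and `l = l'`.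
  obtain ⟨r, rfl⟩ : ∃ r', r = r' + 1 := ⟨r - 1, (Nat.sub_add_cancel hr).symm⟩
  obtain ⟨l', rfl⟩ := Nat.exists_eq_add_of_le hsn.le
  have har' : ar = a (Fin.last r) := har
  subst har'
  have ha1 : ∀ i, 1 ≤ a i := fun i => one_le_two.trans (ha2 i)
  have hba : ∀ j, b j ≤ a (Fin.last r) := fun j =>
    (hb (Fin.le_def.2 (Nat.le_sub_one_of_lt j.2))).trans (hbs ▸ hasbs)
  have hrn : r ≤ s + l' := by omega
  -- As `m - 2l = s - (r + 1) - l'`, the two side conditions are `m - 2l ≥ t_b - t_a` and `m > 2l`.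
  obtain ⟨σ, hσ, hσ1, hσ2⟩ := exists_index_embedding (l := l') ha hb hrs.le hta htb hab hba
    (by push_cast at hm hl; omega) (by push_cast at hm hl; omega)
  obtain ⟨y, hy, -, hyL⟩ := exists_leadingMap_surjective hb1 hσ hσ1 hσ2
  obtain ⟨O, hO, hne, hinv, hOk⟩ := exists_zopen_of_generic_containment ha1 (Nat.succ_le_succ hrn) hgen
  obtain ⟨hC, hCV⟩ := existsUnique_isDominantComponent hb1 (hsn.le.trans (Nat.le_succ _)) ha1 hrn ha
    hO hne hOk
  obtain ⟨x, hx, hD, hL⟩ := exists_generic_params hb1 (hsn.le.trans (Nat.le_succ _)) ha1 hrn ha hO hne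
    hinv hOk ⟨y, hy, hyL⟩
  obtain ⟨x', hx'⟩ := exists_bilinDiff_surjective hba (by push_cast at hm hl; omega) x.2 hx.1.2 hD hL
  obtain ⟨dF, dH, hdF, hdH, hd⟩ := exists_topologicalKrullDim hb1 hsn.le ha1 hrn hx
  -- `W` meets every dominant component, since such a component contains `initPart`; on `W` the rank
  -- statements hold at all points of `Ξ_o`.
  obtain ⟨W, hW, ⟨Q, hQW, hQV⟩, hWΞ⟩ :=
    exists_isOpen_finrank_ker_and_coker hb1 hsn.le ha1 hrn hba hx hD hL
  refine ⟨hC, denseRange_rho hb1 (hsn.le.trans (Nat.le_succ _)) ha1 (Nat.succ_le_succ hrn) hx' hx.1.1,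
    dF, dH, hdF, hdH, fun C hCd => ⟨W, hW, ⟨Q, hQW, hCV C hCd hQV⟩, fun P hP => ?_⟩⟩
  obtain ⟨⟨D, -, rfl⟩, -⟩ := hCd
  obtain ⟨hPW, ⟨P, hPΞ⟩, -, rfl⟩ := hP
  obtain ⟨⟨h1, h2⟩, h3⟩ := hWΞ P hPW hPΞ
  refine ⟨⟨h1, ?_⟩, h3⟩
  rw [h2, ← hd, hm, hl]
  push_cast
  ring
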